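/- Fix an integer $k\ge 0$; $A^{\intercal}$ and $A^{\star}$ denote the transpose and the conjugate transpose of a complex $k\times k$ matrix $A$. Let $a_0=\mathrm{diag}\big(-\tfrac{k-1}{4},-\tfrac{k-1}{4}+\tfrac12,\dots,\tfrac{k-1}{4}\big)$ and let $b_0$ be the matrix whose only non-zero entries are the subdiagonal entries $\gamma_1,\dots,\gamma_{k-1}$, $\gamma_i=\tfrac12\sqrt{i(k-i)}$. **Gauge groups.** $\mathcal G^{\mathbb C}$ is the group of continuous maps $g:[0,1]\to GL(k,\mathbb C)$ that are smooth in $(0,1)$ and satisfy $g(1-t)=(g(t)^{\intercal})^{-1}$; $\mathcal G\subset\mathcal G^{\mathbb C}$ is the subgroup of $U(k)$-valued maps. $\mathcal G^{\mathbb C}$ acts on tuples $(\alpha,\beta_1,\beta_2,\beta_3,v)$ of matrix functions on $(0,1)$ and a vector $v\in\mathbb C^k$ by $\alpha\mapsto g\alpha g^{-1}-\tfrac12\tfrac{dg}{dt}g^{-1}$, $\beta_i\mapsto g\beta_ig^{-1}$, $v\mapsto g(0)v$. $\mathcal G$ acts on tuples $(X_0,\dots,X_7,v)$ by $X_0\mapsto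 gX_0g^{-1}-\tfrac{dg}{dt}g^{-1}$, $X_i\mapsto gX_ig^{-1}$ $(i\ge 1)$, $v\mapsto g(0)v$. Two tuples are equivalent if some gauge transformation maps one to the other. **Framed meromorphic solutions.** These are tuples $(X_0,\dots,X_7,v)$ with $X_i:(0,1)\to\mathbb C^{k\times k}$ smooth and $v\in\mathbb C^k$ such that, with $\alpha=\tfrac12(X_0+iX_1)$, $\beta_1=\tfrac12(X_2+iX_3)$, $\beta_2=\tfrac12(X_4+iX_5)$, $\beta_3=\tfrac12(X_6+iX_7)$: 1. the decoupled octonionic Nahm equations hold on $(0,1)$, that is, the complex equations $\frac{d\beta_i}{dt}+2[\alpha,\beta_i]=0$, $[\beta_i,\beta_j]=0$ for $i,j=1,2,3$, and the real equation $\frac{d}{dt}(\alpha+\alpha^{\star})+2\big([\alpha,\alpha^{\star}]+\sum_{i=1}^3[\beta_i,\beta_i^{\star}]\big)=0$; 2. $X_i^{\star}(t)=-X_i(t)$ and $X_i(1-t)=X_i(t)^{\intercal}$ for $i=0,\dots,7$; 3. $X_0$ is continuous on $[0,1]$, and for $1\le i\le 7$ the function $X_i$ extends to a meromorphic function on a neighbourhood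 of $[0,1]$ in $\mathbb C$ with at most simple poles, located at $0$ and $1$; 4. there are non-zero complex numbers $s_1,s_2,s_3$ with $|s_1|^2+|s_2|^2+|s_3|^2=1$ such that after the action of some $g\in\mathcal G$ the residues of $\alpha,\beta_1,\beta_2,\beta_3$ at $t=0$ are $a_0,s_1b_0,s_2b_0,s_3b_0$; 5. $|v|=1$ and $v$ lies in the $-\tfrac{k-1}{4}$ eigenspace of the residue of $\alpha$ at $t=0$ (a one-dimensional space, by 4, so $v$ is determined up to a phase). Let $\mathcal M^{\mathrm{de}}_{\mathrm{pole}}$ be the set of their $\mathcal G$-equivalence classes. **Nahm complexes.** These are tuples $(\alpha,\beta_1,\beta_2,\beta_3,v)$ where $\alpha,\beta_i:(0,1)\to\mathbb C^{k\times k}$ are smooth, satisfy the complex equations and $\alpha(1-t)=\alpha(t)^{\intercal}$, $\beta_i(1-t)=\beta_i(t)^{\intercal}$, are meromorphic with at most simple poles at $t=0$ and at $t=1$, with residues $a,b_1,b_2,b_3$ at $t=0$, where $\mathrm{Tr}(a)=0$ and $v$ is a unit vector in the $-\tfrac{k-1}{4}$ eigenspace of $a$ such that $\{b_i^jv\}_{j=0}^{k-1}$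 spans $\mathbb C^k$ for each $i=1,2,3$. Let $\mathcal M_{\mathrm{NC}}$ be the set of their $\mathcal G^{\mathbb C}$-equivalence classes. **Theorem.** Forgetting the real equation gives a well-defined bijection $\Xi:\mathcal M^{\mathrm{de}}_{\mathrm{pole}}\to\mathcal M_{\mathrm{NC}}$: there is a bijection $\Xi$ such that, for every framed meromorphic solution $(X,v)$ and every Nahm complex $N$, $\Xi$ maps the class of $(X,v)$ to the class of $N$ if and only if the associated tuple $(\alpha,\beta_1,\beta_2,\beta_3,v)$ is $\mathcal G^{\mathbb C}$-equivalent to $N$. (In particular $\Xi[(X,v)]=[(\alpha,\beta_1,\beta_2,\beta_3,v)]$ whenever the latter tuple is itself a Nahm complex.) -/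

import Mathlib

open Set Filter Topology
open scoped Matrix ContDiff Matrix.Norms.Frobenius

namespace Nahm

/-- Complex `k × k` matrices. (The Frobenius norm, opened above, is used only to speak of
limits and derivatives, which do not depend on the choice of a norm.) -/
abbrev Mat (k : ℕ) := Matrix (Fin k) (Fin k) ℂ

/-- `a₀ = diag(-(k-1)/4, -(k-1)/4 + 1/2, …, (k-1)/4)`. -/
noncomputable def principalA (k : ℕ) : Mat k :=
  Matrix.diagonal fun j => ((-((k : ℝ) - 1) / 4 + (j : ℝ) / 2 : ℝ) : ℂ)

/-- The matrix `b₀` whose only non-zero entries are the subdiagonal ones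
`γ₁, …, γ_{k-1}`, with `γᵢ = √(i (k - i)) / 2`. -/
noncomputable def principalB (k : ℕ) : Mat k :=
  Matrix.of fun i j =>
    if (i : ℕ) = (j : ℕ) + 1 then ((Real.sqrt ((i : ℝ) * ((k : ℝ) - (i : ℝ))) / 2 : ℝ) : ℂ) else 0

/-! ### Gauge transformations -/

/-- Complex gauge transformations: continuous `g : [0,1] → GL(k,ℂ)`, smooth in `(0,1)`, with
`g(1-t) = (g(t)ᵀ)⁻¹`. Only the values of `g` on `[0,1]` matter. -/
structure IsComplexGauge {k : ℕ} (g : ℝ → Mat k) : Prop where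
  continuousOn : ContinuousOn g (Icc 0 1)
  smooth : ContDiffOn ℝ ∞ g (Ioo 0 1)
  isUnit : ∀ t ∈ Icc (0 : ℝ) 1, IsUnit (g t)
  reflection : ∀ t ∈ Icc (0 : ℝ) 1, g (1 - t) = ((g t)ᵀ)⁻¹

/-- Real gauge transformations: those with values in `U(k)`. -/
structure IsUnitaryGauge {k : ℕ} (g : ℝ → Mat k) : Prop extends IsComplexGauge g where
  unitary : ∀ t ∈ Icc (0 : ℝ) 1, g t ∈ Matrix.unitaryGroup (Fin k) ℂ

/-- `g A g⁻¹ - c (dg/dt) g⁻¹`: the gauge action on `X₀` (for `c = 1`) and on `α`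
(for `c = 1/2`). -/
noncomputable def gaugeConnection {k : ℕ} (c : ℂ) (g A : ℝ → Mat k) (t : ℝ) : Mat k :=
  g t * A t * (g t)⁻¹ - c • (deriv g t * (g t)⁻¹)

/-- `g B g⁻¹`: the gauge action on the remaining fields. -/
noncomputable def gaugeField {k : ℕ} (g B : ℝ → Mat k) (t : ℝ) : Mat k :=
  g t * B t * (g t)⁻¹

/-! ### Poles and residues -/

/-- `f`, given on `(0,1)`, extends to a meromorphic function on a neighbourhood of `[0,1]` in
`ℂ` whose only possible poles are at `0` and `1`, and simple. -/
def ExtendsMeromorphically {k : ℕ} (f : ℝ → Mat k) : Prop :=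
  ∃ U : Set ℂ, IsOpen U ∧ (∀ t ∈ Icc (0 : ℝ) 1, (t : ℂ) ∈ U) ∧
    ∃ H : ℂ → Mat k, DifferentiableOn ℂ H U ∧
      ∀ t ∈ Ioo (0 : ℝ) 1, f t = ((t : ℂ) * ((t : ℂ) - 1))⁻¹ • H t

/-- `f`, given on `(0,1)`, is meromorphic at the end point `p` with at most a simple pole. -/
def MeromorphicAtEnd {k : ℕ} (f : ℝ → Mat k) (p : ℝ) : Prop :=
  ∃ H : ℂ → Mat k, AnalyticAt ℂ H (p : ℂ) ∧
    ∀ᶠ t in 𝓝[Ioo 0 1] p, f t = ((t : ℂ) - (p : ℂ))⁻¹ • H t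

/-- `f` has residue `r` at `t = 0`, that is `t f(t) → r` as `t → 0⁺`. -/
def HasResidueAtZero {k : ℕ} (f : ℝ → Mat k) (r : Mat k) : Prop :=
  Tendsto (fun t : ℝ => (t : ℂ) • f t) (𝓝[>] 0) (𝓝 r)

/-- `v` is a unit vector in the `-(k-1)/4` eigenspace of `a`. -/
def IsUnitLowestVector {k : ℕ} (a : Mat k) (v : Fin k → ℂ) : Prop :=
  ∑ i, ‖v i‖ ^ 2 = 1 ∧ a *ᵥ v = (-((k : ℂ) - 1) / 4) • v

/-! ### Nahm complexes -/

/-- A tuple `(α, β₁, β₂, β₃, v)`; only the values of the functions on `(0,1)` matter. -/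
structure ComplexData (k : ℕ) where
  α : ℝ → Mat k
  β : Fin 3 → ℝ → Mat k
  v : Fin k → ℂ

/-- The complex equations on `(0,1)`. -/
def ComplexData.ComplexEquations {k : ℕ} (D : ComplexData k) : Prop :=
  (∀ i, ∀ t ∈ Ioo (0 : ℝ) 1, deriv (D.β i) t + (2 : ℂ) • ⁅D.α t, D.β i t⁆ = 0) ∧
    ∀ i j, ∀ t ∈ Ioo (0 : ℝ) 1, ⁅D.β i t, D.β j t⁆ = 0

/-- The real equation on `(0,1)`. -/
def ComplexData.RealEquation {k : ℕ} (D : ComplexData k) : Prop :=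
  ∀ t ∈ Ioo (0 : ℝ) 1,
    deriv (fun s => D.α s + (D.α s)ᴴ) t
      + (2 : ℂ) • (⁅D.α t, (D.α t)ᴴ⁆ + ∑ i, ⁅D.β i t, (D.β i t)ᴴ⁆) = 0

/-- Nahm complexes. -/
structure IsNahmComplex {k : ℕ} (D : ComplexData k) : Prop where
  equations : D.ComplexEquations
  reflection_α : ∀ t ∈ Ioo (0 : ℝ) 1, D.α (1 - t) = (D.α t)ᵀ
  reflection_β : ∀ i, ∀ t ∈ Ioo (0 : ℝ) 1, D.β i (1 - t) = (D.β i t)ᵀ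
  smooth_α : ContDiffOn ℝ ∞ D.α (Ioo 0 1)
  smooth_β : ∀ i, ContDiffOn ℝ ∞ (D.β i) (Ioo 0 1)
  pole_α : MeromorphicAtEnd D.α 0 ∧ MeromorphicAtEnd D.α 1
  pole_β : ∀ i, MeromorphicAtEnd (D.β i) 0 ∧ MeromorphicAtEnd (D.β i) 1
  residues : ∃ (a : Mat k) (b : Fin 3 → Mat k),
    HasResidueAtZero D.α a ∧ (∀ i, HasResidueAtZero (D.β i) (b i)) ∧
      a.trace = 0 ∧ IsUnitLowestVector a D.v ∧
      ∀ i, Submodule.span ℂ (range fun j : Fin k => (b i ^ (j : ℕ)) *ᵥ D.v) = ⊤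

/-- `D` and `D'` are related by a complex gauge transformation `g` with `g(0) v = v'`. -/
def ComplexData.GaugeEquiv {k : ℕ} (D D' : ComplexData k) : Prop :=
  ∃ g : ℝ → Mat k, IsComplexGauge g ∧
    (∀ t ∈ Ioo (0 : ℝ) 1, D'.α t = gaugeConnection (1 / 2) g D.α t) ∧
    (∀ i, ∀ t ∈ Ioo (0 : ℝ) 1, D'.β i t = gaugeField g (D.β i) t) ∧
    g 0 *ᵥ D.v = D'.v

/-! ### Solutions with poles -/

/-- A tuple `(X₀, …, X₇, v)`; only the values of the functions on `(0,1)` matter. -/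
structure RealData (k : ℕ) where
  X : Fin 8 → ℝ → Mat k
  v : Fin k → ℂ

/-- `α = (X₀ + i X₁)/2`, `β₁ = (X₂ + i X₃)/2`, `β₂ = (X₄ + i X₅)/2`, `β₃ = (X₆ + i X₇)/2`. -/
noncomputable def RealData.toComplexData {k : ℕ} (S : RealData k) : ComplexData k where
  α := fun t => (1 / 2 : ℂ) • (S.X 0 t + Complex.I • S.X 1 t)
  β := ![fun t => (1 / 2 : ℂ) • (S.X 2 t + Complex.I • S.X 3 t),
         fun t => (1 / 2 : ℂ) • (S.X 4 t + Complex.I • S.X 5 t),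
         fun t => (1 / 2 : ℂ) • (S.X 6 t + Complex.I • S.X 7 t)]
  v := S.v

/-- Framed solutions of the decoupled octonionic Nahm equations on `(0,1)` with poles at the
end points. In `residues` the leading coefficients at `t = 0` are brought to the form
`a₀, s₁ b₀, s₂ b₀, s₃ b₀` by a real gauge transformation; `framing` says that `v` is a unit
vector in the `-(k-1)/4` eigenspace of the residue of `α` (which fixes `v` up to a phase). -/
structure IsPoleSolution {k : ℕ} (S : RealData k) : Prop where
  smooth : ∀ i, ContDiffOn ℝ ∞ (S.X i) (Ioo 0 1)
  complexEquations : S.toComplexData.ComplexEquations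
  realEquation : S.toComplexData.RealEquation
  skew : ∀ i, ∀ t ∈ Ioo (0 : ℝ) 1, (S.X i t)ᴴ = -S.X i t
  reflection : ∀ i, ∀ t ∈ Ioo (0 : ℝ) 1, S.X i (1 - t) = (S.X i t)ᵀ
  continuous_zero : ContinuousOn (S.X 0) (Icc 0 1)
  meromorphic : ∀ i, i ≠ 0 → ExtendsMeromorphically (S.X i)
  residues : ∃ (s : Fin 3 → ℂ) (g : ℝ → Mat k),
    (∀ i, s i ≠ 0) ∧ ∑ i, ‖s i‖ ^ 2 = 1 ∧ IsUnitaryGauge g ∧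
      HasResidueAtZero (gaugeConnection (1 / 2) g S.toComplexData.α) (principalA k) ∧
      ∀ i, HasResidueAtZero (gaugeField g (S.toComplexData.β i)) (s i • principalB k)
  framing : ∃ a : Mat k, HasResidueAtZero S.toComplexData.α a ∧ IsUnitLowestVector a S.v

/-- `S` and `S'` are related by a real gauge transformation `g` with `g(0) v = v'`. -/
def RealData.GaugeEquiv {k : ℕ} (S S' : RealData k) : Prop :=
  ∃ g : ℝ → Mat k, IsUnitaryGauge g ∧
    (∀ t ∈ Ioo (0 : ℝ) 1, S'.X 0 t = gaugeConnection 1 g (S.X 0) t) ∧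
    (∀ i, i ≠ 0 → ∀ t ∈ Ioo (0 : ℝ) 1, S'.X i t = gaugeField g (S.X i) t) ∧
    g 0 *ᵥ S.v = S'.v

/-! ### Gauge equivalence is an equivalence relation -/

section Equivalence

variable {k : ℕ}

theorem IsComplexGauge.inv_mul {g : ℝ → Mat k} (hg : IsComplexGauge g) {t : ℝ}
    (ht : t ∈ Icc (0 : ℝ) 1) : (g t)⁻¹ * g t = 1 :=
  Matrix.nonsing_inv_mul _ ((Matrix.isUnit_iff_isUnit_det _).1 (hg.isUnit t ht))

theorem IsComplexGauge.mul_inv {g : ℝ → Mat k} (hg : IsComplexGauge g) {t : ℝ}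
    (ht : t ∈ Icc (0 : ℝ) 1) : g t * (g t)⁻¹ = 1 :=
  Matrix.mul_nonsing_inv _ ((Matrix.isUnit_iff_isUnit_det _).1 (hg.isUnit t ht))

theorem IsComplexGauge.differentiableAt {g : ℝ → Mat k} (hg : IsComplexGauge g) {t : ℝ}
    (ht : t ∈ Ioo (0 : ℝ) 1) : DifferentiableAt ℝ g t :=
  (hg.smooth.contDiffAt (Ioo_mem_nhds ht.1 ht.2)).differentiableAt (by simp)

theorem IsComplexGauge.one : IsComplexGauge (fun _ => (1 : Mat k)) :=
  ⟨continuousOn_const, contDiffOn_const, fun _ _ => isUnit_one, fun _ _ => by simp⟩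

theorem IsComplexGauge.mul {g h : ℝ → Mat k} (hg : IsComplexGauge g) (hh : IsComplexGauge h) :
    IsComplexGauge (fun t => g t * h t) :=
  ⟨hg.continuousOn.mul hh.continuousOn, hg.smooth.mul hh.smooth,
    fun t ht => (hg.isUnit t ht).mul (hh.isUnit t ht), fun t ht => by
      rw [hg.reflection t ht, hh.reflection t ht, Matrix.transpose_mul, Matrix.mul_inv_rev]⟩

theorem IsComplexGauge.inv {g : ℝ → Mat k} (hg : IsComplexGauge g) :
    IsComplexGauge (fun t => (g t)⁻¹) := by
  have e : (fun t => (g t)⁻¹) = fun t => Ring.inverse (g t) := by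
    funext t; exact Matrix.nonsing_inv_eq_ringInverse _
  refine ⟨?_, ?_, fun t ht => Matrix.isUnit_nonsing_inv_iff.2 (hg.isUnit t ht), fun t ht => ?_⟩
  · rw [e]
    intro t ht
    obtain ⟨u, hu⟩ := hg.isUnit t ht
    have hc := NormedRing.inverse_continuousAt u
    rw [hu] at hc
    exact ContinuousAt.comp_continuousWithinAt (g := Ring.inverse) hc (hg.continuousOn t ht)
  · rw [e]
    intro t ht
    obtain ⟨u, hu⟩ := hg.isUnit t ⟨ht.1.le, ht.2.le⟩
    have hc := contDiffAt_ringInverse ℝ (n := ∞) u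
    rw [hu] at hc
    exact ContDiffAt.comp_contDiffWithinAt (g := Ring.inverse) t hc (hg.smooth t ht)
  · rw [hg.reflection t ht, Matrix.transpose_nonsing_inv]

theorem IsUnitaryGauge.one : IsUnitaryGauge (fun _ => (1 : Mat k)) :=
  ⟨IsComplexGauge.one, fun _ _ => one_mem _⟩

theorem IsUnitaryGauge.mul {g h : ℝ → Mat k} (hg : IsUnitaryGauge g) (hh : IsUnitaryGauge h) :
    IsUnitaryGauge (fun t => g t * h t) :=
  ⟨hg.toIsComplexGauge.mul hh.toIsComplexGauge,
    fun t ht => mul_mem (hg.unitary t ht) (hh.unitary t ht)⟩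

theorem IsUnitaryGauge.inv {g : ℝ → Mat k} (hg : IsUnitaryGauge g) :
    IsUnitaryGauge (fun t => (g t)⁻¹) :=
  ⟨hg.toIsComplexGauge.inv, fun t ht => by
    have h := hg.unitary t ht
    have e : (g t)⁻¹ = star (g t) :=
      Matrix.inv_eq_right_inv (Matrix.mem_unitaryGroup_iff.1 h)
    rw [e]
    exact Unitary.star_mem h⟩

theorem gaugeConnection_one (c : ℂ) (A : ℝ → Mat k) (t : ℝ) :
    gaugeConnection c (fun _ => 1) A t = A t := by
  have h : deriv (fun _ : ℝ => (1 : Mat k)) t = 0 := deriv_const t 1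
  simp [gaugeConnection, h]

theorem gaugeField_one (B : ℝ → Mat k) (t : ℝ) : gaugeField (fun _ => 1) B t = B t := by
  simp [gaugeField]

theorem gaugeField_mul (g h B : ℝ → Mat k) (t : ℝ) :
    gaugeField (fun s => h s * g s) B t = h t * gaugeField g B t * (h t)⁻¹ := by
  simp only [gaugeField, Matrix.mul_inv_rev, mul_assoc]

theorem gaugeConnection_mul (c : ℂ) {g h : ℝ → Mat k} (hg : IsComplexGauge g)
    (hh : IsComplexGauge h) (A : ℝ → Mat k) {t : ℝ} (ht : t ∈ Ioo (0 : ℝ) 1) :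
    gaugeConnection c (fun s => h s * g s) A t =
      h t * gaugeConnection c g A t * (h t)⁻¹ - c • (deriv h t * (h t)⁻¹) := by
  have hd : deriv (fun s => h s * g s) t = deriv h t * g t + h t * deriv g t :=
    ((hh.differentiableAt ht).hasDerivAt.mul (hg.differentiableAt ht).hasDerivAt).deriv
  have hi := hg.mul_inv (Ioo_subset_Icc_self ht)
  have e : deriv h t * g t * ((g t)⁻¹ * (h t)⁻¹) = deriv h t * (h t)⁻¹ := by
    rw [mul_assoc, ← mul_assoc (g t), hi, one_mul]
  simp only [gaugeConnection, hd, Matrix.mul_inv_rev, add_mul, e, mul_sub, sub_mul, smul_add,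
    mul_smul_comm, smul_mul_assoc]
  simp only [mul_assoc]
  abel

theorem gaugeConnection_congr {c : ℂ} {g A A' : ℝ → Mat k} {t : ℝ} (h : A t = A' t) :
    gaugeConnection c g A t = gaugeConnection c g A' t := by
  simp only [gaugeConnection, h]

theorem gaugeConnection_inv (c : ℂ) {g A A' : ℝ → Mat k} (hg : IsComplexGauge g)
    (h : ∀ t ∈ Ioo (0 : ℝ) 1, A' t = gaugeConnection c g A t) (t : ℝ) (ht : t ∈ Ioo (0 : ℝ) 1) :
    A t = gaugeConnection c (fun s => (g s)⁻¹) A' t := by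
  have h1 := gaugeConnection_mul c hg hg.inv A ht
  have h2 : (fun s => (g s)⁻¹ * g s) =ᶠ[𝓝 t] fun _ => (1 : Mat k) := by
    filter_upwards [Ioo_mem_nhds ht.1 ht.2] with s hs using hg.inv_mul (Ioo_subset_Icc_self hs)
  have h3 : gaugeConnection c (fun s => (g s)⁻¹ * g s) A t = A t := by
    have h4 : deriv (fun s => (g s)⁻¹ * g s) t = 0 :=
      h2.deriv_eq.trans (deriv_const t (1 : Mat k))
    simp only [gaugeConnection, h4, h2.eq_of_nhds]
    simp
  rw [← h3, h1, ← h t ht]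
  rfl

theorem gaugeField_inv {g B B' : ℝ → Mat k} (hg : IsComplexGauge g)
    (h : ∀ t ∈ Ioo (0 : ℝ) 1, B' t = gaugeField g B t) (t : ℝ) (ht : t ∈ Ioo (0 : ℝ) 1) :
    B t = gaugeField (fun s => (g s)⁻¹) B' t := by
  have h1 := gaugeField_mul g (fun s => (g s)⁻¹) B t
  have h3 : gaugeField (fun s => (g s)⁻¹ * g s) B t = B t := by
    simp only [gaugeField, hg.inv_mul (Ioo_subset_Icc_self ht), inv_one, one_mul, mul_one]
  rw [← h3, h1, ← h t ht]
  rfl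

theorem mulVec_inv {g : ℝ → Mat k} (hg : IsComplexGauge g) {v w : Fin k → ℂ}
    (h : g 0 *ᵥ v = w) : (g 0)⁻¹ *ᵥ w = v := by
  rw [← h, Matrix.mulVec_mulVec, hg.inv_mul (by simp), Matrix.one_mulVec]

theorem ComplexData.gaugeEquiv_equivalence :
    Equivalence (ComplexData.GaugeEquiv : ComplexData k → ComplexData k → Prop) where
  refl D := ⟨fun _ => 1, IsComplexGauge.one, fun t _ => (gaugeConnection_one _ _ t).symm,
    fun i t _ => (gaugeField_one _ t).symm, Matrix.one_mulVec _⟩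
  symm := by
    rintro D D' ⟨g, hg, h1, h2, h3⟩
    exact ⟨_, hg.inv, gaugeConnection_inv _ hg h1, fun i => gaugeField_inv hg (h2 i),
      mulVec_inv hg h3⟩
  trans := by
    rintro D D' D'' ⟨g, hg, h1, h2, h3⟩ ⟨h, hh, h1', h2', h3'⟩
    refine ⟨_, hh.mul hg, fun t ht => ?_, fun i t ht => ?_, ?_⟩
    · rw [gaugeConnection_mul _ hg hh _ ht, ← h1 t ht, h1' t ht]; rfl
    · rw [gaugeField_mul, ← h2 i t ht, h2' i t ht]; rfl
    · rw [← Matrix.mulVec_mulVec, h3, h3']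

theorem RealData.gaugeEquiv_equivalence :
    Equivalence (RealData.GaugeEquiv : RealData k → RealData k → Prop) where
  refl D := ⟨fun _ => 1, IsUnitaryGauge.one, fun t _ => (gaugeConnection_one _ _ t).symm,
    fun i _ t _ => (gaugeField_one _ t).symm, Matrix.one_mulVec _⟩
  symm := by
    rintro D D' ⟨g, hg, h1, h2, h3⟩
    exact ⟨_, hg.inv, gaugeConnection_inv _ hg.toIsComplexGauge h1,
      fun i hi => gaugeField_inv hg.toIsComplexGauge (h2 i hi), mulVec_inv hg.toIsComplexGauge h3⟩
  trans := by
    rintro D D' D'' ⟨g, hg, h1, h2, h3⟩ ⟨h, hh, h1', h2', h3'⟩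
    refine ⟨_, hh.mul hg, fun t ht => ?_, fun i hi t ht => ?_, ?_⟩
    · rw [gaugeConnection_mul _ hg.toIsComplexGauge hh.toIsComplexGauge _ ht, ← h1 t ht,
        h1' t ht]; rfl
    · rw [gaugeField_mul, ← h2 i hi t ht, h2' i hi t ht]; rfl
    · rw [← Matrix.mulVec_mulVec, h3, h3']

end Equivalence

/-! ### Moduli spaces -/

/-- The type of Nahm complexes. -/
def NahmComplex (k : ℕ) := {D : ComplexData k // IsNahmComplex D}

/-- The type of framed meromorphic solutions. -/
def PoleSolution (k : ℕ) := {S : RealData k // IsPoleSolution S}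

instance nahmComplexSetoid (k : ℕ) : Setoid (NahmComplex k) where
  r N N' := N.1.GaugeEquiv N'.1
  iseqv := ComplexData.gaugeEquiv_equivalence.comap Subtype.val

instance poleSolutionSetoid (k : ℕ) : Setoid (PoleSolution k) where
  r S S' := S.1.GaugeEquiv S'.1
  iseqv := RealData.gaugeEquiv_equivalence.comap Subtype.val

/-- Equivalence classes of Nahm complexes. -/
def NahmModuli (k : ℕ) := Quotient (nahmComplexSetoid k)

/-- Real gauge classes of framed meromorphic solutions. -/
def PoleModuli (k : ℕ) := Quotient (poleSolutionSetoid k)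

/-- The class of a Nahm complex. -/
def NahmComplex.toModuli {k : ℕ} (N : NahmComplex k) : NahmModuli k :=
  Quotient.mk (nahmComplexSetoid k) N

/-- The class of a framed meromorphic solution. -/
def PoleSolution.toModuli {k : ℕ} (S : PoleSolution k) : PoleModuli k :=
  Quotient.mk (poleSolutionSetoid k) S

end Nahm

/-!
Framed solutions of the decoupled octonionic Nahm equations with poles correspond to Nahm complexes.

*Trivialization.* Complex gauge transformations without boundary conditions (`Intertwines`) carry
any solution of the complex equations to constant data `flat B`. In such a frame a solution of the
real equation becomes a path `K` of positive definite matrices with `K' = K P` and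
`P' = 4 ∑ [Bᵢ, K⁻¹ Bᵢᴴ K]` (`IsMetricPath`), and for two metric paths `log tr (K₀⁻¹ K)` is convex up
to the difference of their error terms (`IsMetricPath.hasDerivAt_trace`).

*Injectivity.* A complex gauge transformation between two framed solutions is unitary at the end
points, by the normal form of the residues (`unitary_of_normal_form`). By convexity it is unitary
everywhere (`Intertwines.unitary`).

*The map.* The parallel frame of `X₀` brings a framed solution to the gauge `X₀ = 0`
(`IsPoleSolution.exists_temporal`). There all `βᵢ` are affine functions of `β₀`
(`Intertwines.field_affine`), so `(α, β₀, β₀ᴴ)`, rescaled, solves the ordinary Nahm equations, whose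
solutions with the principal pole are meromorphic: the singular equation for the regular part has
integral resonances, and the conserved quantities of the Lax pair annihilate the obstructions
(`resonance_nahmL`, `exists_formal_solution`, `exists_analyticAt_pole`). Hence the transformed data
form a Nahm complex (`IsTemporalSolution.isNahmComplex`).

*Surjectivity.* Representation theory of the residues brings a Nahm complex to a form in which the
real equation holds to leading order at the poles (`IsNahmComplex.exists_isBalanced`). The Dirichlet
problem for metric paths on compact intervals is solved by minimizing a discrete energy and letting
the mesh tend to zero along an ultrafilter (`exists_discrete_minimizer`, `exists_bvp`). The
convexity estimate with the barrier `t^(3/4) + (1-t)^(3/4) - 1` keeps the solutions on exhausting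
intervals within bounded distance of the given metric and gives a metric path on `(0,1)`
(`exists_metric`). The resulting gauge transformation has unitary limits at the end points
(`Intertwines.exists_unitary_limit`). It respects the reflection because the comparison with its
reflection is unitary, hence constant (`IsBalanced.exists_solution`).
-/



open scoped ComplexOrder

namespace Nahm

open Real (exp exp_add exp_le_exp exp_pos log log_mul norm_eq_abs norm_of_nonneg rpow_add
  rpow_le_one rpow_natCast rpow_neg_one rpow_nonneg rpow_one rpow_zero sinh sq_sqrt sqrt)
open HasDerivAt (continuousAt fun_sum)
open Matrix (conjTranspose_add conjTranspose_apply conjTranspose_conjTranspose conjTranspose_mul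
  conjTranspose_one conjTranspose_smul conjTranspose_sub det_mul diagonal_apply_ne diagonal_mul
  frobenius_norm_conjTranspose inv_eq_right_inv isUnit_iff_isUnit_det isUnit_transpose
  mem_unitaryGroup_iff mem_unitaryGroup_iff' mulVec mulVec_diagonal mulVec_mulVec mulVec_smul
  mul_diagonal nonneg_iff_posSemidef nonsing_inv_eq_ringInverse nonsing_inv_nonsing_inv of_apply
  one_mulVec smul_mulVec star_eq_conjTranspose sum_mulVec trace_add trace_mul_comm trace_neg
  trace_one trace_smul trace_sub trace_sum transpose transpose_add transpose_mul
  transpose_nonsing_inv transpose_smul transpose_sub transpose_transpose unitaryGroup)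
open LinearMap (id_apply range_eq_top toContinuousLinearMap)
open ContinuousLinearMap (continuous fst snd)
open Complex (I I_mul_I I_sq add_re coe_smul conj_I conj_ofReal dist_eq mul_conj mul_re neg_re
  normSq_eq_norm_sq norm_ofNat norm_real ofReal_inv ofReal_mul ofReal_one ofReal_sub ofReal_sum
  ofReal_zero re_sum star_def sub_re)
open Finset (card_range mem_filter mul_sum prod_ne_zero_iff smul_sum sum_congr sum_cons sum_const
  sum_eq_single sum_eq_zero sum_le_sum sum_mul sum_neg_distrib sum_nonneg sum_range_succ sum_smul
  sum_sub_distrib)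
open Metric (ball ball_mem_nhds closedBall mem_ball mem_ball_self)
open Nat (cast_nonneg cast_pos hyperfilter_le_atTop succ_ne_zero)
open Function (update update_of_ne update_self)
open Unitary (star_mem)
open Submodule (span)
open Module (Basis)
open Polynomial (X coeff_X_mul coeff_X_pow_mul coeff_add coeff_derivative coeff_mul coeff_smul
  coeff_sub derivative mul_coeff_zero)

variable {k : ℕ}
variable {t : ℝ} {f g G Ψ : ℝ → Mat k} {B : Fin 3 → Mat k} {D D' N : ComplexData k} {U K : Mat k}
  {v : Fin k → ℂ}


/-- The open unit interval. -/
notation "𝕀" => Set.Ioo (0 : ℝ) 1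
notation:max "𝐔" k:max => Matrix.unitaryGroup (Fin k) ℂ
notation:max "Mat³" k:max => Mat k × Mat k × Mat k
/-- `f =O⁺ μ` means `f t = O(t ^ μ)` as `t` tends to `0` from the right. -/
notation:50 f:51 " =O⁺ " μ:max => Asymptotics.IsBigO (nhdsWithin 0 (Set.Ioi 0)) f fun t : ℝ => t ^ (μ : ℝ)
notation "a₀" => principalA
notation "b₀" => principalB
/-- A fixed ultrafilter on `ℕ`, along which all bounded sequences converge. -/
notation "𝒰" => (Filter.hyperfilter ℕ : Filter ℕ)

/-! ### Linear differential equations and smoothness -/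

/-- The radial retraction onto the ball of radius `M`. It makes a linear vector field bounded,
so that the Picard–Lindelöf theorem applies on the whole interval at once. -/
noncomputable def ballRetraction {E : Type*} [NormedAddCommGroup E] [NormedSpace ℝ E]
    (M : ℝ) (x : E) : E := (M / max M ‖x‖) • x

section BallRetraction

variable {E : Type*} [NormedAddCommGroup E] [NormedSpace ℝ E] {M : ℝ}

theorem norm_ballRetraction_le (hM : 0 < M) (x : E) : ‖ballRetraction M x‖ ≤ M := by
  rw [ballRetraction, norm_smul, norm_of_nonneg (by positivity), div_mul_eq_mul_div,
    div_le_iff₀ (lt_of_lt_of_le hM (le_max_left _ _))]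
  simp [*]

theorem ballRetraction_of_norm_le (hM : 0 < M) {x : E} (hx : ‖x‖ ≤ M) : ballRetraction M x = x := by
  rw [ballRetraction, max_eq_left hx, div_self hM.ne', one_smul]

theorem norm_ballRetraction_sub_le (hM : 0 < M) (x y : E) :
    ‖ballRetraction M x - ballRetraction M y‖ ≤ 2 * ‖x - y‖ := by
  set u := max M ‖x‖ with hu
  set v := max M ‖y‖ with hv
  have hu0 : 0 < u := lt_of_lt_of_le hM (le_max_left _ _)
  have hv0 : 0 < v := lt_of_lt_of_le hM (le_max_left _ _)
  have h1 : ballRetraction M x - ballRetraction M y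
      = (M / u) • (x - y) + (M / (u * v) * (v - u)) • y := by
    have e : M / u - M / v = M / (u * v) * (v - u) := by field_simp
    rw [← e, ballRetraction, ballRetraction, ← hu, ← hv, smul_sub, sub_smul]
    abel
  have h2 : |v - u| ≤ ‖x - y‖ := by
    have := abs_max_sub_max_le_max M ‖y‖ M ‖x‖
    rw [sub_self, abs_zero, max_eq_right (abs_nonneg (‖y‖ - ‖x‖))] at this
    exact norm_sub_rev y x ▸ this.trans (abs_norm_sub_norm_le _ _)
  have h4 : M / (u * v) * ‖y‖ ≤ 1 := by
    rw [div_mul_eq_mul_div, div_le_one (by positivity)]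
    exact mul_le_mul (le_max_left _ _) (le_max_right _ _) (norm_nonneg _) hu0.le
  rw [h1]
  refine (norm_add_le _ _).trans ?_
  rw [norm_smul, norm_smul, norm_of_nonneg (by positivity : 0 ≤ M / u), norm_mul,
    norm_of_nonneg (by positivity : 0 ≤ M / (u * v)), norm_eq_abs]
  have h5 : M / (u * v) * |v - u| * ‖y‖ ≤ 1 * ‖x - y‖ := by
    calc M / (u * v) * |v - u| * ‖y‖ = (M / (u * v) * ‖y‖) * |v - u| := by ring
      _ ≤ 1 * ‖x - y‖ := mul_le_mul h4 h2 (abs_nonneg _) zero_le_one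
  have h6 := mul_le_mul_of_nonneg_right ((div_le_one hu0).2 (le_max_left _ _)) (norm_nonneg (x - y))
  linarith

end BallRetraction

/-- Linear equations have global solutions: the Picard iteration applies after a cut-off by the
radial retraction, and Gronwall's inequality shows that the cut-off is inactive. -/
theorem exists_linear_ode_Icc {E : Type*} [NormedAddCommGroup E] [NormedSpace ℝ E]
    [CompleteSpace E] {A : ℝ → E →L[ℝ] E} {c d : ℝ} (hA : ContinuousOn A (Icc c d))
    (hcd : c ≤ d) (x₀ : E) :
    ∃ y : ℝ → E, y c = x₀ ∧ ∀ t ∈ Icc c d, HasDerivWithinAt y (A t (y t)) (Icc c d) t := by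
  obtain ⟨K, hK⟩ := isCompact_Icc.exists_bound_of_continuousOn hA
  set K' : ℝ := max K 0 with hK'
  have hK0 : 0 ≤ K' := le_max_right _ _
  have hb : ∀ t ∈ Icc c d, ‖A t‖ ≤ K' := fun t ht => (hK t ht).trans (le_max_left _ _)
  set M : ℝ := (‖x₀‖ + 1) * exp (K' * (d - c)) with hM
  have hM0 : 0 < M := by positivity
  have hML : 0 ≤ K' * M := by positivity
  have hPL : IsPicardLindelof (fun t x => A t (ballRetraction M x)) (⟨c, le_rfl, hcd⟩ : Icc c d) x₀
      ⟨K' * M * (d - c), mul_nonneg hML (by linarith)⟩ 0 ⟨K' * M, hML⟩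
      ⟨K' * 2, by positivity⟩ := by
    refine ⟨fun t ht => LipschitzOnWith.of_dist_le_mul fun x _ y _ => ?_, fun x _ => ?_,
      fun t ht x _ => ?_, ?_⟩
    · rw [dist_eq_norm, dist_eq_norm, ← map_sub]
      refine ((A t).le_opNorm _).trans ?_
      change _ ≤ K' * 2 * _
      rw [mul_assoc]
      exact mul_le_mul (hb t ht) (norm_ballRetraction_sub_le hM0 x y) (norm_nonneg _) hK0
    · exact hA.clm_apply continuousOn_const
    · exact ((A t).le_opNorm _).trans
        (mul_le_mul (hb t ht) (norm_ballRetraction_le hM0 x) (norm_nonneg _) hK0)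
    · change K' * M * max (d - c) (c - c) ≤ K' * M * (d - c) - 0
      simp [*]
  obtain ⟨y, hy0, hy⟩ := hPL.exists_eq_forall_mem_Icc_hasDerivWithinAt₀
  have hle : ∀ t ∈ Icc c d, ‖y t‖ ≤ M := by
    intro t ht
    have hg := norm_le_gronwallBound_of_norm_deriv_right_le (f := y)
      (f' := fun t => A t (ballRetraction M (y t)))
      (δ := ‖x₀‖) (K := K') (ε := 0) (a := c) (b := d)
      (fun s hs => (hy s hs).continuousWithinAt)
      (fun s hs => (hy s (Ico_subset_Icc_self hs)).mono_of_mem_nhdsWithin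
        (Icc_mem_nhdsGE_of_mem hs))
      (by rw [← hy0]) (fun s hs => by
        rw [add_zero]
        refine ((A s).le_opNorm _).trans
          (mul_le_mul (hb s (Ico_subset_Icc_self hs)) ?_ (norm_nonneg _) hK0)
        rw [ballRetraction, norm_smul, norm_of_nonneg (by positivity)]
        refine mul_le_of_le_one_left (norm_nonneg _) ?_
        exact (div_le_one (lt_of_lt_of_le hM0 (le_max_left _ _))).2 (le_max_left _ _)) t ht
    rw [gronwallBound_ε0] at hg
    refine hg.trans ?_
    rw [hM]
    exact mul_le_mul (by linarith) (exp_le_exp.2 (mul_le_mul_of_nonneg_left (by linarith [ht.2])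
      hK0)) (exp_pos _).le (by positivity)
  refine ⟨y, hy0, fun t ht => ?_⟩
  have := hy t ht
  rwa [ballRetraction_of_norm_le hM0 (hle t ht)] at this

/-- A solution of a differential equation inherits smoothness from the right-hand side. -/
theorem contDiffOn_of_bootstrap {E : Type*} [NormedAddCommGroup E] [NormedSpace ℝ E]
    {y v : ℝ → E} {s : Set ℝ} (hs : IsOpen s) (h : ∀ t ∈ s, HasDerivAt y (v t) t)
    (hv : ∀ n : ℕ, ContDiffOn ℝ n y s → ContDiffOn ℝ n v s) : ContDiffOn ℝ ∞ y s := by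
  rw [contDiffOn_infty]
  intro n
  induction n with
  | zero => exact contDiffOn_zero.2 fun t ht => (continuousAt (𝕜 := ℝ) (h t ht)).continuousWithinAt
  | succ n ih =>
    have := (contDiffOn_succ_iff_deriv_of_isOpen (𝕜 := ℝ) (n := n) (f := y) hs).2
      ⟨(fun t ht => (h t ht).differentiableAt.differentiableWithinAt), fun hn => by simp at hn, (hv
        n ih).congr fun t ht => (h t ht).deriv⟩
    exact_mod_cast this

theorem hasDerivWithinAt_inv {g' : Mat k} {s : Set ℝ}
    (h : HasDerivWithinAt g g' s t) (hu : IsUnit (g t)) :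
    HasDerivWithinAt (fun s => (g s)⁻¹) (-((g t)⁻¹ * g' * (g t)⁻¹)) s t := by
  obtain ⟨u, hu⟩ := hu
  have h1 := hasFDerivAt_ringInverse (𝕜 := ℝ) u
  rw [hu] at h1
  have h2 := h1.comp_hasDerivWithinAt t h
  simp only [nonsing_inv_eq_ringInverse, ← hu, Ring.inverse_unit] at h2 ⊢
  exact h2

theorem hasDerivAt_inv {g' : Mat k}
    (h : HasDerivAt g g' t) (hu : IsUnit (g t)) :
    HasDerivAt (fun s => (g s)⁻¹) (-((g t)⁻¹ * g' * (g t)⁻¹)) t := by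
  exact hasDerivWithinAt_univ.1 (hasDerivWithinAt_inv (hasDerivWithinAt_univ.2 h) hu)

theorem contDiffOn_inv {s : Set ℝ} {n : WithTop ℕ∞} (h : ContDiffOn ℝ n g s)
    (hu : ∀ t ∈ s, IsUnit (g t)) : ContDiffOn ℝ n (fun t => (g t)⁻¹) s := by
  simp only [nonsing_inv_eq_ringInverse]
  intro t ht
  obtain ⟨u, hu⟩ := hu t ht
  have hc := contDiffAt_ringInverse ℝ (n := n) u
  rw [hu] at hc
  exact ContDiffAt.comp_contDiffWithinAt (g := Ring.inverse) t hc (h t ht)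

theorem continuousOn_inv {s : Set ℝ} (h : ContinuousOn g s)
    (hu : ∀ t ∈ s, IsUnit (g t)) : ContinuousOn (fun t => (g t)⁻¹) s :=
  contDiffOn_zero.1 (contDiffOn_inv (contDiffOn_zero.2 h) hu)

theorem tendsto_inv {l : Filter ℝ} (hU : IsUnit U)
    (h : Tendsto G l (𝓝 U)) : Tendsto (fun t => (G t)⁻¹) l (𝓝 U⁻¹) := by
  obtain ⟨u, rfl⟩ := hU
  simp only [nonsing_inv_eq_ringInverse]
  exact (NormedRing.inverse_continuousAt u).tendsto.comp h

/-- Conjugation preserves commutators. -/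
theorem lie_conj {A A' : Mat k} (h : A' * A = 1) (X Y : Mat k) :
    ⁅A * X * A', A * Y * A'⁆ = A * ⁅X, Y⁆ * A' := by
  have e (X Y : Mat k) : (A * X * A') * (A * Y * A') = A * (X * Y) * A' := by
    have := congrArg (A * X * · * (Y * A')) h
    grind
  rw [Ring.lie_def, e, e, Ring.lie_def, mul_sub, sub_mul]

theorem inv_inv' {A : Mat k} (h : IsUnit A) : A⁻¹⁻¹ = A :=
  nonsing_inv_nonsing_inv _ ((isUnit_iff_isUnit_det _).1 h)

theorem nonsing_inv_mul' {A : Mat k} (h : IsUnit A) : A⁻¹ * A = 1 :=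
  Matrix.nonsing_inv_mul _ ((isUnit_iff_isUnit_det _).1 h)

theorem mul_nonsing_inv' {A : Mat k} (h : IsUnit A) : A * A⁻¹ = 1 :=
  Matrix.mul_nonsing_inv _ ((isUnit_iff_isUnit_det _).1 h)

theorem isUnit_nonsing_inv {A : Mat k} (h : IsUnit A) : IsUnit A⁻¹ :=
  Matrix.isUnit_nonsing_inv_iff.2 h

/-- The transpose as a continuous real-linear map. -/
noncomputable def transposeCLM (k : ℕ) : Mat k →L[ℝ] Mat k :=
  (Matrix.transposeLinearEquiv (Fin k) (Fin k) ℝ ℂ).toLinearMap.toContinuousLinearMap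

/-- The conjugate transpose as a continuous real-linear map. -/
noncomputable def conjTransposeCLM (k : ℕ) : Mat k →L[ℝ] Mat k := toContinuousLinearMap
    { toFun := fun A => Aᴴ
      map_add' := conjTranspose_add
      map_smul' := fun c A => by simp }

/-- The real part of the trace as a continuous real-linear map. -/
noncomputable def reTrCLM (k : ℕ) : Mat k →L[ℝ] ℝ := toContinuousLinearMap
    { toFun := fun A => A.trace.re
      map_add' := fun A B => by simp
      map_smul' := fun c A => by simp }

theorem hasDerivAt_transpose {g' : Mat k}
    (h : HasDerivAt g g' t) : HasDerivAt (fun t => (g t)ᵀ) g'ᵀ t :=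
  (transposeCLM k).hasFDerivAt.comp_hasDerivAt t h

theorem hasDerivAt_conjTranspose {g' : Mat k}
    (h : HasDerivAt g g' t) : HasDerivAt (fun t => (g t)ᴴ) g'ᴴ t :=
  (conjTransposeCLM k).hasFDerivAt.comp_hasDerivAt t h

theorem hasDerivAt_reTr {g' : Mat k}
    (h : HasDerivAt g g' t) : HasDerivAt (fun t => (g t).trace.re) g'.trace.re t :=
  (reTrCLM k).hasFDerivAt.comp_hasDerivAt t h

theorem constant_of_hasDerivWithinAt_zero {E : Type*} [NormedAddCommGroup E] [NormedSpace ℝ E]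
    {f : ℝ → E} {s : Set ℝ} (hs : Convex ℝ s) (h : ∀ t ∈ s, HasDerivWithinAt f 0 s t)
    {x y : ℝ} (hx : x ∈ s) (hy : y ∈ s) : f x = f y := by
  have := hs.norm_image_sub_le_of_norm_hasDerivWithin_le (f := f) (f' := fun _ => 0) (C := 0)
    h (by simp) hx hy
  rw [zero_mul] at this
  exact (sub_eq_zero.1 (norm_le_zero_iff.1 this)).symm

theorem hasDerivWithinAt_mul_inv {s : Set ℝ} {h : ℝ → Mat k} {X Y : Mat k}
    (hg : HasDerivWithinAt g (g t * X) s t) (hh : HasDerivWithinAt h (h t * Y) s t)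
    (hu : IsUnit (h t)) :
    HasDerivWithinAt (fun t => g t * (h t)⁻¹) (g t * (X - Y) * (h t)⁻¹) s t := by
  refine (hg.mul (hasDerivWithinAt_inv hh hu)).congr_deriv ?_
  rw [← mul_assoc (h t)⁻¹, nonsing_inv_mul' hu]
  noncomm_ring

/-- Two solutions of `g' = g X` that agree at one point agree everywhere. -/
theorem linear_ode_unique {s : Set ℝ} (hs : Convex ℝ s) {X h : ℝ → Mat k}
    (hg : ∀ t ∈ s, HasDerivWithinAt g (g t * X t) s t)
    (hh : ∀ t ∈ s, HasDerivWithinAt h (h t * X t) s t) (hu : ∀ t ∈ s, IsUnit (h t))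
    {t₀ : ℝ} (h₀ : t₀ ∈ s) (he : g t₀ = h t₀) (ht : t ∈ s) : g t = h t := by
  have h1 : g t * (h t)⁻¹ = g t₀ * (h t₀)⁻¹ :=
    constant_of_hasDerivWithinAt_zero hs (f := fun t => g t * (h t)⁻¹) (fun r hr => by
      exact (hasDerivWithinAt_mul_inv (hg r hr) (hh r hr) (hu r hr)).congr_deriv (by simp)) ht h₀
  rw [he, mul_nonsing_inv' (hu _ h₀)] at h1
  calc g t = g t * ((h t)⁻¹ * h t) := by rw [nonsing_inv_mul' (hu _ ht), mul_one]
    _ = h t := by rw [← mul_assoc, h1, one_mul]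

theorem exists_frame_Icc_left {X : ℝ → Mat k} {c d : ℝ} (hX : ContinuousOn X (Icc c d))
    (hcd : c ≤ d) : ∃ g : ℝ → Mat k, g c = 1 ∧
      ∀ t ∈ Icc c d, HasDerivWithinAt g (g t * X t) (Icc c d) t ∧ IsUnit (g t) := by
  obtain ⟨g, hg0, hg⟩ := exists_linear_ode_Icc
    (A := fun t => (ContinuousLinearMap.mul ℝ (Mat k)).flip (X t))
    ((continuous _).comp_continuousOn hX) hcd 1
  obtain ⟨m, hm0, hm⟩ := exists_linear_ode_Icc
    (A := fun t => (ContinuousLinearMap.mul ℝ (Mat k)) (-X t))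
    ((continuous _).comp_continuousOn hX.neg) hcd 1
  simp only [ContinuousLinearMap.flip_apply, ContinuousLinearMap.mul_apply'] at hg hm
  refine ⟨g, hg0, fun t ht => ⟨hg t ht, ?_⟩⟩
  have h1 : g t * m t = g c * m c :=
    constant_of_hasDerivWithinAt_zero (convex_Icc c d) (f := fun t => g t * m t) (fun s hs => by
      refine ((hg s hs).mul (hm s hs)).congr_deriv ?_
      noncomm_ring) ht ⟨le_rfl, hcd⟩
  rw [hg0, hm0, one_mul] at h1
  exact (isUnit_iff_isUnit_det _).2 (Matrix.isUnit_det_of_right_inverse h1)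

theorem exists_frame_Icc {X : ℝ → Mat k} {c d : ℝ} (hX : ContinuousOn X (Icc c d))
    {t₀ : ℝ} (h₀ : t₀ ∈ Icc c d) : ∃ g : ℝ → Mat k, g t₀ = 1 ∧
      ∀ t ∈ Icc c d, HasDerivWithinAt g (g t * X t) (Icc c d) t ∧ IsUnit (g t) := by
  obtain ⟨g, -, hg⟩ := exists_frame_Icc_left hX (h₀.1.trans h₀.2)
  refine ⟨fun t => (g t₀)⁻¹ * g t, nonsing_inv_mul' (hg _ h₀).2, fun t ht => ⟨?_, ?_⟩⟩
  · exact ((hg t ht).1.const_mul (g t₀)⁻¹).congr_deriv (mul_assoc _ _ _).symm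
  · simp [*]

theorem exists_frame_Ioo {X : ℝ → Mat k} (hX : ContinuousOn X 𝕀) : ∃ g : ℝ → Mat k, g (1 / 2) = 1 ∧
      ∀ t ∈ 𝕀, HasDerivAt g (g t * X t) t ∧ IsUnit (g t) := by
  have key : ∀ c : ℝ, 0 < c → c ≤ 1 / 2 → ∃ g : ℝ → Mat k, g (1 / 2) = 1 ∧
      ∀ t ∈ Icc c (1 - c), HasDerivWithinAt g (g t * X t) (Icc c (1 - c)) t ∧ IsUnit (g t) :=
    fun c h0 hc => exists_frame_Icc
      (hX.mono fun t ht => ⟨by linarith [ht.1], by linarith [ht.2]⟩) ⟨hc, by linarith⟩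
  choose! G hG using key
  have hagree : ∀ c c' t : ℝ, 0 < c → c ≤ c' → c' ≤ 1 / 2 → t ∈ Icc c' (1 - c') →
      G c' t = G c t := by
    intro c c' t hc hcc hc' ht
    have hsub : Icc c' (1 - c') ⊆ Icc c (1 - c) := Icc_subset_Icc hcc (by linarith)
    have h1 := hG c hc (hcc.trans hc')
    have h2 := hG c' (hc.trans_le hcc) hc'
    exact linear_ode_unique (convex_Icc c' (1 - c')) (X := X) (fun s hs => (h2.2 s hs).1)
      (fun s hs => (h1.2 s (hsub hs)).1.mono hsub) (fun s hs => (h1.2 s (hsub hs)).2)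
      (t₀ := 1 / 2) ⟨hc', by linarith⟩ (h2.1.trans h1.1.symm) ht
  refine ⟨fun t => G (min t (1 - t) / 2) t, ?_, fun t ht => ?_⟩
  · exact (hG _ (by norm_num) (by norm_num)).1
  set c := min t (1 - t) / 4 with hc
  have hm : 0 < min t (1 - t) := lt_min ht.1 (by linarith [ht.2])
  have hm1 : min t (1 - t) ≤ t := min_le_left _ _
  have hm2 : min t (1 - t) ≤ 1 - t := min_le_right _ _
  have hcl : ∀ s ∈ Ioo (t - c) (t + c), G (min s (1 - s) / 2) s = G c s := by grind
  have h1 := (hG c (by positivity) (by linarith)).2 t ⟨by linarith, by linarith⟩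
  have hev : (fun t => G (min t (1 - t) / 2) t) =ᶠ[𝓝 t] G c := by
    filter_upwards [Ioo_mem_nhds (by linarith : t - c < t) (by linarith : t < t + c)] with s hs
      using hcl s hs
  simp only [hev.eq_of_nhds]
  exact ⟨(h1.1.hasDerivAt (Icc_mem_nhds (by linarith) (by linarith))).congr_of_eventuallyEq hev,
    h1.2⟩

/-! ### The Frobenius inner product -/

theorem norm_sq_eq_trace (A : Mat k) : ‖A‖ ^ 2 = (Aᴴ * A).trace.re := by
  rw [Matrix.frobenius_norm_def, ← Real.sqrt_eq_rpow, sq_sqrt (by positivity)]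
  rw [Matrix.trace, re_sum, Finset.sum_comm]
  refine sum_congr rfl fun i _ => ?_
  rw [Matrix.diag_apply, Matrix.mul_apply, re_sum]
  refine sum_congr rfl fun j _ => ?_
  rw [conjTranspose_apply, star_def, ← Complex.normSq_eq_conj_mul_self,
    Complex.ofReal_re, normSq_eq_norm_sq]
  norm_num

theorem re_trace_conjTranspose (A : Mat k) : (Aᴴ).trace.re = A.trace.re := by
  rw [Matrix.trace_conjTranspose]; simp

theorem re_trace_mul_le (A B : Mat k) : (Aᴴ * B).trace.re ≤ ‖A‖ * ‖B‖ := by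
  have h1 : ‖A + B‖ ^ 2 = ‖A‖ ^ 2 + ‖B‖ ^ 2 + 2 * (Aᴴ * B).trace.re := by
    have h2 : (Bᴴ * A).trace.re = (Aᴴ * B).trace.re := by rw [← re_trace_conjTranspose]; simp
    rw [norm_sq_eq_trace, norm_sq_eq_trace, norm_sq_eq_trace, conjTranspose_add,
      add_mul, mul_add, mul_add]
    simp only [trace_add, add_re, h2]
    ring
  have h2 : ‖A + B‖ ^ 2 ≤ (‖A‖ + ‖B‖) ^ 2 := pow_le_pow_left₀ (norm_nonneg _) (norm_add_le A B) 2
  nlinarith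

theorem abs_re_trace_mul_le (A B : Mat k) : |(Aᴴ * B).trace.re| ≤ ‖A‖ * ‖B‖ := by
  rw [abs_le]
  refine ⟨?_, re_trace_mul_le A B⟩
  have := re_trace_mul_le (-A) B
  rw [norm_neg, Matrix.conjTranspose_neg, neg_mul, trace_neg, neg_re] at this
  linarith

theorem abs_re_trace_mul_le' (A B : Mat k) : |(A * B).trace.re| ≤ ‖A‖ * ‖B‖ := by
  have := abs_re_trace_mul_le Aᴴ B
  aesop

open scoped MatrixOrder in
theorem exists_posDef_sqrt (hK : K.PosDef) : ∃ Q : Mat k, Q.PosDef ∧ Q * Q = K := by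
  have h1 : CFC.sqrt K * CFC.sqrt K = K := CFC.sqrt_mul_sqrt_self K (nonneg_iff_posSemidef.2
    hK.posSemidef)
  refine ⟨CFC.sqrt K, ((nonneg_iff_posSemidef.1 (CFC.sqrt_nonneg K)).posDef_iff_isUnit).2 ?_, h1⟩
  have := hK.isUnit
  grind

theorem exists_posDef_factor (hK : K.PosDef) : ∃ g : Mat k, IsUnit g ∧ K = gᴴ * g := by
  obtain ⟨Q, hQ, h⟩ := exists_posDef_sqrt hK
  exact ⟨Q, hQ.isUnit, by rw [hQ.1, h]⟩

theorem conjTranspose_inv_mul {g : Mat k} (hg : IsUnit g) : (g⁻¹)ᴴ * gᴴ = 1 := by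
  rw [← conjTranspose_mul, mul_nonsing_inv' hg, conjTranspose_one]

theorem conjTranspose_mul_inv {g : Mat k} (hg : IsUnit g) : gᴴ * (g⁻¹)ᴴ = 1 := by
  rw [← conjTranspose_mul, nonsing_inv_mul' hg, conjTranspose_one]

theorem posDef_conjTranspose_mul_self {g : Mat k} (hg : IsUnit g) : (gᴴ * g).PosDef :=
  (Matrix.posSemidef_conjTranspose_mul_self g).posDef_iff_isUnit.2
    (((Matrix.isUnit_conjTranspose g).2 hg).mul hg)

theorem inv_conjTranspose_mul_self (g : Mat k) : (gᴴ * g)⁻¹ = g⁻¹ * (g⁻¹)ᴴ := by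
  rw [Matrix.mul_inv_rev, Matrix.conjTranspose_nonsing_inv]

theorem norm_factor_sq (g g₀ X : Mat k) :
    ‖g * X * g₀⁻¹‖ ^ 2 = ((gᴴ * g) * X * (g₀ᴴ * g₀)⁻¹ * Xᴴ).trace.re := by
  rw [norm_sq_eq_trace, inv_conjTranspose_mul_self]
  simp only [conjTranspose_mul]
  rw [show (g₀⁻¹)ᴴ * (Xᴴ * gᴴ) * (g * X * g₀⁻¹) = ((g₀⁻¹)ᴴ * Xᴴ) * (gᴴ * g * X * g₀⁻¹) by
    noncomm_ring, trace_mul_comm]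
  congr 2
  noncomm_ring

/-- `tr (K X K₀⁻¹ Xᴴ)` is a squared norm of `X`. -/
theorem weighted_trace_nonneg {K₀ : Mat k} (hK : K.PosDef) (hK₀ : K₀.PosDef) (X : Mat k) :
    0 ≤ (K * X * K₀⁻¹ * Xᴴ).trace.re := by
  obtain ⟨g, -, rfl⟩ := exists_posDef_factor hK
  obtain ⟨g₀, -, rfl⟩ := exists_posDef_factor hK₀
  rw [← norm_factor_sq]
  positivity

theorem trace_inv_mul_factor (g g₀ : Mat k) :
    ((g₀ᴴ * g₀)⁻¹ * (gᴴ * g)).trace.re = ‖g * g₀⁻¹‖ ^ 2 := by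
  have := norm_factor_sq g g₀ 1
  rw [mul_one, mul_one, conjTranspose_one, mul_one] at this
  rw [this, trace_mul_comm]

theorem trace_inv_mul_nonneg {K₀ : Mat k} (hK : K.PosDef) (hK₀ : K₀.PosDef) :
    0 ≤ (K₀⁻¹ * K).trace.re := by
  obtain ⟨g, -, rfl⟩ := exists_posDef_factor hK
  obtain ⟨g₀, -, rfl⟩ := exists_posDef_factor hK₀
  rw [trace_inv_mul_factor]; positivity

theorem trace_inv_mul_pos (hk : 0 < k) {K₀ : Mat k} (hK : K.PosDef) (hK₀ : K₀.PosDef) :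
    0 < (K₀⁻¹ * K).trace.re := by
  obtain ⟨g, hg, rfl⟩ := exists_posDef_factor hK
  obtain ⟨g₀, hg₀, rfl⟩ := exists_posDef_factor hK₀
  rw [trace_inv_mul_factor]
  have : Nonempty (Fin k) := ⟨⟨0, hk⟩⟩
  have := norm_pos_iff.2 (hg.mul (isUnit_nonsing_inv hg₀)).ne_zero
  positivity

theorem trace_inv_mul_mul_factor (g g₀ X : Mat k) :
    ((g₀ᴴ * g₀)⁻¹ * (gᴴ * g) * X).trace = ((g * g₀⁻¹)ᴴ * (g * X * g₀⁻¹)).trace := by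
  rw [inv_conjTranspose_mul_self, conjTranspose_mul, ← mul_assoc _ _ g₀⁻¹, trace_mul_comm _ g₀⁻¹]
  simp only [mul_assoc]

theorem weighted_cauchy_schwarz {K₀ : Mat k} (hK : K.PosDef) (hK₀ : K₀.PosDef) (X : Mat k) :
    (K₀⁻¹ * K * X).trace.re ^ 2 ≤ (K₀⁻¹ * K).trace.re * (K * X * K₀⁻¹ * Xᴴ).trace.re := by
  obtain ⟨g, -, rfl⟩ := exists_posDef_factor hK
  obtain ⟨g₀, -, rfl⟩ := exists_posDef_factor hK₀
  rw [← norm_factor_sq, trace_inv_mul_factor, ← mul_pow, trace_inv_mul_mul_factor, ← sq_abs]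
  exact pow_le_pow_left₀ (abs_nonneg _) (abs_re_trace_mul_le _ _) 2

/-- With `K₀ = g₀ᴴ g₀`, the error term `tr (K₀⁻¹ K E)` is controlled by `g₀ E g₀⁻¹`. -/
theorem abs_trace_inv_mul_mul_le (hK : K.PosDef) {g₀ : Mat k} (hg₀ : IsUnit g₀)
    (E : Mat k) : |((g₀ᴴ * g₀)⁻¹ * K * E).trace.re| ≤
      ((g₀ᴴ * g₀)⁻¹ * K).trace.re * ‖g₀ * E * g₀⁻¹‖ := by
  obtain ⟨g, -, rfl⟩ := exists_posDef_factor hK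
  rw [trace_inv_mul_factor, trace_inv_mul_mul_factor,
    show g * E * g₀⁻¹ = g * g₀⁻¹ * (g₀ * E * g₀⁻¹) by grind [nonsing_inv_mul' hg₀]]
  refine (abs_re_trace_mul_le _ _).trans ?_
  have := norm_mul_le (g * g₀⁻¹) (g₀ * E * g₀⁻¹)
  nlinarith [norm_nonneg (g * g₀⁻¹)]

theorem abs_trace_inv_mul_mul_le' (hK : K.PosDef) {g₀ : Mat k} (hg₀ : IsUnit g₀)
    (E : Mat k) : |(K⁻¹ * (g₀ᴴ * g₀) * E).trace.re| ≤
      (K⁻¹ * (g₀ᴴ * g₀)).trace.re * ‖g₀ * E * g₀⁻¹‖ := by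
  obtain ⟨g, hg, rfl⟩ := exists_posDef_factor hK
  rw [trace_inv_mul_factor, trace_inv_mul_mul_factor,
    show g₀ * E * g⁻¹ = g₀ * E * g₀⁻¹ * (g₀ * g⁻¹) by grind [nonsing_inv_mul' hg₀]]
  refine (abs_re_trace_mul_le _ _).trans ?_
  have := norm_mul_le (g₀ * E * g₀⁻¹) (g₀ * g⁻¹)
  nlinarith [norm_nonneg (g₀ * g⁻¹)]

/-- `‖g - (gᴴ)⁻¹‖² = tr h + tr h⁻¹ - 2k` for `h = gᴴ g`. -/
theorem norm_sub_conjTranspose_inv_sq {g : Mat k} (hg : IsUnit g) :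
    ‖g - (g⁻¹)ᴴ‖ ^ 2 = ‖g‖ ^ 2 + ‖g⁻¹‖ ^ 2 - 2 * k := by
  have h1 := norm_sq_eq_trace g⁻¹ᴴ
  rw [frobenius_norm_conjTranspose] at h1
  rw [norm_sq_eq_trace (g - g⁻¹ᴴ), norm_sq_eq_trace g, h1, conjTranspose_sub,
    conjTranspose_conjTranspose, sub_mul, mul_sub, mul_sub, nonsing_inv_mul' hg,
    conjTranspose_mul_inv hg]
  simp only [trace_sub, sub_re, trace_one]
  simp
  ring

/-! ### Metrics along a Nahm complex and the convexity of their distance -/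

/-- `∑ᵢ [Bᵢ, K⁻¹ Bᵢᴴ K]`: the sum of the commutators of `Bᵢ` with its adjoint for the
metric `K`. -/
noncomputable def curv (B : Fin 3 → Mat k) (K : Mat k) : Mat k := ∑ i, ⁅B i, K⁻¹ * (B i)ᴴ * K⁆

/-- In a frame in which `α = 0` and the `βᵢ = Bᵢ` are constant, a complex gauge transformation `g`
enters only through the metric `K = gᴴ g`. With `P = K⁻¹ K'`, the real equation reads
`P' = 4 ∑ [Bᵢ, K⁻¹ Bᵢᴴ K]`; the function `E` measures the failure of this equation. -/
structure IsMetricPath (B : Fin 3 → Mat k) (s : Set ℝ) (K P E : ℝ → Mat k) : Prop where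
  posDef : ∀ t ∈ s, (K t).PosDef
  symm : ∀ t ∈ s, (P t)ᴴ * K t = K t * P t
  deriv_K : ∀ t ∈ s, HasDerivAt K (K t * P t) t
  deriv_P : ∀ t ∈ s, HasDerivAt P ((4 : ℂ) • curv B (K t) + E t) t

theorem curv_trace_identity {K₀ B : Mat k} (hK : K.PosDef) (hK₀ : K₀.PosDef) :
    (K₀⁻¹ * K * (⁅B, K⁻¹ * Bᴴ * K⁆ - ⁅B, K₀⁻¹ * Bᴴ * K₀⁆)).trace =
      (K * (K⁻¹ * Bᴴ * K - K₀⁻¹ * Bᴴ * K₀) * K₀⁻¹ * (K⁻¹ * Bᴴ * K - K₀⁻¹ * Bᴴ * K₀)ᴴ).trace := by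
  have hD : (K⁻¹ * Bᴴ * K - K₀⁻¹ * Bᴴ * K₀)ᴴ = K * B * K⁻¹ - K₀ * B * K₀⁻¹ := by
    simp [mul_assoc, Matrix.conjTranspose_nonsing_inv, hK.1.eq, hK₀.1.eq]
  rw [hD, show ∀ X Y, ⁅B, X⁆ - ⁅B, Y⁆ = ⁅B, X - Y⁆ by simp [Ring.lie_def]; grind]
  generalize K⁻¹ * Bᴴ * K - K₀⁻¹ * Bᴴ * K₀ = D
  rw [Ring.lie_def, mul_sub, mul_sub, trace_sub, trace_sub]
  congr 1
  · rw [← mul_assoc, trace_mul_comm, mul_assoc K, mul_assoc K, trace_mul_comm K]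
    congr 1
    grind [nonsing_inv_mul' hK.isUnit]
  · rw [mul_assoc K₀⁻¹, trace_mul_comm]
    congr 1
    grind [nonsing_inv_mul' hK₀.isUnit]

/-- The function `f = tr (K₀⁻¹ K)` of two metrics satisfies `f f'' - f'² ≥ - ε f²`, where `ε`
bounds the errors in the real equation. This is the infinitesimal form of the convexity of the
distance in the symmetric space `GL(k)/U(k)`, combined with the convexity of the potential. -/
theorem IsMetricPath.hasDerivAt_trace {s : Set ℝ}
    {K P E K₀ P₀ E₀ : ℝ → Mat k} (h : IsMetricPath B s K P E) (h₀ : IsMetricPath B s K₀ P₀ E₀) :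
    ∃ f₁ f₂ : ℝ → ℝ, ∀ t ∈ s, HasDerivAt (fun t => ((K₀ t)⁻¹ * K t).trace.re) (f₁ t) t ∧
      HasDerivAt f₁ (f₂ t) t ∧
      f₁ t ^ 2 + ((K₀ t)⁻¹ * K t).trace.re * ((K₀ t)⁻¹ * K t * (E t - E₀ t)).trace.re ≤
        ((K₀ t)⁻¹ * K t).trace.re * f₂ t := by
  refine ⟨fun t => ((K₀ t)⁻¹ * K t * (P t - P₀ t)).trace.re,
    fun t => (-(P₀ t * ((K₀ t)⁻¹ * K t * (P t - P₀ t))) + (K₀ t)⁻¹ * (K t * P t) * (P t - P₀ t)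
      + (K₀ t)⁻¹ * K t * (((4 : ℂ) • curv B (K t) + E t) -
          ((4 : ℂ) • curv B (K₀ t) + E₀ t))).trace.re,
    fun t ht => ?_⟩
  have hK := h.posDef t ht
  have hK₀ := h₀.posDef t ht
  have b2 := nonsing_inv_mul' hK₀.isUnit
  have dinv : HasDerivAt (fun t => (K₀ t)⁻¹) (-(P₀ t * (K₀ t)⁻¹)) t := by
    refine (hasDerivAt_inv (h₀.deriv_K t ht) hK₀.isUnit).congr_deriv ?_
    rw [← mul_assoc, b2, one_mul]
  have d1 := dinv.mul (h.deriv_K t ht)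
  have d2 := d1.mul ((h.deriv_P t ht).sub (h₀.deriv_P t ht))
  refine ⟨?_, ?_, ?_⟩
  · refine (hasDerivAt_reTr d1).congr_deriv ?_
    have : (-(P₀ t * (K₀ t)⁻¹) * K t).trace = -((K₀ t)⁻¹ * K t * P₀ t).trace := by
      rw [neg_mul, trace_neg, mul_assoc, trace_mul_comm]
    beta_reduce
    rw [trace_add, this, mul_sub, trace_sub, ← mul_assoc]
    simp only [add_re, sub_re, neg_re]
    ring
  · refine (hasDerivAt_reTr d2).congr_deriv ?_
    congr 2
    change (-(P₀ t * (K₀ t)⁻¹) * K t + (K₀ t)⁻¹ * (K t * P t)) * (P t - P₀ t) +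
      (K₀ t)⁻¹ * K t * _ = _
    grind
  · have hcs := weighted_cauchy_schwarz hK hK₀ (P t - P₀ t)
    have hfirst : (-(P₀ t * ((K₀ t)⁻¹ * K t * (P t - P₀ t)))
        + (K₀ t)⁻¹ * (K t * P t) * (P t - P₀ t)).trace =
        (K t * (P t - P₀ t) * (K₀ t)⁻¹ * (P t - P₀ t)ᴴ).trace := by
      have s1 := h.symm t ht
      have s2 : (K₀ t)⁻¹ * (P₀ t)ᴴ = P₀ t * (K₀ t)⁻¹ := by
        have := congrArg ((K₀ t)⁻¹ * · * (K₀ t)⁻¹) (h₀.symm t ht)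
        grind [mul_nonsing_inv' hK₀.isUnit]
      have u1 : (K t * (P t - P₀ t) * (K₀ t)⁻¹ * (P t)ᴴ).trace =
          ((K₀ t)⁻¹ * (K t * P t) * (P t - P₀ t)).trace := by
        rw [trace_mul_comm, show (P t)ᴴ * (K t * (P t - P₀ t) * (K₀ t)⁻¹) =
          ((P t)ᴴ * K t) * (P t - P₀ t) * (K₀ t)⁻¹ by noncomm_ring, s1, trace_mul_comm,
          ← mul_assoc]
      have u2 : (K t * (P t - P₀ t) * (K₀ t)⁻¹ * (P₀ t)ᴴ).trace =
          (P₀ t * ((K₀ t)⁻¹ * K t * (P t - P₀ t))).trace := by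
        rw [mul_assoc, s2, trace_mul_comm]
        simp only [mul_assoc]
      rw [conjTranspose_sub, mul_sub (K t * (P t - P₀ t) * (K₀ t)⁻¹), trace_sub,
        trace_add, u1, u2, trace_neg]
      ring
    have hsecond : ((K₀ t)⁻¹ * K t * (((4 : ℂ) • curv B (K t) + E t)
          - ((4 : ℂ) • curv B (K₀ t) + E₀ t))).trace.re =
        4 * ∑ i, (K t * ((K t)⁻¹ * (B i)ᴴ * K t - (K₀ t)⁻¹ * (B i)ᴴ * K₀ t) * (K₀ t)⁻¹ *
        ((K t)⁻¹ * (B i)ᴴ * K t - (K₀ t)⁻¹ * (B i)ᴴ * K₀ t)ᴴ).trace.re +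
        ((K₀ t)⁻¹ * K t * (E t - E₀ t)).trace.re := by
      have : (((4 : ℂ) • curv B (K t) + E t) - ((4 : ℂ) • curv B (K₀ t) + E₀ t)) =
          (4 : ℂ) • (∑ i, (⁅B i, (K t)⁻¹ * (B i)ᴴ * K t⁆ - ⁅B i, (K₀ t)⁻¹ * (B i)ᴴ * K₀ t⁆))
          + (E t - E₀ t) := by
        rw [sum_sub_distrib, curv, curv, smul_sub]; abel
      rw [this, mul_add, trace_add, add_re, mul_smul_comm, trace_smul, mul_sum, trace_sum]
      simp only [curv_trace_identity hK hK₀]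
      simp
    have hsum : 0 ≤ ∑ i, (K t * ((K t)⁻¹ * (B i)ᴴ * K t - (K₀ t)⁻¹ * (B i)ᴴ * K₀ t) * (K₀ t)⁻¹ *
        ((K t)⁻¹ * (B i)ᴴ * K t - (K₀ t)⁻¹ * (B i)ᴴ * K₀ t)ᴴ).trace.re :=
      sum_nonneg fun i _ => weighted_trace_nonneg hK hK₀ _
    beta_reduce
    rw [trace_add, add_re, hfirst, hsecond]
    nlinarith [mul_nonneg (trace_inv_mul_nonneg hK hK₀) hsum]

/-- A maximum principle: a positive function whose logarithm is less concave than `w` stays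
below a multiple of `exp w` if it does so at the end points. -/
theorem le_exp_of_log_deriv2 {f f₁ f₂ w w₁ w₂ : ℝ → ℝ} {c d κ : ℝ}
    (hκ : 0 < κ) (hf : ContinuousOn f (Icc c d)) (hw : ContinuousOn w (Icc c d))
    (hpos : ∀ t ∈ Icc c d, 0 < f t)
    (h1 : ∀ t ∈ Ioo c d, HasDerivAt f (f₁ t) t) (h2 : ∀ t ∈ Ioo c d, HasDerivAt f₁ (f₂ t) t)
    (hw1 : ∀ t ∈ Ioo c d, HasDerivAt w (w₁ t) t) (hw2 : ∀ t ∈ Ioo c d, HasDerivAt w₁ (w₂ t) t)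
    (hineq : ∀ t ∈ Ioo c d, f₁ t ^ 2 + w₂ t * f t ^ 2 ≤ f t * f₂ t)
    (hc : f c ≤ κ * exp (w c)) (hd : f d ≤ κ * exp (w d)) :
    ∀ t ∈ Icc c d, f t ≤ κ * exp (w t) := by
  intro t ht
  have hcd : c ≤ d := ht.1.trans ht.2
  have hpos' := fun x hx => hpos x (Ioo_subset_Icc_self hx)
  have hconv : ConvexOn ℝ (Icc c d) (fun t => log (f t) - w t) := by
    refine convexOn_of_hasDerivWithinAt2_nonneg (convex_Icc c d) (f' := fun t => f₁ t / f t - w₁ t)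
      (f'' := fun t => (f₂ t * f t - f₁ t * f₁ t) / f t ^ 2 - w₂ t)
      ((hf.log fun t ht => (hpos t ht).ne').sub hw) ?_ ?_ ?_ <;>
      intro x hx <;> rw [interior_Icc] at * <;> have := hpos' x hx
    · exact (((h1 x hx).log this.ne').sub (hw1 x hx)).hasDerivWithinAt
    · exact (((h2 x hx).div (h1 x hx) this.ne').sub (hw2 x hx)).hasDerivWithinAt
    · rw [sub_nonneg, le_div_iff₀ (by positivity)]
      linarith [hineq x hx]
  have key : ∀ x ∈ Icc c d, (log (f x) - w x ≤ log κ ↔ f x ≤ κ * exp (w x)) := fun x hx => by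
    rw [← Real.log_le_log_iff (hpos x hx) (by positivity), log_mul hκ.ne' (exp_pos _).ne',
      Real.log_exp, sub_le_iff_le_add]
  have hl := left_mem_Icc.2 hcd
  have hr := right_mem_Icc.2 hcd
  exact (key t ht).1 ((hconv.le_max_of_mem_Icc hl hr ht).trans
    (max_le ((key c hl).2 hc) ((key d hr).2 hd)))

/-! ### Limits of approximate trajectories -/

section Euler

variable {E : Type*} [NormedAddCommGroup E]

theorem exists_tendsto_hyperfilter [ProperSpace E] {y : ℕ → E} {M : ℝ}
    (h : ∀ᶠ n in atTop, ‖y n‖ ≤ M) :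
    ∃ a, Tendsto y 𝒰 (𝓝 a) := by
  have h' : ∀ᶠ n in 𝒰, y n ∈ closedBall (0 : E) M := by
    filter_upwards [hyperfilter_le_atTop h] with n hn
    simpa using hn
  obtain ⟨a, -, ha⟩ := (isCompact_closedBall (0 : E) M).ultrafilter_le_nhds
    ((hyperfilter ℕ).map y) (by rw [Ultrafilter.coe_map, le_principal_iff]; exact h')
  exact ⟨a, ha⟩

variable [NormedSpace ℝ E]

theorem hasDerivWithinAt_of_quadratic {Y : ℝ → E} {v : E} {I : Set ℝ} {s C : ℝ}
    (h : ∀ t ∈ I, ‖Y t - Y s - (t - s) • v‖ ≤ C * (t - s) ^ 2) : HasDerivWithinAt Y v I s := by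
  rw [hasDerivWithinAt_iff_isLittleO]
  have h1 : (fun t => Y t - Y s - (t - s) • v) =O[𝓝[I] s] fun t => (t - s) ^ 2 := by
    refine Asymptotics.IsBigO.of_bound C ?_
    filter_upwards [self_mem_nhdsWithin] with t ht
    rw [norm_of_nonneg (by positivity)]
    exact h t ht
  refine h1.trans_isLittleO ?_
  have h2 : Tendsto (fun t : ℝ => t - s) (𝓝[I] s) (𝓝 0) :=
    (Continuous.tendsto' (f := (· - s)) (by fun_prop) s 0 (sub_self s)).mono_left nhdsWithin_le_nhds
  have := Asymptotics.IsLittleO.mul_isBigO ((Asymptotics.isLittleO_one_iff ℝ).2 h2)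
    (Asymptotics.isBigO_refl (fun t : ℝ => t - s) (𝓝[I] s))
  simpa [sq] using this

/-- A pointwise limit, along any filter, of curves that solve `y' = f y` up to a quadratic error
and an error tending to zero is a solution of `y' = f y`. -/
theorem hasDerivWithinAt_of_tendsto {l : Filter ℕ} [l.NeBot] {y : ℕ → ℝ → E} {Y : ℝ → E}
    {f : E → E} {c d C L : ℝ} (hL : 0 ≤ L) (hC : 0 ≤ C)
    (hY : ∀ t ∈ Icc c d, Tendsto (fun n => y n t) l (𝓝 (Y t)))
    (hf : Continuous f) (hfL : ∀ s ∈ Icc c d, ‖f (Y s)‖ ≤ L)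
    (hfLip : ∀ s ∈ Icc c d, ∀ t ∈ Icc c d, ‖f (Y s) - f (Y t)‖ ≤ L * ‖Y s - Y t‖)
    {ε : ℝ → ℕ → ℝ} (hε : ∀ s, Tendsto (ε s) l (𝓝 0))
    (happ : ∀ s ∈ Icc c d, ∀ t ∈ Icc c d, s ≤ t → ∀ᶠ n in l,
      ‖y n t - y n s - (t - s) • f (y n s)‖ ≤ C * (t - s) ^ 2 + ε (t - s) n) :
    ∀ t ∈ Icc c d, HasDerivWithinAt Y (f (Y t)) (Icc c d) t := by
  have key : ∀ s ∈ Icc c d, ∀ t ∈ Icc c d, s ≤ t →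
      ‖Y t - Y s - (t - s) • f (Y s)‖ ≤ C * (t - s) ^ 2 := by
    intro s hs t ht hst
    have h1 : Tendsto (fun n => ‖y n t - y n s - (t - s) • f (y n s)‖) l
        (𝓝 ‖Y t - Y s - (t - s) • f (Y s)‖) :=
      (((hY t ht).sub (hY s hs)).sub (((hf.tendsto _).comp (hY s hs)).const_smul _)).norm
    have h2 : Tendsto (fun n => C * (t - s) ^ 2 + ε (t - s) n) l (𝓝 (C * (t - s) ^ 2 + 0)) :=
      tendsto_const_nhds.add (hε _)
    rw [add_zero] at h2
    exact le_of_tendsto_of_tendsto h1 h2 (happ s hs t ht hst)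
  intro s hs
  refine hasDerivWithinAt_of_quadratic (C := C + L * (L + C * (d - c))) fun t ht => ?_
  have hcd : 0 ≤ d - c := by linarith [hs.1, hs.2]
  rcases le_total s t with hst | hst
  · refine (key s hs t ht hst).trans (mul_le_mul_of_nonneg_right ?_ (by positivity))
    have : 0 ≤ L * (L + C * (d - c)) := by positivity
    linarith
  · have h1 := key t ht s hs hst
    have hts : 0 ≤ s - t := by linarith
    have h2 : ‖Y s - Y t‖ ≤ (s - t) * (L + C * (d - c)) := by
      have e : Y s - Y t = (Y s - Y t - (s - t) • f (Y t)) + (s - t) • f (Y t) := by abel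
      rw [e]
      refine (norm_add_le _ _).trans ?_
      rw [norm_smul, norm_of_nonneg hts]
      have h3 := mul_le_mul_of_nonneg_left (hfL t ht) hts
      have h4 : C * (s - t) ^ 2 ≤ (s - t) * (C * (d - c)) := by
        have : (s - t) * (s - t) ≤ (s - t) * (d - c) :=
          mul_le_mul_of_nonneg_left (by linarith [hs.2, ht.1]) hts
        nlinarith
      linarith
    have e : Y t - Y s - (t - s) • f (Y s) = -(Y s - Y t - (s - t) • f (Y t))
        - (s - t) • (f (Y t) - f (Y s)) := by
      rw [smul_sub, show t - s = -(s - t) by ring, neg_smul]; abel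
    rw [e]
    refine (norm_sub_le _ _).trans ?_
    rw [norm_neg, norm_smul, norm_of_nonneg hts]
    grw [h1, hfLip t ht s hs, norm_sub_rev (Y t), h2]
    exact le_of_eq (by ring)

/-- Bounded Euler polygons follow the flow up to a quadratic error. -/
theorem euler_quadratic {f : E → E} {y : ℕ → E} {δ C L M : ℝ} {N : ℕ} (hδ : 0 ≤ δ) (hδ1 : δ ≤ M)
    (hL : 0 ≤ L) (hC : 0 ≤ C)
    (hfL : ∀ i ≤ N, ‖f (y i)‖ ≤ L)
    (hfLip : ∀ i ≤ N, ∀ j ≤ N, ‖f (y i) - f (y j)‖ ≤ L * ‖y i - y j‖)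
    (hstep : ∀ i < N, ‖y (i + 1) - y i - δ • f (y i)‖ ≤ C * δ ^ 2) (i m : ℕ) (him : i + m ≤ N) :
    ‖y (i + m) - y i - (m * δ) • f (y i)‖ ≤ (C + L * (L + C * M)) * (m * δ) ^ 2 := by
  have hM : 0 ≤ M := hδ.trans hδ1
  have hlin : ∀ m, i + m ≤ N → ‖y (i + m) - y i‖ ≤ m * δ * (L + C * M) := by
    intro m
    induction m with
    | zero => simp
    | succ m ih =>
      intro h
      have h1 := ih (by omega)
      have h2 := hstep (i + m) (by omega)
      have e : y (i + (m + 1)) - y i = (y (i + m) - y i) + (y (i + m + 1) - y (i + m) -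
          δ • f (y (i + m))) + δ • f (y (i + m)) := by
        rw [← add_assoc]; abel
      rw [e]
      refine (norm_add₃_le).trans ?_
      rw [norm_smul, norm_of_nonneg hδ]
      have h3 := mul_le_mul_of_nonneg_left (hfL (i + m) (by omega)) hδ
      have h4 : C * δ ^ 2 ≤ δ * (C * M) := by
        have := mul_le_mul_of_nonneg_left hδ1 (mul_nonneg hC hδ); nlinarith
      push_cast
      linarith
  induction m with
  | zero => simp
  | succ m ih =>
    have h1 := ih (by omega)
    have e : y (i + (m + 1)) - y i - ((m + 1 : ℕ) * δ) • f (y i) =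
        (y (i + m) - y i - (m * δ) • f (y i)) + (y (i + m + 1) - y (i + m) - δ • f (y (i + m)))
        + δ • (f (y (i + m)) - f (y i)) := by
      rw [← add_assoc, smul_sub]; push_cast; rw [add_mul, one_mul, add_smul]; abel
    rw [e]
    refine (norm_add₃_le).trans ?_
    rw [norm_smul, norm_of_nonneg hδ]
    grw [h1, (hstep (i + m) (by omega)), (hfLip (i + m) (by omega) i (by omega)), (hlin m (by
      omega))]
    have h5 : 0 ≤ (C * (2 * m) + L * (L + C * M) * (m + 1)) * δ ^ 2 := by positivity
    push_cast
    linarith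

/-- Bounded Euler polygons for `y' = f y` on `[0, T]`, with mesh tending to zero, have a limit
that solves the equation and inherits all closed conditions. -/
theorem exists_solution_of_euler [ProperSpace E] {f : E → E} (hf : Continuous f) {T C L : ℝ}
    (hT : 0 < T) (hL : 0 ≤ L) (hC : 0 ≤ C) {S : Set E} (hS : IsClosed S)
    {M : ℝ} (hM : ∀ x ∈ S, ‖x‖ ≤ M)
    (hfL : ∀ x ∈ S, ‖f x‖ ≤ L) (hfLip : ∀ x ∈ S, ∀ x' ∈ S, ‖f x - f x'‖ ≤ L * ‖x - x'‖)
    (y : ℕ → ℕ → E) (hyS : ∀ n, 0 < n → ∀ i ≤ n, y n i ∈ S)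
    (hstep : ∀ n, 0 < n → ∀ i < n, ‖y n (i + 1) - y n i - (T / n) • f (y n i)‖ ≤ C * (T / n) ^ 2) :
    ∃ Y : ℝ → E, (∀ t ∈ Icc 0 T, Y t ∈ S) ∧
      (∀ t ∈ Icc 0 T, HasDerivWithinAt Y (f (Y t)) (Icc 0 T) t) ∧
      Tendsto (fun n => y n 0) 𝒰 (𝓝 (Y 0)) ∧
      Tendsto (fun n => y n n) 𝒰 (𝓝 (Y T)) := by
  -- the index of the node of the `n`-th polygon just before `t`
  set ι : ℝ → ℕ → ℕ := fun t n => ⌊t * n / T⌋₊ with hι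
  have hιle : ∀ t ∈ Icc 0 T, ∀ n, ι t n ≤ n := by
    intro t ht n
    refine Nat.floor_le_of_le ?_
    rw [div_le_iff₀ hT, mul_comm]
    exact mul_le_mul_of_nonneg_left ht.2 n.cast_nonneg
  have hex : ∀ t ∈ Icc 0 T, ∃ a, Tendsto (fun n => y n (ι t n)) 𝒰 (𝓝 a) :=
    fun t ht => exists_tendsto_hyperfilter (M := M) (by
      filter_upwards [eventually_gt_atTop 0] with n hn using hM _ (hyS n hn _ (hιle t ht n)))
  choose! Y hY using hex
  have hpos : ∀ᶠ n in 𝒰, 0 < n := hyperfilter_le_atTop (eventually_gt_atTop 0)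
  have hYS : ∀ t ∈ Icc 0 T, Y t ∈ S := by
    intro t ht
    refine hS.mem_of_tendsto (hY t ht) ?_
    filter_upwards [hpos] with n hn using hyS n hn _ (hιle t ht n)
  set C₂ := C + L * (L + C * T) with hC₂
  have hδlim : Tendsto (fun n : ℕ => T / (n : ℝ)) 𝒰 (𝓝 0) :=
    (tendsto_const_div_atTop_nhds_zero_nat T).mono_left hyperfilter_le_atTop
  refine ⟨Y, hYS, ?_, ?_, ?_⟩
  · refine hasDerivWithinAt_of_tendsto (l := 𝒰) (C := C₂) (L := L) hL (by positivity)
      hY hf (fun s hs => hfL _ (hYS s hs)) (fun s hs t ht => hfLip _ (hYS s hs) _ (hYS t ht))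
      (ε := fun r n => 2 * C₂ * (r * (T / n)) + C₂ * (T / n) ^ 2 + L * (T / n)) ?_ ?_
    · intro r
      have h1 := (((hδlim.const_mul r).const_mul (2 * C₂)).add
        ((hδlim.pow 2).const_mul C₂)).add (hδlim.const_mul L)
      simpa using h1
    · intro s hs t ht hst
      filter_upwards [hpos] with n hn
      set δ := T / (n : ℝ) with hδ
      have hδ0 : 0 < δ := by positivity
      have hmono : ι s n ≤ ι t n := by
        refine Nat.floor_le_floor ?_
        gcongr
      obtain ⟨m, hm⟩ := Nat.exists_eq_add_of_le hmono
      have h1 := euler_quadratic (f := f) (y := y n) (M := T) hδ0.le (div_le_self hT.le (by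
        exact_mod_cast hn)) hL hC
        (fun i hi => hfL _ (hyS n hn i hi))
        (fun i hi j hj => hfLip _ (hyS n hn i hi) _ (hyS n hn j hj)) (hstep n hn) (ι s n) m
        (hm ▸ hιle t ht n)
      rw [← hm] at h1
      have hfl : ∀ r ∈ Icc 0 T, (ι r n : ℝ) * δ ≤ r ∧ r < (ι r n : ℝ) * δ + δ := by
        intro r hr
        have e : r * n / T * δ = r := by rw [hδ]; field_simp
        constructor
        · calc (ι r n : ℝ) * δ ≤ r * n / T * δ :=
              mul_le_mul_of_nonneg_right (Nat.floor_le (div_nonneg (mul_nonneg hr.1 (cast_pos.2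
                hn).le) hT.le))
                hδ0.le
            _ = r := e
        · calc r = r * n / T * δ := e.symm
            _ < (ι r n + 1) * δ := mul_lt_mul_of_pos_right (Nat.lt_floor_add_one _) hδ0
            _ = _ := by ring
      have hs1 := hfl s hs
      have ht1 := hfl t ht
      have hmc : (ι t n : ℝ) = ι s n + m := by exact_mod_cast hm
      -- rounding the times to nodes costs at most one step
      have hm1 : |(m : ℝ) * δ - (t - s)| ≤ δ := by
        rw [hmc] at ht1
        rw [abs_le]
        constructor <;> nlinarith
      have hm2 : (m : ℝ) * δ ≤ (t - s) + δ := by linarith [(abs_le.1 hm1).2]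
      have e : y n (ι t n) - y n (ι s n) - (t - s) • f (y n (ι s n)) =
          (y n (ι t n) - y n (ι s n) - (m * δ) • f (y n (ι s n)))
          + (m * δ - (t - s)) • f (y n (ι s n)) := by
        rw [sub_smul (m * δ)]; abel
      rw [e]
      refine (norm_add_le _ _).trans ?_
      rw [norm_smul, norm_eq_abs]
      grw [h1, hm1, hfL _ (hyS n hn _ (hιle s hs n)), hm2]
      exact le_of_eq (by ring)
  · have := hY 0 ⟨le_rfl, hT.le⟩
    simpa [hι] using this
  · have := hY T ⟨hT.le, le_rfl⟩
    have e : ∀ n, ι T n = n := fun n => by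
      simp only [hι]
      rw [mul_div_cancel_left₀ _ hT.ne', Nat.floor_natCast]
    simpa only [e] using this

end Euler

/-! ### The discrete Dirichlet problem -/

/-- `tr (K⁻¹ K') + tr (K'⁻¹ K) - 2k`: to second order, the squared distance of two nearby
metrics in the symmetric space `GL(k)/U(k)`. -/
noncomputable def gap (K K' : Mat k) : ℝ := (K⁻¹ * K').trace.re + (K'⁻¹ * K).trace.re - 2 * k

theorem norm_factor_eq_trace (g : Mat k) : ‖g‖ ^ 2 = (gᴴ * g).trace.re := norm_sq_eq_trace g

theorem norm_le_trace (hK : K.PosDef) : ‖K‖ ≤ K.trace.re := by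
  obtain ⟨g, -, rfl⟩ := exists_posDef_factor hK
  rw [← norm_factor_eq_trace, sq]
  refine (norm_mul_le _ _).trans ?_
  rw [frobenius_norm_conjTranspose]

theorem trace_posDef_pos (hk : 0 < k) (hK : K.PosDef) : 0 < K.trace.re := by
  have := trace_inv_mul_pos hk hK (Matrix.PosDef.one (n := Fin k) (R := ℂ))
  simpa using this

theorem gap_eq_trace {K' : Mat k} (hK : IsUnit K) (hK' : IsUnit K') :
    gap K K' = (K'⁻¹ * ((K' - K) * K⁻¹ * (K' - K))).trace.re := by
  have h2 := nonsing_inv_mul' hK'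
  rw [show K'⁻¹ * ((K' - K) * K⁻¹ * (K' - K)) = (K'⁻¹ * K') * (K⁻¹ * K') - (K'⁻¹ * K') * (K⁻¹ * K)
      - K'⁻¹ * (K * K⁻¹) * K' + K'⁻¹ * (K * K⁻¹) * K by noncomm_ring,
    nonsing_inv_mul' hK, h2, mul_nonsing_inv' hK, mul_one, mul_one, h2, one_mul, gap]
  simp only [trace_add, trace_sub, add_re, sub_re, trace_one]
  simp
  ring

theorem gap_eq_norm_sq {g g' : Mat k} (hg : IsUnit g) (hg' : IsUnit g') :
    gap (gᴴ * g) (g'ᴴ * g') = ‖(g⁻¹)ᴴ * (g'ᴴ * g' - gᴴ * g) * g'⁻¹‖ ^ 2 := by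
  have hH : (g'ᴴ * g' - gᴴ * g)ᴴ = g'ᴴ * g' - gᴴ * g := by simp
  rw [norm_sq_eq_trace, ← mul_assoc, trace_mul_comm, conjTranspose_mul, conjTranspose_mul, hH,
    conjTranspose_conjTranspose, gap_eq_trace (posDef_conjTranspose_mul_self hg).isUnit
      (posDef_conjTranspose_mul_self hg').isUnit, inv_conjTranspose_mul_self,
    inv_conjTranspose_mul_self]
  simp only [mul_assoc]

theorem gap_nonneg {K' : Mat k} (hK : K.PosDef) (hK' : K'.PosDef) : 0 ≤ gap K K' := by
  obtain ⟨g, hg, rfl⟩ := exists_posDef_factor hK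
  obtain ⟨g', hg', rfl⟩ := exists_posDef_factor hK'
  rw [gap_eq_norm_sq hg hg']; positivity

theorem gap_le {K' : Mat k} (hK : K.PosDef) (hK' : K'.PosDef) :
    gap K K' ≤ ‖K'⁻¹‖ * (‖K' - K‖ * ‖K⁻¹‖ * ‖K' - K‖) := by
  rw [gap_eq_trace hK.isUnit hK'.isUnit]
  refine ((le_abs_self _).trans (abs_re_trace_mul_le' _ _)).trans ?_
  gcongr
  exact norm_mul₃_le

theorem gap_inv {K' : Mat k} (hK : K.PosDef) (hK' : K'.PosDef) : gap K⁻¹ K'⁻¹ = gap K K' := by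
  rw [gap, gap, inv_inv' hK.isUnit, inv_inv' hK'.isUnit, trace_mul_comm K, trace_mul_comm K']
  ring

theorem norm_sub_sq_le_gap {K' : Mat k} (hK : K.PosDef) (hK' : K'.PosDef) :
    ‖K' - K‖ ^ 2 ≤ gap K K' * (K.trace.re * K'.trace.re) ∧
    (K'.trace.re - K.trace.re) ^ 2 ≤ gap K K' * (K.trace.re * K'.trace.re) := by
  obtain ⟨g, hg, rfl⟩ := exists_posDef_factor hK
  obtain ⟨g', hg', rfl⟩ := exists_posDef_factor hK'
  rw [gap_eq_norm_sq hg hg', ← norm_factor_eq_trace, ← norm_factor_eq_trace g']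
  set Δ := g'ᴴ * g' - gᴴ * g with hΔ
  set X := (g⁻¹)ᴴ * Δ * g'⁻¹ with hX
  have e : Δ = gᴴ * (X * g') := by
    grind [conjTranspose_mul_inv hg, nonsing_inv_mul' hg']
  have e2 : ‖X‖ ^ 2 * (‖g‖ ^ 2 * ‖g'‖ ^ 2) = (‖g‖ * (‖X‖ * ‖g'‖)) ^ 2 := by ring
  rw [e2]
  constructor
  · refine pow_le_pow_left₀ (norm_nonneg _) ?_ 2
    rw [e]
    exact norm_mul_le_of_le (frobenius_norm_conjTranspose g).le (norm_mul_le _ _)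
  · have e3 : ‖g'‖ ^ 2 - ‖g‖ ^ 2 = (gᴴ * (X * g')).trace.re := by
      rw [← e, hΔ, trace_sub, sub_re, ← norm_factor_eq_trace, ← norm_factor_eq_trace]
    rw [e3, ← sq_abs]
    refine pow_le_pow_left₀ (abs_nonneg _) ?_ 2
    grw [abs_re_trace_mul_le, norm_mul_le X]

theorem le_mul_exp_sqrt {a b D : ℝ} (ha : 0 < a) (hb : 0 < b) (hD : 0 ≤ D)
    (h : (b - a) ^ 2 ≤ D * (a * b)) : b ≤ a * exp (sqrt D) := by
  by_contra hlt
  push Not at hlt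
  set s := sqrt D with hs
  have hs0 : 0 ≤ s := Real.sqrt_nonneg _
  have hsD : s ^ 2 = D := sq_sqrt hD
  set u := log (b / a) / 2 with hu
  have hba : b = a * exp (2 * u) := by
    rw [hu, mul_div_cancel₀ _ (two_ne_zero), Real.exp_log (by positivity)]; field_simp
  have hus : s < 2 * u := by
    rw [hba] at hlt
    exact Real.exp_lt_exp.1 (lt_of_mul_lt_mul_left hlt ha.le)
  have h1 : b - a = a * exp u * (2 * sinh u) := by
    rw [hba, Real.sinh_eq, two_mul, exp_add]
    have : exp u * exp (-u) = 1 := by rw [← exp_add]; simp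
    linear_combination a * this
  have h2 : a * b = (a * exp u) ^ 2 := by rw [hba, two_mul, exp_add]; ring
  rw [h1, h2, ← hsD] at h
  have h3 : u ≤ sinh u := Real.self_le_sinh_iff.2 (by linarith)
  have h4 : 0 < (a * exp u) ^ 2 := by positivity
  have h5 : (2 * sinh u) ^ 2 ≤ s ^ 2 := by nlinarith
  nlinarith

theorem trace_le_of_sum_gap (hk : 0 < k) {x : ℕ → Mat k} (hx : ∀ i, (x i).PosDef) {n : ℕ} {ε : ℝ}
    (h : ∑ i ∈ Finset.range n, gap (x i) (x (i + 1)) ≤ ε) (j : ℕ) (hj : j ≤ n) :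
    (x j).trace.re ≤ (x 0).trace.re * exp (sqrt (n * ε)) := by
  have h1 : ∀ j, (x j).trace.re ≤
      (x 0).trace.re * exp (∑ i ∈ Finset.range j, sqrt (gap (x i) (x (i + 1)))) := by
    intro j
    induction j with
    | zero => simp
    | succ j ih =>
      have h2 := le_mul_exp_sqrt (trace_posDef_pos hk (hx j)) (trace_posDef_pos hk (hx (j + 1)))
        (gap_nonneg (hx j) (hx (j + 1))) (norm_sub_sq_le_gap (hx j) (hx (j + 1))).2
      rw [sum_range_succ, exp_add, ← mul_assoc]
      exact h2.trans (mul_le_mul_of_nonneg_right ih (exp_pos _).le)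
  refine (h1 j).trans (mul_le_mul_of_nonneg_left (exp_le_exp.2 ?_) (trace_posDef_pos hk (hx 0)).le)
  have h3 : ∑ i ∈ Finset.range j, sqrt (gap (x i) (x (i + 1))) ≤
      ∑ i ∈ Finset.range n, sqrt (gap (x i) (x (i + 1))) :=
    Finset.sum_le_sum_of_subset_of_nonneg (Finset.range_mono hj) fun _ _ _ => Real.sqrt_nonneg _
  refine h3.trans (Real.le_sqrt_of_sq_le (sq_sum_le_card_mul_sum_sq.trans ?_))
  rw [card_range]
  refine mul_le_mul_of_nonneg_left (le_trans (le_of_eq (sum_congr rfl fun i _ => ?_)) h)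
    n.cast_nonneg
  exact sq_sqrt (gap_nonneg (hx i) (hx (i + 1)))

/-- The potential `∑ᵢ |Bᵢ|²_K` of the Nahm equations. -/
noncomputable def potential (B : Fin 3 → Mat k) (K : Mat k) : ℝ :=
  ∑ i, (K * B i * K⁻¹ * (B i)ᴴ).trace.re

theorem potential_nonneg (B : Fin 3 → Mat k) (hK : K.PosDef) : 0 ≤ potential B K :=
  sum_nonneg fun _ _ => weighted_trace_nonneg hK hK _

/-- The Euler–Lagrange equation at one node of the discrete variational problem. -/
theorem discrete_euler_lagrange (B : Fin 3 → Mat k) {K₁ K₂ : Mat k} {w : ℝ} (hK₁ : K₁.PosDef)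
    (hK : K.PosDef) (hK₂ : K₂.PosDef)
    (hmin : ∀ K' : Mat k, K'.PosDef → gap K₁ K + gap K K₂ + w * potential B K ≤
      gap K₁ K' + gap K' K₂ + w * potential B K') :
    (K⁻¹ * K₂ - K₂⁻¹ * K) - (K₁⁻¹ * K - K⁻¹ * K₁) = (w : ℂ) • curv B K := by
  have a1 := mul_nonsing_inv' hK.isUnit
  have a2 := nonsing_inv_mul' hK.isUnit
  have hLH : (K⁻¹)ᴴ = K⁻¹ := hK.inv.1
  have hKH : Kᴴ = K := hK.1
  have hL₁H : (K₁⁻¹)ᴴ = K₁⁻¹ := hK₁.inv.1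
  have hL₂H : (K₂⁻¹)ᴴ = K₂⁻¹ := hK₂.inv.1
  have hK₁H : K₁ᴴ = K₁ := hK₁.1
  have hK₂H : K₂ᴴ = K₂ := hK₂.1
  set L := K⁻¹ with hL
  set M : Mat k := K₁⁻¹ + K₂⁻¹ - L * (K₁ + K₂) * L
    + (w : ℂ) • ∑ i, (B i * L * (B i)ᴴ - L * (B i)ᴴ * K * B i * L) with hM
  have hMH : Mᴴ = M := by
    simp only [hM, conjTranspose_add, conjTranspose_sub, conjTranspose_mul,
      conjTranspose_smul, Matrix.conjTranspose_sum, hLH, hKH, hL₁H, hL₂H, hK₁H, hK₂H,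
      conjTranspose_conjTranspose, star_def, conj_ofReal]
    simp only [mul_assoc]
  -- The variation `(1 + εZ)ᴴ K (1 + εZ)` stays positive definite and has derivative `M`.
  set Z : Mat k := (1 / 2 : ℂ) • (L * M) with hZ
  have hvar : Zᴴ * K + K * Z = M := by
    rw [hZ, conjTranspose_smul, conjTranspose_mul, hMH, hLH, smul_mul_assoc,
      mul_assoc, a2, mul_one, mul_smul_comm, ← mul_assoc, a1, one_mul]
    rw [show star (1 / 2 : ℂ) = 1 / 2 by simp, ← add_smul]
    norm_num
  set κ : ℝ → Mat k := fun ε => (1 + ε • Z)ᴴ * K * (1 + ε • Z) with hκ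
  have hκ0 : κ 0 = K := by simp [hκ]
  have hdZ : HasDerivAt (fun ε : ℝ => 1 + ε • Z) Z 0 :=
    (((hasDerivAt_id (0 : ℝ)).smul_const Z).const_add 1).congr_deriv (one_smul _ _)
  have hdκ : HasDerivAt κ M 0 := by
    refine (((hasDerivAt_conjTranspose hdZ).mul_const K).mul hdZ).congr_deriv ?_
    simp only [zero_smul, add_zero, conjTranspose_one, one_mul, mul_one]
    exact hvar
  have hdL : HasDerivAt (fun ε => (κ ε)⁻¹) (-(L * M * L)) 0 := by
    have := hasDerivAt_inv hdκ (by rw [hκ0]; exact hK.isUnit)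
    rwa [hκ0] at this
  have hpd : ∀ᶠ ε in 𝓝 (0 : ℝ), (κ ε).PosDef := by
    have h1 : Tendsto (fun ε : ℝ => 1 + ε • Z) (𝓝 0) (𝓝 (1 : Mat k)) := by
      have h2 : Continuous fun ε : ℝ => (1 : Mat k) + ε • Z := by fun_prop
      exact h2.tendsto' 0 1 (by simp)
    filter_upwards [h1 (Units.isOpen.mem_nhds isUnit_one)] with ε hε
    obtain ⟨g, hg, hgK⟩ := exists_posDef_factor hK
    have : κ ε = (g * (1 + ε • Z))ᴴ * (g * (1 + ε • Z)) := by simp [mul_assoc, *]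
    rw [this]
    exact posDef_conjTranspose_mul_self (hg.mul hε)
  have hder : HasDerivAt (fun ε => gap K₁ (κ ε) + gap (κ ε) K₂ + w * potential B (κ ε))
      ((K₁⁻¹ * M + -(L * M * L) * K₁).trace.re + (-(L * M * L) * K₂ + K₂⁻¹ * M).trace.re
        + w * ∑ i, (M * B i * L * (B i)ᴴ + K * B i * -(L * M * L) * (B i)ᴴ).trace.re) 0 := by
    refine ((HasDerivAt.add ?_ ?_).add (HasDerivAt.const_mul w ?_))
    · refine (((hasDerivAt_reTr (hdκ.const_mul K₁⁻¹)).add (hasDerivAt_reTr (hdL.mul_const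
        K₁))).sub_const (2 * (k : ℝ))).congr_deriv
        ?_
      rw [trace_add, add_re]
    · refine (((hasDerivAt_reTr (hdL.mul_const K₂)).add (hasDerivAt_reTr (hdκ.const_mul
        K₂⁻¹))).sub_const (2 * (k : ℝ))).congr_deriv ?_
      rw [trace_add, add_re]
    · unfold potential
      refine fun_sum fun i _ => (hasDerivAt_reTr (((hdκ.mul_const (B i)).mul hdL).mul_const (B
        i)ᴴ)).congr_deriv ?_
      rw [hκ0, add_mul]
  have hlm : IsLocalMin (fun ε => gap K₁ (κ ε) + gap (κ ε) K₂ + w * potential B (κ ε)) 0 := by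
    filter_upwards [hpd] with ε hε
    simp only [hκ0]
    exact hmin _ hε
  -- this variation was chosen so that the derivative of the functional along it is `‖M‖²`
  have hsq : ‖M‖ ^ 2 = 0 := by
    rw [norm_sq_eq_trace, hMH, ← (hlm.hasDerivAt_eq_zero hder)]
    conv_lhs => rw [hM]
    rw [← hM, add_mul, sub_mul, add_mul]
    simp only [trace_add, trace_sub, add_re, sub_re,
      smul_mul_assoc, trace_smul, sum_mul, trace_sum, smul_eq_mul,
      Complex.re_ofReal_mul, re_sum, sub_mul, neg_mul, mul_neg, trace_neg,
      neg_re]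
    have e1 : ∀ X : Mat k, (L * M * L * X).trace = (L * X * L * M).trace := fun X => by
      rw [show L * M * L * X = (L * M) * (L * X) by noncomm_ring, trace_mul_comm]
      congr 1; noncomm_ring
    have e2 : ∀ i, (M * B i * L * (B i)ᴴ).trace = (B i * L * (B i)ᴴ * M).trace := fun i => by
      rw [show M * B i * L * (B i)ᴴ = M * (B i * L * (B i)ᴴ) by noncomm_ring, trace_mul_comm]
    have e3 : ∀ i, (K * B i * (L * M * L) * (B i)ᴴ).trace =
        (L * (B i)ᴴ * K * B i * L * M).trace := fun i => by
      rw [show K * B i * (L * M * L) * (B i)ᴴ = (K * B i * L * M) * (L * (B i)ᴴ) by noncomm_ring,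
        trace_mul_comm]
      congr 1; noncomm_ring
    simp only [e1, e2, e3, mul_add, add_mul, trace_add, add_re, ← sub_eq_add_neg]
    ring
  have hM0 : M = 0 := by simpa using hsq
  have hMK : M * K = 0 := by rw [hM0, zero_mul]
  rw [hM, add_mul, sub_mul, add_mul, smul_mul_assoc, sum_mul] at hMK
  have e4 : L * (K₁ + K₂) * L * K = L * K₁ + L * K₂ := by rw [mul_assoc, a2, mul_one, mul_add]
  have e5 : ∑ i, (B i * L * (B i)ᴴ - L * (B i)ᴴ * K * B i * L) * K = curv B K := by
    refine sum_congr rfl fun i _ => ?_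
    rw [sub_mul, mul_assoc _ L K, a2, mul_one, Ring.lie_def, ← hL]
    noncomm_ring
  grind

theorem isClosed_posSemidef : IsClosed {K : Mat k | K.PosSemidef} := by
  have : {K : Mat k | K.PosSemidef} = {K | Kᴴ = K} ∩ ⋂ x : Fin k → ℂ,
      {K | 0 ≤ star x ⬝ᵥ (K *ᵥ x)} := by
    ext K
    simp only [Set.mem_ofPred_eq, mem_inter_iff, mem_iInter,
        Matrix.posSemidef_iff_dotProduct_mulVec]
    rfl
  rw [this]
  exact IsClosed.inter (isClosed_eq (by fun_prop) continuous_id) (isClosed_iInter fun x =>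
    (isClosed_le continuous_const (by fun_prop)))

theorem sum_gap_inv {x : ℕ → Mat k} (hx : ∀ i, (x i).PosDef) (n : ℕ) :
    ∑ i ∈ Finset.range n, gap (x i)⁻¹ (x (i + 1))⁻¹ = ∑ i ∈ Finset.range n, gap (x i) (x (i + 1)) :=
  sum_congr rfl fun i _ => gap_inv (hx i) (hx (i + 1))

/-- A bound on the discrete energy keeps the whole sequence in a compact set of metrics. -/
theorem norm_le_of_sum_gap (hk : 0 < k) {x : ℕ → Mat k} (hx : ∀ i, (x i).PosDef) {n : ℕ} {ε : ℝ}
    (h : ∑ i ∈ Finset.range n, gap (x i) (x (i + 1)) ≤ ε) (j : ℕ) (hj : j ≤ n) :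
    (x j).trace.re ≤ ((x 0).trace.re + (x 0)⁻¹.trace.re) * exp (sqrt (n * ε)) ∧
    ‖x j‖ ≤ ((x 0).trace.re + (x 0)⁻¹.trace.re) * exp (sqrt (n * ε)) ∧
    ‖(x j)⁻¹‖ ≤ ((x 0).trace.re + (x 0)⁻¹.trace.re) * exp (sqrt (n * ε)) := by
  have h1 := trace_le_of_sum_gap hk hx h j hj
  have h2 := trace_le_of_sum_gap hk (x := fun i => (x i)⁻¹) (fun i => (hx i).inv)
    ((sum_gap_inv hx n).trans_le h) j hj
  have p1 := trace_posDef_pos hk (hx 0)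
  have e := exp_pos (sqrt (n * ε))
  have m1 := mul_pos p1 e
  have m2 := mul_pos (trace_posDef_pos hk (hx 0).inv) e
  rw [add_mul]
  refine ⟨?_, ?_, ?_⟩
  · linarith
  · linarith [norm_le_trace (hx j)]
  · linarith [norm_le_trace (hx j).inv]

/-- The discrete energy of a sequence of metrics. -/
noncomputable def energy (B : Fin 3 → Mat k) (w : ℝ) (n : ℕ) (x : ℕ → Mat k) : ℝ :=
  ∑ i ∈ Finset.range n, (gap (x i) (x (i + 1)) + w * potential B (x i))

theorem energy_congr (B : Fin 3 → Mat k) (w : ℝ) {n : ℕ} {x y : ℕ → Mat k}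
    (h : ∀ i ≤ n, x i = y i) : energy B w n x = energy B w n y := by
  refine sum_congr rfl fun i hi => ?_
  grind

theorem sum_gap_le_energy (B : Fin 3 → Mat k) {w : ℝ} (hw : 0 ≤ w) (n : ℕ) {x : ℕ → Mat k}
    (hx : ∀ i, (x i).PosDef) :
    ∑ i ∈ Finset.range n, gap (x i) (x (i + 1)) ≤ energy B w n x :=
  sum_le_sum fun i _ => le_add_of_nonneg_right (mul_nonneg hw (potential_nonneg B (hx i)))

theorem posDef_of_posSemidef_of_mul {L : Mat k} (hK : K.PosSemidef) (h : K * L = 1) : K.PosDef :=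
  hK.posDef_iff_isUnit.2 (IsUnit.of_mul_eq_one L h)

/-- The energy attains its minimum: sequences with fixed ends and bounded energy form a compact
set. -/
theorem exists_discrete_minimizer (hk : 0 < k) (B : Fin 3 → Mat k) {w : ℝ} (hw : 0 ≤ w) (n : ℕ)
    {x₀ : ℕ → Mat k} (h₀ : ∀ i, (x₀ i).PosDef) :
    ∃ x : ℕ → Mat k, (∀ i, (x i).PosDef) ∧ x 0 = x₀ 0 ∧ x n = x₀ n ∧
      energy B w n x ≤ energy B w n x₀ ∧
      ∀ y : ℕ → Mat k, (∀ i, (y i).PosDef) → y 0 = x₀ 0 → y n = x₀ n →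
        energy B w n x ≤ energy B w n y := by
  set E₀ := energy B w n x₀ with hE₀
  set Λ := ((x₀ 0).trace.re + (x₀ 0)⁻¹.trace.re) * exp (sqrt (n * E₀)) with hΛ
  set S : Set (Mat k × Mat k) := ({z | z.1.PosSemidef} ∩ {z | z.1 * z.2 = 1})
    ∩ (closedBall 0 Λ) with hS
  have hScl : IsClosed ({z : Mat k × Mat k | z.1.PosSemidef} ∩ {z | z.1 * z.2 = 1}) :=
    (isClosed_posSemidef.preimage continuous_fst).inter
      (isClosed_eq (continuous_fst.mul continuous_snd) continuous_const)
  have : ProperSpace (Mat k × Mat k) := FiniteDimensional.proper_real _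
  set C : Set (ℕ → Mat k × Mat k) := Set.pi univ (fun _ => S) ∩
    {z | (z 0).1 = x₀ 0 ∧ (z n).1 = x₀ n} with hC
  have hCcpt : IsCompact C := by
    refine (isCompact_univ_pi fun _ => ((isCompact_closedBall (0 : Mat k × Mat k) Λ).inter_left
      hScl)).inter_right ?_
    exact (isClosed_eq (continuous_fst.comp (continuous_apply 0)) continuous_const).inter
      (isClosed_eq (continuous_fst.comp (continuous_apply n)) continuous_const)
  -- A competitor of energy at most `E₀`, stopped at time `n`, lies in the compact set `C`.
  have hmem : ∀ y : ℕ → Mat k, (∀ i, (y i).PosDef) → y 0 = x₀ 0 → y n = x₀ n →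
      energy B w n y ≤ E₀ → (fun i => (y (min i n), (y (min i n))⁻¹)) ∈ C := by
    intro y hy hy0 hyn hyE
    refine ⟨fun i _ => ⟨⟨(hy _).posSemidef, mul_nonsing_inv' (hy _).isUnit⟩, ?_⟩, ?_, ?_⟩
    · have h1 := norm_le_of_sum_gap hk hy ((sum_gap_le_energy B hw n hy).trans hyE) (min i n)
        (min_le_right _ _)
      rw [mem_closedBall_zero_iff, Prod.norm_def, hΛ, ← hy0]
      exact max_le h1.2.1 h1.2.2
    · simpa using hy0
    · simpa using hyn
  set 𝓔 : (ℕ → Mat k × Mat k) → ℝ := fun z => ∑ i ∈ Finset.range n,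
    (((z i).2 * (z (i + 1)).1).trace.re + ((z (i + 1)).2 * (z i).1).trace.re - 2 * k
      + w * ∑ j, ((z i).1 * B j * (z i).2 * (B j)ᴴ).trace.re) with h𝓔
  have hcont : Continuous 𝓔 := by fun_prop
  have h𝓔e : ∀ z : ℕ → Mat k × Mat k, (∀ i, (z i).2 = (z i).1⁻¹) →
      𝓔 z = energy B w n (fun i => (z i).1) := by
    intro z hz
    simp only [h𝓔, energy, gap, potential, hz]
  obtain ⟨z, hzC, hzmin⟩ := hCcpt.exists_isMinOn ⟨_, hmem x₀ h₀ rfl rfl le_rfl⟩ hcont.continuousOn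
  have hzS : ∀ i, z i ∈ S := fun i => hzC.1 i (mem_univ _)
  have hzpd : ∀ i, (z i).1.PosDef := fun i => posDef_of_posSemidef_of_mul (hzS i).1.1 (hzS i).1.2
  have hzi : ∀ i, (z i).2 = (z i).1⁻¹ := fun i => (inv_eq_right_inv (hzS i).1.2).symm
  have hmin : ∀ y : ℕ → Mat k, (∀ i, (y i).PosDef) → y 0 = x₀ 0 → y n = x₀ n →
      energy B w n y ≤ E₀ → energy B w n (fun i => (z i).1) ≤ energy B w n y := by
    intro y hy hy0 hyn hyE
    have h1 := hzmin (hmem y hy hy0 hyn hyE)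
    rw [Set.mem_ofPred_eq, h𝓔e z hzi, h𝓔e _ fun i => rfl] at h1
    refine h1.trans (le_of_eq (energy_congr B w fun i hi => ?_))
    simp [min_eq_left hi]
  grind

theorem discrete_euler_lagrange_of_minimizer (B : Fin 3 → Mat k) {w : ℝ} {n : ℕ}
    {x : ℕ → Mat k} (hx : ∀ i, (x i).PosDef)
    (hmin : ∀ y : ℕ → Mat k, (∀ i, (y i).PosDef) → y 0 = x 0 → y n = x n →
      energy B w n x ≤ energy B w n y) {i : ℕ} (hi : i + 1 < n) :
    ((x (i + 1))⁻¹ * x (i + 2) - (x (i + 2))⁻¹ * x (i + 1))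
      - ((x i)⁻¹ * x (i + 1) - (x (i + 1))⁻¹ * x i) = (w : ℂ) • curv B (x (i + 1)) := by
  refine discrete_euler_lagrange B (hx i) (hx (i + 1)) (hx (i + 2)) fun K' hK' => ?_
  set y := update x (i + 1) K' with hy
  have y1 : y (i + 1) = K' := update_self _ _ _
  have y2 : ∀ j, j ≠ i + 1 → y j = x j := fun j hj => update_of_ne hj _ _
  have h1 := hmin y (fun j => by
    by_cases hj : j = i + 1
    · rw [hj, y1]; exact hK'
    · rw [y2 j hj]; exact hx j) (y2 0 (by omega)) (y2 n (by omega))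
  rw [← sub_nonneg, energy, energy, ← sum_sub_distrib,
    Finset.sum_eq_add (a := i) (b := i + 1) (by omega)] at h1
  · grind
  · grind
  · grind
  · simp [*]

/-- `tr (Δ P)` is a sum of two squares, and one of them bounds `‖Δ‖`. -/
theorem norm_le_of_symm_mul {Δ P : Mat k} (hK : K.PosDef) {K' : Mat k} (hK' : K'.PosDef)
    (hΔ : Δᴴ = Δ) (hP : P = (K⁻¹ + K'⁻¹) * Δ) : ‖Δ‖ ≤ K.trace.re * ‖P‖ := by
  obtain ⟨g, hg, rfl⟩ := exists_posDef_factor hK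
  obtain ⟨g', hg', rfl⟩ := exists_posDef_factor hK'
  rw [← norm_factor_eq_trace]
  have h1 : ‖(g⁻¹)ᴴ * Δ‖ ^ 2 ≤ ‖Δ‖ * ‖P‖ := by
    refine le_trans ?_ ((le_abs_self _).trans (abs_re_trace_mul_le' Δ P))
    have e3 : Δ * P = ((g⁻¹)ᴴ * Δ)ᴴ * ((g⁻¹)ᴴ * Δ) + ((g'⁻¹)ᴴ * Δ)ᴴ * ((g'⁻¹)ᴴ * Δ) := by
      rw [hP, inv_conjTranspose_mul_self, inv_conjTranspose_mul_self]
      simp only [conjTranspose_mul, hΔ, conjTranspose_conjTranspose]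
      noncomm_ring
    rw [e3, trace_add, add_re, ← (norm_sq_eq_trace ((g⁻¹)ᴴ * Δ)), ← (norm_sq_eq_trace ((g'⁻¹)ᴴ *
      Δ))]
    simp
  have h2 : ‖Δ‖ ≤ ‖g‖ * ‖(g⁻¹)ᴴ * Δ‖ := by
    have e : Δ = gᴴ * ((g⁻¹)ᴴ * Δ) := by rw [← mul_assoc, conjTranspose_mul_inv hg, one_mul]
    calc ‖Δ‖ = ‖gᴴ * ((g⁻¹)ᴴ * Δ)‖ := by rw [← e]
      _ ≤ ‖gᴴ‖ * ‖(g⁻¹)ᴴ * Δ‖ := norm_mul_le _ _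
      _ = _ := by rw [frobenius_norm_conjTranspose]
  rcases (norm_nonneg Δ).eq_or_lt with h0 | h0
  · rw [← h0]; positivity
  · nlinarith

/-- The linear path between two metrics has discrete energy `O(1/n)`. -/
theorem exists_competitor (B : Fin 3 → Mat k) {T : ℝ} (hT : 0 < T) {Ka Kb : Mat k}
    (ha : Ka.PosDef) (hb : Kb.PosDef) :
    ∃ C : ℝ, 0 ≤ C ∧ ∀ n : ℕ, 0 < n → ∃ x : ℕ → Mat k, (∀ i, (x i).PosDef) ∧ x 0 = Ka ∧ x n = Kb ∧
      energy B (8 * (T / n) ^ 2) n x ≤ C / n := by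
  set γ : ℝ → Mat k := fun s => (1 - s) • Ka + s • Kb with hγ
  have hpd : ∀ s ∈ Icc (0 : ℝ) 1, (γ s).PosDef := by
    intro s hs
    have hsmul : ∀ {K : Mat k} {r : ℝ}, K.PosDef → 0 < r → (r • K).PosDef := fun hK hr => by
      rw [← coe_smul]
      exact hK.smul (by exact_mod_cast hr)
    rcases hs.1.eq_or_lt with h0 | h0
    · simpa [hγ, ← h0] using ha
    rcases hs.2.eq_or_lt with h1 | h1
    · simpa [hγ, h1] using hb
    · exact (hsmul ha (sub_pos.2 h1)).add (hsmul hb h0)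
  have hγc : Continuous γ := by fun_prop
  have hinv : ContinuousOn (fun s => (γ s)⁻¹) (Icc 0 1) :=
    continuousOn_inv hγc.continuousOn fun s hs => (hpd s hs).isUnit
  have hpot : ContinuousOn (fun s => potential B (γ s)) (Icc 0 1) := by
    exact continuousOn_finsetSum _ fun j _ => (reTrCLM k).continuous.comp_continuousOn
      ((((hγc.continuousOn).mul continuousOn_const).mul hinv).mul continuousOn_const)
  obtain ⟨M, hM⟩ := isCompact_Icc.exists_bound_of_continuousOn hinv
  obtain ⟨V, hV⟩ := isCompact_Icc.exists_bound_of_continuousOn hpot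
  have hM0 : 0 ≤ M := (norm_nonneg _).trans (hM 0 ⟨le_rfl, zero_le_one⟩)
  have hV0 : 0 ≤ V := (norm_nonneg _).trans (hV 0 ⟨le_rfl, zero_le_one⟩)
  refine ⟨M * (‖Kb - Ka‖ * M * ‖Kb - Ka‖) + 8 * T ^ 2 * V, by positivity, fun n hn => ?_⟩
  have hn' : (0 : ℝ) < n := cast_pos.2 hn
  set u : ℕ → ℝ := fun i => min ((i : ℝ) / n) 1 with hu
  have hI : ∀ i : ℕ, u i ∈ Icc (0 : ℝ) 1 := fun i =>
    ⟨le_min (by positivity) zero_le_one, min_le_right _ _⟩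
  refine ⟨fun i => γ (u i), fun i => hpd _ (hI i), by simp [hγ, hu],
    by simp [hγ, hu, div_self hn'.ne'], ?_⟩
  have hterm : ∀ i ∈ Finset.range n, gap (γ (u i)) (γ (u (i + 1))) +
      8 * (T / n) ^ 2 * potential B (γ (u i)) ≤
        (M * (‖Kb - Ka‖ * M * ‖Kb - Ka‖) + 8 * T ^ 2 * V) / n ^ 2 := by
    intro i hi
    have hu1 : ∀ j ≤ n, u j = j / n := fun j hj =>
      min_eq_left ((div_le_one hn').2 (by exact_mod_cast hj))
    have hd : ‖γ (u (i + 1)) - γ (u i)‖ = ‖Kb - Ka‖ / n := by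
      rw [hu1 _ (by grind), hu1 _ (by grind), show γ ((i + 1 : ℕ) / n) - γ ((i : ℝ) / n) =
        (1 / (n : ℝ)) • (Kb - Ka) by module, norm_smul, norm_of_nonneg (by positivity)]
      ring
    have hg := gap_le (hpd _ (hI i)) (hpd _ (hI (i + 1)))
    rw [hd] at hg
    have hv := (le_abs_self _).trans (hV _ (hI i))
    have hM1 := hM _ (hI i)
    have hM2 := hM _ (hI (i + 1))
    calc _ ≤ M * (‖Kb - Ka‖ / n * M * (‖Kb - Ka‖ / n)) + 8 * (T / n) ^ 2 * V := by
          gcongr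
          exact hg.trans (by gcongr)
      _ = _ := by field_simp
  refine (sum_le_sum hterm).trans (le_of_eq ?_)
  rw [sum_const, card_range, nsmul_eq_mul]
  field_simp

theorem norm_sub_le_of_small_increments {E : Type*} [NormedAddCommGroup E] {p : ℕ → E} {n : ℕ}
    {c : ℝ} (hc : 0 ≤ c) (h : ∀ i, i + 1 < n → ‖p (i + 1) - p i‖ ≤ c) {i j : ℕ} (hi : i < n)
        (hj : j < n) :
    ‖p i - p j‖ ≤ n * c := by
  wlog hij : i ≤ j generalizing i j
  · rw [norm_sub_rev]; exact this hj hi (by omega)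
  rw [← dist_eq_norm]
  refine (dist_le_Ico_sum_of_dist_le hij (d := fun _ => c) fun _ hl => ?_).trans ?_
  · rw [dist_eq_norm']; exact h _ (by omega)
  · rw [sum_const, nsmul_eq_mul, Nat.card_Ico]
    gcongr
    omega

/-- The right-hand side of the metric form of the Nahm equations, with the inverse of the
metric as an additional unknown, so that it is polynomial. -/
noncomputable def metricField (B : Fin 3 → Mat k) (y : Mat³ k) : Mat³ k :=
  (y.1 * y.2.2, -(y.2.2 * y.2.1), (4 : ℂ) • ∑ i, ⁅B i, y.2.1 * (B i)ᴴ * y.1⁆)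

theorem contDiff_metricField (B : Fin 3 → Mat k) : ContDiff ℝ 1 (metricField B) := by
  have h3 : ContDiff ℝ 1 fun y : Mat³ k => y.2.2 := contDiff_snd.comp contDiff_snd
  refine (contDiff_fst.mul h3).prodMk ((h3.mul (contDiff_fst.comp contDiff_snd)).neg.prodMk
    (ContDiff.const_smul (4 : ℂ) ?_))
  refine ContDiff.sum fun i _ => ?_
  simp only [Ring.lie_def]
  fun_prop

theorem exists_bound_metricField (B : Fin 3 → Mat k) (M : ℝ) : ∃ L : ℝ, 0 ≤ L ∧
    (∀ x ∈ closedBall (0 : Mat³ k) M, ‖metricField B x‖ ≤ L) ∧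
    ∀ x ∈ closedBall (0 : Mat³ k) M, ∀ x' ∈ closedBall (0 : Mat³ k) M,
      ‖metricField B x - metricField B x'‖ ≤ L * ‖x - x'‖ := by
  have : ProperSpace (Mat³ k) := FiniteDimensional.proper_real _
  have hc := isCompact_closedBall (0 : Mat³ k) M
  obtain ⟨L₁, h1⟩ := hc.exists_bound_of_continuousOn
      (contDiff_metricField B).continuous.continuousOn
  obtain ⟨L₂, h2⟩ := LocallyLipschitzOn.exists_lipschitzOnWith_of_compact hc
    ((contDiff_metricField B).locallyLipschitz.locallyLipschitzOn)
  exact ⟨max L₁ L₂, by simp, fun x hx => (h1 x hx).trans (le_max_left _ _), fun x hx x' hx' =>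
    ((h2.norm_sub_le hx hx').trans (by gcongr; simp))⟩

/-- One step of the discrete variational problem is an Euler step up to `O(δ²)`. -/
theorem step_estimate {K' q : Mat k} (hK : IsUnit K) (hK' : IsUnit K') {Λ c c' δ : ℝ}
    (hδ : 0 < δ) (hΛ : 0 ≤ Λ) (hc : 0 ≤ c)
    (h1 : ‖K‖ ≤ Λ) (h2 : ‖K⁻¹‖ ≤ Λ) (h3 : ‖K'⁻¹‖ ≤ Λ) (hΔ : ‖K' - K‖ ≤ c * δ)
    (hq : ‖q - (1 / (2 * δ)) • (K⁻¹ * K' - K'⁻¹ * K)‖ ≤ c' * δ) :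
    ‖K' - K - δ • (K * q)‖ ≤ (Λ * c ^ 2 + Λ ^ 3 * c ^ 2 + Λ * c') * δ ^ 2 ∧
    ‖K'⁻¹ - K⁻¹ - δ • (-(q * K⁻¹))‖ ≤ (Λ * c ^ 2 + Λ ^ 3 * c ^ 2 + Λ * c') * δ ^ 2 := by
  have a1 := nonsing_inv_mul' hK
  have a2 := mul_nonsing_inv' hK
  have b1 := nonsing_inv_mul' hK'
  have b2 := mul_nonsing_inv' hK'
  set L := K⁻¹
  set L' := K'⁻¹
  set r := q - (1 / (2 * δ)) • (L * K' - L' * K) with hr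
  have hqr : q = (1 / (2 * δ)) • (L * K' - L' * K) + r := by rw [hr]; abel
  have hc' : 0 ≤ c' * δ := (norm_nonneg _).trans hq
  have hδc : 0 ≤ c * δ := by positivity
  have e1 : K' - K - δ • (K * q) = (1 / 2 : ℝ) • ((K' - K) * L' * (K' - K)) - δ • (K * r) := by
    have hx : (K' - K) * L' * (K' - K) = K' - K - K + K * L' * K := by
      simp only [mul_sub, sub_mul]; grind
    have hy : K * (L * K' - L' * K) = K' - K * L' * K := by
      rw [mul_sub, ← mul_assoc, ← mul_assoc, a2, one_mul]
    rw [hx, hqr, mul_add, mul_smul_comm, hy, smul_add, smul_smul,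
      show δ * (1 / (2 * δ)) = 1 / 2 by field_simp]
    module
  have e2 : L' - L - δ • (-(q * L)) =
      (1 / 2 : ℝ) • (L * (K' - K) * L' * (K' - K) * L) + δ • (r * L) := by
    have hx : L * (K' - K) * L' * (K' - K) * L = L * K' * L - L - L + L' := by
      simp only [mul_sub, sub_mul]; grind
    have hy : (L * K' - L' * K) * L = L * K' * L - L' := by
      rw [sub_mul, mul_assoc L' K, a2, mul_one]
    rw [hx, hqr, add_mul, smul_mul_assoc, hy, neg_add, smul_add, smul_neg, smul_smul,
      show δ * (1 / (2 * δ)) = 1 / 2 by field_simp]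
    module
  have n1 : ‖(K' - K) * L' * (K' - K)‖ ≤ (c * δ) * Λ * (c * δ) :=
    norm_mul_le_of_le (norm_mul_le_of_le hΔ h3) hΔ
  have n2 : ‖L * (K' - K) * L' * (K' - K) * L‖ ≤ Λ * ((c * δ) * Λ * (c * δ)) * Λ := by
    rw [mul_assoc L, mul_assoc L]
    exact norm_mul_le_of_le (norm_mul_le_of_le h2 n1) h2
  have p1 : 0 ≤ (c * δ) * Λ * (c * δ) := by positivity
  have p2 : 0 ≤ Λ * ((c * δ) * Λ * (c * δ)) * Λ := by positivity
  constructor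
  · rw [e1]
    refine (norm_sub_le _ _).trans ?_
    rw [norm_smul, norm_smul, norm_of_nonneg hδ.le]
    norm_num
    nlinarith [mul_le_mul_of_nonneg_left (norm_mul_le_of_le h1 hq) hδ.le]
  · rw [e2]
    refine (norm_add_le _ _).trans ?_
    rw [norm_smul, norm_smul, norm_of_nonneg hδ.le]
    norm_num
    nlinarith [mul_le_mul_of_nonneg_left (norm_mul_le_of_le hq h2) hδ.le]

/-- Uniform bounds for the discrete minimizers: they form bounded Euler polygons for
`metricField`. The third component is the discrete momentum, shifted by one step so that its
equation holds exactly. -/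
theorem exists_euler_polygon (hk : 0 < k) (B : Fin 3 → Mat k) {T : ℝ} (hT : 0 < T) {Ka Kb : Mat k}
    (ha : Ka.PosDef) (hb : Kb.PosDef) :
    ∃ M C : ℝ, 0 ≤ C ∧ ∀ n : ℕ, 0 < n → ∃ y : ℕ → Mat³ k, (y 0).1 = Ka ∧ (y n).1 = Kb ∧
      (∀ i ≤ n, (y i).1.PosSemidef ∧ (y i).1 * (y i).2.1 = 1 ∧ ‖y i‖ ≤ M) ∧
      ∀ i < n, ‖y (i + 1) - y i - (T / n) • metricField B (y i)‖ ≤ C * (T / n) ^ 2 := by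
  obtain ⟨C₀, hC₀, hcomp⟩ := exists_competitor B hT ha hb
  set Λ := (Ka.trace.re + Ka⁻¹.trace.re) * exp (sqrt C₀) with hΛ
  have hΛ0 : 0 ≤ Λ := by
    have := trace_posDef_pos hk ha
    have := trace_posDef_pos hk ha.inv
    positivity
  -- a bound for the curvature term on the relevant compact set of metrics
  obtain ⟨W, hW0, hW⟩ : ∃ W : ℝ, 0 ≤ W ∧ ∀ K : Mat k, K.PosDef → ‖K‖ ≤ Λ → ‖K⁻¹‖ ≤ Λ →
      ‖curv B K‖ ≤ W := by
    obtain ⟨L, hL, hL1, -⟩ := exists_bound_metricField B Λ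
    refine ⟨L, hL, fun K hK h1 h2 => ?_⟩
    have h3 := hL1 (K, K⁻¹, 0) (by
      rw [mem_closedBall_zero_iff]
      simp only [Prod.norm_def, norm_zero]
      exact max_le h1 (max_le h2 hΛ0))
    have h4 : ‖(4 : ℂ) • curv B K‖ ≤ L := ((norm_snd_le _).trans (norm_snd_le _)).trans h3
    rw [norm_smul] at h4
    norm_num at h4
    linarith [norm_nonneg (curv B K)]
  set Cp := 2 * Λ * (sqrt C₀ * Λ / T) + 8 * T * W with hCp
  set Q := Cp / 2 + 4 * T * W with hQ
  set c := Λ * Cp with hc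
  refine ⟨max Λ Q, Λ * c ^ 2 + Λ ^ 3 * c ^ 2 + Λ * (4 * W), by positivity, fun n hn => ?_⟩
  obtain ⟨x₀, hx₀, hx00, hx0n, hE⟩ := hcomp n hn
  obtain ⟨x, hx, hxa, hxb, hxE, hmin⟩ := exists_discrete_minimizer hk B
    (show 0 ≤ 8 * (T / n) ^ 2 by positivity) n hx₀
  rw [hx00] at hxa
  rw [hx0n] at hxb
  set δ := T / (n : ℝ) with hδ
  have hδ0 : 0 < δ := by positivity
  have hδT : δ ≤ T := div_le_self hT.le (by exact_mod_cast hn)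
  have hnδ : n * δ = T := by rw [hδ]; field_simp
  have hsum : ∑ i ∈ Finset.range n, gap (x i) (x (i + 1)) ≤ C₀ / n :=
    (sum_gap_le_energy B (by positivity) n hx).trans (hxE.trans hE)
  have hbd := norm_le_of_sum_gap hk hx hsum
  rw [show (n : ℝ) * (C₀ / n) = C₀ by field_simp, hxa, ← hΛ] at hbd
  set p : ℕ → Mat k := fun i => (x i)⁻¹ * x (i + 1) - (x (i + 1))⁻¹ * x i with hp
  have hp2 : ∀ i, p i = ((x i)⁻¹ + (x (i + 1))⁻¹) * (x (i + 1) - x i) := fun i => by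
    simp only [hp, add_mul, mul_sub, nonsing_inv_mul' (hx _).isUnit]
    abel
  have hEL : ∀ i, i + 1 < n → p (i + 1) - p i = ((8 * δ ^ 2 : ℝ) : ℂ) • curv B (x (i + 1)) :=
    fun i hi => discrete_euler_lagrange_of_minimizer B hx
      (fun y hy h0 h1 => hmin y hy (by rw [h0, hxa, hx00]) (by rw [h1, hxb, hx0n])) hi
  have hcurv : ∀ i ≤ n, ‖curv B (x i)‖ ≤ W := fun i hi => hW _ (hx i) (hbd i hi).2.1 (hbd i hi).2.2
  -- some increment is at most the average one, and the momenta vary slowly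
  obtain ⟨i₀, hi₀, hgap⟩ : ∃ i ∈ Finset.range n, gap (x i) (x (i + 1)) ≤ C₀ / n ^ 2 := by
    refine Finset.exists_le_of_sum_le ⟨0, Finset.mem_range.2 hn⟩ (hsum.trans (le_of_eq ?_))
    rw [sum_const, card_range, nsmul_eq_mul]
    field_simp
  have hi₀' := Finset.mem_range.1 hi₀
  have hp0 : ‖p i₀‖ ≤ 2 * Λ * (sqrt C₀ * Λ / T) * δ := by
    have t1 := trace_posDef_pos hk (hx i₀)
    have t2 := trace_posDef_pos hk (hx (i₀ + 1))
    have h2 : ‖x (i₀ + 1) - x i₀‖ ^ 2 ≤ (sqrt C₀ * Λ / T * δ) ^ 2 := by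
      have := (hbd i₀ hi₀'.le).1
      have := (hbd (i₀ + 1) hi₀').1
      refine (((norm_sub_sq_le_gap (hx i₀) (hx (i₀ + 1))).1).trans (show _ ≤ C₀ / n ^ 2 * (Λ * Λ)
        by gcongr)).trans (le_of_eq ?_)
      rw [mul_pow, div_pow, mul_pow, sq_sqrt hC₀, hδ]
      field_simp
    have h3 := (abs_le_of_sq_le_sq' h2 (by positivity)).2
    rw [hp2]
    have h4 : ‖(x i₀)⁻¹ + (x (i₀ + 1))⁻¹‖ ≤ 2 * Λ := by
      refine (norm_add_le _ _).trans ?_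
      grind
    exact (norm_mul_le_of_le h4 h3).trans (le_of_eq (by ring))
  have hpb : ∀ i < n, ‖p i‖ ≤ Cp * δ := by
    intro i hi
    have h1 := norm_sub_le_of_small_increments (p := p) (n := n) (c := 8 * δ ^ 2 * W)
      (by positivity) (fun i hi => by
        rw [hEL i hi, norm_smul, norm_real, norm_of_nonneg (by positivity)]
        exact mul_le_mul_of_nonneg_left (hcurv _ hi.le) (by positivity)) hi hi₀'
    have h2 : ‖p i‖ ≤ ‖p i - p i₀‖ + ‖p i₀‖ := by simpa using norm_add_le (p i - p i₀) (p i₀)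
    have h3 : (n : ℝ) * (8 * δ ^ 2 * W) = 8 * T * W * δ := by rw [← hnδ]; ring
    linarith
  -- `x (i + 1) - x i` solves a Sylvester equation with right-hand side `p i`
  have hΔ : ∀ i < n, ‖x (i + 1) - x i‖ ≤ c * δ := by
    intro i hi
    refine (norm_le_of_symm_mul (hx i) (hx (i + 1)) ?_ (hp2 i)).trans ?_
    · rw [conjTranspose_sub, (hx _).1.eq, (hx _).1.eq]
    · rw [hc, mul_assoc]
      exact mul_le_mul (hbd i hi.le).1 (hpb i hi) (norm_nonneg _) hΛ0
  set q : ℕ → Mat k := fun i => match i with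
    | 0 => (1 / (2 * δ)) • p 0 - ((4 * δ : ℝ) : ℂ) • curv B (x 0)
    | i + 1 => (1 / (2 * δ)) • p i with hq
  have hq1 : ∀ i < n, q (i + 1) - q i = ((4 * δ : ℝ) : ℂ) • curv B (x i) := by
    intro i hi
    cases i with
    | zero => simp only [hq]; abel
    | succ i =>
      simp only [hq]
      rw [← smul_sub, hEL i hi, ← coe_smul, smul_smul]
      congr 1
      push_cast
      have : (δ : ℂ) ≠ 0 := by exact_mod_cast hδ0.ne'
      field_simp
      norm_num
  have hp3 : ∀ i < n, ‖(1 / (2 * δ)) • p i‖ ≤ Cp / 2 := by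
    intro i hi
    rw [norm_smul, norm_of_nonneg (by positivity)]
    refine (mul_le_mul_of_nonneg_left (hpb i hi) (by positivity)).trans (le_of_eq ?_)
    field_simp
  have hcn : ∀ i ≤ n, ‖((4 * δ : ℝ) : ℂ) • curv B (x i)‖ ≤ 4 * W * δ := by
    intro i hi
    rw [norm_smul, norm_real, norm_of_nonneg (by positivity)]
    nlinarith [hcurv i hi]
  have hqb : ∀ i ≤ n, ‖q i‖ ≤ Q := by
    intro i hi
    cases i with
    | zero =>
      refine (norm_sub_le _ _).trans ?_
      have := hcn 0 hi
      have h5 : 4 * W * δ ≤ 4 * T * W := by nlinarith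
      linarith [hp3 0 hn]
    | succ i =>
      have : 0 ≤ 4 * T * W := by positivity
      linarith [hp3 i hi]
  refine ⟨fun i => (x i, (x i)⁻¹, q i), hxa, hxb, fun i hi => ⟨(hx i).posSemidef,
    mul_nonsing_inv' (hx i).isUnit, ?_⟩, fun i hi => ?_⟩
  · simp only [Prod.norm_def]
    exact max_le ((hbd i hi).2.1.trans (le_max_left _ _))
      (max_le ((hbd i hi).2.2.trans (le_max_left _ _)) ((hqb i hi).trans (le_max_right _ _)))
  · have h1 := step_estimate (q := q i) (c' := 4 * W) (hx i).isUnit (hx (i + 1)).isUnit hδ0 hΛ0 (by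
      positivity)
      (hbd i hi.le).2.1 (hbd i hi.le).2.2 (hbd (i + 1) hi).2.2 (hΔ i hi) (by
        have : q i - (1 / (2 * δ)) • p i = -(((4 * δ : ℝ) : ℂ) • curv B (x i)) := by
          rw [← hq1 i hi]; simp only [hq]; abel
        change ‖q i - (1 / (2 * δ)) • p i‖ ≤ _
        rw [this, norm_neg]
        exact hcn i hi.le)
    have h2 : q (i + 1) - q i - δ • ((4 : ℂ) • curv B (x i)) = 0 := by
      rw [hq1 i hi, ← coe_smul, smul_smul, sub_eq_zero]
      push_cast; congr 1; ring
    simp only [Prod.norm_def]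
    refine max_le h1.1 (max_le h1.2 ?_)
    change ‖q (i + 1) - q i - δ • ((4 : ℂ) • curv B (x i))‖ ≤ _
    rw [h2, norm_zero]
    positivity

/-- The Dirichlet problem for the metric form of the Nahm equations is solvable on every
compact interval, with arbitrary boundary values. -/
theorem exists_bvp (hk : 0 < k) (B : Fin 3 → Mat k) {T : ℝ} (hT : 0 < T) {Ka Kb : Mat k}
    (ha : Ka.PosDef) (hb : Kb.PosDef) :
    ∃ K P : ℝ → Mat k, K 0 = Ka ∧ K T = Kb ∧ (∀ t ∈ Icc 0 T, (K t).PosDef) ∧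
      ∀ t ∈ Icc 0 T, HasDerivWithinAt K (K t * P t) (Icc 0 T) t ∧
        HasDerivWithinAt P ((4 : ℂ) • curv B (K t)) (Icc 0 T) t := by
  have : ProperSpace (Mat³ k) := FiniteDimensional.proper_real _
  obtain ⟨M, C, hC, h⟩ := exists_euler_polygon hk B hT ha hb
  obtain ⟨L, hL, hf1, hf2⟩ := exists_bound_metricField B M
  choose! y hy using h
  set S : Set (Mat³ k) := ({z | z.1.PosSemidef} ∩ {z | z.1 * z.2.1 = 1}) ∩ closedBall 0 M with hS
  have hSc : IsClosed S := by
    refine IsClosed.inter (IsClosed.inter (isClosed_posSemidef.preimage continuous_fst) ?_)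
      Metric.isClosed_closedBall
    exact isClosed_eq (continuous_fst.mul (continuous_fst.comp continuous_snd)) continuous_const
  obtain ⟨Y, hYS, hYd, hY0, hYT⟩ := exists_solution_of_euler (contDiff_metricField B).continuous hT
    hL hC hSc (fun x hx => mem_closedBall_zero_iff.1 hx.2) (fun x hx => hf1 x hx.2)
    (fun x hx x' hx' => hf2 x hx.2 x' hx'.2) y
    (fun n hn i hi => ⟨⟨((hy n hn).2.2.1 i hi).1, ((hy n hn).2.2.1 i hi).2.1⟩,
      mem_closedBall_zero_iff.2 ((hy n hn).2.2.1 i hi).2.2⟩)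
    (fun n hn => (hy n hn).2.2.2)
  have hpos : ∀ᶠ n in 𝒰, 0 < n := hyperfilter_le_atTop (eventually_gt_atTop 0)
  have hinv : ∀ t ∈ Icc 0 T, (Y t).2.1 = (Y t).1⁻¹ := fun t ht =>
    (inv_eq_right_inv (hYS t ht).1.2).symm
  refine ⟨fun t => (Y t).1, fun t => (Y t).2.2, ?_, ?_, fun t ht =>
    posDef_of_posSemidef_of_mul (hYS t ht).1.1 (hYS t ht).1.2, fun t ht => ⟨?_, ?_⟩⟩
  · refine tendsto_nhds_unique ((continuous_fst.tendsto _).comp hY0) (tendsto_const_nhds.congr' ?_)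
    filter_upwards [hpos] with n hn using (hy n hn).1.symm
  · refine tendsto_nhds_unique ((continuous_fst.tendsto _).comp hYT) (tendsto_const_nhds.congr' ?_)
    filter_upwards [hpos] with n hn using (hy n hn).2.1.symm
  · exact ((fst ℝ (Mat k) (Mat k × Mat k)).hasFDerivAt).comp_hasDerivWithinAt t (hYd t ht)
  · have h1 := (((snd ℝ (Mat k) (Mat k)).comp
      (snd ℝ (Mat k) (Mat k × Mat k))).hasFDerivAt).comp_hasDerivWithinAt t
      (hYd t ht)
    refine h1.congr_deriv ?_
    change (4 : ℂ) • ∑ i, ⁅B i, (Y t).2.1 * (B i)ᴴ * (Y t).1⁆ = _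
    rw [hinv t ht]
    rfl

/-! ### Complex gauge transformations and metrics -/

/-- `g` carries the fields of `D` to those of `D'`: the gauge transformation law, in the form of
a linear differential equation for `g`, on the open interval and without boundary conditions. -/
structure Intertwines (g : ℝ → Mat k) (D D' : ComplexData k) : Prop where
  isUnit : ∀ t ∈ 𝕀, IsUnit (g t)
  deriv : ∀ t ∈ 𝕀, HasDerivAt g ((2 : ℂ) • (g t * D.α t - D'.α t * g t)) t
  field : ∀ i, ∀ t ∈ 𝕀, g t * D.β i t = D'.β i t * g t

/-- The data with `α = 0` and constant fields `βᵢ = Bᵢ`. An intertwiner from `D` to `flat B` is a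
trivialization of `D`. -/
def flat (B : Fin 3 → Mat k) : ComplexData k := ⟨fun _ => 0, fun i _ => B i, 0⟩

namespace Intertwines

variable {h : ℝ → Mat k} {D'' : ComplexData k}

theorem mul (hh : Intertwines h D' D'') (hg : Intertwines g D D') :
    Intertwines (fun t => h t * g t) D D'' where
  isUnit t ht := (hh.isUnit t ht).mul (hg.isUnit t ht)
  deriv t ht := by
    refine ((hh.deriv t ht).mul (hg.deriv t ht)).congr_deriv ?_
    simp only [smul_mul_assoc, mul_smul_comm, ← smul_add]
    congr 1; noncomm_ring
  field i t ht := by rw [mul_assoc, hg.field i t ht, ← mul_assoc, hh.field i t ht, mul_assoc]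

theorem inv (hg : Intertwines g D D') : Intertwines (fun t => (g t)⁻¹) D' D where
  isUnit t ht := isUnit_nonsing_inv (hg.isUnit t ht)
  deriv t ht := by
    have a1 := nonsing_inv_mul' (hg.isUnit t ht)
    have a2 := mul_nonsing_inv' (hg.isUnit t ht)
    refine (hasDerivAt_inv (hg.deriv t ht) (hg.isUnit t ht)).congr_deriv ?_
    rw [mul_smul_comm, smul_mul_assoc, ← smul_neg, mul_sub, sub_mul]
    congr 1
    grind
  field i t ht := by
    have a1 := nonsing_inv_mul' (hg.isUnit t ht)
    have a2 := mul_nonsing_inv' (hg.isUnit t ht)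
    have := congrArg ((g t)⁻¹ * · * (g t)⁻¹) (hg.field i t ht)
    grind

theorem congr (hg : Intertwines g D D') (he : ∀ t ∈ 𝕀, h t = g t) : Intertwines h D D' where
  isUnit t ht := by rw [he t ht]; exact hg.isUnit t ht
  deriv t ht := by
    rw [he t ht]
    refine (hg.deriv t ht).congr_of_eventuallyEq ?_
    filter_upwards [Ioo_mem_nhds ht.1 ht.2] with s hs using he s hs
  field i t ht := by rw [he t ht]; exact hg.field i t ht

theorem continuousOn (hg : Intertwines g D D') : ContinuousOn g 𝕀 := fun t ht =>
  (continuousAt (𝕜 := ℝ) (hg.deriv t ht)).continuousWithinAt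

theorem contDiffOn (hg : Intertwines g D D') (h1 : ContDiffOn ℝ ∞ D.α 𝕀)
    (h2 : ContDiffOn ℝ ∞ D'.α 𝕀) : ContDiffOn ℝ ∞ g 𝕀 := by
  refine contDiffOn_of_bootstrap isOpen_Ioo hg.deriv fun n hn => ?_
  exact ContDiffOn.const_smul (2 : ℂ) ((hn.mul (h1.of_le (by exact_mod_cast le_top))).sub
    ((h2.of_le (by exact_mod_cast le_top)).mul
    hn))

theorem field_eq (hg : Intertwines g D D') (i : Fin 3) (ht : t ∈ 𝕀) :
    D'.β i t = g t * D.β i t * (g t)⁻¹ := by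
  rw [hg.field i t ht, mul_assoc, mul_nonsing_inv' (hg.isUnit t ht), mul_one]

theorem gaugeField (hg : Intertwines g D D') (i : Fin 3) (ht : t ∈ 𝕀) :
    D'.β i t = Nahm.gaugeField g (D.β i) t := hg.field_eq i ht

theorem gaugeConnection (hg : Intertwines g D D') (ht : t ∈ 𝕀) :
    D'.α t = Nahm.gaugeConnection (1 / 2) g D.α t := by
  have hd : _root_.deriv g t = (2 : ℂ) • (g t * D.α t - D'.α t * g t) := (hg.deriv t ht).deriv
  rw [Nahm.gaugeConnection, hd, smul_mul_assoc, smul_smul]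
  norm_num
  rw [sub_mul, mul_assoc (D'.α t), (mul_nonsing_inv' (hg.isUnit t ht)), mul_one]
  abel

theorem of_gauge (hu : ∀ t ∈ 𝕀, IsUnit (g t)) (hd : ∀ t ∈ 𝕀, DifferentiableAt ℝ g t)
    (h1 : ∀ t ∈ 𝕀, D'.α t = Nahm.gaugeConnection (1 / 2) g D.α t)
    (h2 : ∀ i, ∀ t ∈ 𝕀, D'.β i t = Nahm.gaugeField g (D.β i) t) :
    Intertwines g D D' where
  isUnit := hu
  deriv t ht := by
    have a1 := nonsing_inv_mul' (hu t ht)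
    refine (hd t ht).hasDerivAt.congr_deriv ?_
    rw [h1 t ht, Nahm.gaugeConnection, sub_mul, mul_assoc (g t * D.α t), a1, mul_one,
      smul_mul_assoc, mul_assoc, a1, mul_one, sub_sub_cancel, smul_smul]
    norm_num
    rfl
  field i t ht := by
    rw [h2 i t ht, Nahm.gaugeField, mul_assoc (g t * D.β i t), nonsing_inv_mul' (hu t ht), mul_one]

/-- The complex equations make the fields constant in a frame of parallel sections. -/
theorem exists_flat (hα : ContinuousOn D.α 𝕀)
    (hβ : ∀ i, ∀ t ∈ 𝕀, DifferentiableAt ℝ (D.β i) t) (hD : D.ComplexEquations) :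
    ∃ (Ψ : ℝ → Mat k) (B : Fin 3 → Mat k), Intertwines Ψ D (flat B) ∧ ∀ i j, ⁅B i, B j⁆ = 0 := by
  obtain ⟨Ψ, -, hΨ⟩ := exists_frame_Ioo (X := fun t => (2 : ℂ) • D.α t)
      (ContinuousOn.const_smul hα (2 : ℂ) :)
  have hm : (1 / 2 : ℝ) ∈ 𝕀 := by norm_num
  have hconst : ∀ i, ∀ t ∈ 𝕀, Ψ t * D.β i t * (Ψ t)⁻¹ =
      Ψ (1 / 2) * D.β i (1 / 2) * (Ψ (1 / 2))⁻¹ := by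
    intro i t ht
    refine constant_of_hasDerivWithinAt_zero (convex_Ioo 0 1)
      (f := fun t => Ψ t * D.β i t * (Ψ t)⁻¹) (fun s hs => ?_) ht hm
    have hb : HasDerivAt (D.β i) (-((2 : ℂ) • ⁅D.α s, D.β i s⁆)) s :=
      (hβ i s hs).hasDerivAt.congr_deriv (eq_neg_of_add_eq_zero_left (hD.1 i s hs))
    refine ((((hΨ s hs).1.mul hb).mul (hasDerivAt_inv (hΨ s hs).1 (hΨ s hs).2)).congr_deriv
      ?_).hasDerivWithinAt
    rw [← mul_assoc (Ψ s)⁻¹, (nonsing_inv_mul' (hΨ s hs).2), one_mul, Ring.lie_def]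
    simp only [mul_neg, mul_smul_comm, smul_mul_assoc]
    rw [mul_sub, smul_sub]
    simp only [Pi.mul_apply, add_mul, sub_mul, neg_mul, smul_mul_assoc, mul_assoc]
    abel
  refine ⟨Ψ, fun i => Ψ (1 / 2) * D.β i (1 / 2) * (Ψ (1 / 2))⁻¹, ⟨fun t ht => (hΨ t ht).2,
    fun t ht => ?_, fun i t ht => ?_⟩, fun i j => ?_⟩
  · refine (hΨ t ht).1.congr_deriv ?_
    simp [flat]
  · have := hconst i t ht
    change _ = Ψ (1 / 2) * D.β i (1 / 2) * (Ψ (1 / 2))⁻¹ * Ψ t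
    rw [← this, mul_assoc _ _ (Ψ t), nonsing_inv_mul' (hΨ t ht).2, mul_one]
  · rw [lie_conj (nonsing_inv_mul' (hΨ _ hm).2), hD.2 i j _ hm, mul_zero, zero_mul]

/-- In the presence of a trivialization with commuting fields the complex equations hold. -/
theorem complexEquations (hΨ : Intertwines Ψ D (flat B))
    (hB : ∀ i j, ⁅B i, B j⁆ = 0) :
    (∀ i, ∀ t ∈ 𝕀, HasDerivAt (D.β i) (-((2 : ℂ) • ⁅D.α t, D.β i t⁆)) t) ∧ D.ComplexEquations := by
  have hi := hΨ.inv
  have e : ∀ i, ∀ t ∈ 𝕀, D.β i t = (Ψ t)⁻¹ * B i * (Ψ t) := by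
    intro i t ht
    have := hi.field_eq i ht
    rwa [inv_inv' (hΨ.isUnit t ht)] at this
  have hd : ∀ i, ∀ t ∈ 𝕀, HasDerivAt (D.β i) (-((2 : ℂ) • ⁅D.α t, D.β i t⁆)) t := by
    intro i t ht
    have h2 : HasDerivAt (D.β i) _ t := (((hi.deriv t ht).mul_const (B i)).mul (hΨ.deriv t
      ht)).congr_of_eventuallyEq (by
      filter_upwards [Ioo_mem_nhds ht.1 ht.2] with s hs using e i s hs)
    refine h2.congr_deriv ?_
    rw [Ring.lie_def, e i t ht]
    simp only [flat, mul_zero, zero_mul, zero_sub, sub_zero, smul_mul_assoc, mul_smul_comm, neg_mul]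
    rw [smul_sub]
    simp only [mul_assoc]
    module
  refine ⟨hd, fun i t ht => ?_, fun i j t ht => ?_⟩
  · have h : _root_.deriv (D.β i) t = -((2 : ℂ) • ⁅D.α t, D.β i t⁆) := (hd i t ht).deriv
    rw [h, neg_add_cancel]
  · rw [e i t ht, e j t ht, lie_conj (mul_nonsing_inv' (hΨ.isUnit t ht)), hB, mul_zero, zero_mul]

end Intertwines

/-- The left-hand side of the real equation. -/
noncomputable def ComplexData.defect (D : ComplexData k) (t : ℝ) : Mat k :=
  deriv (fun s => D.α s + (D.α s)ᴴ) t + (2 : ℂ) • (⁅D.α t, (D.α t)ᴴ⁆ + ∑ i, ⁅D.β i t, (D.β i t)ᴴ⁆)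

/-- The metric `Ψ⁻ᴴ Ψ⁻¹` of data `D` in a trivialization `Ψ`. -/
noncomputable def frameMetric (Ψ : ℝ → Mat k) (t : ℝ) : Mat k := ((Ψ t)⁻¹)ᴴ * (Ψ t)⁻¹

/-- The real equation for `D`, written in a trivialization, is the equation of metric paths. -/
theorem Intertwines.isMetricPath {D : ComplexData k}
    (hΨ : Intertwines Ψ D (flat B)) (hα : ∀ t ∈ 𝕀, DifferentiableAt ℝ D.α t) :
    IsMetricPath B 𝕀 (frameMetric Ψ) (fun t => (-2 : ℂ) • (Ψ t * (D.α t + (D.α t)ᴴ) * (Ψ t)⁻¹))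
      (fun t => (-2 : ℂ) • (Ψ t * D.defect t * (Ψ t)⁻¹)) := by
  have hnd : ∀ t ∈ 𝕀, HasDerivAt (fun t => (Ψ t)⁻¹) ((-2 : ℂ) • (D.α t * (Ψ t)⁻¹)) t :=
    fun t ht => (hΨ.inv.deriv t ht).congr_deriv (by simp [flat])
  have hd : ∀ t ∈ 𝕀, HasDerivAt Ψ ((2 : ℂ) • (Ψ t * D.α t)) t :=
    fun t ht => (hΨ.deriv t ht).congr_deriv (by simp [flat])
  have hpd : ∀ t ∈ 𝕀, (frameMetric Ψ t).PosDef := fun t ht =>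
    posDef_conjTranspose_mul_self (isUnit_nonsing_inv (hΨ.isUnit t ht))
  have c1 : ∀ t ∈ 𝕀, ∀ X : Mat k, (Ψ t)⁻¹ * (Ψ t * X) = X := fun t ht X => by
    rw [← mul_assoc, nonsing_inv_mul' (hΨ.isUnit t ht), one_mul]
  have c3 : ∀ t ∈ 𝕀, ∀ X : Mat k, (Ψ t)ᴴ * (((Ψ t)⁻¹)ᴴ * X) = X := fun t ht X => by
    rw [← mul_assoc, conjTranspose_mul_inv (hΨ.isUnit t ht), one_mul]
  refine ⟨hpd, fun t ht => ?_, fun t ht => ?_, fun t ht => ?_⟩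
  · simp only [frameMetric, conjTranspose_smul, conjTranspose_mul, conjTranspose_add,
      conjTranspose_conjTranspose, smul_mul_assoc, mul_smul_comm, star_def, map_neg, map_ofNat,
      mul_add, add_mul, mul_assoc, c1 t ht, c3 t ht]
    congr 1
    abel
  · refine ((hasDerivAt_conjTranspose (hnd t ht)).mul (hnd t ht)).congr_deriv ?_
    simp only [frameMetric, conjTranspose_smul, conjTranspose_mul, smul_mul_assoc, mul_smul_comm,
      star_def, map_neg, map_ofNat, mul_add, add_mul, mul_assoc, c1 t ht]
    module
  · have hαd := (hα t ht).hasDerivAt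
    have hsum : HasDerivAt (fun s => D.α s + (D.α s)ᴴ)
        (_root_.deriv (fun s => D.α s + (D.α s)ᴴ) t) t :=
      (HasDerivAt.differentiableAt (𝕜 := ℝ) (hαd.add (hasDerivAt_conjTranspose hαd))).hasDerivAt
    refine (((((hd t ht).mul hsum).mul (hnd t ht))).const_smul (-2 : ℂ)).congr_deriv ?_
    have hinv : (frameMetric Ψ t)⁻¹ = Ψ t * (Ψ t)ᴴ := by
      rw [frameMetric, inv_conjTranspose_mul_self, inv_inv' (hΨ.isUnit t ht)]
    have hcurv : curv B (frameMetric Ψ t) = Ψ t * (∑ i, ⁅D.β i t, (D.β i t)ᴴ⁆) * (Ψ t)⁻¹ := by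
      rw [curv, mul_sum, sum_mul]
      refine sum_congr rfl fun i _ => ?_
      have e1 : B i = Ψ t * D.β i t * (Ψ t)⁻¹ := hΨ.field_eq i ht
      have e2 : (frameMetric Ψ t)⁻¹ * (B i)ᴴ * frameMetric Ψ t = Ψ t * (D.β i t)ᴴ * (Ψ t)⁻¹ := by
        rw [hinv, e1, frameMetric, conjTranspose_mul, conjTranspose_mul]
        simp only [mul_assoc, c3 t ht]
      rw [e2, e1, lie_conj (nonsing_inv_mul' (hΨ.isUnit t ht))]
    rw [hcurv, ComplexData.defect]
    simp only [Pi.mul_apply, Ring.lie_def, smul_mul_assoc, mul_smul_comm, add_mul, mul_add,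
      sub_mul, mul_sub, smul_add, smul_sub, smul_smul, mul_assoc]
    module

/-! ### Uniqueness -/

theorem ComplexData.defect_eq_zero (h : D.RealEquation)
    (ht : t ∈ 𝕀) : D.defect t = 0 := h t ht

theorem frameMetric_trace (hΨ : IsUnit (Ψ t)) (hg : IsUnit (g t)) :
    ((frameMetric Ψ t)⁻¹ * frameMetric (fun t => Ψ t * (g t)⁻¹) t).trace.re = ‖g t‖ ^ 2 := by
  rw [frameMetric, frameMetric, (trace_inv_mul_factor ((Ψ t * (g t)⁻¹)⁻¹) (Ψ t)⁻¹),
    Matrix.mul_inv_rev, mul_assoc,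
    inv_inv' hg,
    inv_inv' hΨ,
    nonsing_inv_mul' hΨ, mul_one]

/-- The squared norm of an intertwiner between two solutions is logarithmically convex. -/
theorem Intertwines.norm_sq_log_convex
    (hg : Intertwines g D D')
    (hΨ : Intertwines Ψ D (flat B)) (hα : ∀ t ∈ 𝕀, DifferentiableAt ℝ D.α t)
    (hα' : ∀ t ∈ 𝕀, DifferentiableAt ℝ D'.α t) (hR : D.RealEquation)
    (hR' : D'.RealEquation) : ∃ f₁ f₂ : ℝ → ℝ, ∀ t ∈ 𝕀,
      HasDerivAt (fun t => ‖g t‖ ^ 2) (f₁ t) t ∧ HasDerivAt f₁ (f₂ t) t ∧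
      f₁ t ^ 2 ≤ ‖g t‖ ^ 2 * f₂ t := by
  obtain ⟨f₁, f₂, hf⟩ := ((hΨ.mul hg.inv).isMetricPath hα').hasDerivAt_trace (hΨ.isMetricPath hα)
  have he : ∀ t ∈ 𝕀, ((frameMetric Ψ t)⁻¹ *
      frameMetric (fun t => Ψ t * (g t)⁻¹) t).trace.re = ‖g t‖ ^ 2 := fun t ht =>
    frameMetric_trace (hΨ.isUnit t ht) (hg.isUnit t ht)
  refine ⟨f₁, f₂, fun t ht => ⟨(hf t ht).1.congr_of_eventuallyEq ?_, (hf t ht).2.1, ?_⟩⟩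
  · filter_upwards [Ioo_mem_nhds ht.1 ht.2] with s hs using (he s hs).symm
  · have := (hf t ht).2.2
    rw [ComplexData.defect_eq_zero hR ht, ComplexData.defect_eq_zero hR' ht, he t ht] at this
    simpa using this

theorem conjTranspose_of_unitary (hU : U ∈ 𝐔 k) :
    U⁻¹ = Uᴴ := inv_eq_right_inv (mem_unitaryGroup_iff.1 hU)

theorem isUnit_of_unitary (hU : U ∈ 𝐔 k) : IsUnit U :=
  IsUnit.of_mul_eq_one _ (mem_unitaryGroup_iff.1 hU)

theorem inv_mem_unitaryGroup (hU : U ∈ 𝐔 k) : U⁻¹ ∈ 𝐔 k := by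
  rw [conjTranspose_of_unitary hU]
  exact star_mem hU

theorem norm_sq_of_unitary (hU : U ∈ 𝐔 k) : ‖U‖ ^ 2 = k := by
  rw [norm_sq_eq_trace, ← star_eq_conjTranspose, mem_unitaryGroup_iff'.1 hU]
  simp

theorem Intertwines.norm_sq_le (hk : 0 < k)
    (hg : Intertwines g D D') (hc : ContinuousOn g (Icc 0 1))
        (hu : ∀ t ∈ Icc (0 : ℝ) 1, IsUnit (g t))
    (hΨ : Intertwines Ψ D (flat B)) (hα : ∀ t ∈ 𝕀, DifferentiableAt ℝ D.α t)
    (hα' : ∀ t ∈ 𝕀, DifferentiableAt ℝ D'.α t) (hR : D.RealEquation)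
    (hR' : D'.RealEquation) (h0 : ‖g 0‖ ^ 2 = k) (h1 : ‖g 1‖ ^ 2 = k) :
    ∀ t ∈ Icc (0 : ℝ) 1, ‖g t‖ ^ 2 ≤ k := by
  obtain ⟨f₁, f₂, hf⟩ := hg.norm_sq_log_convex hΨ hα hα' hR hR'
  have hne : Nonempty (Fin k) := ⟨⟨0, hk⟩⟩
  have := le_exp_of_log_deriv2 (f := fun t => ‖g t‖ ^ 2) (f₁ := f₁) (f₂ := f₂) (w := fun _ => 0)
    (w₁ := fun _ => 0) (w₂ := fun _ => 0) (c := 0) (d := 1) (κ := k) (cast_pos.2 hk) (hc.norm.pow 2)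
    continuousOn_const (fun t ht => by
      have : g t ≠ 0 := (hu t ht).ne_zero
      positivity) (fun t ht => (hf t ht).1) (fun t ht => (hf t ht).2.1)
    (fun t _ => hasDerivAt_const t 0) (fun t _ => hasDerivAt_const t 0)
    (fun t ht => by simpa using (hf t ht).2.2) (by simp [h0]) (by simp [h1])
  simpa using this

/-- An intertwiner between two solutions that is unitary at both ends is unitary. -/
theorem Intertwines.unitary (hk : 0 < k)
    (hg : Intertwines g D D') (hc : ContinuousOn g (Icc 0 1))
        (hu : ∀ t ∈ Icc (0 : ℝ) 1, IsUnit (g t))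
    (hΨ : Intertwines Ψ D (flat B)) (hα : ∀ t ∈ 𝕀, DifferentiableAt ℝ D.α t)
    (hα' : ∀ t ∈ 𝕀, DifferentiableAt ℝ D'.α t) (hR : D.RealEquation)
    (hR' : D'.RealEquation) (h0 : g 0 ∈ 𝐔 k)
    (h1 : g 1 ∈ 𝐔 k) :
    ∀ t ∈ Icc (0 : ℝ) 1, g t ∈ 𝐔 k := by
  have a := hg.norm_sq_le hk hc hu hΨ hα hα' hR hR' (norm_sq_of_unitary h0) (norm_sq_of_unitary h1)
  have b := hg.inv.norm_sq_le hk (continuousOn_inv hc hu) (fun t ht => isUnit_nonsing_inv (hu t ht))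
    (hΨ.mul hg.inv) hα' hα hR' hR (norm_sq_of_unitary (inv_mem_unitaryGroup h0))
        (norm_sq_of_unitary (inv_mem_unitaryGroup h1))
  intro t ht
  have h2 := norm_sub_conjTranspose_inv_sq (hu t ht)
  have h3 : ‖g t - ((g t)⁻¹)ᴴ‖ ^ 2 ≤ 0 := by
    have b' : ‖(g t)⁻¹‖ ^ 2 ≤ k := b t ht
    linarith [a t ht]
  have h4 : g t = ((g t)⁻¹)ᴴ :=
    sub_eq_zero.1 (norm_eq_zero.1 (by nlinarith [norm_nonneg (g t - ((g t)⁻¹)ᴴ)]))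
  rw [mem_unitaryGroup_iff', star_eq_conjTranspose]
  conv_lhs => rw [h4]
  rw [conjTranspose_conjTranspose, ← h4, nonsing_inv_mul' (hu t ht)]

/-- A unitary intertwiner between data with Hermitian `α` is constant. -/
theorem Intertwines.constant_of_unitary
    (hg : Intertwines g D D') (hU : ∀ t ∈ 𝕀, g t ∈ 𝐔 k)
    (hα : ∀ t ∈ 𝕀, (D.α t)ᴴ = D.α t) (hα' : ∀ t ∈ 𝕀, (D'.α t)ᴴ = D'.α t) :
    ∀ t ∈ 𝕀, g t = g (1 / 2) := by
  intro t ht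
  refine constant_of_hasDerivWithinAt_zero (convex_Ioo 0 1) (fun s hs => ?_) ht (by norm_num)
  have hU1 : ∀ r ∈ 𝕀, g r * (g r)ᴴ = 1 := fun r hr => mem_unitaryGroup_iff.1 (hU r hr)
  have hU2 : (g s)ᴴ * g s = 1 := mem_unitaryGroup_iff'.1 (hU s hs)
  have hd := hg.deriv s hs
  have h1 := hd.mul (hasDerivAt_conjTranspose hd)
  have h2 : HasDerivAt (fun r => g r * (g r)ᴴ) 0 s :=
    (hasDerivAt_const s (1 : Mat k)).congr_of_eventuallyEq (by
      filter_upwards [Ioo_mem_nhds hs.1 hs.2] with r hr using hU1 r hr)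
  have h3 := h1.unique h2
  have e1 : (2 : ℂ) • (g s * D.α s - D'.α s * g s) * (g s)ᴴ =
      (2 : ℂ) • (g s * D.α s * (g s)ᴴ - D'.α s) := by
    rw [smul_mul_assoc, sub_mul, mul_assoc (D'.α s), hU1 s hs, mul_one]
  have e2 : g s * ((2 : ℂ) • (g s * D.α s - D'.α s * g s))ᴴ =
      (2 : ℂ) • (g s * D.α s * (g s)ᴴ - D'.α s) := by
    rw [conjTranspose_smul, conjTranspose_sub, conjTranspose_mul,
      conjTranspose_mul, hα s hs, hα' s hs, mul_smul_comm, mul_sub, ← mul_assoc,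
      ← mul_assoc, hU1 s hs, one_mul]
    simp
  rw [e1, e2, ← two_smul ℂ, smul_smul, smul_eq_zero] at h3
  have h4 : g s * D.α s * (g s)ᴴ - D'.α s = 0 := h3.resolve_left (by norm_num)
  refine hd.hasDerivWithinAt.congr_deriv ?_
  have h5 : g s * D.α s = D'.α s * g s := by grind
  rw [h5, sub_self, smul_zero]

/-! ### Residues and gauge transformations -/

/-- If `u` is continuous at `0`, then `t u'(t)` can only tend to zero. -/
theorem eq_zero_of_tendsto_smul_deriv {E : Type*} [NormedAddCommGroup E] [NormedSpace ℝ E]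
    {u u' : ℝ → E} {ℓ a : E} (hu : Tendsto u (𝓝[>] 0) (𝓝 a))
    (hd : ∀ t ∈ 𝕀, HasDerivAt u (u' t) t)
    (hl : Tendsto (fun t => t • u' t) (𝓝[>] 0) (𝓝 ℓ)) : ℓ = 0 := by
  have key : ∀ ε > 0, log 2 * ‖ℓ‖ ≤ ε := by
    intro ε hε
    have h1 : ∀ᶠ t in 𝓝[>] (0 : ℝ), ‖t • u' t - ℓ‖ < ε := by
      exact (tendsto_iff_norm_sub_tendsto_zero.1 hl).eventually (gt_mem_nhds hε)
    obtain ⟨η, hη, hη1⟩ := mem_nhdsGT_iff_exists_Ioo_subset.1 h1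
    have hη0 : (0 : ℝ) < η := hη
    have h2 : ∀ᶠ t in 𝓝[>] (0 : ℝ), ‖u (2 * t) - u t - log 2 • ℓ‖ ≤ ε := by
      have hm : Ioo (0 : ℝ) (min η 1 / 2) ∈ 𝓝[>] (0 : ℝ) := Ioo_mem_nhdsGT (by positivity)
      filter_upwards [hm] with t ht
      have hm1 : min η 1 ≤ η := min_le_left _ _
      have hm2 : min η 1 ≤ 1 := min_le_right _ _
      have hseg : ∀ s ∈ Icc t (2 * t), HasDerivWithinAt (fun s => u s - log s • ℓ)
          (u' s - s⁻¹ • ℓ) (Icc t (2 * t)) s := by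
        intro s hs
        have hs0 : 0 < s := ht.1.trans_le hs.1
        exact ((hd s ⟨hs0, by linarith [hs.2, ht.2]⟩).sub
          ((Real.hasDerivAt_log hs0.ne').smul_const ℓ)).hasDerivWithinAt
      have hb : ∀ s ∈ Icc t (2 * t), ‖u' s - s⁻¹ • ℓ‖ ≤ ε / t := by
        intro s hs
        have hs0 : 0 < s := ht.1.trans_le hs.1
        have h3 : ‖s • u' s - ℓ‖ < ε := hη1 ⟨hs0, by linarith [hs.2, ht.2]⟩
        have e : u' s - s⁻¹ • ℓ = s⁻¹ • (s • u' s - ℓ) := by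
          rw [smul_sub, smul_smul, inv_mul_cancel₀ hs0.ne', one_smul]
        rw [e, norm_smul, norm_inv, norm_of_nonneg hs0.le, inv_mul_eq_div]
        exact div_le_div₀ hε.le h3.le ht.1 hs.1
      have h4 := (convex_Icc t (2 * t)).norm_image_sub_le_of_norm_hasDerivWithin_le hseg hb
        (left_mem_Icc.2 (by linarith [ht.1])) (right_mem_Icc.2 (by linarith [ht.1]))
      have e : u (2 * t) - log (2 * t) • ℓ - (u t - log t • ℓ) = u (2 * t) - u t - log 2 • ℓ := by
        rw [log_mul two_ne_zero ht.1.ne', add_smul]; abel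
      rw [e, show 2 * t - t = t by ring, norm_of_nonneg ht.1.le, div_mul_cancel₀ _ ht.1.ne'] at h4
      exact h4
    have h3 : Tendsto (fun t : ℝ => u (2 * t) - u t - log 2 • ℓ) (𝓝[>] 0)
        (𝓝 (a - a - log 2 • ℓ)) := by
      have hmul : Tendsto (fun t : ℝ => 2 * t) (𝓝[>] 0) (𝓝[>] 0) := by
        refine tendsto_nhdsWithin_iff.2 ⟨?_, ?_⟩
        · have : Continuous fun t : ℝ => 2 * t := by fun_prop
          exact (this.tendsto' 0 0 (by simp)).mono_left nhdsWithin_le_nhds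
        · filter_upwards [self_mem_nhdsWithin] with t ht
          have : (0 : ℝ) < t := ht
          change (0 : ℝ) < 2 * t
          linarith
      exact ((hu.comp hmul).sub hu).sub_const _
    have h4 := le_of_tendsto h3.norm h2
    rw [sub_self, zero_sub, norm_neg, norm_smul, norm_of_nonneg (Real.log_nonneg one_le_two)] at h4
    exact h4
  have h5 : log 2 * ‖ℓ‖ ≤ 0 := le_of_forall_pos_le_add fun ε hε => by simpa using key ε hε
  have h6 : 0 < log 2 := Real.log_pos one_lt_two
  have h7 : ‖ℓ‖ ≤ 0 := by nlinarith [norm_nonneg ℓ]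
  exact norm_le_zero_iff.1 h7

theorem tendsto_smul_comm_coe {r : Mat k} (h : HasResidueAtZero f r) :
    Tendsto (fun t : ℝ => t • f t) (𝓝[>] 0) (𝓝 r) := by
  exact h.congr fun t => coe_smul _ _

theorem tendsto_zero_of_continuousOn (hc : ContinuousOn g (Icc 0 1)) :
    Tendsto g (𝓝[>] 0) (𝓝 (g 0)) :=
  (hc 0 ⟨le_rfl, zero_le_one⟩).mono_left (nhdsWithin_le_of_mem (mem_of_superset
    (Ioo_mem_nhdsGT zero_lt_one) Ioo_subset_Icc_self))

theorem Intertwines.residues (hg : Intertwines g D D')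
    (hc : ContinuousOn g (Icc 0 1)) {a a' : Mat k} (ha : HasResidueAtZero D.α a)
    (ha' : HasResidueAtZero D'.α a') : g 0 * a = a' * g 0 := by
  have hg0 := tendsto_zero_of_continuousOn hc
  have h1 := eq_zero_of_tendsto_smul_deriv (ℓ := (2 : ℂ) • (g 0 * a - a' * g 0)) hg0 hg.deriv (by
    have h2 := ((hg0.mul (tendsto_smul_comm_coe ha)).sub
      ((tendsto_smul_comm_coe ha').mul hg0)).const_smul (2 : ℂ)
    refine h2.congr fun t => ?_
    rw [mul_smul_comm, smul_mul_assoc, ← smul_sub, smul_comm])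
  rw [smul_eq_zero] at h1
  exact sub_eq_zero.1 (h1.resolve_left (by norm_num))

theorem Intertwines.residues_field
    (hg : Intertwines g D D') (hc : ContinuousOn g (Icc 0 1)) {i : Fin 3} {b b' : Mat k}
    (hb : HasResidueAtZero (D.β i) b)
    (hb' : HasResidueAtZero (D'.β i) b') : g 0 * b = b' * g 0 := by
  have hg0 := tendsto_zero_of_continuousOn hc
  refine tendsto_nhds_unique (hg0.mul (tendsto_smul_comm_coe hb)) (((tendsto_smul_comm_coe hb').mul
    hg0).congr' ?_)
  filter_upwards [Ioo_mem_nhdsGT (zero_lt_one (α := ℝ))] with t ht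
  rw [mul_smul_comm, smul_mul_assoc, hg.field i t ht]

/-! ### The normal form of the residues -/

theorem principalA_sub (i j : Fin k) :
    ((-((k : ℝ) - 1) / 4 + (i : ℝ) / 2 : ℝ) : ℂ) - ((-((k : ℝ) - 1) / 4 + (j : ℝ) / 2 : ℝ) : ℂ) =
      ((i : ℂ) - (j : ℂ)) / 2 := by
  push_cast; ring

theorem fin_coe_sub_ne_zero {i j : Fin k} (h : i ≠ j) : ((i : ℕ) : ℂ) - ((j : ℕ) : ℂ) ≠ 0 := by
  rw [sub_ne_zero]
  intro h1
  exact h (Fin.ext (by exact_mod_cast h1))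

/-- A matrix commuting with `a₀` is diagonal. -/
theorem apply_eq_zero_of_commute {m : Mat k} (h : a₀ k * m = m * a₀ k)
    {i j : Fin k} (hij : i ≠ j) : m i j = 0 := by
  have h1 := congrFun (congrFun h i) j
  rw [principalA, diagonal_mul, mul_diagonal] at h1
  have h2 : ((i : ℂ) - (j : ℂ)) / 2 * m i j = 0 := by rw [← principalA_sub, sub_mul, h1]; ring
  exact (mul_eq_zero.1 h2).resolve_left (div_ne_zero (fin_coe_sub_ne_zero hij) two_ne_zero)

/-- A matrix `m` with `[a₀, m] = m / 2` is supported on the subdiagonal. -/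
theorem apply_eq_zero_of_lie {m : Mat k} (h : a₀ k * m - m * a₀ k = (1 / 2 : ℂ) • m)
    {i j : Fin k} (hij : (i : ℕ) ≠ j + 1) : m i j = 0 := by
  have h1 := congrFun (congrFun h i) j
  rw [Matrix.sub_apply, principalA, diagonal_mul, mul_diagonal, Matrix.smul_apply,
    smul_eq_mul] at h1
  have h2 : ((i : ℂ) - (j : ℂ) - 1) / 2 * m i j = 0 := by
    have := principalA_sub i j
    linear_combination h1 - this * m i j
  refine (mul_eq_zero.1 h2).resolve_left (div_ne_zero ?_ two_ne_zero)
  rw [sub_sub, sub_ne_zero]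
  exact_mod_cast hij

theorem principalB_apply_pos {i j : Fin k} (h : (i : ℕ) = j + 1) : ∃ γ : ℝ, 0 < γ ∧
    b₀ k i j = γ ∧ γ = sqrt ((i : ℝ) * ((k : ℝ) - (i : ℝ))) / 2 := by
  refine ⟨_, ?_, by rw [principalB, of_apply, if_pos h], rfl⟩
  have h1 : (0 : ℝ) < (i : ℝ) := by rw [h]; positivity
  have h2 : (0 : ℝ) < (k : ℝ) - (i : ℝ) := sub_pos.2 (by exact_mod_cast i.2)
  positivity

theorem principalB_apply_of_ne {i j : Fin k} (h : (i : ℕ) ≠ j + 1) : b₀ k i j = 0 := by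
  simp [principalB, h]

theorem lowest_apply_eq_zero {x : Fin k → ℂ} (h : IsUnitLowestVector (a₀ k) x)
    {j : Fin k} (hj : (j : ℕ) ≠ 0) : x j = 0 := by
  have h1 := congrFun h.2 j
  rw [principalA, mulVec_diagonal, Pi.smul_apply, smul_eq_mul] at h1
  aesop

theorem norm_lowest {x : Fin k → ℂ} (h : IsUnitLowestVector (a₀ k) x)
    {j : Fin k} (hj : (j : ℕ) = 0) : ‖x j‖ = 1 := by
  have h1 := h.1
  rw [sum_eq_single j] at h1
  · nlinarith [norm_nonneg (x j)]
  · intro i _ hi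
    rw [lowest_apply_eq_zero h (fun h0 => hi (Fin.ext (by omega)))]
    simp
  · simp

/-- A linear map between two normal forms of the residues that respects the framing is
unitary: it is diagonal, and its entries all have the same absolute value as the first one. -/
theorem unitary_of_normal_form {m : Mat k} (hm : a₀ k * m = m * a₀ k)
    {s s' : Fin 3 → ℂ} (hs : ∑ i, ‖s i‖ ^ 2 = 1) (hs' : ∑ i, ‖s' i‖ ^ 2 = 1)
    (hb : ∀ i, m * (s i • b₀ k) = (s' i • b₀ k) * m)
    {x : Fin k → ℂ} (hx : IsUnitLowestVector (a₀ k) x)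
    (hmx : IsUnitLowestVector (a₀ k) (m *ᵥ x)) :
    m ∈ 𝐔 k := by
  have hdiag : m = Matrix.diagonal (fun j => m j j) := by
    ext i j
    by_cases h : i = j
    · subst h; simp
    · rw [apply_eq_zero_of_commute hm h, diagonal_apply_ne _ h]
  have hone : ∀ n : ℕ, ∀ hn : n < k, ‖m ⟨n, hn⟩ ⟨n, hn⟩‖ = 1 := by
    intro n
    induction n with
    | zero =>
      intro hn
      have h2 := norm_lowest hmx (j := ⟨0, hn⟩) rfl
      rw [hdiag, mulVec_diagonal, norm_mul, (norm_lowest hx (j := ⟨0, hn⟩) rfl), mul_one] at h2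
      exact h2
    | succ n ih =>
      intro hn
      have hn' : n < k := by omega
      obtain ⟨γ, hγ, hγB, -⟩ := principalB_apply_pos (k := k) (i := ⟨n + 1, hn⟩) (j := ⟨n, hn'⟩) rfl
      have h1 : ∀ i, ‖m ⟨n + 1, hn⟩ ⟨n + 1, hn⟩‖ ^ 2 * ‖s i‖ ^ 2 = ‖s' i‖ ^ 2 := by
        intro i
        have h2 := congrFun (congrFun (hb i) ⟨n + 1, hn⟩) ⟨n, hn'⟩
        rw [hdiag, diagonal_mul, mul_diagonal, Matrix.smul_apply, Matrix.smul_apply,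
          hγB, smul_eq_mul, smul_eq_mul] at h2
        have h3 := congrArg norm h2
        simp only [norm_mul, norm_real, norm_of_nonneg hγ.le, ih hn', mul_one] at h3
        have h4 : ‖m ⟨n + 1, hn⟩ ⟨n + 1, hn⟩‖ * ‖s i‖ = ‖s' i‖ :=
          mul_right_cancel₀ hγ.ne' (by rw [← h3]; ring)
        rw [← h4]; ring
      have h2 : ‖m ⟨n + 1, hn⟩ ⟨n + 1, hn⟩‖ ^ 2 = 1 := by
        rw [← hs', ← sum_congr rfl fun i _ => h1 i, ← mul_sum, hs, mul_one]
      nlinarith [norm_nonneg (m ⟨n + 1, hn⟩ ⟨n + 1, hn⟩)]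
  rw [mem_unitaryGroup_iff, hdiag, star_eq_conjTranspose,
    Matrix.diagonal_conjTranspose, Matrix.diagonal_mul_diagonal, ← Matrix.diagonal_one]
  congr 1
  funext j
  rw [Pi.star_apply, star_def, mul_conj, normSq_eq_norm_sq, hone j.1 j.2]
  simp

/-- The matrix of the cyclic basis `v, b v, b² v, …`. -/
def cyclicMatrix (b : Mat k) (v : Fin k → ℂ) : Mat k := Matrix.of fun i j => ((b ^ (j : ℕ)) *ᵥ v) i

theorem isUnit_cyclicMatrix {b : Mat k}
    (h : span ℂ (range fun j : Fin k => (b ^ (j : ℕ)) *ᵥ v) = ⊤) :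
    IsUnit (cyclicMatrix b v) := by
  rw [← Matrix.mulVec_surjective_iff_isUnit]
  have h1 : LinearMap.range (cyclicMatrix b v).mulVecLin = ⊤ := by
    rw [Matrix.range_mulVecLin, ← h]
    rfl
  exact range_eq_top.1 h1

theorem cyclicMatrix_mul_apply {b : Mat k} (A : Mat k) (i j : Fin k) :
    (A * cyclicMatrix b v) i j = ((A * b ^ (j : ℕ)) *ᵥ v) i := by
  rw [← mulVec_mulVec]
  rfl

theorem mul_pow_of_lie {a b : Mat k} (h : a * b - b * a = (1 / 2 : ℂ) • b) (j : ℕ) :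
    a * b ^ j = b ^ j * a + ((j : ℂ) / 2) • b ^ j := by
  induction j with
  | zero => simp
  | succ j ih =>
    have h' : a * b = b * a + (1 / 2 : ℂ) • b := by rw [← h]; abel
    rw [pow_succ, ← mul_assoc, ih, add_mul, mul_assoc _ a, h', mul_add, mul_smul_comm,
      smul_mul_assoc, ← mul_assoc]
    push_cast
    module

/-- The residues of a Nahm complex are conjugate to `a₀, s₁ b₀, s₂ b₀, s₃ b₀`. -/
theorem exists_normal_form (hk : 0 < k) {a : Mat k} {b : Fin 3 → Mat k}
    (hcomm : ∀ i j, b i * b j = b j * b i)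
    (hab : ∀ i, a * b i - b i * a = (1 / 2 : ℂ) • b i) (hv : IsUnitLowestVector a v)
    (hspan : ∀ i, span ℂ (range fun j : Fin k => (b i ^ (j : ℕ)) *ᵥ v) = ⊤) :
    ∃ (s : Fin 3 → ℂ) (M : Mat k), IsUnit M ∧ (∀ i, s i ≠ 0) ∧ ∑ i, ‖s i‖ ^ 2 = 1 ∧
      M * a = a₀ k * M ∧ (∀ i, M * b i = (s i • b₀ k) * M) ∧
      IsUnitLowestVector (a₀ k) (M *ᵥ v) := by
  set E := cyclicMatrix (b 0) v with hE
  have hEu : IsUnit E := isUnit_cyclicMatrix (hspan 0)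
  have e1 := nonsing_inv_mul' hEu
  have e2 := mul_nonsing_inv' hEu
  have haE : a * E = E * a₀ k := by
    ext i j
    rw [hE, cyclicMatrix_mul_apply, mul_pow_of_lie (hab 0), Matrix.add_mulVec,
      ← mulVec_mulVec, hv.2, principalA, mul_diagonal, mulVec_smul,
      smul_mulVec]
    simp only [Pi.add_apply, Pi.smul_apply, smul_eq_mul, cyclicMatrix, of_apply]
    push_cast; ring
  have haE' : E⁻¹ * a = a₀ k * E⁻¹ := by
    calc E⁻¹ * a = E⁻¹ * (a * E) * E⁻¹ := by rw [mul_assoc, mul_assoc, e2, mul_one]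
      _ = _ := by rw [haE, ← mul_assoc, e1, one_mul]
  -- the matrices of the residues in the cyclic basis of the first one
  set c : Fin 3 → Mat k := fun i => E⁻¹ * b i * E with hc
  have hbc : ∀ i, E⁻¹ * b i = c i * E⁻¹ := fun i => by grind
  have hcsupp : ∀ i, ∀ p q : Fin k, (p : ℕ) ≠ q + 1 → c i p q = 0 := by
    intro i p q hpq
    refine apply_eq_zero_of_lie ?_ hpq
    have h1 : a₀ k = E⁻¹ * a * E := by rw [haE', mul_assoc, e1, mul_one]
    rw [h1]
    exact (lie_conj e2 a (b i)).trans (by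
      rw [Ring.lie_def, hab, mul_smul_comm, smul_mul_assoc])
  have hc0 : ∀ p q : Fin k, (p : ℕ) = q + 1 → c 0 p q = 1 := by
    intro p q hpq
    have h1 : ∀ r, (b 0 * E) r q = E r p := by
      intro r
      rw [hE, cyclicMatrix_mul_apply, ← pow_succ']
      simp only [cyclicMatrix, of_apply, hpq]
    have h2 : c 0 p q = (E⁻¹ * E) p p := by
      rw [hc]; beta_reduce
      rw [mul_assoc, Matrix.mul_apply, Matrix.mul_apply]
      exact sum_congr rfl fun r _ => by rw [h1]
    rw [h2, e1, Matrix.one_apply_eq]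
  have hccomm : ∀ i j, c i * c j = c j * c i := by grind
  have hshift : ∀ i, ∃ d : ℂ, d ≠ 0 ∧ ∀ p q : Fin k, (p : ℕ) = q + 1 → c i p q = d := by
    intro i
    by_cases hk1 : k = 1
    · exact ⟨1, one_ne_zero, fun p q hpq => by omega⟩
    have hk2 : 1 < k := by omega
    -- the entries of `cᵢ` on the subdiagonal agree, as `cᵢ` commutes with the shift `c₀`
    have hconst : ∀ n (hn : n + 1 < k), c i ⟨n + 1, hn⟩ ⟨n, by omega⟩ = c i ⟨1, hk2⟩ ⟨0, hk⟩ := by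
      intro n
      induction n with
      | zero => intro hn; rfl
      | succ n ih =>
        intro hn
        rw [← ih (by omega)]
        have h1 := congrFun (congrFun (hccomm i 0) ⟨n + 2, hn⟩) ⟨n, by omega⟩
        rw [Matrix.mul_apply, Matrix.mul_apply, sum_eq_single ⟨n + 1, by omega⟩,
          sum_eq_single ⟨n + 1, by omega⟩, hc0 _ _ rfl, hc0 _ _ rfl, mul_one, one_mul] at h1
        · exact h1
        · grind
        · simp
        · grind
        · simp
    refine ⟨c i ⟨1, hk2⟩ ⟨0, hk⟩, ?_, fun p q hpq => ?_⟩
    · intro h0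
      have hci : c i = 0 := by
        ext p q
        by_cases hpq : (p : ℕ) = q + 1
        · obtain ⟨p, hp⟩ := p
          obtain ⟨q, hq⟩ := q
          simp only at hpq
          subst hpq
          rw [hconst q hp, h0]; rfl
        · rw [hcsupp i p q hpq]; rfl
      have hbi : b i = 0 := by
        rw [← one_mul (b i), ← e2, mul_assoc, hbc, hci, zero_mul, mul_zero]
      have h3 := nonsing_inv_mul' (isUnit_cyclicMatrix (hspan i))
      have h5 := congrFun (congrFun h3 ⟨1, hk2⟩) ⟨1, hk2⟩
      rw [Matrix.one_apply_eq, Matrix.mul_apply] at h5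
      have h6 : ∀ r, cyclicMatrix (b i) v r ⟨1, hk2⟩ = 0 := by
        intro r
        simp [cyclicMatrix, hbi]
      simp [h6] at h5
    · obtain ⟨p, hp⟩ := p
      obtain ⟨q, hq⟩ := q
      grind
  choose d hd0 hd using hshift
  -- normalize the lengths and rescale the basis so that the shift becomes `b₀`
  set n := sqrt (∑ i, ‖d i‖ ^ 2) with hn
  have hsum : 0 < ∑ i, ‖d i‖ ^ 2 :=
    Finset.sum_pos (fun i _ => by have := norm_pos_iff.2 (hd0 i); positivity) Finset.univ_nonempty
  have hn0 : 0 < n := Real.sqrt_pos.2 hsum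
  have hn0' : (n : ℂ) ≠ 0 := by exact_mod_cast hn0.ne'
  set δ : ℕ → ℂ := fun j => ∏ q ∈ Finset.range j,
    ((sqrt (((q + 1 : ℕ) : ℝ) * ((k : ℝ) - ((q + 1 : ℕ) : ℝ))) / 2 : ℝ) : ℂ) / n with hδ
  have hδ0 : ∀ j, j < k → δ j ≠ 0 := by
    intro j hj
    refine prod_ne_zero_iff.2 fun q hq => div_ne_zero ?_ hn0'
    have hq' : q + 1 < k := by have := Finset.mem_range.1 hq; omega
    have h2 : (0 : ℝ) < (k : ℝ) - ((q + 1 : ℕ) : ℝ) := sub_pos.2 (by exact_mod_cast hq')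
    positivity
  set Δ : Mat k := Matrix.diagonal fun j => δ j with hΔ
  have hΔu : IsUnit Δ := by
    rw [isUnit_iff_isUnit_det, hΔ, Matrix.det_diagonal, isUnit_iff_ne_zero]
    exact prod_ne_zero_iff.2 fun j _ => hδ0 _ j.2
  have hΔa : Δ * a₀ k = a₀ k * Δ := by
    rw [hΔ, principalA, Matrix.diagonal_mul_diagonal, Matrix.diagonal_mul_diagonal]
    congr 1; funext j; ring
  have hΔc : ∀ i, Δ * c i = ((d i / n) • b₀ k) * Δ := by
    intro i
    ext p q
    rw [hΔ, diagonal_mul, mul_diagonal, Matrix.smul_apply, smul_eq_mul]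
    by_cases hpq : (p : ℕ) = q + 1
    · rw [hd i p q hpq]
      simp only [hδ, hpq, Finset.prod_range_succ, principalB, of_apply, if_true]
      ring
    · rw [hcsupp i p q hpq, principalB_apply_of_ne hpq]; simp
  have hEv : E⁻¹ *ᵥ v = Pi.single ⟨0, hk⟩ 1 := by
    have h1 : E *ᵥ Pi.single ⟨0, hk⟩ 1 = v := by
      rw [Matrix.mulVec_single_one]
      funext r
      simp [hE, cyclicMatrix]
    rw [← h1, mulVec_mulVec, e1, one_mulVec]
  have hMv : (Δ * E⁻¹) *ᵥ v = Pi.single ⟨0, hk⟩ 1 := by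
    rw [← mulVec_mulVec, hEv, hΔ]
    simp [*]
  have hMa : Δ * E⁻¹ * a = a₀ k * (Δ * E⁻¹) := by rw [mul_assoc, haE', ← mul_assoc, hΔa, mul_assoc]
  refine ⟨fun i => d i / n, Δ * E⁻¹, hΔu.mul (isUnit_nonsing_inv hEu),
    fun i => div_ne_zero (hd0 i) hn0', ?_, hMa, fun i => ?_, ?_, ?_⟩
  · have : ∀ i, ‖d i / (n : ℂ)‖ ^ 2 = ‖d i‖ ^ 2 / n ^ 2 := fun i => by
      rw [norm_div, norm_real, norm_of_nonneg hn0.le, div_pow]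
    simp only [this]
    rw [← Finset.sum_div, hn, sq_sqrt hsum.le, div_self hsum.ne']
  · grind
  · rw [hMv, sum_eq_single ⟨0, hk⟩]
    · simp
    · intro j _ hj; simp [Pi.single_eq_of_ne hj]
    · simp
  · rw [mulVec_mulVec, ← hMa, ← mulVec_mulVec, hv.2, mulVec_smul]

/-! ### Gauge equivalence of solutions -/

theorem inv_transpose_mem_unitaryGroup (hU : U ∈ 𝐔 k) : (Uᵀ)⁻¹ ∈ 𝐔 k := by
  refine inv_mem_unitaryGroup (mem_unitaryGroup_iff.2 ?_)
  have h := congrArg transpose (mem_unitaryGroup_iff'.1 hU)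
  rwa [transpose_mul, Matrix.transpose_one] at h

theorem sum_norm_sq_mulVec_of_unitary (hU : U ∈ 𝐔 k)
    (v : Fin k → ℂ) : ∑ i, ‖(U *ᵥ v) i‖ ^ 2 = ∑ i, ‖v i‖ ^ 2 := by
  have h : ∀ w : Fin k → ℂ, ((∑ i, ‖w i‖ ^ 2 : ℝ) : ℂ) = star w ⬝ᵥ w := fun w => by
    simp [dotProduct, Complex.conj_mul']
  have h2 : star (U *ᵥ v) ⬝ᵥ (U *ᵥ v) = star v ⬝ᵥ v := by
    rw [Matrix.star_mulVec, Matrix.dotProduct_mulVec, Matrix.vecMul_vecMul,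
      ← star_eq_conjTranspose, mem_unitaryGroup_iff'.1 hU, Matrix.vecMul_one]
  rw [← h, ← h] at h2
  exact_mod_cast h2

theorem isUnitLowestVector_mulVec {a a' : Mat k} (hU : U ∈ 𝐔 k)
    (h : U * a = a' * U) (hv : IsUnitLowestVector a v) :
    IsUnitLowestVector a' (U *ᵥ v) := by
  refine ⟨by rw [sum_norm_sq_mulVec_of_unitary hU]; exact hv.1, ?_⟩
  rw [mulVec_mulVec, ← h, ← mulVec_mulVec, hv.2, mulVec_smul]

theorem IsComplexGauge.intertwines (hg : IsComplexGauge g)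
    (h1 : ∀ t ∈ 𝕀, D'.α t = gaugeConnection (1 / 2) g D.α t)
    (h2 : ∀ i, ∀ t ∈ 𝕀, D'.β i t = gaugeField g (D.β i) t) : Intertwines g D D' :=
  Intertwines.of_gauge (fun t ht => hg.isUnit t (Ioo_subset_Icc_self ht))
    (fun _ => hg.differentiableAt) h1 h2

theorem IsComplexGauge.tendsto_zero (hg : IsComplexGauge g) :
    Tendsto g (𝓝[>] 0) (𝓝 (g 0)) :=
  tendsto_zero_of_continuousOn hg.continuousOn

/-- Residues of a field after undoing a gauge transformation. -/
theorem Intertwines.hasResidueAtZero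
    (hg : Intertwines g D D') {g₀ : Mat k} (hc : Tendsto g (𝓝[>] 0) (𝓝 g₀)) (hu : IsUnit g₀)
    {i : Fin 3} {b : Mat k} (hb : HasResidueAtZero (D.β i) b) :
    HasResidueAtZero (D'.β i) (g₀ * b * g₀⁻¹) := by
  refine ((hc.mul hb).mul (tendsto_inv hu hc)).congr' ?_
  filter_upwards [Ioo_mem_nhdsGT (zero_lt_one (α := ℝ))] with t ht
  rw [hg.field_eq i ht, mul_smul_comm, smul_mul_assoc]

section PoleSolution

variable {S : RealData k}

theorem IsPoleSolution.smooth_α (hS : IsPoleSolution S) : ContDiffOn ℝ ∞ S.toComplexData.α 𝕀 :=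
  ContDiffOn.const_smul (1 / 2 : ℂ) ((hS.smooth 0).add (ContDiffOn.const_smul I (hS.smooth 1)))

theorem IsPoleSolution.smooth_β (hS : IsPoleSolution S) (i : Fin 3) :
    ContDiffOn ℝ ∞ (S.toComplexData.β i) 𝕀 := by
  fin_cases i
  · exact ContDiffOn.const_smul (1 / 2 : ℂ)
      ((hS.smooth 2).add (ContDiffOn.const_smul I (hS.smooth 3)))
  · exact ContDiffOn.const_smul (1 / 2 : ℂ)
      ((hS.smooth 4).add (ContDiffOn.const_smul I (hS.smooth 5)))
  · exact ContDiffOn.const_smul (1 / 2 : ℂ)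
      ((hS.smooth 6).add (ContDiffOn.const_smul I (hS.smooth 7)))

theorem differentiableAt_of_smooth (h : ContDiffOn ℝ ∞ f 𝕀) :
    ∀ t ∈ 𝕀, DifferentiableAt ℝ f t := fun _ ht =>
  (h.contDiffAt (Ioo_mem_nhds ht.1 ht.2)).differentiableAt (by simp)

theorem IsPoleSolution.exists_flat (hS : IsPoleSolution S) :
    ∃ (Ψ : ℝ → Mat k) (B : Fin 3 → Mat k), Intertwines Ψ S.toComplexData (flat B) ∧
      ∀ i j, ⁅B i, B j⁆ = 0 :=
  Intertwines.exists_flat hS.smooth_α.continuousOn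
    (fun i => differentiableAt_of_smooth (hS.smooth_β i)) hS.complexEquations

/-- The residues of a framed solution at `0` are unitarily equivalent to the normal form. -/
theorem IsPoleSolution.exists_residues (hS : IsPoleSolution S) :
    ∃ (s : Fin 3 → ℂ) (U a : Mat k) (b : Fin 3 → Mat k), U ∈ 𝐔 k ∧
      (∀ i, s i ≠ 0) ∧ ∑ i, ‖s i‖ ^ 2 = 1 ∧
      HasResidueAtZero S.toComplexData.α a ∧ (∀ i, HasResidueAtZero (S.toComplexData.β i) (b i)) ∧
      U * a = a₀ k * U ∧ (∀ i, U * b i = (s i • b₀ k) * U) ∧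
      IsUnitLowestVector a S.v := by
  obtain ⟨s, g, hs0, hs1, hg, ha, hb⟩ := hS.residues
  obtain ⟨a, haα, hv⟩ := hS.framing
  set D' : ComplexData k := ⟨gaugeConnection (1 / 2) g S.toComplexData.α,
    fun i => gaugeField g (S.toComplexData.β i), 0⟩ with hD'
  have hI : Intertwines g S.toComplexData D' :=
    hg.toIsComplexGauge.intertwines (fun _ _ => rfl) fun _ _ _ => rfl
  have hU := hg.unitary 0 ⟨le_rfl, zero_le_one⟩
  have hu := isUnit_of_unitary hU
  have hgi : Tendsto (fun t => (g t)⁻¹) (𝓝[>] 0) (𝓝 (g 0)⁻¹) := hg.toIsComplexGauge.inv.tendsto_zero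
  refine ⟨s, g 0, a, _, hU, hs0, hs1, haα,
    fun i => hI.inv.hasResidueAtZero hgi (isUnit_nonsing_inv hu) (hb i),
    hI.residues hg.continuousOn haα ha, fun i => ?_, hv⟩
  grind [inv_inv' hu, mul_nonsing_inv' hu]

/-- A pair of skew-Hermitian fields is recovered from its complex combination. -/
theorem IsPoleSolution.X_field (hS : IsPoleSolution S) {j j' : Fin 8}
    (hj : f = fun t => (1 / 2 : ℂ) • (S.X j t + I • S.X j' t)) (ht : t ∈ 𝕀) :
    S.X j t = f t - (f t)ᴴ ∧ S.X j' t = -I • (f t + (f t)ᴴ) := by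
  simp only [hj, conjTranspose_smul, conjTranspose_add, hS.skew _ t ht, star_def, map_div₀,
    map_one, map_ofNat, conj_I]
  constructor
  · module
  · simp only [smul_add, smul_smul, smul_neg, neg_smul]
    ring_nf
    rw [I_sq]
    module

end PoleSolution

theorem gaugeField_conjTranspose {B : ℝ → Mat k} (hU : g t ∈ 𝐔 k) :
    (gaugeField g B t)ᴴ = gaugeField g (fun t => (B t)ᴴ) t := by
  rw [gaugeField, gaugeField, conjTranspose_of_unitary hU, conjTranspose_mul,
    conjTranspose_mul, conjTranspose_conjTranspose, mul_assoc]

/-- A complex gauge transformation between framed solutions with unitary values is a real one. -/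
theorem RealData.GaugeEquiv.of_unitary {S S' : RealData k} (hS : IsPoleSolution S)
    (hS' : IsPoleSolution S') (hg : IsUnitaryGauge g)
    (h1 : ∀ t ∈ 𝕀, S'.toComplexData.α t = gaugeConnection (1 / 2) g S.toComplexData.α t)
    (h2 : ∀ i, ∀ t ∈ 𝕀, S'.toComplexData.β i t = gaugeField g (S.toComplexData.β i) t)
    (hv : g 0 *ᵥ S.v = S'.v) : S.GaugeEquiv S' := by
  have hU : ∀ t ∈ 𝕀, g t ∈ 𝐔 k := fun t ht => hg.unitary t (Ioo_subset_Icc_self ht)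
  have hfield : ∀ (i : Fin 3) (j j' : Fin 8),
      (S.toComplexData.β i = fun t => (1 / 2 : ℂ) • (S.X j t + I • S.X j' t)) →
      (S'.toComplexData.β i = fun t => (1 / 2 : ℂ) • (S'.X j t + I • S'.X j' t)) →
      ∀ t ∈ 𝕀, S'.X j t = gaugeField g (S.X j) t ∧ S'.X j' t = gaugeField g (S.X j') t := by
    intro i j j' hj hj' t ht
    rw [(hS'.X_field hj' ht).1, (hS'.X_field hj' ht).2, h2 i t ht,
      gaugeField_conjTranspose (hU t ht)]
    simp only [gaugeField, hS.X_field hj ht]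
    constructor <;> noncomm_ring
  -- the term `g' g⁻¹` is skew-Hermitian
  have hskew : ∀ t ∈ 𝕀, (deriv g t * (g t)⁻¹)ᴴ = -(deriv g t * (g t)⁻¹) := by
    intro t ht
    have hd := (hg.toIsComplexGauge.differentiableAt ht).hasDerivAt
    have e2 : HasDerivAt (fun r => g r * (g r)ᴴ) 0 t :=
      (hasDerivAt_const t (1 : Mat k)).congr_of_eventuallyEq (by
        filter_upwards [Ioo_mem_nhds ht.1 ht.2] with r hr using mem_unitaryGroup_iff.1 (hU r hr))
    rw [conjTranspose_of_unitary (hU t ht), conjTranspose_mul, conjTranspose_conjTranspose]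
    exact eq_neg_of_add_eq_zero_right ((hd.mul (hasDerivAt_conjTranspose hd)).unique e2)
  have hα : ∀ t ∈ 𝕀, (S'.toComplexData.α t)ᴴ =
      gaugeField g (fun t => (S.toComplexData.α t)ᴴ) t + (1 / 2 : ℂ) • (deriv g t * (g t)⁻¹) := by
    intro t ht
    rw [h1 t ht, gaugeConnection, conjTranspose_sub, conjTranspose_smul,
      hskew t ht, ← gaugeField_conjTranspose (hU t ht), gaugeField]
    simp
  refine ⟨g, hg, fun t ht => ?_, fun i hi t ht => ?_, hv⟩
  · rw [(hS'.X_field (f := S'.toComplexData.α) rfl ht).1, hα t ht, h1 t ht, gaugeConnection,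
        gaugeConnection, (hS.X_field (f := S.toComplexData.α) rfl ht).1,
      gaugeField, mul_sub, sub_mul]
    module
  · fin_cases i
    · exact absurd rfl hi
    · change S'.X 1 t = gaugeField g (S.X 1) t
      rw [(hS'.X_field (f := S'.toComplexData.α) rfl ht).2, hα t ht, h1 t ht]
      simp only [gaugeConnection, gaugeField, (hS.X_field (f := S.toComplexData.α) rfl ht).2]
      noncomm_ring
    · exact (hfield 0 2 3 rfl rfl t ht).1
    · exact (hfield 0 2 3 rfl rfl t ht).2
    · exact (hfield 1 4 5 rfl rfl t ht).1
    · exact (hfield 1 4 5 rfl rfl t ht).2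
    · exact (hfield 2 6 7 rfl rfl t ht).1
    · exact (hfield 2 6 7 rfl rfl t ht).2

/-- A real gauge transformation is also a complex one. -/
theorem RealData.GaugeEquiv.toComplexData {S S' : RealData k} (h : S.GaugeEquiv S') :
    S.toComplexData.GaugeEquiv S'.toComplexData := by
  obtain ⟨g, hg, h0, h1, hv⟩ := h
  have key : ∀ j j' : Fin 8, j ≠ 0 → j' ≠ 0 → ∀ t ∈ 𝕀, (1 / 2 : ℂ) • (S'.X j t + I • S'.X j' t) =
      gaugeField g (fun t => (1 / 2 : ℂ) • (S.X j t + I • S.X j' t)) t := by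
    intro j j' hj hj' t ht
    rw [h1 j hj t ht, h1 j' hj' t ht]
    simp only [gaugeField, mul_smul_comm, smul_mul_assoc, mul_add, add_mul]
  refine ⟨g, hg.toIsComplexGauge, fun t ht => ?_, fun i t ht => ?_, hv⟩
  · change (1 / 2 : ℂ) • (S'.X 0 t + I • S'.X 1 t) =
      gaugeConnection (1 / 2) g (fun t => (1 / 2 : ℂ) • (S.X 0 t + I • S.X 1 t)) t
    rw [h0 t ht, h1 1 (by decide) t ht]
    simp only [gaugeConnection, gaugeField, mul_smul_comm, smul_mul_assoc, mul_add, add_mul]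
    module
  · fin_cases i
    · exact key 2 3 (by decide) (by decide) t ht
    · exact key 4 5 (by decide) (by decide) t ht
    · exact key 6 7 (by decide) (by decide) t ht

/-- Framed solutions that are related by a complex gauge transformation are related by a
real one. -/
theorem gaugeEquiv_of_complex (hk : 0 < k) {S S' : RealData k} (hS : IsPoleSolution S)
    (hS' : IsPoleSolution S') (h : S.toComplexData.GaugeEquiv S'.toComplexData) :
    S.GaugeEquiv S' := by
  obtain ⟨g, hg, h1, h2, hv⟩ := h
  have hI := hg.intertwines h1 h2
  obtain ⟨s, U, a, b, hU, -, hs1, ha, hb, hUa, hUb, hl⟩ := hS.exists_residues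
  obtain ⟨s', U', a', b', hU', -, hs1', ha', hb', hUa', hUb', hl'⟩ := hS'.exists_residues
  have u1 := nonsing_inv_mul' (isUnit_of_unitary hU)
  have u3 := nonsing_inv_mul' (isUnit_of_unitary hU')
  have v1 : (U' * g 0 * U⁻¹) *ᵥ (U *ᵥ S.v) = U' *ᵥ S'.v := by
    rw [mulVec_mulVec, mul_assoc, u1, mul_one, ← mulVec_mulVec, show g 0 *ᵥ S.v = S'.v from hv]
  have key {X X' Y Y' : Mat k} (e1 : U * X = Y * U) (e2 : g 0 * X = X' * g 0)
      (e3 : U' * X' = Y' * U') : U' * g 0 * U⁻¹ * Y = Y' * (U' * g 0 * U⁻¹) := by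
    rw [show Y = U * X * U⁻¹ by rw [e1, mul_assoc, (mul_nonsing_inv' (isUnit_of_unitary hU)),
      mul_one], ← mul_assoc Y', ← mul_assoc Y',
      ← e3, mul_assoc U' X', ← e2]
    grind
  have hm : U' * g 0 * U⁻¹ ∈ 𝐔 k := by
    refine unitary_of_normal_form ?_ hs1 hs1' (fun i => ?_) (isUnitLowestVector_mulVec hU hUa hl)
      (by rw [v1]; exact isUnitLowestVector_mulVec hU' hUa' hl')
    · exact (key hUa (hI.residues hg.continuousOn ha ha') hUa').symm
    · exact key (hUb i) ((fun i => hI.residues_field hg.continuousOn (hb i) (hb' i)) i) (hUb' i)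
  have hg0 : g 0 ∈ 𝐔 k := by
    rw [show g 0 = U'⁻¹ * (U' * g 0 * U⁻¹) * U by grind]
    exact mul_mem (mul_mem (inv_mem_unitaryGroup hU') hm) hU
  have hg1 : g 1 ∈ 𝐔 k := by
    have := hg.reflection 0 ⟨le_rfl, zero_le_one⟩
    rw [sub_zero] at this
    exact this ▸ inv_transpose_mem_unitaryGroup hg0
  obtain ⟨Ψ, B, hΨ, -⟩ := hS.exists_flat
  have hUn := hI.unitary hk hg.continuousOn hg.isUnit hΨ (differentiableAt_of_smooth hS.smooth_α)
    (differentiableAt_of_smooth hS'.smooth_α) hS.realEquation hS'.realEquation hg0 hg1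
  exact RealData.GaugeEquiv.of_unitary hS hS' ⟨hg, hUn⟩ h1 h2 hv

/-! ### Asymptotics of solutions at a regular singular point -/

section Asymptotics

open Asymptotics

variable {E : Type*} [NormedAddCommGroup E]

theorem eventually_nhdsGT_iff {p : ℝ → Prop} :
    (∀ᶠ t in 𝓝[>] (0 : ℝ), p t) ↔ ∃ δ > 0, ∀ t ∈ Ioo (0 : ℝ) δ, p t := by
  rw [Filter.Eventually, mem_nhdsGT_iff_exists_Ioo_subset]
  rfl

theorem norm_rpow_of_pos (ht : 0 < t) (μ : ℝ) : ‖t ^ μ‖ = t ^ μ :=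
  norm_of_nonneg (rpow_nonneg ht.le μ)

/-- Unpacks a `O(t ^ μ)` estimate at `0⁺` together with finitely many other local conditions. -/
theorem exists_bound_of_isBigO {u : ℝ → E} {μ : ℝ} {p : ℝ → Prop}
    (h : u =O⁺ μ) (hp : ∀ᶠ t in 𝓝[>] (0 : ℝ), p t) :
    ∃ C > 0, ∃ δ > 0, δ ≤ 1 ∧ ∀ t ∈ Ioo (0 : ℝ) δ, p t ∧ ‖u t‖ ≤ C * t ^ μ := by
  obtain ⟨C, hC, hb⟩ := h.exists_pos
  obtain ⟨δ, hδ, h1⟩ := eventually_nhdsGT_iff.1 (hp.and hb.bound)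
  refine ⟨C, hC, min δ 1, by positivity, min_le_right _ _, fun t ht => ?_⟩
  have h2 := h1 t ⟨ht.1, ht.2.trans_le (min_le_left _ _)⟩
  refine ⟨h2.1, ?_⟩
  have h3 := h2.2
  rwa [norm_rpow_of_pos ht.1] at h3

theorem isBigO_of_bound {u : ℝ → E} {μ C δ : ℝ} (hδ : 0 < δ)
    (h : ∀ t ∈ Ioo (0 : ℝ) δ, ‖u t‖ ≤ C * t ^ μ) : u =O⁺ μ := by
  refine IsBigO.of_bound C ?_
  filter_upwards [Ioo_mem_nhdsGT hδ] with t ht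
  rw [norm_rpow_of_pos ht.1]
  exact h t ht

theorem rpow_isBigO_rpow {μ ν : ℝ} (h : ν ≤ μ) : (fun t : ℝ => t ^ μ) =O⁺ ν := by
  refine isBigO_of_bound (C := 1) (δ := 1) one_pos fun t ht => ?_
  rw [norm_rpow_of_pos ht.1, one_mul]
  exact Real.rpow_le_rpow_of_exponent_ge ht.1 ht.2.le h

theorem tendsto_zero_of_isBigO_rpow {u : ℝ → E} {μ : ℝ} (hμ : 0 < μ)
    (h : u =O⁺ μ) : Tendsto u (𝓝[>] 0) (𝓝 0) := by
  refine h.trans_tendsto ?_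
  simpa [hμ.ne'] using (Real.continuousAt_rpow_const 0 μ (Or.inr hμ.le)).tendsto.mono_left
    nhdsWithin_le_nhds

theorem tendsto_of_sub_isBigO_rpow {u : ℝ → E} {u₀ : E} {μ : ℝ} (hμ : 0 < μ)
    (h : (fun t => u t - u₀) =O⁺ μ) : Tendsto u (𝓝[>] 0) (𝓝 u₀) := by
  have := (tendsto_zero_of_isBigO_rpow hμ h).add_const u₀
  simpa using this

variable [NormedSpace ℝ E]

theorem norm_sub_le_rpow {u u' : ℝ → E} {s C μ : ℝ} (hμ : μ ≠ 0) (hs : 0 < s) (hst : s ≤ t)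
    (hd : ∀ r ∈ Icc s t, HasDerivAt u (u' r) r) (hb : ∀ r ∈ Icc s t, ‖u' r‖ ≤ C * r ^ (μ - 1)) :
    ‖u t - u s‖ ≤ C / μ * (t ^ μ - s ^ μ) := by
  have hB : ∀ r ∈ Icc s t, HasDerivAt (fun r => C / μ * (r ^ μ - s ^ μ)) (C * r ^ (μ - 1)) r := by
    intro r hr
    refine (((Real.hasDerivAt_rpow_const (p := μ) (Or.inl ((hs.trans_le hr.1).ne'))).sub_const (s ^
      μ)).const_mul
      (C / μ)).congr_deriv ?_
    field_simp
  exact image_norm_le_of_norm_deriv_right_le_deriv_boundary' (f := fun r => u r - u s)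
    (f' := u') (a := s) (b := t) (B := fun r => C / μ * (r ^ μ - s ^ μ))
    (B' := fun r => C * r ^ (μ - 1))
    (fun r hr => ((hd r hr).sub_const (u s)).continuousAt.continuousWithinAt)
    (fun r hr => ((hd r (Ico_subset_Icc_self hr)).sub_const (u s)).hasDerivWithinAt)
    (by simp)
    (fun r hr => (hB r hr).continuousAt.continuousWithinAt)
    (fun r hr => (hB r (Ico_subset_Icc_self hr)).hasDerivWithinAt)
    (fun r hr => hb r (Ico_subset_Icc_self hr)) (right_mem_Icc.2 hst)

/-- A function whose derivative is `O(t^(μ-1))` with `μ > 0` has a limit at `0⁺`, which it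
approaches at the rate `t^μ`. -/
theorem exists_limit_of_deriv_isBigO [CompleteSpace E] {u u' : ℝ → E} {μ : ℝ} (hμ : 0 < μ)
    (hd : ∀ᶠ t in 𝓝[>] (0 : ℝ), HasDerivAt u (u' t) t)
    (hO : u' =O⁺ (μ - 1)) :
    ∃ u₀ : E, (fun t => u t - u₀) =O⁺ μ := by
  obtain ⟨C, hC, δ, hδ, -, h⟩ := exists_bound_of_isBigO hO hd
  have key : ∀ s t : ℝ, 0 < s → s ≤ t → t < δ → ‖u t - u s‖ ≤ C / μ * t ^ μ := by
    intro s t hs hst ht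
    have h1 := norm_sub_le_rpow hμ.ne' hs hst
      (fun r hr => (h r ⟨hs.trans_le hr.1, hr.2.trans_lt ht⟩).1)
      (fun r hr => (h r ⟨hs.trans_le hr.1, hr.2.trans_lt ht⟩).2)
    refine h1.trans ?_
    gcongr
    linarith [rpow_nonneg hs.le μ]
  have hlim : ∃ u₀, Tendsto u (𝓝[>] 0) (𝓝 u₀) := by
    rw [← cauchy_map_iff_exists_tendsto, Metric.cauchy_iff]
    refine ⟨inferInstance, fun ε hε => ?_⟩
    have h0 : Tendsto (fun t : ℝ => C / μ * t ^ μ) (𝓝[>] 0) (𝓝 0) :=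
      tendsto_zero_of_isBigO_rpow (E := ℝ) hμ ((isBigO_refl _ _).const_mul_left _)
    obtain ⟨η, hη, h1⟩ := eventually_nhdsGT_iff.1 (h0.eventually (gt_mem_nhds hε))
    refine ⟨u '' Ioo 0 (min η δ), image_mem_map (Ioo_mem_nhdsGT (by positivity)), ?_⟩
    have hle : ∀ s t : ℝ, 0 < s → s ≤ t → t < min η δ → ‖u t - u s‖ < ε := fun s t hs hst ht =>
      (key s t hs hst (ht.trans_le (min_le_right _ _))).trans_lt
        (h1 t ⟨hs.trans_le hst, ht.trans_le (min_le_left _ _)⟩)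
    rintro _ ⟨s, hs, rfl⟩ _ ⟨t, ht, rfl⟩
    rw [dist_eq_norm]
    rcases le_total s t with hst | hst
    · rw [norm_sub_rev]; exact hle s t hs.1 hst ht.2
    · exact hle t s ht.1 hst hs.2
  obtain ⟨u₀, hu₀⟩ := hlim
  refine ⟨u₀, isBigO_of_bound (C := C / μ) hδ fun t ht => ?_⟩
  have h2 : Tendsto (fun s => ‖u t - u s‖) (𝓝[>] 0) (𝓝 ‖u t - u₀‖) :=
    (tendsto_const_nhds.sub hu₀).norm
  refine le_of_tendsto h2 ?_
  filter_upwards [Ioo_mem_nhdsGT ht.1] with s hs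
  exact key s t hs.1 hs.2.le ht.2

theorem isBigO_rpow_smul {f : ℝ → E} {μ ν : ℝ} (h : f =O⁺ μ) :
    (fun t => t ^ ν • f t) =O⁺ (ν + μ) := by
  refine ((isBigO_refl (fun t : ℝ => t ^ ν) _).smul h).congr' EventuallyEq.rfl ?_
  filter_upwards [self_mem_nhdsWithin] with t ht
  rw [smul_eq_mul, rpow_add ht]

theorem isBigO_of_rpow_smul {f : ℝ → E} {μ ν : ℝ} (h : (fun t => t ^ ν • f t) =O⁺ (ν + μ)) :
    f =O⁺ μ := by
  have h1 := isBigO_rpow_smul (ν := -ν) h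
  rw [neg_add_cancel_left] at h1
  refine h1.congr' ?_ EventuallyEq.rfl
  filter_upwards [self_mem_nhdsWithin] with t ht
  rw [smul_smul, ← rpow_add ht, neg_add_cancel, rpow_zero, one_smul]

/-- The substitution `v = t^(-ν) u` in the equation `t u' = ν u + f`. -/
theorem hasDerivAt_rpow_smul {u f : ℝ → E} {ν : ℝ} (ht : 0 < t)
    (h : HasDerivAt u (t⁻¹ • (ν • u t + f t)) t) :
    HasDerivAt (fun t => t ^ (-ν) • u t) (t ^ (-ν - 1) • f t) t := by
  refine ((Real.hasDerivAt_rpow_const (p := -ν) (Or.inl ht.ne')).smul h).congr_deriv ?_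
  rw [smul_smul, ← div_eq_mul_inv, ← Real.rpow_sub_one ht.ne']
  module

theorem rpow_smul_of_singular_ode {u f : ℝ → E} {ν μ : ℝ}
    (hd : ∀ᶠ t in 𝓝[>] (0 : ℝ), HasDerivAt u (t⁻¹ • (ν • u t + f t)) t) (hf : f =O⁺ μ) :
    (∀ᶠ t in 𝓝[>] (0 : ℝ), HasDerivAt (fun t => t ^ (-ν) • u t) (t ^ (-ν - 1) • f t) t) ∧
      (fun t => t ^ (-ν - 1) • f t) =O⁺ ((-ν + μ) - 1) := by
  refine ⟨?_, by simpa [sub_add_eq_add_sub] using isBigO_rpow_smul (ν := -ν - 1) hf⟩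
  filter_upwards [hd, self_mem_nhdsWithin] with t ht ht0
  exact hasDerivAt_rpow_smul ht0 ht

/-- Solutions of `t u' = ν u + O(t^μ)` that grow less than `t^ν`, for `ν < μ`. -/
theorem isBigO_of_singular_ode_of_lt [CompleteSpace E] {u f : ℝ → E} {ν μ κ : ℝ}
    (hd : ∀ᶠ t in 𝓝[>] (0 : ℝ), HasDerivAt u (t⁻¹ • (ν • u t + f t)) t)
    (hf : f =O⁺ μ) (hu : u =O⁺ κ)
    (hκ : ν < κ) (hμ : ν < μ) : u =O⁺ μ := by
  obtain ⟨h1, h2⟩ := rpow_smul_of_singular_ode hd hf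
  obtain ⟨u₀, hu₀⟩ := exists_limit_of_deriv_isBigO (by linarith) h1 h2
  have h4 : Tendsto (fun t => t ^ (-ν) • u t) (𝓝[>] 0) (𝓝 0) :=
    tendsto_zero_of_isBigO_rpow (μ := -ν + κ) (by linarith) (isBigO_rpow_smul hu)
  rw [tendsto_nhds_unique (tendsto_of_sub_isBigO_rpow (by linarith) hu₀) h4] at hu₀
  simp only [sub_zero] at hu₀
  exact isBigO_of_rpow_smul hu₀

/-- Solutions of `t u' = ν u + O(t^μ)` for `μ < ν`. -/
theorem isBigO_of_singular_ode_of_gt {u f : ℝ → E} {ν μ : ℝ}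
    (hd : ∀ᶠ t in 𝓝[>] (0 : ℝ), HasDerivAt u (t⁻¹ • (ν • u t + f t)) t)
    (hf : f =O⁺ μ) (hμ : μ < ν) :
    u =O⁺ μ := by
  obtain ⟨h1, h2⟩ := rpow_smul_of_singular_ode hd hf
  obtain ⟨C, hC, δ, hδ, -, h⟩ := exists_bound_of_isBigO h2 h1
  set e := -ν + μ with he
  have he0 : e < 0 := by linarith
  refine isBigO_of_rpow_smul (ν := -ν) (isBigO_of_bound (δ := δ / 2)
    (C := ‖(δ / 2) ^ (-ν) • u (δ / 2)‖ / (δ / 2) ^ e + C / -e) (by positivity) fun t ht => ?_)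
  have ht2 : t ≤ δ / 2 := ht.2.le
  have h3 := norm_sub_le_rpow he0.ne ht.1 ht2
    (fun r hr => (h r ⟨ht.1.trans_le hr.1, by linarith [hr.2]⟩).1)
    (fun r hr => (h r ⟨ht.1.trans_le hr.1, by linarith [hr.2]⟩).2)
  have h4 : C / e * ((δ / 2) ^ e - t ^ e) ≤ C / -e * t ^ e := by
    have : C / e * ((δ / 2) ^ e - t ^ e) = C / -e * t ^ e - C / -e * (δ / 2) ^ e := by
      rw [div_neg]; ring
    rw [this]
    have : 0 < C / -e * (δ / 2) ^ e := mul_pos (div_pos hC (neg_pos.2 he0)) (by positivity)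
    linarith
  have h6 : ‖(δ / 2) ^ (-ν) • u (δ / 2)‖ ≤ ‖(δ / 2) ^ (-ν) • u (δ / 2)‖ / (δ / 2) ^ e * t ^ e := by
    rw [div_mul_eq_mul_div, le_div_iff₀ (by positivity)]
    exact mul_le_mul_of_nonneg_left (Real.rpow_le_rpow_of_nonpos ht.1 ht2 he0.le) (norm_nonneg _)
  have h7 := norm_sub_norm_le (t ^ (-ν) • u t) ((δ / 2) ^ (-ν) • u (δ / 2))
  rw [norm_sub_rev] at h7
  beta_reduce at h3
  rw [add_mul]
  linarith

/-- Interpolation: a bound for a function and a Lipschitz bound for its derivative at scale `t`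
give a bound for the derivative. -/
theorem deriv_isBigO_of_interpolation {f f' : ℝ → E} {a B : ℝ} (ha : 0 < a) (hf : f =O⁺ a)
    (hd : ∀ᶠ t in 𝓝[>] (0 : ℝ), HasDerivAt f (f' t) t)
    (hL : ∀ᶠ t in 𝓝[>] (0 : ℝ), ∀ s ∈ Icc t (2 * t), ‖f' s - f' t‖ ≤ B / t ^ 2 * (s - t)) :
    f' =O⁺ (a / 2 - 1) := by
  obtain ⟨C, hC, δ, hδ, hδ1, h⟩ := exists_bound_of_isBigO hf (hd.and hL)
  refine isBigO_of_bound (C := C + C * 2 ^ a + |B|) (δ := δ / 2) (by positivity) fun t ht => ?_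
  have ht0 := ht.1
  -- the step that balances the two contributions
  set η := t ^ (1 + a / 2) with hη
  have hη0 : 0 < η := by positivity
  have hηt : η ≤ t := by
    have := Real.rpow_le_rpow_of_exponent_ge ht0 (by linarith [ht.2]) (show (1 : ℝ) ≤ 1 + a / 2 by
      linarith)
    rwa [rpow_one] at this
  have hseg : ∀ s ∈ Icc t (t + η), s ∈ Ioo 0 δ ∧ s ∈ Icc t (2 * t) := fun s hs =>
    ⟨⟨ht0.trans_le hs.1, by linarith [hs.2, ht.2]⟩, hs.1, by linarith [hs.2]⟩
  have h1 : ‖f (t + η) - (t + η) • f' t - (f t - t • f' t)‖ ≤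
      |B| / t ^ 2 * η * ‖(t + η) - t‖ := by
    refine (convex_Icc t (t + η)).norm_image_sub_le_of_norm_hasDerivWithin_le
      (f := fun s => f s - s • f' t) (f' := fun s => f' s - f' t) (fun s hs => ?_)
      (fun s hs => ?_) (left_mem_Icc.2 (by linarith)) (right_mem_Icc.2 (by linarith))
    · refine (((h s (hseg s hs).1).1.1).sub
          ((hasDerivAt_id s).smul_const (f' t))).hasDerivWithinAt.congr_deriv ?_
      rw [one_smul]
    · refine ((h t ⟨ht0, by linarith [ht.2]⟩).1.2 s (hseg s hs).2).trans ?_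
      refine mul_le_mul (div_le_div_of_nonneg_right (le_abs_self B) (by positivity))
        (by linarith [hs.2]) (by linarith [hs.1]) (by positivity)
  have e1 : f (t + η) - (t + η) • f' t - (f t - t • f' t) = f (t + η) - f t - η • f' t := by
    rw [add_smul]; abel
  rw [e1, add_sub_cancel_left, norm_of_nonneg hη0.le] at h1
  have hft := (h t ⟨ht0, by linarith [ht.2]⟩).2
  have hfη := (h (t + η) (hseg _ (right_mem_Icc.2 (by linarith))).1).2
  have hta : (t + η) ^ a ≤ 2 ^ a * t ^ a := by
    rw [← Real.mul_rpow (by norm_num) ht0.le]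
    exact Real.rpow_le_rpow (by positivity) (by linarith) ha.le
  have h2 : η * ‖f' t‖ ≤ C * (2 ^ a * t ^ a) + C * t ^ a + |B| / t ^ 2 * η * η := by
    have e2 : η * ‖f' t‖ = ‖η • f' t‖ := by rw [norm_smul, norm_of_nonneg hη0.le]
    have e3 : η • f' t = f (t + η) - f t - (f (t + η) - f t - η • f' t) := by abel
    rw [e2, e3]
    refine (norm_sub_le _ _).trans (add_le_add ((norm_sub_le _ _).trans
      (add_le_add (hfη.trans (mul_le_mul_of_nonneg_left hta hC.le)) hft)) h1)
  have p1 : η * t ^ (a / 2 - 1) = t ^ a := by rw [hη, ← rpow_add ht0]; congr 1; ring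
  have p2 : η / t ^ 2 = t ^ (a / 2 - 1) := by
    rw [hη, ← rpow_natCast, ← Real.rpow_sub ht0]; congr 1; push_cast; ring
  refine le_of_mul_le_mul_left ?_ hη0
  calc η * ‖f' t‖ ≤ _ := h2
    _ = η * ((C + C * 2 ^ a) * t ^ (a / 2 - 1)) + η * (|B| * (η / t ^ 2)) := by
        rw [show η * ((C + C * 2 ^ a) * t ^ (a / 2 - 1)) =
          (C + C * 2 ^ a) * (η * t ^ (a / 2 - 1)) by ring, p1]
        ring
    _ = _ := by rw [p2]; ring

end Asymptotics

/-! ### The algebra of the Nahm equations at a pole -/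

section Quadratic

variable {A : Type*} [Ring A] [Algebra ℂ A]

/-- The bilinear map with `T' = Q(T, T)` for the Nahm equations `α' = -[β, γ]`, `β' = -2 [α, β]`,
`γ' = 2 [α, γ]` on `T = (α, β, γ)`. -/
noncomputable def nahmQ (X Y : A × A × A) : A × A × A :=
  (-(X.2.1 * Y.2.2 - Y.2.2 * X.2.1), (-2 : ℂ) • (X.1 * Y.2.1 - Y.2.1 * X.1),
    (2 : ℂ) • (X.1 * Y.2.2 - Y.2.2 * X.1))

/-- The Lax matrix `β - ζ α - ζ² γ / 4` of `T = (α, β, γ)` with spectral parameter `ζ`. -/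
noncomputable def laxEv (ζ : ℂ) (T : A × A × A) : A := T.2.1 - ζ • T.1 - (ζ ^ 2 / 4) • T.2.2

/-- The other member `2 α + ζ γ` of the Lax pair. -/
noncomputable def laxM (ζ : ℂ) (T : A × A × A) : A := (2 : ℂ) • T.1 + ζ • T.2.2

theorem laxEv_nahmQ (ζ : ℂ) (X Y : A × A × A) : laxEv ζ (nahmQ X Y + nahmQ Y X) =
      (laxEv ζ X * laxM ζ Y - laxM ζ Y * laxEv ζ X)
      + (laxEv ζ Y * laxM ζ X - laxM ζ X * laxEv ζ Y) := by
  simp only [laxEv, laxM, nahmQ, Prod.fst_add, Prod.snd_add]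
  simp only [mul_add, add_mul, sub_mul, mul_sub, smul_add, smul_sub, smul_mul_assoc,
    mul_smul_comm, smul_smul, smul_neg]
  module

theorem laxEv_nahmQ_self (ζ : ℂ) (X : A × A × A) :
    laxEv ζ (nahmQ X X) = laxEv ζ X * laxM ζ X - laxM ζ X * laxEv ζ X := by
  simp only [laxEv, laxM, nahmQ]
  simp only [mul_add, add_mul, sub_mul, mul_sub, smul_add, smul_sub, smul_mul_assoc,
    mul_smul_comm, smul_smul, smul_neg]
  module

theorem laxEv_add (ζ : ℂ) (X Y : A × A × A) : laxEv ζ (X + Y) = laxEv ζ X + laxEv ζ Y := by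
  simp only [laxEv, Prod.fst_add, Prod.snd_add, smul_add]; abel

theorem laxEv_smul (ζ c : ℂ) (X : A × A × A) : laxEv ζ (c • X) = c • laxEv ζ X := by
  simp only [laxEv, Prod.smul_fst, Prod.smul_snd, smul_sub, smul_comm c]

theorem nahmQ_add_left (X X' Y : A × A × A) : nahmQ (X + X') Y = nahmQ X Y + nahmQ X' Y := by
  simp only [nahmQ, Prod.fst_add, Prod.snd_add, Prod.mk_add_mk, add_mul, mul_add]
  refine Prod.ext ?_ (Prod.ext ?_ ?_) <;> simp only <;> module

theorem nahmQ_add_right (X Y Y' : A × A × A) : nahmQ X (Y + Y') = nahmQ X Y + nahmQ X Y' := by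
  simp only [nahmQ, Prod.fst_add, Prod.snd_add, Prod.mk_add_mk, add_mul, mul_add]
  refine Prod.ext ?_ (Prod.ext ?_ ?_) <;> simp only <;> module

theorem nahmQ_smul_left (c : ℂ) (X Y : A × A × A) : nahmQ (c • X) Y = c • nahmQ X Y := by
  simp only [nahmQ, Prod.smul_fst, Prod.smul_snd, Prod.smul_mk, smul_mul_assoc, mul_smul_comm,
    ← smul_sub, smul_neg]
  rw [smul_comm c (-2 : ℂ), smul_comm c (2 : ℂ)]

theorem nahmQ_smul_right (c : ℂ) (X Y : A × A × A) : nahmQ X (c • Y) = c • nahmQ X Y := by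
  simp only [nahmQ, Prod.smul_fst, Prod.smul_snd, Prod.smul_mk, smul_mul_assoc, mul_smul_comm,
    ← smul_sub, smul_neg]
  rw [smul_comm c (-2 : ℂ), smul_comm c (2 : ℂ)]

/-- `Q(ρ, X) + Q(X, ρ)`: the linearization of the Nahm equations at `ρ / t`. -/
noncomputable def nahmL (ρ : A × A × A) : (A × A × A) →ₗ[ℂ] (A × A × A) where
  toFun X := nahmQ ρ X + nahmQ X ρ
  map_add' X Y := by rw [nahmQ_add_left, nahmQ_add_right]; abel
  map_smul' c X := by rw [nahmQ_smul_left, nahmQ_smul_right, smul_add]; rfl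

theorem nahmL_apply (ρ X : A × A × A) : nahmL ρ X = nahmQ ρ X + nahmQ X ρ := rfl

end Quadratic

/-- `c₀ = b₀ᴴ`. -/
noncomputable def principalC (k : ℕ) : Mat k := (b₀ k)ᴴ

notation "c₀" => principalC

theorem principalC_apply (i j : Fin k) : c₀ k i j = b₀ k j i := by
  rw [principalC, conjTranspose_apply]
  simp only [principalB, of_apply]
  split_ifs
  · rw [star_def, conj_ofReal]
  · exact star_zero _

theorem principalC_apply_of_ne {i j : Fin k} (h : (j : ℕ) ≠ i + 1) : c₀ k i j = 0 := by
  rw [principalC_apply, principalB_apply_of_ne h]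

theorem principalC_apply_ne_zero {i j : Fin k} (h : (j : ℕ) = i + 1) : c₀ k i j ≠ 0 := by
  obtain ⟨γ, hγ, h1, -⟩ := principalB_apply_pos h
  rw [principalC_apply, h1]
  exact_mod_cast hγ.ne'

theorem principalA_conjTranspose : (a₀ k)ᴴ = a₀ k := by
  rw [principalA, Matrix.diagonal_conjTranspose]
  simp

theorem principalA_mul_apply (w : Mat k) (i j : Fin k) :
    (a₀ k * w - w * a₀ k) i j = (((i : ℕ) : ℂ) - ((j : ℕ) : ℂ)) / 2 * w i j := by
  rw [Matrix.sub_apply, principalA, diagonal_mul, mul_diagonal]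
  linear_combination (principalA_sub i j) * w i j

theorem lie_principalA_principalB : a₀ k * b₀ k - b₀ k * a₀ k = (1 / 2 : ℂ) • b₀ k := by
  ext i j
  rw [principalA_mul_apply, Matrix.smul_apply, smul_eq_mul]
  by_cases h : (i : ℕ) = j + 1
  · rw [h]; push_cast; ring
  · rw [principalB_apply_of_ne h]; simp

theorem lie_principalA_principalC : a₀ k * c₀ k - c₀ k * a₀ k = (-1 / 2 : ℂ) • c₀ k := by
  ext i j
  rw [principalA_mul_apply, Matrix.smul_apply, smul_eq_mul]
  by_cases h : (j : ℕ) = i + 1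
  · rw [h]; push_cast; ring
  · rw [principalC_apply_of_ne h]; simp

theorem principalB_mul_principalC_apply (i j : Fin k) : (b₀ k * c₀ k) i j =
      if i = j then (((i : ℝ) * ((k : ℝ) - i) / 4 : ℝ) : ℂ) else 0 := by
  rw [Matrix.mul_apply]
  by_cases hi : (i : ℕ) = 0
  · rw [sum_eq_zero fun l _ => by
      rw [principalB_apply_of_ne (by omega : (i : ℕ) ≠ l + 1), zero_mul]]
    simp [hi]
  · have hl : (i : ℕ) - 1 < k := by omega
    rw [sum_eq_single ⟨(i : ℕ) - 1, hl⟩]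
    · have e : (i : ℕ) = (⟨(i : ℕ) - 1, hl⟩ : Fin k) + 1 := by simp only; omega
      by_cases hij : i = j
      · subst hij
        obtain ⟨γ, hγ, h1, h2⟩ := principalB_apply_pos e
        rw [principalC_apply, h1, if_pos rfl, ← ofReal_mul, h2]
        have hnn : (0 : ℝ) ≤ (i : ℝ) * ((k : ℝ) - i) :=
          mul_nonneg (by positivity) (sub_nonneg.2 (by exact_mod_cast i.2.le))
        grind
      · rw [principalC_apply_of_ne (fun h => hij (Fin.ext (by omega))), mul_zero, if_neg hij]
    · intro l _ hl'
      rw [principalB_apply_of_ne (fun h => hl' (Fin.ext (by simp only; omega))), zero_mul]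
    · simp

theorem principalC_mul_principalB_apply (i j : Fin k) : (c₀ k * b₀ k) i j =
      if i = j then ((((i : ℝ) + 1) * ((k : ℝ) - (i + 1)) / 4 : ℝ) : ℂ) else 0 := by
  rw [Matrix.mul_apply]
  by_cases hi : (i : ℕ) + 1 = k
  · rw [sum_eq_zero fun l _ => by
      rw [principalC_apply_of_ne (by omega : (l : ℕ) ≠ i + 1), zero_mul]]
    have : (k : ℝ) = (i : ℝ) + 1 := by exact_mod_cast hi.symm
    simp [this]
  · have hl : (i : ℕ) + 1 < k := by omega
    rw [sum_eq_single ⟨(i : ℕ) + 1, hl⟩]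
    · by_cases hij : i = j
      · subst hij
        obtain ⟨γ, hγ, h1, h2⟩ := principalB_apply_pos (i := ⟨(i : ℕ) + 1, hl⟩) (j := i) rfl
        rw [principalC_apply, h1, if_pos rfl, ← ofReal_mul, h2]
        have hnn : (0 : ℝ) ≤ ((i : ℝ) + 1) * ((k : ℝ) - (i + 1)) :=
          mul_nonneg (by positivity) (sub_nonneg.2 (by exact_mod_cast hl.le))
        grind
      · rw [principalB_apply_of_ne (fun h => hij (Fin.ext (by simp only at h; omega))), mul_zero,
          if_neg hij]
    · intro l _ hl'
      rw [principalC_apply_of_ne (fun h => hl' (Fin.ext (by simp only; omega))), zero_mul]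
    · simp

theorem lie_principalB_principalC : b₀ k * c₀ k - c₀ k * b₀ k = a₀ k := by
  ext i j
  rw [Matrix.sub_apply, principalB_mul_principalC_apply, principalC_mul_principalB_apply]
  by_cases hij : i = j
  · subst hij
    rw [if_pos rfl, if_pos rfl, principalA, Matrix.diagonal_apply_eq]
    push_cast; ring
  · rw [if_neg hij, if_neg hij, principalA, diagonal_apply_ne _ hij, sub_zero]

theorem principalC_pow_apply_of_ne (n : ℕ) {i j : Fin k} (h : (j : ℕ) ≠ i + n) :
    (c₀ k ^ n) i j = 0 := by
  induction n generalizing j with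
  | zero => rw [pow_zero, Matrix.one_apply_ne]; rintro rfl; exact h rfl
  | succ n ih =>
    rw [pow_succ, Matrix.mul_apply]
    refine sum_eq_zero fun l _ => ?_
    by_cases hl : (l : ℕ) = i + n
    · rw [principalC_apply_of_ne (by omega : (j : ℕ) ≠ l + 1), mul_zero]
    · rw [ih hl, zero_mul]

theorem principalC_pow_apply_ne_zero (n : ℕ) {i j : Fin k} (h : (j : ℕ) = i + n) :
    (c₀ k ^ n) i j ≠ 0 := by
  induction n generalizing j with
  | zero =>
    have : i = j := Fin.ext (by omega)
    subst this
    simp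
  | succ n ih =>
    rw [pow_succ, Matrix.mul_apply, sum_eq_single ⟨(i : ℕ) + n, (by omega)⟩]
    · refine mul_ne_zero (ih rfl) (principalC_apply_ne_zero ?_)
      simp only; omega
    · intro l _ hl'
      rw [principalC_pow_apply_of_ne n (fun h => hl' (Fin.ext (by simp only; omega))), zero_mul]
    · simp

theorem isNilpotent_principalC : IsNilpotent (c₀ k) := by
  refine ⟨k, ?_⟩
  ext i j
  rw [principalC_pow_apply_of_ne k (by omega)]
  rfl

/-- The first row is cyclic for `c₀`: a matrix commuting with `c₀` is determined by it. -/
theorem eq_zero_of_commute_principalC {w : Mat k} (h : w * c₀ k = c₀ k * w)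
    (h0 : ∀ i j : Fin k, (i : ℕ) = 0 → w i j = 0) : w = 0 := by
  have key : ∀ n (hn : n < k) (j : Fin k), w ⟨n, hn⟩ j = 0 := by
    intro n
    induction n with
    | zero => intro hn j; exact h0 _ j rfl
    | succ n ih =>
      intro hn j
      have hn' : n < k := by omega
      have h1 := congrFun (congrFun h ⟨n, hn'⟩) j
      rw [Matrix.mul_apply, sum_eq_zero fun l _ => by rw [ih hn' l, zero_mul],
        Matrix.mul_apply, sum_eq_single ⟨n + 1, hn⟩] at h1
      · exact (mul_eq_zero.1 h1.symm).resolve_left (principalC_apply_ne_zero rfl)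
      · intro l _ hl
        rw [principalC_apply_of_ne (fun h => hl (Fin.ext h)), zero_mul]
      · simp
  ext i j
  exact key i i.2 j

/-- The leading coefficient `(a₀, b₀, c₀)` of a solution with a pole. -/
noncomputable def principalT (k : ℕ) : Mat³ k := (a₀ k, b₀ k, c₀ k)

theorem nahmQ_principalT : nahmQ (principalT k) (principalT k) = -principalT k := by
  simp only [nahmQ, principalT, lie_principalB_principalC, lie_principalA_principalB,
    lie_principalA_principalC, smul_smul]
  refine Prod.ext rfl (Prod.ext ?_ ?_)
  · simp
  · change (_ : ℂ) • c₀ k = -c₀ k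
    rw [← neg_one_smul ℂ]; norm_num

theorem trace_conjTranspose_mul_lie (b p q : Mat k) :
    (pᴴ * (b * q - q * b)).trace = ((bᴴ * p - p * bᴴ)ᴴ * q).trace := by
  simp only [conjTranspose_sub, conjTranspose_mul, conjTranspose_conjTranspose,
    mul_sub, sub_mul, trace_sub]
  rw [← mul_assoc pᴴ q b, trace_mul_comm (pᴴ * q) b]
  simp only [mul_assoc]

/-- A linear map that is symmetric for some inner product has a basis of eigenvectors with real
eigenvalues. -/
theorem exists_eigenbasis {V : Type*} [AddCommGroup V] [Module ℂ V] [FiniteDimensional ℂ V]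
    (core : InnerProductSpace.Core ℂ V) (L : V →ₗ[ℂ] V)
    (hL : ∀ x y, core.inner (L x) y = core.inner x (L y)) :
    ∃ (n : ℕ) (e : Basis (Fin n) ℂ V) (l : Fin n → ℝ), ∀ i, L (e i) = (l i : ℂ) • e i := by
  let : NormedAddCommGroup V := core.toNormedAddCommGroup
  let : InnerProductSpace ℂ V := InnerProductSpace.ofCore core.toCore
  have hs : L.IsSymmetric := hL
  exact ⟨_, (hs.eigenvectorBasis rfl).toBasis, hs.eigenvalues rfl, fun i => by
    rw [OrthonormalBasis.coe_toBasis]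
    exact hs.apply_eigenvectorBasis rfl i⟩

/-- The inner product for which the linearization at `(a₀, b₀, c₀) / t` is symmetric. -/
@[reducible]
noncomputable def nahmCore (k : ℕ) : InnerProductSpace.Core ℂ (Mat³ k) where
  inner X Y := 2 * (X.1ᴴ * Y.1).trace + (X.2.1ᴴ * Y.2.1).trace + (X.2.2ᴴ * Y.2.2).trace
  conj_inner_symm X Y := by
    have h : ∀ p q : Mat k, (starRingEnd ℂ) (pᴴ * q).trace = (qᴴ * p).trace := by
      intro p q
      rw [← star_def, ← Matrix.trace_conjTranspose, conjTranspose_mul, conjTranspose_conjTranspose]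
    simp only [map_add, map_mul, h, map_ofNat]
  re_inner_nonneg X := by
    have h : ∀ p : Mat k, 0 ≤ (pᴴ * p).trace.re := fun p => by rw [← norm_sq_eq_trace]; positivity
    have h1 := h X.1
    have h2 := h X.2.1
    have h3 := h X.2.2
    simp only [RCLike.re_to_complex, add_re, mul_re]
    norm_num
    linarith
  add_left X Y Z := by
    simp only [Prod.fst_add, Prod.snd_add, conjTranspose_add, add_mul, trace_add]
    ring
  smul_left X Y r := by
    simp only [Prod.smul_fst, Prod.smul_snd, conjTranspose_smul, smul_mul_assoc,
      trace_smul, smul_eq_mul, star_def]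
    ring
  definite X h := by
    have h0 : ∀ p : Mat k, (pᴴ * p).trace.re = ‖p‖ ^ 2 := fun p => (norm_sq_eq_trace p).symm
    have h1 := congrArg Complex.re h
    simp only [add_re, mul_re, h0] at h1
    norm_num at h1
    have e1 : ‖X.1‖ = 0 := by nlinarith [sq_nonneg ‖X.1‖, sq_nonneg ‖X.2.1‖, sq_nonneg ‖X.2.2‖]
    have e2 : ‖X.2.1‖ = 0 := by nlinarith [sq_nonneg ‖X.1‖, sq_nonneg ‖X.2.1‖, sq_nonneg ‖X.2.2‖]
    aesop

theorem nahmL_principalT_apply (X : Mat³ k) : nahmL (principalT k) X =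
    (-(b₀ k * X.2.2 - X.2.2 * b₀ k) + (c₀ k * X.2.1 - X.2.1 * c₀ k),
      (-2 : ℂ) • (a₀ k * X.2.1 - X.2.1 * a₀ k) + (2 : ℂ) • (b₀ k * X.1 - X.1 * b₀ k),
      (2 : ℂ) • (a₀ k * X.2.2 - X.2.2 * a₀ k) + (-2 : ℂ) • (c₀ k * X.1 - X.1 * c₀ k)) := by
  rw [nahmL_apply]
  simp only [nahmQ, principalT, Prod.mk_add_mk]
  refine Prod.ext ?_ (Prod.ext ?_ ?_) <;> simp only <;> module

theorem nahmL_symmetric (X Y : Mat³ k) : (nahmCore k).inner (nahmL (principalT k) X) Y =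
      (nahmCore k).inner X (nahmL (principalT k) Y) := by
  have ha := trace_conjTranspose_mul_lie (a₀ k)
  have hb := trace_conjTranspose_mul_lie (b₀ k)
  have hc := trace_conjTranspose_mul_lie (c₀ k)
  rw [principalA_conjTranspose] at ha
  rw [show (c₀ k)ᴴ = b₀ k from conjTranspose_conjTranspose _] at hc
  rw [show (b₀ k)ᴴ = c₀ k from rfl] at hb
  have hi : ∀ X Y, (nahmCore k).inner X Y =
      2 * (X.1ᴴ * Y.1).trace + (X.2.1ᴴ * Y.2.1).trace + (X.2.2ᴴ * Y.2.2).trace := fun _ _ => rfl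
  rw [nahmL_principalT_apply, nahmL_principalT_apply, hi, hi]
  simp only [conjTranspose_add, Matrix.conjTranspose_neg,
    conjTranspose_smul, star_def, map_neg, map_ofNat, add_mul, neg_mul, smul_mul_assoc, mul_add,
        mul_neg,
    mul_smul_comm, trace_add, trace_neg, trace_smul, smul_eq_mul, ha, hb, hc]
  ring

/-! ### Resonances of the linearized equations -/

/-- The Lax matrix of the leading coefficient. -/
noncomputable def principalR (k : ℕ) (ζ : ℂ) : Mat k := laxEv ζ (principalT k)

theorem lie_principalR (ζ : ℂ) :
    laxM ζ (principalT k) * principalR k ζ - principalR k ζ * laxM ζ (principalT k) =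
      principalR k ζ := by
  have h := laxEv_nahmQ_self ζ (principalT k)
  rw [nahmQ_principalT, ← neg_one_smul ℂ, laxEv_smul, neg_one_smul] at h
  rw [principalR, ← neg_sub, ← h, neg_neg]

theorem lie_pow_eq_nsmul {A : Type*} [Ring A] {M r : A} (h : M * r - r * M = r) (m : ℕ) :
    M * r ^ m - r ^ m * M = m • r ^ m := by
  induction m with
  | zero => simp
  | succ m ih =>
    calc M * r ^ (m + 1) - r ^ (m + 1) * M
        = (M * r ^ m - r ^ m * M) * r + r ^ m * (M * r - r * M) := by rw [pow_succ]; noncomm_ring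
      _ = (m + 1) • r ^ (m + 1) := by rw [ih, h, add_smul, one_smul, smul_mul_assoc, pow_succ]

/-- The linear functional `tr (r(ζ)ᵐ X(ζ))`: the first order variation of the conserved quantity
`tr (A(ζ)ᵐ⁺¹) / (m + 1)`. -/
noncomputable def resonance (m : ℕ) (ζ : ℂ) (X : Mat³ k) : ℂ :=
  (principalR k ζ ^ m * laxEv ζ X).trace

theorem resonance_add (m : ℕ) (ζ : ℂ) (X Y : Mat³ k) :
    resonance m ζ (X + Y) = resonance m ζ X + resonance m ζ Y := by
  rw [resonance, laxEv_add, mul_add, trace_add]; rfl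

theorem resonance_smul (m : ℕ) (ζ c : ℂ) (X : Mat³ k) :
    resonance m ζ (c • X) = c * resonance m ζ X := by
  rw [resonance, laxEv_smul, mul_smul_comm, trace_smul]; rfl

theorem resonance_nahmL (m : ℕ) (ζ : ℂ) (X : Mat³ k) :
    resonance m ζ (nahmL (principalT k) X) = m * resonance m ζ X := by
  set r := principalR k ζ with hr
  set M := laxM ζ (principalT k)
  set E := laxEv ζ X
  set N := laxM ζ X
  have h1 : (r ^ m * (r * N - N * r)).trace = 0 := by
    rw [mul_sub, trace_sub, ← mul_assoc, ← mul_assoc, trace_mul_comm (r ^ m * N) r,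
      ← mul_assoc, ← pow_succ', pow_succ, sub_self]
  have h2 : (r ^ m * (E * M - M * E)).trace = ((M * r ^ m - r ^ m * M) * E).trace := by
    rw [mul_sub, sub_mul, trace_sub, trace_sub, ← mul_assoc,
      trace_mul_comm (r ^ m * E) M, mul_assoc, mul_assoc]
  rw [resonance, nahmL_apply, laxEv_nahmQ, mul_add, trace_add]
  change (r ^ m * (r * N - N * r)).trace + (r ^ m * (E * M - M * E)).trace = _
  rw [h1, h2, (lie_pow_eq_nsmul (lie_principalR (k := k) ζ) m), zero_add, smul_mul_assoc,
    trace_smul, nsmul_eq_mul]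
  rfl

/-- The infinitesimal action of the nilpotent direction of `sl₂` on triples. It commutes with the
linearization, and it translates the spectral parameter. -/
noncomputable def shiftOp (k : ℕ) : (Mat³ k) →ₗ[ℂ] (Mat³ k) where
  toFun X := (c₀ k * X.1 - X.1 * c₀ k - (1 / 2 : ℂ) • X.2.2,
    c₀ k * X.2.1 - X.2.1 * c₀ k + X.1,
    c₀ k * X.2.2 - X.2.2 * c₀ k)
  map_add' X Y := by
    refine Prod.ext ?_ (Prod.ext ?_ ?_) <;>
      simp only [Prod.fst_add, Prod.snd_add, mul_add, add_mul, smul_add] <;> abel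
  map_smul' c X := by
    refine Prod.ext ?_ (Prod.ext ?_ ?_) <;>
      simp only [Prod.smul_fst, Prod.smul_snd, mul_smul_comm, smul_mul_assoc, RingHom.id_apply,
        smul_sub, smul_add, smul_comm c]

theorem shiftOp_apply (X : Mat³ k) : shiftOp k X =
    (c₀ k * X.1 - X.1 * c₀ k - (1 / 2 : ℂ) • X.2.2,
    c₀ k * X.2.1 - X.2.1 * c₀ k + X.1,
    c₀ k * X.2.2 - X.2.2 * c₀ k) := rfl

theorem shiftOp_nahmL (X : Mat³ k) :
    shiftOp k (nahmL (principalT k) X) = nahmL (principalT k) (shiftOp k X) := by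
  obtain ⟨x, y, z⟩ := X
  have hbc := lie_principalB_principalC (k := k)
  have hac := lie_principalA_principalC (k := k)
  rw [nahmL_principalT_apply, nahmL_principalT_apply, shiftOp_apply, shiftOp_apply]
  set a := a₀ k
  set b := b₀ k
  set c := c₀ k
  have hbc' : b * c = a + c * b := by rw [← hbc]; abel
  have hac' : a * c = (-1 / 2 : ℂ) • c + c * a := by rw [← hac]; abel
  have e1 (w : Mat k) : b * (c * w) = a * w + c * (b * w) := by
    rw [← mul_assoc, hbc', add_mul, mul_assoc]
  have e2 (w : Mat k) : a * (c * w) = (-1 / 2 : ℂ) • (c * w) + c * (a * w) := by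
    rw [← mul_assoc, hac', add_mul, mul_assoc, smul_mul_assoc]
  refine Prod.ext ?_ (Prod.ext ?_ ?_) <;>
    simp only [mul_add, add_mul, mul_sub, sub_mul, mul_smul_comm, smul_mul_assoc, smul_add,
      smul_sub, mul_neg, neg_mul, mul_assoc, e1, e2, hbc', hac', smul_smul, neg_sub] <;>
    module

theorem hasDerivAt_principalR_pow (m : ℕ) (ζ : ℂ) : HasDerivAt (fun ζ : ℂ => principalR k ζ ^ m)
      (c₀ k * principalR k ζ ^ m - principalR k ζ ^ m * c₀ k) ζ := by
  have h1 : HasDerivAt (fun ζ : ℂ => principalR k ζ)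
      (c₀ k * principalR k ζ - principalR k ζ * c₀ k) ζ := by
    have hC := (((hasDerivAt_id ζ).pow 2).div_const 4).smul_const (c₀ k)
    refine ((((hasDerivAt_id ζ).smul_const (a₀ k)).const_sub (b₀ k)).sub hC).congr_deriv ?_
    rw [principalR, laxEv, principalT]
    simp only [mul_sub, sub_mul, mul_smul_comm, smul_mul_assoc, id_eq,
      sub_eq_iff_eq_add.1 (lie_principalB_principalC (k := k)),
      sub_eq_iff_eq_add.1 (lie_principalA_principalC (k := k))]
    simp
    module
  induction m with
  | zero =>
    simp only [pow_zero, mul_one, one_mul, sub_self]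
    exact hasDerivAt_const ζ 1
  | succ m ih =>
    simp only [pow_succ]
    refine (ih.mul h1).congr_deriv ?_
    noncomm_ring

theorem resonance_shiftOp {m : ℕ} {X : Mat³ k} (h : ∀ ζ, resonance m ζ X = 0)
    (ζ : ℂ) : resonance m ζ (shiftOp k X) = 0 := by
  have hE : HasDerivAt (fun ζ : ℂ => laxEv ζ X) (-X.1 - (ζ / 2) • X.2.2) ζ := by
    refine ((((hasDerivAt_id ζ).smul_const X.1).const_sub X.2.1).sub ((((hasDerivAt_id ζ).pow
      2).div_const 4).smul_const X.2.2)).congr_deriv ?_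
    simp
    module
  have h2 : HasDerivAt (fun ζ : ℂ => resonance m ζ X)
      (((c₀ k * principalR k ζ ^ m - principalR k ζ ^ m * c₀ k) * laxEv ζ X
        + principalR k ζ ^ m * (-X.1 - (ζ / 2) • X.2.2)).trace) ζ :=
    ((Matrix.traceLinearMap (Fin k) ℂ ℂ).toContinuousLinearMap.hasFDerivAt).comp_hasDerivAt ζ
      ((hasDerivAt_principalR_pow (k := k) m ζ).mul hE)
  have h3 := h2.unique ((hasDerivAt_const ζ (0 : ℂ)).congr_of_eventuallyEq (Eventually.of_forall h))
  set r := principalR k ζ ^ m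
  set E := laxEv ζ X with hEd
  have h4 : laxEv ζ (shiftOp k X) =
      (c₀ k * E - E * c₀ k) - (-X.1 - (ζ / 2) • X.2.2) := by
    rw [hEd, shiftOp_apply, laxEv, laxEv]
    simp only [mul_sub, sub_mul, mul_smul_comm, smul_mul_assoc]
    module
  have h5 : (r * (c₀ k * E - E * c₀ k)).trace
      = -((c₀ k * r - r * c₀ k) * E).trace := by
    rw [mul_sub, sub_mul, trace_sub, trace_sub, ← mul_assoc, ← mul_assoc,
      trace_mul_comm (r * E), mul_assoc (c₀ k)]
    ring
  rw [trace_add] at h3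
  rw [resonance, h4, mul_sub, trace_sub, h5]
  linear_combination -h3

theorem eq_zero_of_lie_principalC {w : Mat k} {μ : ℂ} (hμ : μ ≠ 0)
    (h : c₀ k * w - w * c₀ k = μ • w) : w = 0 := by
  have h1 : ∀ n : ℕ, c₀ k ^ n * w = w * (c₀ k + μ • 1) ^ n := by
    intro n
    induction n with
    | zero => simp
    | succ n ih =>
      rw [pow_succ', mul_assoc, ih, ← mul_assoc, show c₀ k * w =
        w * (c₀ k + μ • 1) by rw [mul_add, mul_smul_comm, mul_one, ← h]; abel, mul_assoc,
        ← pow_succ']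
  obtain ⟨n, hn⟩ := isNilpotent_principalC (k := k)
  have hu : IsUnit (c₀ k + μ • (1 : Mat k)) := by
    exact IsNilpotent.isUnit_add_right_of_commute ⟨n, hn⟩ ((isUnit_one (M := Mat k)).smul
      (Units.mk0 μ hμ))
      ((Commute.one_right _).smul_right μ)
  have h2 := h1 n
  rw [hn, zero_mul] at h2
  exact ((hu.pow n).mul_left_eq_zero).1 h2.symm

/-- An invariant subspace of the shift contains a highest weight vector. -/
theorem exists_shiftOp_eq_zero (W : Submodule ℂ (Mat³ k)) (hW : W ≠ ⊥)
    (h : ∀ X ∈ W, shiftOp k X ∈ W) : ∃ Y ∈ W, Y ≠ 0 ∧ shiftOp k Y = 0 := by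
  have : Nontrivial W := Submodule.nontrivial_iff_ne_bot.2 hW
  obtain ⟨μ, hμ⟩ := Module.End.exists_eigenvalue ((shiftOp k).restrict h)
  obtain ⟨Y, hY⟩ := hμ.exists_hasEigenvector
  have h1 : shiftOp k (Y : Mat³ k) = μ • (Y : Mat³ k) := congrArg Subtype.val hY.apply_eq_smul
  have h0 : (Y : Mat³ k) ≠ 0 := fun e => hY.2 (Subtype.ext e)
  refine ⟨Y, Y.2, h0, ?_⟩
  by_cases hm : μ = 0
  · rw [h1, hm, zero_smul]
  · exfalso
    obtain ⟨e1, e2, e3⟩ := by simpa only [shiftOp_apply, Prod.ext_iff] using h1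
    have hz := eq_zero_of_lie_principalC hm e3
    rw [hz, smul_zero, sub_zero] at e1
    have hx := eq_zero_of_lie_principalC hm e1
    rw [hx, add_zero] at e2
    exact h0 (Prod.ext hx (Prod.ext (eq_zero_of_lie_principalC hm e2) hz))

/-- The highest weight vectors with eigenvalue larger than `-1` are the powers of `c₀`. -/
theorem eq_principalC_pow {Y : Mat³ k} (hY : Y ≠ 0) (hF : shiftOp k Y = 0) {l : ℝ}
    (hl : -1 < l) (hL : nahmL (principalT k) Y = (l : ℂ) • Y) :
    ∃ (m : ℕ) (κ : ℂ), l = m ∧ Y = (0, κ • c₀ k ^ m, 0) := by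
  obtain ⟨x, y, z⟩ := Y
  simp only [shiftOp_apply, Prod.mk_eq_zero] at hF
  obtain ⟨f1, f2, f3⟩ := hF
  simp only [nahmL_principalT_apply, Prod.smul_mk, Prod.mk.injEq] at hL
  obtain ⟨l1, l2, l3⟩ := hL
  have hz : z = 0 := by
    refine eq_zero_of_commute_principalC (sub_eq_zero.1 f3).symm fun i
      j hi => ?_
    rw [sub_eq_zero.1 f1] at l3
    have h1 := congrFun (congrFun l3 i) j
    rw [Matrix.add_apply, Matrix.smul_apply, principalA_mul_apply, hi] at h1
    simp only [Matrix.smul_apply, smul_eq_mul] at h1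
    have h2 : (((j : ℕ) + l + 1 : ℝ) : ℂ) * z i j = 0 := by
      push_cast at h1 ⊢
      linear_combination -h1
    refine (mul_eq_zero.1 h2).resolve_left ?_
    have : (0 : ℝ) < (j : ℕ) + l + 1 := by linarith
    exact_mod_cast this.ne'
  have hx : x = 0 := by
    rw [hz, mul_zero, zero_mul, sub_zero, neg_zero, zero_add, eq_neg_of_add_eq_zero_left f2] at l1
    have h2 : ((l + 1 : ℝ) : ℂ) • x = 0 := by
      push_cast
      rw [add_smul, ← l1, one_smul, neg_add_cancel]
    refine (smul_eq_zero.1 h2).resolve_left ?_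
    have : (0 : ℝ) < l + 1 := by linarith
    exact_mod_cast this.ne'
  rw [hx, add_zero] at f2
  rw [hx, mul_zero, zero_mul, sub_zero, smul_zero, add_zero] at l2
  have hrow : ∀ i j : Fin k, (i : ℕ) = 0 → y i j ≠ 0 → l = (j : ℕ) := by
    intro i j hi hij
    have h1 := congrFun (congrFun l2 i) j
    rw [Matrix.smul_apply, principalA_mul_apply, hi] at h1
    simp only [Matrix.smul_apply, smul_eq_mul] at h1
    have h2 : (l - (j : ℕ) : ℂ) * y i j = 0 := by
      push_cast at h1
      linear_combination -h1
    exact_mod_cast (sub_eq_zero.1 ((mul_eq_zero.1 h2).resolve_right hij))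
  obtain ⟨i, j, hi, hij⟩ : ∃ i j : Fin k, (i : ℕ) = 0 ∧ y i j ≠ 0 := by
    by_contra hcon
    push Not at hcon
    exact (fun e => hY (by rw [hx, e, hz]; rfl)) (eq_zero_of_commute_principalC (sub_eq_zero.1
      f2).symm hcon)
  have hc : (c₀ k ^ (j : ℕ)) i j ≠ 0 := principalC_pow_apply_ne_zero _ (by omega)
  refine ⟨j, y i j / (c₀ k ^ (j : ℕ)) i j, hrow i j hi hij, (Prod.ext hx (Prod.ext
    (sub_eq_zero.1 (eq_zero_of_commute_principalC ?_ fun i' j' hi' => ?_)) hz))⟩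
  · rw [sub_mul, mul_sub, ← sub_eq_zero.1 f2, smul_mul_assoc, mul_smul_comm, ← pow_succ,
      ← pow_succ']
  · have ei : i' = i := Fin.ext (by omega)
    subst ei
    change y i' j' - y i' j / (c₀ k ^ (j : ℕ)) i' j * (c₀ k ^ (j : ℕ)) i' j' = 0
    by_cases hj : j' = j
    · simp [*]
    · rw [principalC_pow_apply_of_ne (j : ℕ) (i := i') (j := j')
        (fun e => hj (Fin.ext (by omega))), mul_zero, sub_zero]
      by_contra hne
      have h1 := hrow i' j hi hij
      rw [hrow i' j' hi' hne] at h1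
      exact hj (Fin.ext (by exact_mod_cast h1))

theorem eq_natCast_of_eigenvalue {l : ℝ} (hl : -1 < l) {X : Mat³ k} (hX : X ≠ 0)
    (hL : nahmL (principalT k) X = (l : ℂ) • X) : ∃ m : ℕ, l = m := by
  obtain ⟨Y, hY, h0, hF⟩ := exists_shiftOp_eq_zero
    (LinearMap.ker (nahmL (principalT k) - (l : ℂ) • LinearMap.id))
    (fun e => hX ((Submodule.mem_bot ℂ).1 (e ▸ by simp [hL]))) (fun Z hZ => by
      simp only [LinearMap.mem_ker, LinearMap.sub_apply, LinearMap.smul_apply, id_apply,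
        sub_eq_zero] at hZ ⊢
      rw [← shiftOp_nahmL, hZ, map_smul])
  simp only [LinearMap.mem_ker, LinearMap.sub_apply, LinearMap.smul_apply, id_apply,
    sub_eq_zero] at hY
  obtain ⟨m, -, h, -⟩ := eq_principalC_pow h0 hF hl hY
  exact ⟨m, h⟩

/-- The conserved quantities detect the resonant directions. -/
theorem eq_zero_of_resonance {m : ℕ} {X : Mat³ k}
    (hL : nahmL (principalT k) X = (m : ℂ) • X) (hX : ∀ ζ, resonance m ζ X = 0) : X = 0 := by
  by_contra hne
  let W : Submodule ℂ (Mat³ k) :=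
    { carrier := {Z | nahmL (principalT k) Z = (m : ℂ) • Z ∧ ∀ ζ, resonance m ζ Z = 0}
      add_mem' := fun {Z Z'} h h' => ⟨by rw [map_add, h.1, h'.1, smul_add], fun ζ => by
        rw [resonance_add, h.2, h'.2, add_zero]⟩
      zero_mem' := ⟨by simp, fun ζ => by
        have := resonance_smul (k := k) m ζ 0 0
        rwa [zero_smul, zero_mul] at this⟩
      smul_mem' := fun c Z h => ⟨by rw [map_smul, h.1, smul_comm], fun ζ => by
        rw [resonance_smul, h.2, mul_zero]⟩ }
  obtain ⟨Y, hY, h0, hF⟩ := exists_shiftOp_eq_zero W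
    (fun e => hne ((Submodule.mem_bot ℂ).1 (e ▸ (⟨hL, hX⟩ : X ∈ W)))) (fun Z hZ =>
      ⟨by rw [← shiftOp_nahmL, hZ.1, map_smul], resonance_shiftOp hZ.2⟩)
  have hm : (-1 : ℝ) < (m : ℝ) := by linarith
  obtain ⟨m', κ, hm', hYe⟩ := eq_principalC_pow h0 hF hm (by simpa using hY.1)
  have : m = m' := by exact_mod_cast hm'
  subst this
  have h1 := hY.2 0
  rw [hYe, resonance, principalR] at h1
  simp only [laxEv, principalT, zero_smul, sub_zero, smul_zero, ne_eq, OfNat.ofNat_ne_zero,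
    not_false_eq_true, zero_pow, zero_div] at h1
  rw [mul_smul_comm, trace_smul, smul_eq_mul] at h1
  have h2 : b₀ k ^ m = (c₀ k ^ m)ᴴ := by
    rw [Matrix.conjTranspose_pow, principalC, conjTranspose_conjTranspose]
  rcases mul_eq_zero.1 h1 with h | h
  · exact h0 (by rw [hYe, h, zero_smul]; rfl)
  · rw [h2] at h
    have h3 := norm_sq_eq_trace (c₀ k ^ m)
    aesop

/-! ### Formal solutions at a pole -/

open Finset.HasAntidiagonal (antidiagonal mem_antidiagonal)

section Formal

variable {A : Type*} [Ring A] [Algebra ℂ A]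

/-- The coefficients of `t Q(S, S)` for the power series `S` with coefficients `T`. -/
noncomputable def nahmF (T : ℕ → A × A × A) : ℕ → A × A × A
  | 0 => 0
  | n + 1 => ∑ p ∈ antidiagonal n, nahmQ (T p.1) (T p.2)
theorem nahmF_congr {T T' : ℕ → A × A × A} {m : ℕ} (h : ∀ n < m, T n = T' n) :
    nahmF T m = nahmF T' m := by
  cases m with
  | zero => rfl
  | succ m =>
    refine sum_congr rfl fun p hp => ?_
    aesop

theorem nahmQ_zero_left (Y : A × A × A) : nahmQ 0 Y = 0 := by simp [nahmQ]

theorem nahmQ_zero_right (Y : A × A × A) : nahmQ Y 0 = 0 := by simp [nahmQ]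

theorem laxEv_zero (ζ : ℂ) : laxEv ζ (0 : A × A × A) = 0 := by simp [laxEv]

theorem laxEv_sub (ζ : ℂ) (X Y : A × A × A) : laxEv ζ (X - Y) = laxEv ζ X - laxEv ζ Y := by
  simp only [laxEv, Prod.fst_sub, Prod.snd_sub, smul_sub]; abel

/-- The `n`-th coefficient of a triple of polynomials. -/
def coeffTriple (n : ℕ) (P : Polynomial A × Polynomial A × Polynomial A) : A × A × A :=
  (P.1.coeff n, P.2.1.coeff n, P.2.2.coeff n)

theorem coeffTriple_nahmQ (n : ℕ) (P P' : Polynomial A × Polynomial A × Polynomial A) :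
    coeffTriple n (nahmQ P P') =
      ∑ p ∈ antidiagonal n, nahmQ (coeffTriple p.1 P) (coeffTriple p.2 P') := by
  have key : ∀ u v : Polynomial A, (u * v - v * u).coeff n =
      ∑ p ∈ antidiagonal n, (u.coeff p.1 * v.coeff p.2 - v.coeff p.2 * u.coeff p.1) := by
    intro u v
    rw [coeff_sub, coeff_mul, coeff_mul, ← Finset.Nat.sum_antidiagonal_swap (f := fun p =>
      v.coeff p.1 * u.coeff p.2), sum_sub_distrib]
    rfl
  refine Prod.ext ?_ (Prod.ext ?_ ?_) <;>
    simp only [nahmQ, coeffTriple, Prod.fst_sum, Prod.snd_sum, Polynomial.coeff_neg, coeff_smul,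
      key, sum_neg_distrib, smul_sum]

theorem coeff_laxEv (n : ℕ) (ζ : ℂ) (P : Polynomial A × Polynomial A × Polynomial A) :
    (laxEv ζ P).coeff n = laxEv ζ (coeffTriple n P) := by
  simp only [laxEv, coeff_sub, coeff_smul, coeffTriple]

end Formal

theorem derivation_mul_step {R : Type*} [Ring R] {x y B B' U U' M Y W : R} {n : ℕ}
    (hx : ∀ z, x * z = z * x) (hy : ∀ z, y * z = z * y)
    (h : x * B' - B = (B * M - M * B) + y * Y) (hU : x * U' - n • U = (U * M - M * U) + y * W) :
    x * (U' * B + U * B') - (n + 1) • (U * B) = (U * B * M - M * (U * B)) +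
        y * (W * B + U * Y) := by
  have h1 : x * B' = B + ((B * M - M * B) + y * Y) := by rw [← h]; abel
  have h2 : x * U' = n • U + ((U * M - M * U) + y * W) := by rw [← hU]; abel
  have h3 : x * (U' * B + U * B') = (x * U') * B + U * (x * B') := by
    rw [mul_add, ← mul_assoc, ← mul_assoc, hx U, mul_assoc U]
  have h4 : y * (U * Y) = U * (y * Y) := by rw [← mul_assoc, hy U, mul_assoc]
  rw [h3, h1, h2, mul_add y, h4, add_smul, one_smul]
  grind

/-- If `X B' - B = [B, M] + Xⁿ Y`, then the traces of the powers of `B` satisfy the corresponding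
equation to leading order. -/
theorem exists_derivative_pow_eq {B M Y : Polynomial (Mat k)} {m : ℕ}
    (h : X * derivative B - B = (B * M - M * B) + X ^ (m + 1) * Y)
    (n : ℕ) : ∃ W : Polynomial (Mat k), X * derivative (B ^ (n + 1)) - (n + 1) • B ^ (n + 1) =
        (B ^ (n + 1) * M - M * B ^ (n + 1)) + X ^ (m + 1) * W ∧
      ∀ i, (B.coeff 0 ^ i * W.coeff 0).trace =
        (n + 1) * (B.coeff 0 ^ (i + n) * Y.coeff 0).trace := by
  induction n with
  | zero => exact ⟨Y, by simpa using h, fun i => by simp⟩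
  | succ n ih =>
    obtain ⟨W, hW, hi⟩ := ih
    refine ⟨W * B + B ^ (n + 1) * Y, ?_, fun i => ?_⟩
    · rw [pow_succ B (n + 1), Polynomial.derivative_mul]
      exact derivation_mul_step (fun z => Polynomial.X_mul) (fun z => Polynomial.X_pow_mul) h hW
    · have h0 : (B ^ (n + 1)).coeff 0 = B.coeff 0 ^ (n + 1) := by
        rw [← Polynomial.constantCoeff_apply, map_pow, Polynomial.constantCoeff_apply]
      rw [coeff_add, mul_coeff_zero, mul_coeff_zero, h0, mul_add,
        trace_add, ← mul_assoc, trace_mul_comm (B.coeff 0 ^ i * W.coeff 0),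
        ← mul_assoc, ← pow_succ', (hi (i + 1)), ← mul_assoc, ← pow_add]
      grind

theorem trace_coeff_mul_comm (n : ℕ) (P P' : Polynomial (Mat k)) :
    ((P * P').coeff n).trace = ((P' * P).coeff n).trace := by
  rw [coeff_mul, coeff_mul, ← Finset.Nat.sum_antidiagonal_swap, trace_sum, trace_sum]
  exact sum_congr rfl fun p _ => trace_mul_comm _ _

theorem sum_antidiagonal_nahmQ {A : Type*} [Ring A] [Algebra ℂ A] (ρ : A × A × A)
    (T V : ℕ → A × A × A) (h0 : V 0 = ρ) (h : ∀ n, V (n + 1) = T n) (j : ℕ) :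
    ∑ p ∈ antidiagonal (j + 1), nahmQ (V p.1) (V p.2) = nahmL ρ (T j) + nahmF T j := by
  rw [nahmL_apply]
  cases j with
  | zero =>
    rw [show Finset.HasAntidiagonal.antidiagonal (0 + 1) = {(0, 1), (1, 0)} from rfl,
      Finset.sum_pair (by simp)]
    aesop
  | succ j =>
    rw [Finset.Nat.antidiagonal_succ_succ', sum_cons, sum_cons, Finset.sum_map]
    change nahmQ (V 0) (V (j + 1 + 1)) + (nahmQ (V (j + 1 + 1)) (V 0) +
      ∑ p ∈ antidiagonal j, nahmQ (V (p.1 + 1)) (V (p.2 + 1))) = _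
    rw [h, h0, ← add_assoc]
    aesop

/-- The obstruction to solving the recursion at a resonance vanishes, because the traces of the
powers of the Lax matrix are conserved. -/
theorem resonance_nahmF {T : ℕ → Mat³ k} {m : ℕ}
    (hT : ∀ n < m, (n : ℂ) • T n = nahmL (principalT k) (T n) + nahmF T n) (ζ : ℂ) :
    resonance m ζ (nahmF T m) = 0 := by
  -- the truncated solution, multiplied by `t`
  let T' : ℕ → Mat³ k := fun n => if n < m then T n else 0
  let V : ℕ → Mat³ k := fun n => if n = 0 then principalT k else T' (n - 1)
  have hV0 : V 0 = principalT k := if_pos rfl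
  have hV : ∀ n, V (n + 1) = T' n := fun n => if_neg (succ_ne_zero n)
  have hT' : ∀ n < m, T' n = T n := fun n hn => if_pos hn
  have hTm : ∀ n, m ≤ n → T' n = 0 := fun n hn => if_neg (not_lt.2 hn)
  let toPoly : (ℕ → Mat k) → Polynomial (Mat k) := fun f =>
    ∑ n ∈ Finset.range (m + 1), Polynomial.monomial n (f n)
  have hpoly : ∀ f : ℕ → Mat k, (∀ n, m < n → f n = 0) → ∀ n, (toPoly f).coeff n = f n := by
    intro f hf n
    rw [Polynomial.finsetSum_coeff]
    simp only [Polynomial.coeff_monomial, Finset.sum_ite_eq', Finset.mem_range]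
    grind
  have hVm : ∀ n, m < n → V n = 0 := by grind
  let P : Polynomial (Mat k) × Polynomial (Mat k) × Polynomial (Mat k) :=
    (toPoly fun n => (V n).1, toPoly fun n => (V n).2.1, toPoly fun n => (V n).2.2)
  have hP : ∀ n, coeffTriple n P = V n := fun n => by
    simp only [coeffTriple, P]
    rw [hpoly, hpoly, hpoly] <;> intro n hn <;> rw [hVm n hn] <;> rfl
  set B := laxEv ζ P with hB
  set M := laxM ζ P with hM
  -- the defect of the truncated solution
  have hY : ∀ n, n ≤ m + 1 → (X * derivative B - B - (B * M - M * B)).coeff n =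
        if n = m + 1 then -laxEv ζ (nahmF T m) else 0 := by
    intro n hn
    rw [((laxEv_nahmQ_self ζ P).symm), coeff_sub, coeff_sub, hB, coeff_laxEv, coeff_laxEv,
      coeffTriple_nahmQ]
    simp only [hP]
    cases n with
    | zero =>
      rw [mul_coeff_zero, Polynomial.coeff_X_zero, zero_mul, zero_sub,
        show antidiagonal 0 = {((0 : ℕ), (0 : ℕ))} from rfl,
        Finset.sum_singleton, hV0, nahmQ_principalT,
        if_neg (succ_ne_zero m).symm, ← neg_one_smul ℂ (principalT k), laxEv_smul,
        neg_one_smul, sub_self]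
    | succ n =>
      rw [coeff_X_mul, coeff_derivative, coeff_laxEv, hP, sum_antidiagonal_nahmQ _ T' V hV0 hV, hV]
      have e : laxEv ζ (T' n) * ((n : Mat k) + 1) - laxEv ζ (T' n) = laxEv ζ ((n : ℂ) • T' n) := by
        rw [laxEv_smul, mul_add, mul_one, add_sub_cancel_right, ← Nat.cast_smul_eq_nsmul ℂ n
          (1 : Mat k) |>.trans (nsmul_one n), mul_smul_comm, mul_one]
      rw [e, ← laxEv_sub, nahmF_congr (T' := T) fun j hj => hT' j (by omega)]
      by_cases h : n = m
      · subst h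
        rw [if_pos rfl, hTm n le_rfl, smul_zero, map_zero, zero_add, zero_sub,
          ← neg_one_smul ℂ, laxEv_smul, neg_one_smul]
      · rw [if_neg (by omega), hT' n (by omega), hT n (by omega), sub_self, laxEv_zero]
  obtain ⟨Y, hYd⟩ : X ^ (m + 1) ∣ X * derivative B - B - (B * M - M * B) :=
    Polynomial.X_pow_dvd_iff.2 fun d hd => by rw [hY d hd.le, if_neg hd.ne]
  have hY0 : Y.coeff 0 = -laxEv ζ (nahmF T m) := by
    have h1 := hY (m + 1) le_rfl
    rw [hYd, if_pos rfl] at h1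
    have h2 := coeff_X_pow_mul Y (m + 1) 0
    rw [zero_add] at h2
    rw [← h2, h1]
  obtain ⟨W, hW, hi⟩ := exists_derivative_pow_eq (m := m) (M := M) (Y := Y)
    (sub_eq_iff_eq_add'.1 hYd) m
  have h1 := hi 0
  rw [pow_zero, one_mul, zero_add, hY0, hB, coeff_laxEv, hP, hV0, mul_neg, trace_neg] at h1
  have h2 := congrArg (fun p : Polynomial (Mat k) => (p.coeff (m + 1)).trace) hW
  simp only [coeff_sub, coeff_add, trace_sub, trace_add] at h2
  have h3 := coeff_X_pow_mul W (m + 1) 0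
  rw [zero_add] at h3
  rw [trace_coeff_mul_comm (m + 1) (B ^ (m + 1)) M, sub_self, zero_add, h3, h1,
    coeff_X_mul, coeff_derivative, coeff_smul] at h2
  have h4 : (B ^ (m + 1)).coeff (m + 1) * ((m : Mat k) + 1) =
      (m + 1) • (B ^ (m + 1)).coeff (m + 1) := by
    rw [nsmul_eq_mul', Nat.cast_add, Nat.cast_one]
  rw [h4, sub_self] at h2
  have h5 : ((m : ℂ) + 1) * resonance m ζ (nahmF T m) = 0 := by
    rw [resonance, principalR]
    linear_combination h2
  exact (mul_eq_zero.1 h5).resolve_left (Nat.cast_add_one_ne_zero m)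

/-! ### Convergence of the formal solutions -/

theorem norm_nahmQ_le (X Y : Mat³ k) : ‖nahmQ X Y‖ ≤ 4 * ‖X‖ * ‖Y‖ := by
  have h : ∀ p q : Mat k, ‖p‖ ≤ ‖X‖ → ‖q‖ ≤ ‖Y‖ → ‖p * q - q * p‖ ≤ 2 * (‖X‖ * ‖Y‖) := by
    intro p q hp hq
    have h1 := norm_mul_le p q
    have h2 := norm_mul_le q p
    have h3 := norm_sub_le (p * q) (q * p)
    have h4 := mul_le_mul hp hq (norm_nonneg _) (norm_nonneg _)
    nlinarith
  have hX1 := norm_fst_le X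
  have hY3 := (norm_snd_le Y.2).trans (norm_snd_le Y)
  have h0 : 0 ≤ ‖X‖ * ‖Y‖ := by positivity
  refine norm_prod_le_iff.2 ⟨?_, norm_prod_le_iff.2 ⟨?_, ?_⟩⟩ <;>
    simp only [nahmQ, norm_neg, norm_smul, norm_ofNat] <;>
    linarith [h _ _ ((norm_fst_le X.2).trans (norm_snd_le X)) hY3, h _ _ hX1 ((norm_fst_le
      Y.2).trans (norm_snd_le Y)), h _ _ hX1 hY3]

theorem norm_nahmL_le (ρ X : Mat³ k) : ‖nahmL ρ X‖ ≤ 8 * ‖ρ‖ * ‖X‖ := by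
  rw [nahmL_apply]
  linarith [norm_add_le (nahmQ ρ X) (nahmQ X ρ), norm_nahmQ_le ρ X, norm_nahmQ_le X ρ]

/-- The coefficients of a formal solution grow at most geometrically: the factor `n` dominates the
linear part and the number of terms of the quadratic part. -/
theorem exists_bound_of_recursion (ρ : Mat³ k) {T : ℕ → Mat³ k}
    (hT : ∀ n : ℕ, (n : ℂ) • T n = nahmL ρ (T n) + nahmF T n) :
    ∃ K > 0, ∃ r > 0, ∀ n, ‖T n‖ ≤ K * r ^ n := by
  set Λ := 8 * ‖ρ‖ with hΛ
  obtain ⟨N, hN⟩ := exists_nat_gt (2 * Λ)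
  set K := 1 + ∑ n ∈ Finset.range N, ‖T n‖ with hK
  have hK0 : 1 ≤ K := by
    have : 0 ≤ ∑ n ∈ Finset.range N, ‖T n‖ := sum_nonneg fun _ _ => norm_nonneg _
    linarith
  refine ⟨K, by linarith, 8 * K, by linarith, fun n => ?_⟩
  induction n using Nat.strong_induction_on with
  | _ n ih =>
    by_cases hn : n < N
    · have h1 : ‖T n‖ ≤ K := by
        have := Finset.single_le_sum (f := fun n => ‖T n‖) (fun _ _ => norm_nonneg _)
          (Finset.mem_range.2 hn)
        linarith
      have h2 : (1 : ℝ) ≤ (8 * K) ^ n := one_le_pow₀ (by linarith)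
      nlinarith
    · obtain ⟨j, rfl⟩ : ∃ j, n = j + 1 := ⟨n - 1, by
        have : (0 : ℝ) < N := lt_of_le_of_lt (by positivity) hN
        have : 0 < N := by exact_mod_cast this
        omega⟩
      have h1 : ‖nahmF T (j + 1)‖ ≤ (j + 1) * (4 * K ^ 2 * (8 * K) ^ j) := by
        refine (norm_sum_le _ _).trans ?_
        have : ∀ p ∈ antidiagonal j, ‖nahmQ (T p.1) (T p.2)‖ ≤ 4 * K ^ 2 * (8 * K) ^ j := by
          intro p hp
          have hp' := mem_antidiagonal.1 hp
          have h1 := ih p.1 (by omega)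
          have h2 := ih p.2 (by omega)
          calc ‖nahmQ (T p.1) (T p.2)‖ ≤ 4 * ‖T p.1‖ * ‖T p.2‖ := norm_nahmQ_le _ _
            _ ≤ 4 * (K * (8 * K) ^ p.1) * (K * (8 * K) ^ p.2) := by gcongr
            _ = 4 * K ^ 2 * (8 * K) ^ j := by rw [← hp', pow_add]; ring
        refine (sum_le_sum this).trans ?_
        simp
      have h2 : ((j : ℝ) + 1) * ‖T (j + 1)‖ ≤ Λ * ‖T (j + 1)‖ +
          (j + 1) * (4 * K ^ 2 * (8 * K) ^ j) := by
        have h3 : ((j : ℝ) + 1) * ‖T (j + 1)‖ = ‖((j + 1 : ℕ) : ℂ) • T (j + 1)‖ := by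
          rw [norm_smul, Complex.norm_natCast]; push_cast; ring
        rw [h3, hT]
        exact (norm_add_le _ _).trans (add_le_add (norm_nahmL_le ρ _) h1)
      have h4 : Λ ≤ ((j : ℝ) + 1) / 2 := by
        have : (N : ℝ) ≤ (j : ℝ) + 1 := by exact_mod_cast not_lt.1 hn
        linarith
      have h5 : Λ * ‖T (j + 1)‖ ≤ ((j : ℝ) + 1) / 2 * ‖T (j + 1)‖ := by gcongr
      have h6 : ((j : ℝ) + 1) / 2 * ‖T (j + 1)‖ ≤ ((j : ℝ) + 1) / 2 * (K * (8 * K) ^ (j + 1)) := by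
        rw [pow_succ]
        linarith
      nlinarith

theorem hasSum_nahmQ {u : ℕ → Mat³ k} (hu : Summable fun n => ‖u n‖) :
    HasSum (fun n => ∑ p ∈ antidiagonal n, nahmQ (u p.1) (u p.2))
      (nahmQ (∑' n, u n) (∑' n, u n)) := by
  have hs : Summable u := hu.of_norm
  -- `Q` is a componentwise commutator in the product ring, after permuting components
  let σ : Mat³ k →L[ℝ] Mat³ k :=
    ⟨⟨⟨fun X => (X.2.1, X.1, X.1), fun _ _ => rfl⟩, fun _ _ => rfl⟩, by dsimp; fun_prop⟩
  let τ : Mat³ k →L[ℝ] Mat³ k :=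
    ⟨⟨⟨fun X => (X.2.2, X.2.1, X.2.2), fun _ _ => rfl⟩, fun _ _ => rfl⟩, by dsimp; fun_prop⟩
  have hQ : ∀ X Y, nahmQ X Y = (-1, (-2 : ℂ) • 1, (2 : ℂ) • 1) * (σ X * τ Y - τ Y * σ X) := by
    simp [nahmQ, σ, τ]
  have hle : ∀ f : Mat³ k →L[ℝ] Mat³ k, (∀ X, ‖f X‖ ≤ ‖X‖) → Summable fun n => ‖f (u n)‖ :=
    fun f h => .of_nonneg_of_le (fun _ => norm_nonneg _) (fun n => h (u n)) hu
  have hσ := hle σ fun X => by simp [σ, Prod.norm_def]; grind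
  have hτ := hle τ fun X => by simp [τ, Prod.norm_def]
  have h1 := (summable_norm_sum_mul_antidiagonal_of_summable_norm hσ hτ).of_norm.hasSum
  have h2 := (summable_norm_sum_mul_antidiagonal_of_summable_norm hτ hσ).of_norm.hasSum
  rw [← tsum_mul_tsum_eq_tsum_sum_antidiagonal_of_summable_norm hσ hτ] at h1
  rw [← tsum_mul_tsum_eq_tsum_sum_antidiagonal_of_summable_norm hτ hσ] at h2
  rw [hQ, σ.map_tsum hs, τ.map_tsum hs]
  refine ((h1.sub h2).mul_left _).congr_fun fun n => ?_
  rw [← Finset.Nat.sum_antidiagonal_swap (f := fun p => τ (u p.1) * σ (u p.2)),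
    ← sum_sub_distrib, mul_sum]
  simp only [hQ]
  rfl

theorem norm_pow_smul_le {E : Type*} [NormedAddCommGroup E] [NormedSpace ℂ E] {T : ℕ → E}
    {K r : ℝ} (hr : 0 < r) (hb : ∀ n, ‖T n‖ ≤ K * r ^ n) {z : ℂ} (hz : ‖z‖ < (2 * r)⁻¹)
    (N n : ℕ) : ‖z ^ n • T (n + N)‖ ≤ K * r ^ N * (1 / 2) ^ n := by
  rw [norm_smul, norm_pow]
  have h0 : (2 * r)⁻¹ * r = 1 / 2 := by field_simp
  calc ‖z‖ ^ n * ‖T (n + N)‖ ≤ (2 * r)⁻¹ ^ n * (K * r ^ (n + N)) := by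
        gcongr
        exact hb _
    _ = K * r ^ N * ((2 * r)⁻¹ * r) ^ n := by rw [mul_pow, pow_add]; ring
    _ = _ := by rw [h0]

theorem hasDerivAt_tsum_pow_smul {E : Type*} [NormedAddCommGroup E] [NormedSpace ℂ E]
    [CompleteSpace E] {T : ℕ → E} {K r : ℝ} (hr : 0 < r) (hb : ∀ n, ‖T n‖ ≤ K * r ^ n) {z : ℂ}
    (hz : ‖z‖ < (2 * r)⁻¹) {D : E}
    (hD : HasSum (fun n : ℕ => (((n : ℂ) + 1) * z ^ n) • T (n + 1)) D) :
    HasDerivAt (fun z : ℂ => ∑' n : ℕ, z ^ n • T n) D z := by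
  have hg : ∀ (n : ℕ) (y : ℂ),
      HasDerivAt (fun y : ℂ => y ^ n • T n) (((n : ℂ) * y ^ (n - 1)) • T n) y := fun n y =>
    (hasDerivAt_pow n y).smul_const (T n)
  have hu : Summable fun n : ℕ => 2 * K * r * ((n : ℝ) ^ 1 * (1 / 2 : ℝ) ^ n) := by
    have h2 : ‖(1 / 2 : ℝ)‖ < 1 := by norm_num
    exact Summable.mul_left _ (summable_pow_mul_geometric_of_norm_lt_one (R := ℝ) 1 h2)
  have hs : Summable fun n : ℕ => z ^ n • T n :=
    Summable.of_norm_bounded (summable_geometric_two.mul_left (K * r ^ 0))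
      fun n => norm_pow_smul_le hr hb hz 0 n
  have hu' : ∀ n : ℕ, ∀ y ∈ ball (0 : ℂ) (2 * r)⁻¹,
      ‖((n : ℂ) * y ^ (n - 1)) • T n‖ ≤ 2 * K * r * ((n : ℝ) ^ 1 * (1 / 2 : ℝ) ^ n) := by
    intro n y hy
    cases n with
    | zero => simp
    | succ n =>
      have h1 := norm_pow_smul_le hr hb (mem_ball_zero_iff.1 hy) 1 n
      rw [add_tsub_cancel_right, mul_smul, norm_smul, Complex.norm_natCast]
      rw [pow_one] at h1
      calc ((n + 1 : ℕ) : ℝ) * ‖y ^ n • T (n + 1)‖ ≤ ((n + 1 : ℕ) : ℝ) * (K * r * (1 / 2) ^ n) :=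
            mul_le_mul_of_nonneg_left h1 (cast_nonneg _)
        _ = 2 * K * r * (((n + 1 : ℕ) : ℝ) ^ 1 * (1 / 2 : ℝ) ^ (n + 1)) := by
            rw [pow_one, pow_succ]; ring
  have hd : HasDerivAt (fun z : ℂ => ∑' n : ℕ, z ^ n • T n)
      (∑' n : ℕ, ((n : ℂ) * z ^ (n - 1)) • T n) z := by
    exact hasDerivAt_tsum_of_isPreconnected (t := ball (0 : ℂ) (2 * r)⁻¹) (y₀ := z)
      hu Metric.isOpen_ball (convex_ball (0 : ℂ) _).isPreconnected (fun n y _ => hg n y)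
      hu' (mem_ball_zero_iff.2 hz) hs (mem_ball_zero_iff.2 hz)
  have h1 : HasSum (fun n : ℕ => ((n : ℂ) * z ^ (n - 1)) • T n) D := by
    refine (hasSum_nat_add_iff' (f := fun n : ℕ => ((n : ℂ) * z ^ (n - 1)) • T n) 1).1 ?_
    simpa using hD
  rwa [h1.tsum_eq] at hd

/-- The formal solutions converge. -/
theorem exists_series_solution (ρ : Mat³ k) {T : ℕ → Mat³ k}
    (hT : ∀ n : ℕ, (n : ℂ) • T n = nahmL ρ (T n) + nahmF T n) :
    ∃ δ > 0, ∃ S U : ℂ → Mat³ k,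
      (∀ z ∈ ball (0 : ℂ) δ, HasDerivAt S (nahmL ρ (U z) + nahmQ (S z) (S z)) z ∧
        S z = T 0 + z • U z) ∧
      ∀ N : ℕ, ∃ C, ∀ z ∈ ball (0 : ℂ) δ,
        ‖S z - ∑ j ∈ Finset.range N, z ^ j • T j‖ ≤ C * ‖z‖ ^ N := by
  obtain ⟨K, hK, r, hr, hb⟩ := exists_bound_of_recursion ρ hT
  have hpow : ∀ z ∈ ball (0 : ℂ) (2 * r)⁻¹, ∀ (N n : ℕ),
      ‖z ^ n • T (n + N)‖ ≤ K * r ^ N * (1 / 2) ^ n := fun z hz =>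
    norm_pow_smul_le hr hb (mem_ball_zero_iff.1 hz)
  have hsum : ∀ z ∈ ball (0 : ℂ) (2 * r)⁻¹, ∀ N : ℕ, Summable fun n => ‖z ^ n • T (n + N)‖ :=
    fun z hz N => Summable.of_nonneg_of_le (fun _ => norm_nonneg _) (hpow z hz N)
      (summable_geometric_two.mul_left _)
  have hsplit : ∀ z ∈ ball (0 : ℂ) (2 * r)⁻¹, ∀ N : ℕ, ∑' n, z ^ n • T n =
      ∑ j ∈ Finset.range N, z ^ j • T j + z ^ N • ∑' n, z ^ n • T (n + N) := by
    intro z hz N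
    have h0 := (hsum z hz 0).of_norm.sum_add_tsum_nat_add N
    simp only [add_zero] at h0
    refine h0.symm.trans (congrArg _ (Eq.trans (tsum_congr fun n => ?_) ((hsum z hz
      N).of_norm.tsum_const_smul (z ^ N))))
    rw [smul_smul, ← pow_add, add_comm N n]
  refine ⟨(2 * r)⁻¹, by positivity, fun z => ∑' n, z ^ n • T n, fun z => ∑' n, z ^ n • T (n + 1),
    fun z hz => ⟨?_, ?_⟩, fun N => ⟨K * r ^ N * 2, fun z hz => ?_⟩⟩
  · refine hasDerivAt_tsum_pow_smul hr hb (mem_ball_zero_iff.1 hz) ?_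
    have hs1 : HasSum (fun n => nahmL ρ (z ^ n • T (n + 1))) (nahmL ρ (∑' n, z ^ n • T (n + 1))) :=
      (hsum z hz 1).of_norm.hasSum.map (nahmL ρ)
        (AddMonoidHomClass.continuous_of_bound (nahmL ρ) _ (norm_nahmL_le ρ))
    refine (hs1.add (hasSum_nahmQ (hsum z hz 0))).congr_fun fun n => ?_
    rw [mul_comm, mul_smul, ← Nat.cast_succ, hT (n + 1), smul_add, ← map_smul]
    refine congrArg _ ?_
    rw [nahmF, smul_sum]
    refine sum_congr rfl fun p hp => ?_
    rw [nahmQ_smul_left, nahmQ_smul_right, smul_smul, ← pow_add, mem_antidiagonal.1 hp]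
    rfl
  · simpa using hsplit z hz 1
  · beta_reduce
    rw [hsplit z hz N, add_sub_cancel_left, norm_smul, norm_pow, mul_comm]
    gcongr
    exact tsum_of_norm_bounded (hasSum_geometric_two.mul_left _) (hpow z hz N)

/-! ### Solutions are meromorphic at their poles -/

section Singular

open Asymptotics

theorem rpow_isBigO_natPow_smul {E : Type*} [NormedAddCommGroup E] [NormedSpace ℂ E] {a : ℝ} {j : ℕ}
    (h : a ≤ j) (X : E) :
    (fun t : ℝ => (t : ℂ) ^ j • X) =O⁺ a := by
  refine isBigO_of_bound (C := ‖X‖) one_pos fun t ht => ?_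
  rw [norm_smul, norm_pow, norm_real, norm_of_nonneg ht.1.le, mul_comm, ← rpow_natCast]
  exact mul_le_mul_of_nonneg_left (Real.rpow_le_rpow_of_exponent_ge ht.1 ht.2.le h) (norm_nonneg _)

/-- A solution of `‖u'‖ ≤ (Λ / t) ‖u‖` that vanishes to order larger than `Λ` is zero. -/
theorem eventually_eq_zero_of_singular_ode {E : Type*} [NormedAddCommGroup E] [NormedSpace ℝ E]
    {u u' : ℝ → E} {Λ κ : ℝ} (hΛ : 0 < Λ) (hκ : Λ < κ)
    (hd : ∀ᶠ t in 𝓝[>] (0 : ℝ), HasDerivAt u (u' t) t)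
    (hb : ∀ᶠ t in 𝓝[>] (0 : ℝ), ‖u' t‖ ≤ Λ / t * ‖u t‖)
    (hu : u =O⁺ κ) : ∀ᶠ t in 𝓝[>] (0 : ℝ), u t = 0 := by
  obtain ⟨C, hC, δ, hδ, -, h⟩ := exists_bound_of_isBigO hu (hd.and hb)
  have hκ0 : 0 < κ := hΛ.trans hκ
  have key : ∀ n : ℕ, ∀ t ∈ Ioo (0 : ℝ) δ, ‖u t‖ ≤ C * (Λ / κ) ^ n * t ^ κ := by
    intro n
    induction n with
    | zero => intro t ht; simpa using (h t ht).2
    | succ n ih =>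
      intro t ht
      have h1 : ∀ s ∈ Ioo (0 : ℝ) t, ‖u t - u s‖ ≤ C * (Λ / κ) ^ (n + 1) * t ^ κ := by
        intro s hs
        have h2 := norm_sub_le_rpow (u := u) (u' := u') (C := Λ * (C * (Λ / κ) ^ n)) hκ0.ne' hs.1
          hs.2.le (fun r hr => (h r ⟨hs.1.trans_le hr.1, hr.2.trans_lt ht.2⟩).1.1) (fun r hr => by
            have hr0 : r ∈ Ioo (0 : ℝ) δ := ⟨hs.1.trans_le hr.1, hr.2.trans_lt ht.2⟩
            refine (h r hr0).1.2.trans ((mul_le_mul_of_nonneg_left (ih r hr0)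
              (div_nonneg hΛ.le hr0.1.le)).trans (le_of_eq ?_))
            rw [Real.rpow_sub_one hr0.1.ne']
            ring)
        refine h2.trans ?_
        have h3 : 0 ≤ s ^ κ := rpow_nonneg hs.1.le _
        calc Λ * (C * (Λ / κ) ^ n) / κ * (t ^ κ - s ^ κ) ≤ Λ * (C * (Λ / κ) ^ n) / κ * t ^ κ := by
              refine mul_le_mul_of_nonneg_left (by linarith) ?_
              positivity
          _ = _ := by rw [pow_succ]; ring
      have h4 : Tendsto (fun s => ‖u t - u s‖) (𝓝[>] 0) (𝓝 ‖u t - 0‖) :=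
        (tendsto_const_nhds.sub (tendsto_zero_of_isBigO_rpow hκ0 hu)).norm
      rw [sub_zero] at h4
      refine le_of_tendsto h4 ?_
      filter_upwards [Ioo_mem_nhdsGT ht.1] with s hs using h1 s hs
  filter_upwards [Ioo_mem_nhdsGT hδ] with t ht
  have h5 : Tendsto (fun n : ℕ => C * (Λ / κ) ^ n * t ^ κ) atTop (𝓝 (C * 0 * t ^ κ)) :=
    ((tendsto_pow_atTop_nhds_zero_of_lt_one (by positivity)
      ((div_lt_one hκ0).2 hκ)).const_mul C).mul_const _
  have h6 := ge_of_tendsto' h5 fun n => key n t ht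
  rw [mul_zero, zero_mul] at h6
  exact norm_le_zero_iff.1 h6

section Coordinates

variable {E : Type*} [NormedAddCommGroup E] [NormedSpace ℂ E] {ι : Type*}

theorem coord_apply_of_eigenbasis {e : Basis ι ℂ E} {L : E →ₗ[ℂ] E} {l : ι → ℝ}
    (he : ∀ i, L (e i) = (l i : ℂ) • e i) (i : ι) (X : E) :
    e.coord i (L X) = (l i : ℂ) * e.coord i X := by
  classical
  have h : (e.coord i).comp L = (l i : ℂ) • e.coord i := by
    refine e.ext fun j => ?_
    rw [LinearMap.comp_apply, he, map_smul, LinearMap.smul_apply, smul_eq_mul, smul_eq_mul,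
      Module.Basis.coord_apply, Module.Basis.repr_self, Finsupp.single_apply]
    split_ifs with hij
    · rw [hij]
    · simp
  exact LinearMap.congr_fun h X

theorem exists_solution_of_eigenbasis [Fintype ι] {e : Basis ι ℂ E} {L : E →ₗ[ℂ] E} {l : ι → ℝ}
    (he : ∀ i, L (e i) = (l i : ℂ) • e i) {n : ℕ} (hn : ∀ i, l i ≠ n) (F : E) :
    ∃ X, (n : ℂ) • X = L X + F := by
  refine ⟨∑ i, ((e.coord i F) / ((n : ℂ) - l i)) • e i, e.ext_elem fun i => ?_⟩
  have hc : ∀ Y, e.repr Y i = e.coord i Y := fun _ => rfl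
  have hs : e.coord i (∑ j, ((e.coord j F) / ((n : ℂ) - l j)) • e j) =
      (e.coord i F) / ((n : ℂ) - l i) := by
    rw [← hc, e.repr_sum_self]
  rw [hc, hc, map_smul, map_add, coord_apply_of_eigenbasis he, hs, smul_eq_mul]
  have : (n : ℂ) - l i ≠ 0 := fun h => hn i (by
    have := sub_eq_zero.1 h
    exact_mod_cast this.symm)
  field_simp
  ring

theorem isBigO_of_coord [Fintype ι] (e : Basis ι ℂ E) {u : ℝ → E} {g : ℝ → ℝ} {l : Filter ℝ}
    (h : ∀ i, (fun t => e.coord i (u t)) =O[l] g) : u =O[l] g := by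
  have h1 : u = fun t => ∑ i, e.coord i (u t) • e i := by
    funext t
    exact (e.sum_repr (u t)).symm
  have h2 : ∀ i, (fun t => e.coord i (u t) • e i) =O[l] g := fun i => by
    refine IsBigO.trans (g := fun t => e.coord i (u t))
      (IsBigO.of_bound ‖e i‖ (Eventually.of_forall fun t => ?_)) (h i)
    rw [norm_smul, mul_comm]
  rw [h1]
  exact IsBigO.fun_sum fun i _ => h2 i

variable [FiniteDimensional ℂ E]

theorem isBigO_coord (e : Basis ι ℂ E) (i : ι) {u : ℝ → E} {g : ℝ → ℝ} {l : Filter ℝ}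
    (h : u =O[l] g) : (fun t => e.coord i (u t)) =O[l] g :=
  ((toContinuousLinearMap (e.coord i)).isBigO_comp u l).trans h

theorem hasDerivAt_coord {e : Basis ι ℂ E} {L : E →ₗ[ℂ] E} {l : ι → ℝ}
    (he : ∀ i, L (e i) = (l i : ℂ) • e i) (i : ι) {u : ℝ → E} {w : E}
    (h : HasDerivAt u (t⁻¹ • (L (u t) + w)) t) : HasDerivAt (fun t => e.coord i (u t))
      (t⁻¹ • (l i • e.coord i (u t) + e.coord i w)) t := by
  refine (((toContinuousLinearMap (e.coord i)).restrictScalars ℝ).hasFDerivAt.comp_hasDerivAt t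
    h).congr_deriv ?_
  change e.coord i (t⁻¹ • _) = _
  rw [← coe_smul, map_smul, coe_smul, map_add, coord_apply_of_eigenbasis he, ← coe_smul (l i),
    smul_eq_mul]

variable [Fintype ι]

/-- One step of the expansion at a pole: solutions of `t u' = (L - m) u + F + O(√t)` that are
`O(1 / √t)` have a limit, provided that there is no resonance. -/
theorem exists_limit_of_eigenbasis {e : Basis ι ℂ E} {L : E →ₗ[ℂ] E} {l : ι → ℝ}
    (he : ∀ i, L (e i) = (l i : ℂ) • e i) (hl : ∀ i, l i ≤ -1 ∨ ∃ m : ℕ, l i = m) (m : ℕ)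
    {u f : ℝ → E} {F : E} (hF : ∀ i, l i = m → e.coord i F = 0)
    (hd : ∀ᶠ t in 𝓝[>] (0 : ℝ), HasDerivAt u (t⁻¹ • (L (u t) - (m : ℂ) • u t + F + f t)) t)
    (hf : f =O⁺ (1 / 2))
    (hu : u =O⁺ (-1 / 2)) :
    ∃ X, (m : ℂ) • X = L X + F ∧ (fun t => u t - X) =O⁺ (1 / 2) := by
  have key : ∀ i, ∃ x : ℂ, (m : ℂ) * x = l i * x + e.coord i F ∧
      (fun t => e.coord i (u t) - x) =O⁺ (1 / 2) := by
    intro i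
    have hfi := isBigO_coord e i hf
    have hdi : ∀ᶠ t in 𝓝[>] (0 : ℝ), HasDerivAt (fun t => e.coord i (u t))
        (t⁻¹ • ((l i - m : ℝ) • e.coord i (u t) + e.coord i F + e.coord i (f t))) t := by
      filter_upwards [hd] with t ht
      refine (hasDerivAt_coord he i (w := F + f t - (m : ℂ) • u t)
        (ht.congr_deriv (by congr 1; abel))).congr_deriv ?_
      rw [map_sub, map_add, map_smul, ← coe_smul (l i), ← coe_smul (l i - m)]
      push_cast
      congr 1
      simp only [smul_eq_mul]
      ring
    -- at a resonance the inhomogeneity vanishes by `hF`; otherwise `x` is a stationary point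
    by_cases hlm : l i = m
    · have hFi := hF i hlm
      obtain ⟨x, hx⟩ := exists_limit_of_deriv_isBigO (μ := 1 / 2) (by norm_num) hdi (by
        simp only [hlm, hFi, sub_self, zero_smul, zero_add, add_zero]
        have := isBigO_rpow_smul (ν := -1) hfi
        refine (this.congr' ?_ EventuallyEq.rfl).trans (by norm_num; exact isBigO_refl _ _)
        filter_upwards with t
        rw [rpow_neg_one])
      exact ⟨x, by rw [hFi, hlm, add_zero]; norm_cast, hx⟩
    · have hνc : (l i : ℂ) - m ≠ 0 := by exact_mod_cast (sub_ne_zero.2 hlm)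
      set x : ℂ := -(e.coord i F) / ((l i : ℂ) - m) with hx
      have hx1 : ((l i : ℂ) - m) * x = -(e.coord i F) := by rw [hx]; field_simp
      have hdx : ∀ᶠ t in 𝓝[>] (0 : ℝ), HasDerivAt (fun t => e.coord i (u t) - x)
          (t⁻¹ • ((l i - m : ℝ) • (e.coord i (u t) - x) + e.coord i (f t))) t := by
        filter_upwards [hdi] with t ht
        refine (ht.sub_const x).congr_deriv ?_
        congr 1
        rw [← coe_smul (l i - m), ← coe_smul (l i - m), smul_eq_mul, smul_eq_mul]
        push_cast
        linear_combination hx1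
      refine ⟨x, by linear_combination -hx1, ?_⟩
      -- no solution `t ^ (l i - m)` is `O(1 / √t)` without being `O(√t)`
      have hge : l i - m ≤ -1 ∨ 1 ≤ l i - m := by
        rcases hl i with h | ⟨n, hn⟩
        · left
          linarith [m.cast_nonneg (α := ℝ)]
        · rw [hn] at hlm ⊢
          have : (n : ℤ) - m ≤ -1 ∨ 1 ≤ (n : ℤ) - m := by
            have : n ≠ m := by exact_mod_cast hlm
            omega
          exact_mod_cast this
      rcases hge with h | h
      · refine isBigO_of_singular_ode_of_lt (κ := -1 / 2) hdx hfi ((isBigO_coord e i hu).sub ?_)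
          (by linarith)
          (by linarith)
        have := rpow_isBigO_natPow_smul (j := 0) (a := -1 / 2) (by norm_num) x
        simpa using this
      · exact isBigO_of_singular_ode_of_gt hdx hfi (by linarith)
  choose x hx hO using key
  have hcs : ∀ i, e.coord i (∑ j, x j • e j) = x i := fun i => by
    rw [Module.Basis.coord_apply, e.repr_sum_self]
  refine ⟨∑ i, x i • e i, e.ext_elem fun i => ?_, isBigO_of_coord e fun i => ?_⟩
  · change e.coord i _ = e.coord i _
    rw [map_smul, map_add, coord_apply_of_eigenbasis he, hcs, smul_eq_mul, hx]
  · simpa only [map_sub, hcs] using hO i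

/-- Away from the eigenvalues, solutions of `t u' = L u + f` inherit the decay of `f`. -/
theorem isBigO_of_eigenbasis {e : Basis ι ℂ E} {L : E →ₗ[ℂ] E} {l : ι → ℝ}
    (he : ∀ i, L (e i) = (l i : ℂ) • e i) {κ μ : ℝ} (hl : ∀ i, (l i < κ ∧ l i < μ) ∨ μ < l i)
    {u f : ℝ → E}
    (hd : ∀ᶠ t in 𝓝[>] (0 : ℝ), HasDerivAt u (t⁻¹ • (L (u t) + f t)) t)
    (hf : f =O⁺ μ) (hu : u =O⁺ κ) :
    u =O⁺ μ := by
  refine isBigO_of_coord e fun i => ?_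
  have hdi : ∀ᶠ t in 𝓝[>] (0 : ℝ), HasDerivAt (fun t => e.coord i (u t))
      (t⁻¹ • (l i • e.coord i (u t) + e.coord i (f t))) t := by
    exact hd.mono fun t ht => hasDerivAt_coord he i ht
  rcases hl i with h | h
  · exact isBigO_of_singular_ode_of_lt hdi (isBigO_coord e i hf) (isBigO_coord e i hu) h.1 h.2
  · exact isBigO_of_singular_ode_of_gt hdi (isBigO_coord e i hf) h

end Coordinates

end Singular

section Poles

open Asymptotics

theorem exists_eigenbasis_principalT (k : ℕ) :
    ∃ (n : ℕ) (e : Basis (Fin n) ℂ (Mat³ k)) (l : Fin n → ℝ),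
      (∀ i, nahmL (principalT k) (e i) = (l i : ℂ) • e i) ∧
      ∀ i, l i ≤ -1 ∨ ∃ m : ℕ, l i = m := by
  obtain ⟨n, e, l, h⟩ := exists_eigenbasis (nahmCore k) (nahmL (principalT k)) nahmL_symmetric
  refine ⟨n, e, l, h, fun i => ?_⟩
  rcases le_or_gt (l i) (-1) with h1 | h1
  · exact Or.inl h1
  · exact Or.inr (eq_natCast_of_eigenvalue h1 (e.ne_zero i) (h i))

/-- The components of the inhomogeneity along the resonant directions vanish as soon as the
conserved quantities do. -/
theorem coord_eq_zero_of_resonance {n : ℕ} {e : Basis (Fin n) ℂ (Mat³ k)}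
    {l : Fin n → ℝ} (he : ∀ i, nahmL (principalT k) (e i) = (l i : ℂ) • e i) {m : ℕ}
    {F : Mat³ k} (hF : ∀ ζ, resonance m ζ F = 0) (i : Fin n) (hi : l i = m) :
    e.coord i F = 0 := by
  classical
  -- the component of `F` in the eigenspace for the eigenvalue `m`
  set X := ∑ j, (if l j = m then e.coord j F else 0) • e j with hX
  have hX0 : X = 0 := by
    refine eq_zero_of_resonance (m := m) ?_ fun ζ => ?_
    · rw [hX, map_sum, smul_sum]
      refine sum_congr rfl fun j _ => ?_
      rw [map_smul, he, smul_comm]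
      aesop
    · let φ : (Mat³ k) →ₗ[ℂ] ℂ :=
        { toFun := resonance m ζ, map_add' := resonance_add m ζ, map_smul' := resonance_smul m ζ }
      have hφ : ∀ j, l j ≠ m → φ (e j) = 0 := by
        intro j hj
        have h1 : φ (nahmL (principalT k) (e j)) = m * φ (e j) := resonance_nahmL m ζ (e j)
        rw [he, map_smul, smul_eq_mul] at h1
        have h2 : ((l j : ℂ) - m) * φ (e j) = 0 := by linear_combination h1
        refine (mul_eq_zero.1 h2).resolve_left fun h => hj ?_
        have := sub_eq_zero.1 h
        exact_mod_cast this
      have h3 : φ F = φ X := by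
        conv_lhs => rw [← e.sum_repr F]
        rw [hX, map_sum, map_sum]
        refine sum_congr rfl fun j _ => ?_
        rw [map_smul, map_smul]
        aesop
      exact h3.symm.trans (hF ζ)
  have h4 : e.coord i X = e.coord i F := by
    rw [Module.Basis.coord_apply, hX, e.repr_sum_self, if_pos hi]
  rw [← h4, hX0, map_zero]

theorem nahmQ_isBigO {X Y : ℝ → Mat³ k} {a b : ℝ}
    (hX : X =O⁺ a) (hY : Y =O⁺ b) :
    (fun t => nahmQ (X t) (Y t)) =O⁺ (a + b) := by
  have h1 : (fun t => nahmQ (X t) (Y t)) =O[𝓝[>] (0 : ℝ)] fun t => ‖X t‖ * ‖Y t‖ := by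
    refine IsBigO.of_bound 4 (Eventually.of_forall fun t => ?_)
    rw [norm_mul, norm_norm, norm_norm, ← mul_assoc]
    exact norm_nahmQ_le _ _
  refine (h1.trans (hX.norm_left.mul hY.norm_left)).congr' EventuallyEq.rfl ?_
  filter_upwards [self_mem_nhdsWithin] with t ht
  rw [rpow_add ht]

theorem nahmQ_sub_nahmQ {A : Type*} [Ring A] [Algebra ℂ A] (X Y : A × A × A) :
    nahmQ X X - nahmQ Y Y = nahmQ (X - Y) X + nahmQ Y (X - Y) := by
  have h1 := nahmQ_add_left (X - Y) Y X
  have h2 := nahmQ_add_right Y (X - Y) Y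
  rw [sub_add_cancel] at h1 h2
  rw [h1, h2]
  abel

/-- The regular part of a solution with leading term `ρ / t`. -/
theorem hasDerivAt_sub_pole {T : ℝ → Mat³ k} (ht : 0 < t)
    (hT : HasDerivAt T (nahmQ (T t) (T t)) t) :
    HasDerivAt (fun t : ℝ => T t - (t : ℂ)⁻¹ • principalT k)
      (t⁻¹ • (nahmL (principalT k) (T t - (t : ℂ)⁻¹ • principalT k)
        + t • nahmQ (T t - (t : ℂ)⁻¹ • principalT k) (T t - (t : ℂ)⁻¹ • principalT k))) t := by
  have ht0 : (t : ℂ) ≠ 0 := by exact_mod_cast ht.ne'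
  have h1 : HasDerivAt (fun t : ℝ => (t : ℂ)⁻¹ • principalT k)
      ((-((t : ℂ) ^ 2)⁻¹) • principalT k) t :=
    ((_root_.hasDerivAt_inv ht0).comp_ofReal).smul_const _
  refine (hT.sub h1).congr_deriv ?_
  set R := T t - (t : ℂ)⁻¹ • principalT k with hR
  have h2 : T t = (t : ℂ)⁻¹ • principalT k + R := by rw [hR]; abel
  rw [h2, nahmQ_add_left, nahmQ_add_right, nahmQ_add_right, nahmQ_smul_left, nahmQ_smul_left,
    nahmQ_smul_right, nahmQ_smul_right, nahmQ_principalT, nahmL_apply, smul_add, smul_smul t⁻¹ t,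
    inv_mul_cancel₀ ht.ne', one_smul, ← coe_smul t⁻¹, ofReal_inv]
  module

/-- Sequences defined by a recursion in which the `n`-th term depends on the previous ones. -/
theorem exists_sequence {V : Type*} [Zero V] (G : (ℕ → V) → ℕ → V)
    (hG : ∀ n T T', (∀ j < n, T j = T' j) → G T n = G T' n) : ∃ T : ℕ → V, ∀ n, T n = G T n := by
  classical
  let T : ℕ → V := WellFounded.fix (C := fun _ => V) Nat.lt_wfRel.wf
    (fun n rec => G (fun j => if h : j < n then rec j h else 0) n)
  refine ⟨T, fun n => ?_⟩
  have h1 : T n = G (fun j => if _ : j < n then T j else 0) n := WellFounded.fix_eq _ _ n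
  grind

theorem sum_nahmQ_range {A : Type*} [Ring A] [Algebra ℂ A] (T : ℕ → A × A × A) (m : ℕ) (t : ℂ) :
    t • nahmQ (∑ j ∈ Finset.range m, t ^ j • T j) (∑ j ∈ Finset.range m, t ^ j • T j) =
      ∑ j ∈ Finset.range (m + 1), t ^ j • nahmF T j +
        ∑ p ∈ (Finset.range m ×ˢ Finset.range m).filter fun p => ¬ p.1 + p.2 < m,
          t ^ (p.1 + p.2 + 1) • nahmQ (T p.1) (T p.2) := by
  have h1 : t • nahmQ (∑ j ∈ Finset.range m, t ^ j • T j) (∑ j ∈ Finset.range m, t ^ j • T j) =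
      ∑ p ∈ Finset.range m ×ˢ Finset.range m,
          t ^ (p.1 + p.2 + 1) • nahmQ (T p.1) (T p.2) := by
    have hl : ∀ (s : Finset ℕ) (f : ℕ → A × A × A) (Y : A × A × A),
        nahmQ (∑ j ∈ s, f j) Y = ∑ j ∈ s, nahmQ (f j) Y := fun s f Y =>
      map_sum (AddMonoidHom.mk' (fun X => nahmQ X Y) fun X X' => nahmQ_add_left X X' Y) f s
    have hr : ∀ (s : Finset ℕ) (f : ℕ → A × A × A) (X : A × A × A),
        nahmQ X (∑ j ∈ s, f j) = ∑ j ∈ s, nahmQ X (f j) := fun s f X =>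
      map_sum (AddMonoidHom.mk' (fun Y => nahmQ X Y) fun Y Y' => nahmQ_add_right X Y Y') f s
    rw [hl, Finset.sum_product, smul_sum]
    refine sum_congr rfl fun i _ => ?_
    rw [hr, smul_sum]
    refine sum_congr rfl fun j _ => ?_
    rw [nahmQ_smul_left, nahmQ_smul_right, smul_smul, smul_smul]
    congr 1
    ring
  rw [h1, ← Finset.sum_filter_add_sum_filter_not _ fun p : ℕ × ℕ => p.1 + p.2 < m]
  congr 1
  rw [← Finset.sum_fiberwise_of_maps_to (t := Finset.range m) (g := fun p : ℕ × ℕ => p.1 + p.2)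
    fun p hp => Finset.mem_range.2 (mem_filter.1 hp).2, Finset.sum_range_succ']
  simp only [nahmF, smul_zero, add_zero]
  refine sum_congr rfl fun j hj => ?_
  have h2 : ((Finset.range m ×ˢ Finset.range m).filter fun p => p.1 + p.2 < m).filter
      (fun p => p.1 + p.2 = j) = Finset.HasAntidiagonal.antidiagonal j := by
    ext p
    have := Finset.mem_range.1 hj
    simp only [mem_filter, Finset.mem_product, Finset.mem_range,
      Finset.HasAntidiagonal.mem_antidiagonal]
    omega
  rw [h2, smul_sum]
  refine sum_congr rfl fun p hp => ?_
  grind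

theorem hasDerivAt_sum_pow_smul (T : ℕ → Mat³ k) (m : ℕ) (t : ℝ) :
    HasDerivAt (fun t : ℝ => ∑ j ∈ Finset.range m, (t : ℂ) ^ j • T j)
      (∑ j ∈ Finset.range m, ((j : ℂ) * (t : ℂ) ^ (j - 1)) • T j) t :=
  fun_sum fun j _ => ((hasDerivAt_pow j (t : ℂ)).comp_ofReal).smul_const (T j)

/-- Solutions with leading term `ρ / t` have an asymptotic expansion in powers of `t`: there are
no logarithms. -/
theorem exists_expansion {R : ℝ → Mat³ k}
    (hR : ∀ᶠ t in 𝓝[>] (0 : ℝ), HasDerivAt R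
      (t⁻¹ • (nahmL (principalT k) (R t) + t • nahmQ (R t) (R t))) t)
    (hO : R =O⁺ 0) (m : ℕ) :
    ∃ T : ℕ → Mat³ k,
      (∀ n < m, (n : ℂ) • T n = nahmL (principalT k) (T n) + nahmF T n) ∧
      (fun t => R t - ∑ j ∈ Finset.range m, (t : ℂ) ^ j • T j)
        =O⁺ ((m : ℝ) - 1 / 2) := by
  obtain ⟨d, e, l, he, hl⟩ := exists_eigenbasis_principalT k
  induction m with
  | zero =>
    refine ⟨fun _ => 0, fun n hn => absurd hn (Nat.not_lt_zero n), ?_⟩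
    simpa using hO.trans (rpow_isBigO_rpow (by norm_num))
  | succ m ih =>
    obtain ⟨T, hT, hE⟩ := ih
    set S : ℝ → Mat³ k := fun t => ∑ j ∈ Finset.range m, (t : ℂ) ^ j • T j with hS
    set G : ℝ → Mat³ k := fun t => nahmL (principalT k) (S t)
      - t • (∑ j ∈ Finset.range m, ((j : ℂ) * (t : ℂ) ^ (j - 1)) • T j) + t • nahmQ (R t) (R t)
      with hG
    have hSO : S =O⁺ 0 :=
      IsBigO.fun_sum fun j _ => rpow_isBigO_natPow_smul (cast_nonneg j) (T j)
    have hd : ∀ᶠ t in 𝓝[>] (0 : ℝ), HasDerivAt (fun t => R t - S t)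
        (t⁻¹ • (nahmL (principalT k) (R t - S t) + G t)) t := by
      filter_upwards [hR, self_mem_nhdsWithin] with t ht ht0
      refine (ht.sub (hasDerivAt_sum_pow_smul T m t)).congr_deriv ?_
      rw [hG, map_sub]
      simp only [smul_add, smul_sub, smul_smul t⁻¹ t, inv_mul_cancel₀ (ne_of_gt (mem_Ioi.1 ht0)),
        one_smul]
      abel
    -- by the recursion, the terms of `G` of order below `m` cancel
    have hGF : (fun t : ℝ => G t - (t : ℂ) ^ m • nahmF T m)
        =O⁺ ((m : ℝ) + 1 / 2) := by
      have e1 : (fun t : ℝ => G t - (t : ℂ) ^ m • nahmF T m) = fun t : ℝ =>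
          (∑ p ∈ (Finset.range m ×ˢ Finset.range m).filter fun p => ¬ p.1 + p.2 < m,
            (t : ℂ) ^ (p.1 + p.2 + 1) • nahmQ (T p.1) (T p.2)) +
          t • (nahmQ (R t - S t) (R t) + nahmQ (S t) (R t - S t)) := by
        funext t
        have h1 := sum_nahmQ_range T m (t : ℂ)
        rw [sum_range_succ] at h1
        have h2 : nahmL (principalT k) (S t)
            - t • (∑ j ∈ Finset.range m, ((j : ℂ) * (t : ℂ) ^ (j - 1)) • T j) =
            -∑ j ∈ Finset.range m, (t : ℂ) ^ j • nahmF T j := by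
          rw [hS, map_sum, ← coe_smul, smul_sum, ← sum_sub_distrib,
            ← sum_neg_distrib]
          refine sum_congr rfl fun j hj => ?_
          have h3 := hT j (Finset.mem_range.1 hj)
          have h4 : (t : ℂ) * ((j : ℂ) * (t : ℂ) ^ (j - 1)) = (t : ℂ) ^ j * j := by
            cases j with
            | zero => simp
            | succ j => rw [add_tsub_cancel_right, pow_succ]; ring
          rw [map_smul, smul_smul, h4, mul_smul, h3, smul_add]
          abel
        have h6 : G t = -∑ j ∈ Finset.range m, (t : ℂ) ^ j • nahmF T j + t • nahmQ (R t) (R t) := by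
          rw [← h2]
        have h7 : t • nahmQ (S t) (S t) = _ := (coe_smul t (nahmQ (S t) (S t))).symm.trans h1
        rw [← nahmQ_sub_nahmQ, smul_sub, h7, h6]
        abel
      rw [e1]
      refine IsBigO.add (IsBigO.fun_sum fun p hp => rpow_isBigO_natPow_smul ?_ _) ?_
      · have h1 := (mem_filter.1 hp).2
        have h2 : (m : ℝ) ≤ ((p.1 + p.2 : ℕ) : ℝ) := by exact_mod_cast not_lt.1 h1
        push_cast at h2 ⊢
        linarith
      · have h1 := isBigO_rpow_smul (ν := 1) ((nahmQ_isBigO hE hO).add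
          ((nahmQ_isBigO hSO hE).congr_right fun t => by rw [zero_add, add_zero]))
        simp only [rpow_one] at h1
        rwa [show (1 : ℝ) + ((m : ℝ) - 1 / 2 + 0) = m + 1 / 2 by ring] at h1
    -- after rescaling by `t⁻ᵐ`, the next coefficient is the limit of `u` at `0`
    set u : ℝ → Mat³ k := fun t => t ^ (-(m : ℝ)) • (R t - S t) with hu
    set f : ℝ → Mat³ k := fun t =>
      t ^ (-(m : ℝ)) • (G t - (t : ℂ) ^ m • nahmF T m) with hf
    have hpow : ∀ t : ℝ, 0 < t → ∀ X : Mat³ k,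
        t ^ (-(m : ℝ)) • ((t : ℂ) ^ m • X) = X := by
      intro t ht X
      rw [← coe_smul, smul_smul, Complex.ofReal_cpow ht.le, Complex.ofReal_neg,
        Complex.ofReal_natCast, Complex.cpow_neg, Complex.cpow_natCast,
        inv_mul_cancel₀ (pow_ne_zero _ (by exact_mod_cast ht.ne')), one_smul]
    have hdu : ∀ᶠ t in 𝓝[>] (0 : ℝ), HasDerivAt u
        (t⁻¹ • (nahmL (principalT k) (u t) - (m : ℂ) • u t + nahmF T m + f t)) t := by
      filter_upwards [hd, self_mem_nhdsWithin] with t ht ht0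
      have h1 := hasDerivAt_rpow_smul (u := fun t => R t - S t) (ν := (m : ℝ))
        (f := fun t => nahmL (principalT k) (R t - S t) - (m : ℂ) • (R t - S t) + G t) ht0
        (ht.congr_deriv (by
          congr 1
          rw [← coe_smul (m : ℝ), Complex.ofReal_natCast]
          abel))
      refine h1.congr_deriv ?_
      have h2 : t ^ (-(m : ℝ) - 1) = t⁻¹ * t ^ (-(m : ℝ)) := by
        rw [Real.rpow_sub_one (ne_of_gt ht0), div_eq_inv_mul]
      rw [h2, mul_smul, hu, hf]
      beta_reduce
      rw [smul_sub (t ^ (-(m : ℝ))) (G t), hpow t ht0, smul_add, smul_sub]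
      simp only [← coe_smul (t ^ (-(m : ℝ))), map_smul]
      module
    obtain ⟨X, hX, hXO⟩ := exists_limit_of_eigenbasis he hl m
      (coord_eq_zero_of_resonance he (resonance_nahmF hT)) hdu
      (by
        have := isBigO_rpow_smul (ν := -(m : ℝ)) hGF
        rwa [neg_add_cancel_left] at this)
      (by
        have := isBigO_rpow_smul (ν := -(m : ℝ)) hE
        rwa [show -(m : ℝ) + ((m : ℝ) - 1 / 2) = -1 / 2 by ring] at this)
    have hup : ∀ j < m, update T m X j = T j := fun j hj =>
      update_of_ne hj.ne _ _
    refine ⟨update T m X, fun n hn => ?_, ?_⟩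
    · rcases Nat.lt_succ_iff_lt_or_eq.1 hn with h | rfl
      · rw [hup n h, nahmF_congr fun j hj => hup j (hj.trans h)]
        exact hT n h
      · rw [update_self, nahmF_congr fun j hj => hup j hj]
        exact hX
    · have h1 := isBigO_rpow_smul (ν := (m : ℝ)) hXO
      refine (h1.congr' ?_ EventuallyEq.rfl).trans (by
        push_cast
        rw [show (m : ℝ) + 1 - 1 / 2 = m + 1 / 2 by ring]
        exact isBigO_refl _ _)
      filter_upwards [self_mem_nhdsWithin] with t ht
      have ht0 : (0 : ℝ) < t := ht
      rw [sum_range_succ, update_self,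
        sum_congr rfl fun j hj => by rw [hup j (Finset.mem_range.1 hj)], smul_sub, hu]
      beta_reduce
      rw [smul_smul, ← rpow_add ht0, add_neg_cancel, rpow_zero, one_smul,
        rpow_natCast, ← coe_smul, Complex.ofReal_pow, hS]
      abel

end Poles

section Meromorphic

open Asymptotics

theorem hasDerivAt_comp_ofReal {E : Type*} [NormedAddCommGroup E] [NormedSpace ℂ E] {S : ℂ → E}
    {S' : E} {z : ℝ → ℂ} (h : HasDerivAt S S' (z t)) (hz : HasDerivAt z 1 t) :
    HasDerivAt (fun t => S (z t)) S' t := by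
  exact ((h.hasFDerivAt.restrictScalars ℝ).comp_hasDerivAt t hz).congr_deriv (by simp)

/-- Beyond the largest eigenvalue of the linearization the recursion is uniquely solvable, so a long
enough expansion continues to a formal solution. -/
theorem exists_formal_solution (k : ℕ) : ∃ N₀ : ℕ, ∀ N, N₀ ≤ N → ∀ T₀ : ℕ → Mat³ k,
    (∀ n < N, (n : ℂ) • T₀ n = nahmL (principalT k) (T₀ n) + nahmF T₀ n) →
    ∃ T : ℕ → Mat³ k, (∀ n < N, T n = T₀ n) ∧
      ∀ n : ℕ, (n : ℂ) • T n = nahmL (principalT k) (T n) + nahmF T n := by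
  classical
  obtain ⟨d, e, l, he, hl⟩ := exists_eigenbasis_principalT k
  obtain ⟨N₀, hN₀⟩ := exists_nat_gt (∑ i, |l i|)
  have hne : ∀ n : ℕ, N₀ ≤ n → ∀ i, l i ≠ n := by
    intro n hn i hi
    have h1 := Finset.single_le_sum (f := fun i => |l i|) (fun _ _ => abs_nonneg _)
      (Finset.mem_univ i)
    have h2 : (N₀ : ℝ) ≤ n := by exact_mod_cast hn
    linarith [le_abs_self (l i)]
  refine ⟨N₀, fun N hN T₀ hT₀ => ?_⟩
  have hsol : ∀ (n : ℕ) (F : Mat³ k), N₀ ≤ n → ∃ X, (n : ℂ) • X = nahmL (principalT k) X + F :=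
    fun n F h => exists_solution_of_eigenbasis he (hne n h) F
  choose! sol hsol using hsol
  obtain ⟨T, hT⟩ := exists_sequence
    (fun (T : ℕ → Mat³ k) n => if n < N then T₀ n else sol n (nahmF T n))
    (fun n T T' h => by simp only [nahmF_congr h])
  have hlt : ∀ n < N, T n = T₀ n := fun n hn => (hT n).trans (if_pos hn)
  refine ⟨T, hlt, fun n => ?_⟩
  by_cases hn : n < N
  · rw [hlt n hn, nahmF_congr fun j hj => hlt j (hj.trans hn)]
    exact hT₀ n hn
  · have h2 := hsol n (nahmF T n) (hN.trans (not_lt.1 hn))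
    rwa [← ((hT n).trans (if_neg hn))] at h2

/-- The regular part of a solution with a pole is bounded, as the linearization has no eigenvalue
between `-1` and `0`. -/
theorem isBigO_zero_of_pole {R : ℝ → Mat³ k} (hR : ∀ᶠ t in 𝓝[>] (0 : ℝ), HasDerivAt R
      (t⁻¹ • (nahmL (principalT k) (R t) + t • nahmQ (R t) (R t))) t)
    (hO : R =O⁺ (-13 / 16)) :
    R =O⁺ 0 := by
  obtain ⟨d, e, l, he, hl⟩ := exists_eigenbasis_principalT k
  have hquad : ∀ {a b : ℝ}, b = 1 + (a + a) → (R =O⁺ a) →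
      (fun t => t • nahmQ (R t) (R t)) =O⁺ b := by
    intro a b hb h
    have h1 := isBigO_rpow_smul (ν := 1) (nahmQ_isBigO h h)
    simp only [rpow_one] at h1
    rwa [hb]
  -- the exponent of the remainder improves from `κ` to `1 + 2 κ`
  have hstep : ∀ {κ μ : ℝ}, -1 < κ → μ < 0 → μ = 1 + (κ + κ) → (R =O⁺ κ) → R =O⁺ μ := by
    intro κ μ hκ hμ hμκ hO
    refine isBigO_of_eigenbasis he (κ := κ) (fun i => ?_) hR (hquad hμκ hO) hO
    rcases hl i with h | ⟨m, h⟩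
    · left
      constructor <;> linarith
    · right
      have : (0 : ℝ) ≤ m := cast_nonneg _
      linarith
  have h1 : R =O⁺ (-1 / 4) := hstep (by norm_num) (by norm_num) (by norm_num)
      (hstep (μ := -5 / 8) (by norm_num) (by norm_num) (by norm_num) hO)
  obtain ⟨X, -, hX⟩ := exists_limit_of_eigenbasis he hl 0 (F := 0) (fun _ _ => map_zero _)
    (u := R) (f := fun t => t • nahmQ (R t) (R t)) (by
      filter_upwards [hR] with t ht
      refine ht.congr_deriv ?_
      rw [Nat.cast_zero, zero_smul, sub_zero, add_zero]) (hquad (by norm_num) h1)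
    (h1.trans (rpow_isBigO_rpow (by norm_num)))
  have h2 := (hX.trans (rpow_isBigO_rpow (show (0 : ℝ) ≤ 1 / 2 by norm_num))).add
    (rpow_isBigO_natPow_smul (j := 0) (a := 0) (by norm_num) X)
  simpa using h2

/-- A solution of the Nahm equations with leading term `ρ / t` is meromorphic at `0`. -/
theorem exists_analyticAt_pole {T : ℝ → Mat³ k}
    (hT : ∀ᶠ t in 𝓝[>] (0 : ℝ), HasDerivAt T (nahmQ (T t) (T t)) t)
    (hO : (fun t : ℝ => T t - (t : ℂ)⁻¹ • principalT k) =O⁺ (-13 / 16)) :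
    ∃ H : ℂ → Mat³ k, AnalyticAt ℂ H 0 ∧ ∀ᶠ t : ℝ in 𝓝[>] 0, T t = (t : ℂ)⁻¹ • H t := by
  set R : ℝ → Mat³ k := fun t => T t - (t : ℂ)⁻¹ • principalT k with hRdef
  have hR : ∀ᶠ t in 𝓝[>] (0 : ℝ), HasDerivAt R
      (t⁻¹ • (nahmL (principalT k) (R t) + t • nahmQ (R t) (R t))) t := by
    filter_upwards [hT, self_mem_nhdsWithin] with t ht ht0
    exact hasDerivAt_sub_pole ht0 ht
  have hR0 := isBigO_zero_of_pole hR hO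
  obtain ⟨N₀, hN₀⟩ := exists_formal_solution k
  -- an expansion longer than `Λ` determines the solution, by the Gronwall argument below
  set Λ : ℝ := 8 * ‖principalT k‖ + 1 with hΛ
  obtain ⟨N₁, hN₁⟩ := exists_nat_gt (Λ + 1 / 2)
  obtain ⟨T₀, hT₀, hE⟩ := exists_expansion hR hR0 (max N₀ N₁)
  obtain ⟨c, hcT, hc⟩ := hN₀ _ (le_max_left N₀ N₁) T₀ hT₀
  set N := max N₀ N₁ with hN
  obtain ⟨δ, hδ, S, U, hSU, hrem⟩ := exists_series_solution (principalT k) hc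
  obtain ⟨C, hC⟩ := hrem N
  have hball : ∀ t ∈ Ioo (0 : ℝ) δ, (t : ℂ) ∈ ball (0 : ℂ) δ := fun t ht => by
    rw [mem_ball_zero_iff, norm_real, norm_of_nonneg ht.1.le]
    exact ht.2
  -- the difference of `R` and the series solution `S` satisfies a linear equation
  have hd : ∀ᶠ t in 𝓝[>] (0 : ℝ), HasDerivAt (fun t : ℝ => R t - S t)
      (t⁻¹ • nahmL (principalT k) (R t - S t)
        + (nahmQ (R t - S t) (R t) + nahmQ (S t) (R t - S t))) t := by
    filter_upwards [hR, Ioo_mem_nhdsGT hδ] with t ht ht0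
    have h1 := hasDerivAt_comp_ofReal (z := fun t : ℝ => (t : ℂ)) (hSU t (hball t ht0)).1
      Complex.ofRealCLM.hasDerivAt
    refine (ht.sub h1).congr_deriv ?_
    have h2 : nahmL (principalT k) (S t) = (t : ℂ) • nahmL (principalT k) (U t) := by
      have h4 : nahmL (principalT k) (c 0) = 0 := by simpa [nahmF] using (hc 0).symm
      rw [(hSU t (hball t ht0)).2, map_add, h4, zero_add, map_smul]
    rw [← nahmQ_sub_nahmQ, map_sub _ (R t), h2, coe_smul, smul_add, smul_sub, smul_smul t⁻¹ t,
      smul_smul t⁻¹ t, inv_mul_cancel₀ ht0.1.ne', one_smul, one_smul]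
    abel
  have hbd : ∀ᶠ t in 𝓝[>] (0 : ℝ), ‖t⁻¹ • nahmL (principalT k) (R t - S t)
        + (nahmQ (R t - S t) (R t) + nahmQ (S t) (R t - S t))‖ ≤ Λ / t * ‖R t - S t‖ := by
    obtain ⟨C₁, -, δ₁, hδ₁, -, h1⟩ := exists_bound_of_isBigO (p := fun _ => True) hR0
      (Eventually.of_forall fun _ => trivial)
    have hS : Tendsto (fun t : ℝ => S t) (𝓝[>] 0) (𝓝 (S 0)) :=
      (((hSU 0 (mem_ball_self hδ)).1.continuousAt).tendsto.comp (Complex.continuous_ofReal.tendsto'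
        0 0 ofReal_zero)).mono_left
        nhdsWithin_le_nhds
    have h0 : Tendsto (fun t : ℝ => t * (4 * (C₁ + ‖S t‖))) (𝓝[>] 0) (𝓝 (0 * (4 * (C₁ + ‖S 0‖)))) :=
      (tendsto_id.mono_left nhdsWithin_le_nhds).mul ((hS.norm.const_add C₁).const_mul 4)
    rw [zero_mul] at h0
    filter_upwards [Ioo_mem_nhdsGT hδ₁, h0.eventually (gt_mem_nhds one_pos)] with t ht ht1
    have hRt := (h1 t ht).2
    rw [rpow_zero, mul_one] at hRt
    set E := R t - S t
    have e1 : ‖t⁻¹ • nahmL (principalT k) E‖ ≤ t⁻¹ * (8 * ‖principalT k‖ * ‖E‖) := by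
      rw [norm_smul, norm_inv, norm_of_nonneg ht.1.le]
      have := ht.1
      grw [norm_nahmL_le]
    have e2 : ‖nahmQ E (R t)‖ ≤ 4 * C₁ * ‖E‖ := by
      refine (norm_nahmQ_le _ _).trans ?_
      nlinarith [norm_nonneg E]
    have e3 := norm_nahmQ_le (S t) E
    have e4 : (4 * (C₁ + ‖S t‖)) * ‖E‖ ≤ t⁻¹ * ‖E‖ := by
      refine mul_le_mul_of_nonneg_right ?_ (norm_nonneg _)
      rw [inv_eq_one_div, le_div_iff₀ ht.1]
      linarith
    refine (norm_add_le _ _).trans ?_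
    have e5 := norm_add_le (nahmQ E (R t)) (nahmQ (S t) E)
    rw [div_eq_inv_mul, hΛ]
    nlinarith
  have hO' : (fun t : ℝ => R t - S t) =O⁺ ((N : ℝ) - 1 / 2) := by
    have h1 : (fun t : ℝ => S t - ∑ j ∈ Finset.range N, (t : ℂ) ^ j • c j) =O⁺ N := by
      refine isBigO_of_bound hδ (C := C) fun t ht => ?_
      have := hC t (hball t ht)
      rwa [norm_real, norm_of_nonneg ht.1.le, ← rpow_natCast] at this
    refine (hE.sub (h1.trans (rpow_isBigO_rpow (by linarith)))).congr_left fun t => ?_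
    have : ∑ j ∈ Finset.range N, (t : ℂ) ^ j • c j = ∑ j ∈ Finset.range N, (t : ℂ) ^ j • T₀ j :=
      sum_congr rfl fun j hj => by rw [hcT j (Finset.mem_range.1 hj)]
    rw [this]
    abel
  have hzero := eventually_eq_zero_of_singular_ode (Λ := Λ) (by positivity) (by
    have : (N₁ : ℝ) ≤ N := by exact_mod_cast le_max_right N₀ N₁
    linarith) hd hbd hO'
  refine ⟨fun z => principalT k + z • S z, ?_, ?_⟩
  · have hS : AnalyticAt ℂ S 0 := DifferentiableOn.analyticAt (s := ball (0 : ℂ) δ)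
        (fun z hz => (hSU z hz).1.differentiableAt.differentiableWithinAt)
        (ball_mem_nhds _ hδ)
    exact analyticAt_const.add (analyticAt_id.smul hS)
  · filter_upwards [hzero, self_mem_nhdsWithin] with t ht ht0
    rw [smul_add, smul_smul, inv_mul_cancel₀ (by exact_mod_cast (ne_of_gt (mem_Ioi.1 ht0))),
      one_smul, ← sub_eq_zero.1 ht]
    exact (add_sub_cancel _ _).symm

theorem exists_analyticAt_interior {T : ℝ → Mat³ k} {t₀ : ℝ}
    (hT : ∀ᶠ t in 𝓝 t₀, HasDerivAt T (nahmQ (T t) (T t)) t) :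
    ∃ H : ℂ → Mat³ k, AnalyticAt ℂ H t₀ ∧ ∀ᶠ t : ℝ in 𝓝 t₀, T t = H t := by
  classical
  obtain ⟨c, hc⟩ := exists_sequence (fun (c : ℕ → Mat³ k) n =>
    if n = 0 then T t₀ else (n : ℂ)⁻¹ • nahmF c n)
    (fun n T T' h => by simp only [nahmF_congr h])
  have hrec : ∀ n : ℕ, (n : ℂ) • c n = nahmL 0 (c n) + nahmF c n := by
    intro n
    rw [nahmL_apply, nahmQ_zero_left, nahmQ_zero_right, add_zero, zero_add]
    cases n with
    | zero => rw [Nat.cast_zero, zero_smul]; rfl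
    | succ n =>
      rw [hc (n + 1), if_neg (succ_ne_zero n), smul_smul,
        mul_inv_cancel₀ (Nat.cast_ne_zero.2 (succ_ne_zero n)), one_smul]
  obtain ⟨δ, hδ, S, U, hSU, -⟩ := exists_series_solution 0 hrec
  have hS0 : S 0 = T t₀ := by
    rw [(hSU 0 (mem_ball_self hδ)).2, zero_smul, add_zero, ((hc 0).trans (if_pos rfl))]
  have hSd : ∀ᶠ t : ℝ in 𝓝 t₀, HasDerivAt (fun t : ℝ => S ((t : ℂ) - t₀))
      (nahmQ (S ((t : ℂ) - t₀)) (S ((t : ℂ) - t₀))) t := by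
    filter_upwards [ball_mem_nhds t₀ hδ] with t ht
    have h1 : (t : ℂ) - t₀ ∈ ball (0 : ℂ) δ := by
      rw [mem_ball_zero_iff, ← ofReal_sub, norm_real]
      exact mem_ball_iff_norm.1 ht
    have h2 := (hSU _ h1).1
    rw [nahmL_apply, nahmQ_zero_left, nahmQ_zero_right, add_zero, zero_add] at h2
    exact hasDerivAt_comp_ofReal (z := fun t : ℝ => (t : ℂ) - t₀) h2
      (Complex.ofRealCLM.hasDerivAt.sub_const _)
  set M := ‖T t₀‖ + 1
  have hLip : LipschitzOnWith (Real.toNNReal (8 * M)) (fun X : Mat³ k => nahmQ X X) (ball 0 M) := by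
    refine LipschitzOnWith.of_dist_le_mul fun X hX Y hY => ?_
    rw [dist_eq_norm, dist_eq_norm, nahmQ_sub_nahmQ, Real.coe_toNNReal _ (by positivity)]
    have hX' := (mem_ball_zero_iff.1 hX).le
    have hY' := (mem_ball_zero_iff.1 hY).le
    have h1 := norm_nahmQ_le (X - Y) X
    have h2 := norm_nahmQ_le Y (X - Y)
    refine (norm_add_le _ _).trans ?_
    nlinarith [norm_nonneg (X - Y)]
  have hmem : ∀ {f : ℝ → Mat³ k}, ContinuousAt f t₀ → f t₀ = T t₀ →
      ∀ᶠ t in 𝓝 t₀, f t ∈ ball (0 : Mat³ k) M := by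
    intro f hf h0
    refine hf.eventually (Metric.isOpen_ball.mem_nhds ?_)
    rw [h0, mem_ball_zero_iff]
    exact lt_add_one _
  have hS0' : (fun t : ℝ => S ((t : ℂ) - t₀)) t₀ = T t₀ := by
    beta_reduce
    rw [sub_self, hS0]
  have huniq := ODE_solution_unique_of_eventually (v := fun (_ : ℝ) (X : Mat³ k) => nahmQ X X)
    (s := fun _ => ball (0 : Mat³ k) M)
    (Eventually.of_forall fun _ => hLip)
    (hT.and (hmem hT.self_of_nhds.continuousAt rfl))
    (hSd.and (hmem hSd.self_of_nhds.continuousAt hS0')) hS0'.symm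
  refine ⟨fun z => S (z - t₀), ?_, huniq⟩
  have hS : AnalyticAt ℂ S ((t₀ : ℂ) - t₀) := by
    rw [sub_self]
    exact DifferentiableOn.analyticAt (s := ball (0 : ℂ) δ)
      (fun z hz => (hSU z hz).1.differentiableAt.differentiableWithinAt)
      (ball_mem_nhds _ hδ)
  exact AnalyticAt.fun_comp hS (analyticAt_id.sub analyticAt_const)

end Meromorphic

/-! ### Meromorphic extension from local extensions -/

/-- Near `p`, the function `t (t - 1) f t` on `(0,1)` is the restriction of an analytic one. -/
def LocallyExtends (f : ℝ → Mat k) (p : ℝ) : Prop := ∃ H : ℂ → Mat k, AnalyticAt ℂ H p ∧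
    ∀ᶠ t : ℝ in 𝓝[Ioo 0 1] p, ((t : ℂ) * ((t : ℂ) - 1)) • f t = H t

theorem mul_sub_one_ne_zero (ht : t ∈ 𝕀) : (t : ℂ) * ((t : ℂ) - 1) ≠ 0 := by
  refine mul_ne_zero (by exact_mod_cast ht.1.ne') ?_
  rw [← ofReal_one, ← ofReal_sub]
  exact_mod_cast (sub_neg.2 ht.2).ne

theorem LocallyExtends.affine {p : ℝ} (h : LocallyExtends f p) (A B C : Mat k)
    (hg : ∀ t ∈ 𝕀, g t = A * f t * B + C) : LocallyExtends g p := by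
  obtain ⟨H, hH, he⟩ := h
  refine ⟨fun z => A * H z * B + (z * (z - 1)) • C, ?_, ?_⟩
  · fun_prop
  · filter_upwards [he, self_mem_nhdsWithin] with t ht ht'
    rw [hg t ht', ← ht, smul_add, mul_smul_comm, smul_mul_assoc]

/-- Through the reflection, a local extension at `0` gives one at `1`. -/
theorem LocallyExtends.reflect (h : LocallyExtends f 0)
    (hf : ∀ t ∈ 𝕀, f (1 - t) = (f t)ᵀ) : LocallyExtends f 1 := by
  obtain ⟨H, hH, he⟩ := h
  let L : Mat k →L[ℂ] Mat k :=
    toContinuousLinearMap (Matrix.transposeLinearEquiv (Fin k) (Fin k) ℂ ℂ).toLinearMap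
  have hL : ∀ A, L A = Aᵀ := fun A => rfl
  refine ⟨fun z => L (H (1 - z)), ?_, ?_⟩
  · exact (L.analyticAt _).comp (AnalyticAt.fun_comp (by simpa using hH) (analyticAt_const.sub
      analyticAt_id))
  · have ht : Tendsto (fun t : ℝ => 1 - t) (𝓝[Ioo 0 1] 1) (𝓝[Ioo 0 1] 0) := by
      refine tendsto_nhdsWithin_iff.2
        ⟨(Continuous.tendsto' (by fun_prop) _ _ (sub_self 1)).mono_left nhdsWithin_le_nhds, ?_⟩
      filter_upwards [self_mem_nhdsWithin] with t ht
      grind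
    filter_upwards [ht.eventually he, self_mem_nhdsWithin] with t h1 ht'
    have h2 := hf (1 - t) ⟨by linarith [ht'.2], by linarith [ht'.1]⟩
    rw [sub_sub_cancel] at h2
    push_cast at h1
    rw [hL, ← h1, h2, transpose_smul]
    congr 1; ring

/-- Local analytic extensions on discs centred on `[0,1]` agree on overlaps, because an overlap is
convex and meets `(0,1)` in an interval. -/
theorem extendsMeromorphically_of_local
    (h : ∀ p ∈ Icc (0 : ℝ) 1, LocallyExtends f p) : ExtendsMeromorphically f := by
  have h1 : ∀ p : Icc (0 : ℝ) 1, ∃ (H : ℂ → Mat k) (r : ℝ), 0 < r ∧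
      AnalyticOnNhd ℂ H (ball (p : ℂ) r) ∧
      ∀ t ∈ 𝕀, |t - p| < r → ((t : ℂ) * ((t : ℂ) - 1)) • f t = H t := by
    intro p
    obtain ⟨H, hH, he⟩ := h p p.2
    obtain ⟨r, hr, hr'⟩ := hH.exists_ball_analyticOnNhd
    obtain ⟨ε, hε, hε'⟩ := Metric.mem_nhdsWithin_iff.1 he
    refine ⟨H, min r ε, lt_min hr hε, hr'.mono (Metric.ball_subset_ball (min_le_left _ _)), ?_⟩
    intro t ht htp
    exact hε' ⟨by rw [mem_ball, Real.dist_eq]; exact htp.trans_le (min_le_right _ _), ht⟩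
  choose H r hr hH he using h1
  set U : Icc (0 : ℝ) 1 → Set ℂ := fun p => ball ((p : ℝ) : ℂ) (r p) with hU
  have hUo : ∀ p, IsOpen (U p) := fun _ => Metric.isOpen_ball
  have hagree : ∀ p q : Icc (0 : ℝ) 1, (p : ℝ) ≤ q → ∀ z ∈ U p, z ∈ U q → H p z = H q z := by
    intro p q hpq z hzp hzq
    rcases hpq.eq_or_lt with hpq | hpq
    · rw [Subtype.ext hpq]
    have hd : (q : ℝ) - p < r p + r q := by
      have h1 := dist_triangle_left ((p : ℝ) : ℂ) ((q : ℝ) : ℂ) z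
      rw [hU, mem_ball] at hzp hzq
      rw [dist_eq, ← ofReal_sub, norm_real, norm_eq_abs, abs_sub_comm,
        abs_of_pos (sub_pos.2 hpq)] at h1
      linarith
    obtain ⟨x, hx⟩ : ∃ x : ℝ, x ∈ Ioo (max (p : ℝ) (q - r q)) (min (q : ℝ) (p + r p)) :=
      exists_between (max_lt (lt_min hpq (by linarith [hr p]))
        (lt_min (by linarith [hr q]) (by linarith)))
    have hmem : (x : ℂ) ∈ U p ∩ U q := by
      obtain ⟨ha, hb⟩ := max_lt_iff.1 hx.1
      obtain ⟨hc, hd⟩ := lt_min_iff.1 hx.2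
      constructor <;> rw [mem_ball, dist_eq, ← ofReal_sub, norm_real, norm_eq_abs] <;> grind
    refine AnalyticOnNhd.eqOn_of_preconnected_of_frequently_eq ((hH p).mono inter_subset_left)
      ((hH q).mono inter_subset_right)
      ((convex_ball _ _).inter (convex_ball _ _)).isPreconnected hmem ?_ ⟨hzp, hzq⟩
    have hlim : Tendsto (fun t : ℝ => (t : ℂ)) (𝓝[≠] x) (𝓝[≠] (x : ℂ)) :=
      tendsto_nhdsWithin_iff.2 ⟨(Complex.continuous_ofReal.tendsto x).mono_left nhdsWithin_le_nhds,
        eventually_nhdsWithin_of_forall fun t ht => by simpa using ht⟩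
    refine hlim.frequently (Eventually.frequently ?_)
    filter_upwards [nhdsWithin_le_nhds (Ioo_mem_nhds hx.1 hx.2)] with t ht
    grind
  classical
  set F : ℂ → Mat k := fun z => if hz : ∃ p, z ∈ U p then H hz.choose z else 0 with hF
  have heq : ∀ p, ∀ z ∈ U p, F z = H p z := by
    intro p z hz
    have hex : ∃ p, z ∈ U p := ⟨p, hz⟩
    grind
  refine ⟨⋃ p, U p, isOpen_iUnion hUo, fun t ht => mem_iUnion.2 ⟨⟨t, ht⟩, mem_ball_self (hr _)⟩,
    F, fun z hz => ?_, fun t ht => ?_⟩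
  · obtain ⟨p, hp⟩ := mem_iUnion.1 hz
    refine ((hH p z hp).differentiableAt.congr_of_eventuallyEq ?_).differentiableWithinAt
    filter_upwards [(hUo p).mem_nhds hp] with w hw using heq p w hw
  · rw [heq ⟨t, Ioo_subset_Icc_self ht⟩ t (mem_ball_self (hr _)),
      ← he ⟨t, Ioo_subset_Icc_self ht⟩ t ht (by simpa using hr _), smul_smul, inv_mul_cancel₀,
      one_smul]
    exact mul_sub_one_ne_zero ht

theorem ExtendsMeromorphically.contDiffOn (h : ExtendsMeromorphically f) :
    ContDiffOn ℝ ∞ f 𝕀 := by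
  obtain ⟨U, hU, hI, H, hH, he⟩ := h
  intro t ht
  have h1 : ContDiffAt ℂ ∞ (fun z : ℂ => (z * (z - 1))⁻¹ • H z) t := by
    have h2 : ContDiffAt ℂ ∞ H (t : ℂ) :=
      (hH.contDiffOn hU).contDiffAt (hU.mem_nhds (hI t (Ioo_subset_Icc_self ht)))
    refine ContDiffAt.smul (ContDiffAt.inv
      (contDiffAt_id.mul (contDiffAt_id.sub contDiffAt_const)) (mul_sub_one_ne_zero ht)) h2
  have h4 : ContDiffAt ℝ ∞ (fun t : ℝ => ((t : ℂ) * ((t : ℂ) - 1))⁻¹ • H t) t :=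
    (h1.restrict_scalars ℝ).comp t Complex.ofRealCLM.contDiff.contDiffAt
  exact h4.contDiffWithinAt.congr (fun s hs => he s hs) (he t ht)

theorem ExtendsMeromorphically.meromorphicAtEnd (h : ExtendsMeromorphically f) :
    MeromorphicAtEnd f 0 ∧ MeromorphicAtEnd f 1 := by
  obtain ⟨U, hU, hI, H, hH, he⟩ := h
  have hA : ∀ p ∈ Icc (0 : ℝ) 1, AnalyticAt ℂ H p := fun p hp =>
    hH.analyticAt (hU.mem_nhds (hI p hp))
  constructor
  · refine ⟨fun z => (z - 1)⁻¹ • H z, ((analyticAt_id.sub analyticAt_const).inv (by simp)).smul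
      (hA 0 (by simp)), ?_⟩
    filter_upwards [self_mem_nhdsWithin] with t ht
    rw [he t ht, smul_smul, mul_inv, ofReal_zero, sub_zero]
  · refine ⟨fun z => z⁻¹ • H z, (analyticAt_id.inv (by simp)).smul (hA 1 (by simp)), ?_⟩
    filter_upwards [self_mem_nhdsWithin] with t ht
    rw [he t ht, smul_smul, mul_inv, ofReal_one, mul_comm]

theorem ExtendsMeromorphically.linearComb {h : ℝ → Mat k} (hf : ExtendsMeromorphically f)
    (hg : ExtendsMeromorphically g) (c d : ℂ) (hh : ∀ t ∈ 𝕀, h t = c • f t + d • g t) :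
    ExtendsMeromorphically h := by
  obtain ⟨U, hU, hI, F, hF, he⟩ := hf
  obtain ⟨V, hV, hJ, G, hG, he'⟩ := hg
  refine ⟨U ∩ V, hU.inter hV, fun t ht => ⟨hI t ht, hJ t ht⟩, fun z => c • F z + d • G z,
    ((hF.mono inter_subset_left).const_smul c).add ((hG.mono inter_subset_right).const_smul d), ?_⟩
  intro t ht
  rw [hh t ht, he t ht, he' t ht, smul_add, smul_comm c, smul_comm d]

/-! ### The three fields are affinely related -/

theorem span_of_isUnit_cyclicMatrix {b : Mat k} (h : IsUnit (cyclicMatrix b v)) :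
    span ℂ (range fun j : Fin k => (b ^ (j : ℕ)) *ᵥ v) = ⊤ := by
  rw [← Matrix.mulVec_surjective_iff_isUnit] at h
  have h1 : LinearMap.range (cyclicMatrix b v).mulVecLin = ⊤ := range_eq_top.2 h
  rw [Matrix.range_mulVecLin] at h1
  rw [← h1]
  rfl

/-- In the normal form of the residues, the lowest vector is cyclic. -/
theorem isUnit_cyclicMatrix_of_normal_form {M b : Mat k} {s : ℂ} (hs : s ≠ 0)
    (hb : M * b = (s • b₀ k) * M)
    (hv : IsUnitLowestVector (a₀ k) (M *ᵥ v)) : IsUnit (cyclicMatrix b v) := by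
  have h1 : ∀ j : ℕ, M * b ^ j = (s • b₀ k) ^ j * M := by
    intro j
    induction j with
    | zero => simp
    | succ j ih => rw [pow_succ, ← mul_assoc, ih, mul_assoc, hb, ← mul_assoc, ← pow_succ]
  have h2 : ∀ i j : Fin k, (M * cyclicMatrix b v) i j =
      s ^ (j : ℕ) * ∑ l, (b₀ k ^ (j : ℕ)) i l * (M *ᵥ v) l := by
    intro i j
    rw [cyclicMatrix_mul_apply, h1, smul_pow, smul_mul_assoc, smul_mulVec, ← mulVec_mulVec]
    rfl
  have hpow : ∀ (n : ℕ) (i l : Fin k), (b₀ k ^ n) i l = star ((c₀ k ^ n) l i) := by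
    intro n i l
    rw [← conjTranspose_apply, Matrix.conjTranspose_pow, principalC, conjTranspose_conjTranspose]
  have h3 : M * cyclicMatrix b v = Matrix.diagonal fun j => (M * cyclicMatrix b v) j j := by
    ext i j
    by_cases hij : i = j
    · rw [hij, Matrix.diagonal_apply_eq]
    · rw [diagonal_apply_ne _ hij, h2]
      refine mul_eq_zero_of_right _ (sum_eq_zero fun l _ => ?_)
      by_cases hl : (l : ℕ) = 0
      · rw [hpow, principalC_pow_apply_of_ne _ (by
          rw [hl, zero_add]; exact fun h => hij (Fin.ext h)), star_zero, zero_mul]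
      · rw [lowest_apply_eq_zero hv hl, mul_zero]
  have h4 : IsUnit (M * cyclicMatrix b v) := by
    rw [h3, isUnit_iff_isUnit_det, Matrix.det_diagonal, isUnit_iff_ne_zero]
    refine prod_ne_zero_iff.2 fun j _ => ?_
    rw [h2, sum_eq_single ⟨0, j.pos⟩]
    · refine mul_ne_zero (pow_ne_zero _ hs) (mul_ne_zero ?_ ?_)
      · rw [hpow]
        exact star_ne_zero.2 (principalC_pow_apply_ne_zero _ (by simp))
      · rw [← norm_pos_iff, norm_lowest hv rfl]; exact one_pos
    · intro l _ hl
      rw [lowest_apply_eq_zero hv (fun h => hl (Fin.ext h)), mul_zero]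
    · simp
  grind

theorem conj_pow {Ψ B β : Mat k} (hΨ : Ψ * β = B * Ψ) (n : ℕ) : Ψ * β ^ n = B ^ n * Ψ := by
  induction n with
  | zero => simp
  | succ n ih => rw [pow_succ, ← mul_assoc, ih, mul_assoc, hΨ, ← mul_assoc, ← pow_succ]

/-- If the residues of two of the commuting fields are proportional and the first residue is
cyclic, the fields themselves are proportional up to a scalar: the difference `D` is a polynomial
`∑ cⱼ B₀ʲ` with constant coefficients, and `cⱼ β₀ʲ` has a pole of order `j` at `0`. -/
theorem Intertwines.field_affine
    (hΨ : Intertwines Ψ D (flat B)) (hB : ∀ i j, ⁅B i, B j⁆ = 0) {b : Fin 3 → Mat k}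
    (hb : ∀ i, HasResidueAtZero (D.β i) (b i)) (hv : IsUnit (cyclicMatrix (b 0) v))
    {i : Fin 3} {σ : ℂ} (hσ : b i = σ • b 0) :
    ∃ d : ℂ, ∀ t ∈ 𝕀, D.β i t = σ • D.β 0 t + d • (1 : Mat k) := by
  set δ : ℝ → Mat k := fun t => D.β i t - σ • D.β 0 t with hδ
  set V : ℝ → Mat k := fun t => cyclicMatrix ((t : ℂ) • D.β 0 t) v with hVdef
  set Δ : Mat k := B i - σ • B 0 with hΔ
  have hΨδ : ∀ t ∈ 𝕀, Ψ t * δ t = Δ * Ψ t := by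
    intro t ht
    have h1 := hΨ.field i t ht
    have h2 := hΨ.field 0 t ht
    simp only [flat] at h1 h2
    rw [hδ, hΔ, mul_sub, sub_mul, mul_smul_comm, smul_mul_assoc, h1, h2]
  have hVapp : ∀ (t : ℝ) (p j : Fin k),
      V t p j = (t : ℂ) ^ (j : ℕ) * ((D.β 0 t ^ (j : ℕ)) *ᵥ v) p := by
    intro t p j
    change ((((t : ℂ) • D.β 0 t) ^ (j : ℕ)) *ᵥ v) p = _
    rw [smul_pow, smul_mulVec, Pi.smul_apply, smul_eq_mul]
  have hVlim : Tendsto V (𝓝[>] 0) (𝓝 (cyclicMatrix (b 0) v)) := by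
    have hc : Continuous fun X : Mat k => cyclicMatrix X v := by
      unfold cyclicMatrix
      fun_prop
    exact (hc.tendsto _).comp (hb 0)
  have hVu : ∀ᶠ t in 𝓝[>] (0 : ℝ), IsUnit (V t) := hVlim.eventually (Units.isOpen.mem_nhds hv)
  have hI : ∀ᶠ t : ℝ in 𝓝[>] 0, t ∈ 𝕀 := Ioo_mem_nhdsGT one_pos
  obtain ⟨t₁, hV₁, ht₁⟩ := (hVu.and hI).exists
  have hcomm : Commute (B i) (B 0) := by have := hB i 0; rwa [Ring.lie_def, sub_eq_zero] at this
  -- the coefficients of `Δ` in powers of `B 0`, read off at one point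
  set c : Fin k → ℂ := fun j => (t₁ : ℂ) ^ (j : ℕ) * ((V t₁)⁻¹ *ᵥ (δ t₁ *ᵥ v)) j with hcdef
  have hβδ : Commute (δ t₁) (D.β 0 t₁) := by
    have h2 := hΨ.field 0 t₁ ht₁
    simp only [flat] at h2
    have h1 := hΨδ t₁ ht₁
    refine (hΨ.isUnit t₁ ht₁).mul_left_cancel ?_
    rw [← mul_assoc, h1, mul_assoc, h2, ← mul_assoc, (hcomm.sub_left ((Commute.refl _).smul_left
      σ)).eq, mul_assoc, ← h1, ← mul_assoc, ← h2,
      mul_assoc]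
  have hsum : δ t₁ = ∑ j, c j • D.β 0 t₁ ^ (j : ℕ) := by
    have h1 : (∑ j, c j • D.β 0 t₁ ^ (j : ℕ)) *ᵥ v = δ t₁ *ᵥ v := by
      have h2 : V t₁ *ᵥ ((V t₁)⁻¹ *ᵥ (δ t₁ *ᵥ v)) = δ t₁ *ᵥ v := by
        rw [mulVec_mulVec, mul_nonsing_inv' hV₁, one_mulVec]
      rw [← h2]
      ext p
      rw [sum_mulVec, Finset.sum_apply, mulVec, dotProduct]
      refine sum_congr rfl fun j _ => ?_
      rw [hVapp, smul_mulVec, Pi.smul_apply, smul_eq_mul, hcdef]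
      ring
    have h3 : Commute (∑ j, c j • D.β 0 t₁ ^ (j : ℕ)) (D.β 0 t₁) :=
      Commute.sum_left _ _ _ fun j _ => ((Commute.refl _).pow_left _).smul_left _
    refine hV₁.mul_right_cancel ?_
    ext p q
    rw [hVdef, cyclicMatrix_mul_apply, cyclicMatrix_mul_apply, smul_pow, mul_smul_comm,
      mul_smul_comm, (hβδ.pow_right _).eq, (h3.pow_right _).eq, smul_mulVec,
      smul_mulVec, ← mulVec_mulVec, ← mulVec_mulVec, h1]
  clear_value c
  have hconj : ∀ t ∈ 𝕀, Ψ t * ∑ j, c j • D.β 0 t ^ (j : ℕ) = (∑ j, c j • B 0 ^ (j : ℕ)) * Ψ t := by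
    intro t ht
    rw [mul_sum, sum_mul]
    refine sum_congr rfl fun j _ => ?_
    rw [mul_smul_comm, smul_mul_assoc, conj_pow (hΨ.field 0 t ht)]
    rfl
  have hΔsum : Δ = ∑ j, c j • B 0 ^ (j : ℕ) := by
    refine (hΨ.isUnit t₁ ht₁).mul_right_cancel ?_
    rw [← hΨδ t₁ ht₁, hsum, hconj t₁ ht₁]
  have hδsum : ∀ t ∈ 𝕀, δ t = ∑ j, c j • D.β 0 t ^ (j : ℕ) := by
    intro t ht
    refine (hΨ.isUnit t ht).mul_left_cancel ?_
    rw [hΨδ t ht, hΔsum, hconj t ht]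
  have hδlim : Tendsto (fun t : ℝ => (V t)⁻¹ *ᵥ (((t : ℂ) • δ t) *ᵥ v)) (𝓝[>] 0) (𝓝 0) := by
    have h1 : Tendsto (fun t : ℝ => (t : ℂ) • δ t) (𝓝[>] 0) (𝓝 (0 : Mat k)) := by
      have h2 := (hb i).sub ((hb 0).const_smul σ)
      rw [← hσ, sub_self] at h2
      refine h2.congr fun t => ?_
      rw [hδ, smul_sub, smul_comm σ]
    have h3 : Tendsto (fun t => (V t)⁻¹) (𝓝[>] 0) (𝓝 (cyclicMatrix (b 0) v)⁻¹) := by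
      obtain ⟨u, hu⟩ := hv
      simp only [nonsing_inv_eq_ringInverse, ← hu] at hVlim ⊢
      exact (NormedRing.inverse_continuousAt u).tendsto.comp hVlim
    have hcont : Continuous fun x : Mat k × Mat k => x.1 *ᵥ (x.2 *ᵥ v) := by fun_prop
    have h5 := (hcont.tendsto ((cyclicMatrix (b 0) v)⁻¹, 0)).comp (h3.prodMk_nhds h1)
    simp only [Matrix.zero_mulVec, Matrix.mulVec_zero] at h5
    exact h5
  -- `cⱼ t^(1 - j)` is the `j`-th coordinate of a vector tending to `0`
  have hc0 : ∀ j : Fin k, (j : ℕ) ≠ 0 → c j = 0 := by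
    intro j hj
    have h1 := (tendsto_pi_nhds.1 hδlim j).norm
    rw [Pi.zero_apply, norm_zero] at h1
    have h2 : ∀ᶠ t : ℝ in 𝓝[>] 0, ‖c j‖ ≤ ‖((V t)⁻¹ *ᵥ (((t : ℂ) • δ t) *ᵥ v)) j‖ := by
      filter_upwards [hVu, hI] with t hVt ht
      have ht0 : (t : ℂ) ≠ 0 := by exact_mod_cast ht.1.ne'
      have h3 : ((t : ℂ) • δ t) *ᵥ v = V t *ᵥ fun j => (t : ℂ) * ((t : ℂ) ^ (j : ℕ))⁻¹ * c j := by
        ext p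
        rw [hδsum t ht, smul_sum, sum_mulVec, Finset.sum_apply, mulVec, dotProduct]
        refine sum_congr rfl fun j _ => ?_
        rw [hVapp, smul_mulVec, smul_mulVec, Pi.smul_apply, Pi.smul_apply, smul_eq_mul, smul_eq_mul]
        field_simp
      rw [h3, mulVec_mulVec, nonsing_inv_mul' hVt, one_mulVec, norm_mul]
      obtain ⟨m, hm⟩ := Nat.exists_eq_succ_of_ne_zero hj
      rw [hm, pow_succ, mul_inv, mul_comm, mul_comm (t : ℂ), mul_assoc, inv_mul_cancel₀ ht0,
        mul_one, norm_inv, norm_pow, norm_real, norm_eq_abs, abs_of_pos ht.1]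
      exact le_mul_of_one_le_right (norm_nonneg _)
        (one_le_inv_iff₀.2 ⟨pow_pos ht.1 m, pow_le_one₀ ht.1.le ht.2.le⟩)
    exact norm_le_zero_iff.1 (ge_of_tendsto h1 h2)
  rcases Nat.eq_zero_or_pos k with hk | hk
  · subst hk
    exact ⟨0, fun t _ => Subsingleton.elim _ _⟩
  refine ⟨c ⟨0, hk⟩, fun t ht => ?_⟩
  have h1 := hδsum t ht
  rw [sum_eq_single ⟨0, hk⟩ (fun j _ hj => by
    rw [hc0 j (fun h => hj (Fin.ext h)), zero_smul]) (by simp)] at h1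
  grind

/-! ### Solutions in temporal gauge -/

/-- Solutions with reflection symmetry for which `α` is Hermitian, that is, `X₀ = 0`. -/
structure IsTemporalSolution (D : ComplexData k) : Prop where
  trivial : ∃ (Ψ : ℝ → Mat k) (B : Fin 3 → Mat k), Intertwines Ψ D (flat B) ∧ ∀ i j, ⁅B i, B j⁆ = 0
  differentiable : ∀ t ∈ 𝕀, DifferentiableAt ℝ D.α t
  realEquation : D.RealEquation
  hermitian : ∀ t ∈ 𝕀, (D.α t)ᴴ = D.α t
  reflection_α : ∀ t ∈ 𝕀, D.α (1 - t) = (D.α t)ᵀ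
  reflection_β : ∀ i, ∀ t ∈ 𝕀, D.β i (1 - t) = (D.β i t)ᵀ

/-- At `t = 0` the data have the poles `U a₀ Uᴴ / t` and `sᵢ U b₀ Uᴴ / t`, up to smaller terms. -/
structure HasPrincipalPole (D : ComplexData k) (U : Mat k) (s : Fin 3 → ℂ) : Prop where
  unitary : U ∈ 𝐔 k
  ne_zero : ∀ i, s i ≠ 0
  norm : ∑ i, ‖s i‖ ^ 2 = 1
  lowest : IsUnitLowestVector (a₀ k) (Uᴴ *ᵥ D.v)
  pole_α : (fun t : ℝ => D.α t - (t : ℂ)⁻¹ • (U * a₀ k * Uᴴ)) =O⁺ (-13 / 16)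
  pole_β : ∀ i, (fun t : ℝ => D.β i t - (t : ℂ)⁻¹ • (U * (s i • b₀ k) * Uᴴ)) =O⁺ (-13 / 16)

theorem isBigO_mul_mul {g : ℝ → ℝ} {l : Filter ℝ} (h : f =O[l] g) (A B : Mat k) :
    (fun t => A * f t * B) =O[l] g := by
  exact (Asymptotics.IsBigO.of_bound (‖A‖ * ‖B‖) (Eventually.of_forall fun t =>
    (norm_mul₃_le.trans_eq (mul_right_comm _ _ _)))).trans h

theorem isBigO_conjTranspose {g : ℝ → ℝ} {l : Filter ℝ} (h : f =O[l] g) :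
    (fun t => (f t)ᴴ) =O[l] g :=
  (Asymptotics.IsBigO.of_bound 1 (Eventually.of_forall fun t => by
    rw [frobenius_norm_conjTranspose, one_mul])).trans h

theorem hasResidueAtZero_of_isBigO {r : Mat k} {μ : ℝ} (hμ : -1 < μ)
    (h : (fun t : ℝ => f t - (t : ℂ)⁻¹ • r) =O⁺ μ) :
    HasResidueAtZero f r := by
  refine tendsto_of_sub_isBigO_rpow (μ := 1 + μ) (by linarith) ((isBigO_rpow_smul (ν := 1)
    h).congr' ?_ EventuallyEq.rfl)
  filter_upwards [self_mem_nhdsWithin] with t ht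
  rw [rpow_one, ← coe_smul, smul_sub, smul_smul, mul_inv_cancel₀ (by exact_mod_cast (ne_of_gt ht)),
    one_smul]

/-- By the affine relation between the three fields, a temporal solution with residues
`U a₀ U⁻¹`, `sᵢ U b₀ U⁻¹` amounts to a solution of the ordinary Nahm equations with the standard
pole; it is therefore meromorphic. -/
theorem IsTemporalSolution.extendsMeromorphically (h : IsTemporalSolution D)
    {s : Fin 3 → ℂ} (hp : HasPrincipalPole D U s) :
    ExtendsMeromorphically D.α ∧ ∀ i, ExtendsMeromorphically (D.β i) ∧
      ExtendsMeromorphically fun t => (D.β i t)ᴴ := by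
  obtain ⟨hU, hs0, hs, hv, hα, hβ⟩ := hp
  obtain ⟨Ψ, B, hΨ, hB⟩ := h.trivial
  obtain ⟨hdβ, -⟩ := hΨ.complexEquations hB
  have hUU : Uᴴ * U = 1 := mem_unitaryGroup_iff'.1 hU
  have hUU' : U * Uᴴ = 1 := mem_unitaryGroup_iff.1 hU
  have hres : ∀ i, HasResidueAtZero (D.β i) (U * (s i • b₀ k) * Uᴴ) := fun i =>
    hasResidueAtZero_of_isBigO (by norm_num) (hβ i)
  have hcyc : IsUnit (cyclicMatrix (U * (s 0 • b₀ k) * Uᴴ) D.v) := by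
    refine isUnit_cyclicMatrix_of_normal_form (M := Uᴴ) (hs0 0) (by grind) hv
  have haff : ∀ i, ∃ d : ℂ, ∀ t ∈ 𝕀,
      D.β i t = (s i * (s 0)⁻¹) • D.β 0 t + d • (1 : Mat k) := fun i => by
    refine hΨ.field_affine hB hres hcyc ?_
    rw [mul_smul_comm, smul_mul_assoc, mul_smul_comm, smul_mul_assoc, smul_smul,
      mul_assoc (s i), inv_mul_cancel₀ (hs0 0), mul_one]
  choose d hd using haff
  set b : ℝ → Mat k := fun t => (s 0)⁻¹ • D.β 0 t with hb
  set T : ℝ → Mat³ k := fun t => (Uᴴ * D.α t * U, Uᴴ * b t * U, Uᴴ * (b t)ᴴ * U) with hTdef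
  -- the sum over the three fields is the commutator of the normalized one
  have hsum : ∀ t ∈ 𝕀, ∑ i, ⁅D.β i t, (D.β i t)ᴴ⁆ = ⁅b t, (b t)ᴴ⁆ := by
    intro t ht
    have h1 : ∀ i, ⁅D.β i t, (D.β i t)ᴴ⁆ = ((‖s i‖ ^ 2 : ℝ) : ℂ) • ⁅b t, (b t)ᴴ⁆ := by
      intro i
      have h2 : D.β i t = s i • (b t) + d i • (1 : Mat k) := by rw [hd i t ht, hb, smul_smul]
      have h3 : ((‖s i‖ ^ 2 : ℝ) : ℂ) = s i * star (s i) := by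
        rw [star_def, mul_conj, normSq_eq_norm_sq]
      rw [h2, h3]
      simp only [Ring.lie_def, conjTranspose_add, conjTranspose_smul,
        conjTranspose_one, add_mul, mul_add, smul_mul_assoc, mul_smul_comm, mul_one, one_mul]
      module
    rw [sum_congr rfl fun i _ => h1 i, ← sum_smul, ← ofReal_sum, hs, ofReal_one, one_smul]
  have hdα : ∀ t ∈ 𝕀, HasDerivAt D.α (-⁅b t, (b t)ᴴ⁆) t := by
    intro t ht
    have h1 := (h.differentiable t ht).hasDerivAt
    refine h1.congr_deriv ?_
    have h2 := h.realEquation t ht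
    have h3 : deriv (fun s => D.α s + (D.α s)ᴴ) t = deriv D.α t + deriv D.α t := by
      refine Eq.trans (EventuallyEq.deriv_eq ?_) (h1.add h1).deriv
      filter_upwards [Ioo_mem_nhds ht.1 ht.2] with r hr
      rw [h.hermitian r hr]; rfl
    rw [h3, h.hermitian t ht, Ring.lie_def (D.α t), sub_self, zero_add, hsum t ht, ← two_smul ℂ,
        ← smul_add] at h2
    exact eq_neg_of_add_eq_zero_left ((smul_eq_zero.1 h2).resolve_left two_ne_zero)
  have hdb : ∀ t ∈ 𝕀, HasDerivAt b ((-2 : ℂ) • ⁅D.α t, b t⁆) t := by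
    intro t ht
    refine ((hdβ 0 t ht).const_smul (s 0)⁻¹).congr_deriv ?_
    simp only [hb, Ring.lie_def, mul_smul_comm, smul_mul_assoc]
    module
  have hT : ∀ t ∈ 𝕀, HasDerivAt T (nahmQ (T t) (T t)) t := by
    intro t ht
    have hc : ∀ {f : ℝ → Mat k} {f' : Mat k}, HasDerivAt f f' t →
        HasDerivAt (fun t => Uᴴ * f t * U) (Uᴴ * f' * U) t := fun hf =>
      (hf.const_mul Uᴴ).mul_const U
    refine ((hc (hdα t ht)).prodMk ((hc (hdb t ht)).prodMk (hc (hasDerivAt_conjTranspose (hdb t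
      ht))))).congr_deriv ?_
    simp only [nahmQ, hTdef, ← Ring.lie_def, lie_conj hUU']
    refine Prod.ext ?_ (Prod.ext ?_ ?_)
    · simp
    · simp
    · have h4 : (⁅D.α t, b t⁆)ᴴ = -⁅D.α t, (b t)ᴴ⁆ := by
        simp only [Ring.lie_def, conjTranspose_sub, conjTranspose_mul, h.hermitian t ht]
        abel
      simp only [conjTranspose_smul, h4]
      simp
  have hO : (fun t : ℝ => T t - (t : ℂ)⁻¹ • principalT k) =O⁺ (-13 / 16) := by
    have hconj (X : Mat k) : Uᴴ * (U * X * Uᴴ) * U = X := by grind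
    have h2 := isBigO_mul_mul ((hβ 0).const_smul_left (s 0)⁻¹) Uᴴ U
    refine ((isBigO_mul_mul hα Uᴴ U).prod_left (h2.prod_left (isBigO_conjTranspose h2))).congr_left
      fun t => ?_
    have e2 : Uᴴ * b t * U - (t : ℂ)⁻¹ • b₀ k =
        Uᴴ * ((s 0)⁻¹ • (D.β 0 t - (t : ℂ)⁻¹ • (U * (s 0 • b₀ k) * Uᴴ))) * U := by
      have e3 : (s 0)⁻¹ • ((t : ℂ)⁻¹ • (U * (s 0 • b₀ k) * Uᴴ)) = (t : ℂ)⁻¹ • (U * b₀ k * Uᴴ) := by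
        rw [smul_comm, mul_smul_comm, smul_mul_assoc, smul_smul (s 0)⁻¹, inv_mul_cancel₀ (hs0 0),
          one_smul]
      rw [smul_sub, e3, mul_sub, sub_mul, mul_smul_comm (t : ℂ)⁻¹, smul_mul_assoc (t : ℂ)⁻¹, hconj]
    have e4 : ((t : ℂ)⁻¹ • b₀ k)ᴴ = (t : ℂ)⁻¹ • (b₀ k)ᴴ := by
      rw [conjTranspose_smul, ← ofReal_inv, star_def, conj_ofReal]
    refine Prod.ext ?_ (Prod.ext ?_ ?_)
    · change Uᴴ * (D.α t - (t : ℂ)⁻¹ • (U * a₀ k * Uᴴ)) * U = Uᴴ * D.α t * U - (t : ℂ)⁻¹ • a₀ k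
      rw [mul_sub, sub_mul, mul_smul_comm, smul_mul_assoc, hconj]
    · exact e2.symm
    · change (Uᴴ * ((s 0)⁻¹ • (D.β 0 t - (t : ℂ)⁻¹ • (U * (s 0 • b₀ k) * Uᴴ))) * U)ᴴ =
        Uᴴ * (b t)ᴴ * U - (t : ℂ)⁻¹ • c₀ k
      rw [← e2, conjTranspose_sub, conjTranspose_mul, conjTranspose_mul,
        conjTranspose_conjTranspose, ← mul_assoc, e4, principalC]
  -- multiplication by `t (t - 1)` removes the pole; `t = 1` follows by the reflection below
  have hext : ∀ p ∈ Ico (0 : ℝ) 1, LocallyExtends (fun t => (T t).1) p ∧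
      LocallyExtends (fun t => (T t).2.1) p ∧ LocallyExtends (fun t => (T t).2.2) p := by
    intro p hp
    obtain ⟨H, hH, he⟩ : ∃ H : ℂ → Mat³ k, AnalyticAt ℂ H p ∧
        ∀ᶠ t : ℝ in 𝓝[Ioo 0 1] p, ((t : ℂ) * ((t : ℂ) - 1)) • T t = H t := by
      rcases hp.1.eq_or_lt with hp0 | hp0
      · subst hp0
        obtain ⟨H, hH, he⟩ := exists_analyticAt_pole (T := T) (by
          filter_upwards [Ioo_mem_nhdsGT one_pos] with t ht using hT t ht) hO
        refine ⟨fun z => (z - 1) • H z, (analyticAt_id.sub analyticAt_const).smul hH, ?_⟩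
        rw [nhdsWithin_Ioo_eq_nhdsGT one_pos]
        filter_upwards [he, self_mem_nhdsWithin] with t ht ht0
        rw [ht, smul_smul, mul_comm (t : ℂ), mul_assoc, mul_inv_cancel₀ (by exact_mod_cast
          (ne_of_gt ht0)), mul_one]
      · obtain ⟨H, hH, he⟩ := exists_analyticAt_interior (T := T) (t₀ := p) (by
          filter_upwards [Ioo_mem_nhds hp0 hp.2] with t ht using hT t ht)
        refine ⟨fun z => (z * (z - 1)) • H z,
          (analyticAt_id.mul (analyticAt_id.sub analyticAt_const)).smul hH, ?_⟩
        filter_upwards [mem_nhdsWithin_of_mem_nhds he] with t ht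
        rw [ht]
    exact ⟨⟨fun z => (H z).1, analyticAt_fst.fun_comp hH, he.mono fun t ht => congrArg Prod.fst ht⟩,
      ⟨fun z => (H z).2.1, analyticAt_fst.fun_comp (analyticAt_snd.fun_comp hH),
        he.mono fun t ht => congrArg (fun x => x.2.1) ht⟩,
      ⟨fun z => (H z).2.2, analyticAt_snd.fun_comp (analyticAt_snd.fun_comp hH),
        he.mono fun t ht => congrArg (fun x => x.2.2) ht⟩⟩
  have hconj' (X : Mat k) : U * (Uᴴ * X * U) * Uᴴ = X := by grind
  have hglue : ∀ f : ℝ → Mat k, (∀ t ∈ 𝕀, f (1 - t) = (f t)ᵀ) →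
      (∀ p ∈ Ico (0 : ℝ) 1, LocallyExtends f p) → ExtendsMeromorphically f := by
    refine fun f hf h => extendsMeromorphically_of_local fun p hp => ?_
    rcases hp.2.eq_or_lt with rfl | hp1
    · exact (h 0 (by simp)).reflect hf
    · exact h p ⟨hp.1, hp1⟩
  have hβd : ∀ i, ∀ t ∈ 𝕀, D.β i t = (s i • U) * (T t).2.1 * Uᴴ + d i • (1 : Mat k) := by
    intro i t ht
    rw [hTdef, smul_mul_assoc, smul_mul_assoc, hconj', hd i t ht, smul_smul]
  refine ⟨hglue _ h.reflection_α fun p hp => (hext p hp).1.affine U Uᴴ 0 fun t ht => ?_,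
    fun i => ⟨hglue _ (h.reflection_β i) fun p hp => (hext p hp).2.1.affine (s i • U) Uᴴ
      (d i • 1) (hβd i),
    hglue _ (fun t ht => ?_) fun p hp => (hext p hp).2.2.affine U (star (s i) • Uᴴ)
      (star (d i) • 1) fun t ht => ?_⟩⟩
  · rw [hTdef, hconj', add_zero]
  · rw [h.reflection_β i t ht]; rfl
  · rw [hβd i t ht]
    change (s i • U * (Uᴴ * b t * U) * Uᴴ + d i • (1 : Mat k))ᴴ =
      U * (Uᴴ * (b t)ᴴ * U) * (star (s i) • Uᴴ) + star (d i) • (1 : Mat k)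
    generalize b t = X
    simp only [conjTranspose_add, conjTranspose_mul, conjTranspose_smul,
      conjTranspose_conjTranspose, conjTranspose_one, mul_assoc, mul_smul_comm]

/-! ### The real equation on the open interval -/

theorem symm_of_hasDerivAt {s : Set ℝ} (hs : IsOpen s) {K P : ℝ → Mat k}
    (hK : ∀ t ∈ s, (K t).PosDef) (hd : ∀ t ∈ s, HasDerivAt K (K t * P t) t) :
    ∀ t ∈ s, (P t)ᴴ * K t = K t * P t := by
  intro t ht
  have h2 : HasDerivAt (fun t => (K t)ᴴ) (K t * P t) t := (hd t ht).congr_of_eventuallyEq (by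
      filter_upwards [hs.mem_nhds ht] with r hr using (hK r hr).isHermitian)
  have h3 : (K t * P t)ᴴ = K t * P t := HasDerivAt.unique (hasDerivAt_conjTranspose (hd t ht)) h2
  rwa [conjTranspose_mul, (hK t ht).isHermitian] at h3

theorem exists_bvp_Icc (hk : 0 < k) (B : Fin 3 → Mat k) {c d : ℝ} (hcd : c < d) {Ka Kb : Mat k}
    (ha : Ka.PosDef) (hb : Kb.PosDef) : ∃ K P : ℝ → Mat k, K c = Ka ∧ K d = Kb ∧
      ContinuousOn K (Icc c d) ∧ (∀ t ∈ Icc c d, (K t).PosDef) ∧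
      IsMetricPath B (Ioo c d) K P fun _ => 0 := by
  obtain ⟨K, P, h0, h1, hpos, hd⟩ := exists_bvp hk B (sub_pos.2 hcd) ha hb
  have hm : MapsTo (fun t : ℝ => t - c) (Icc c d) (Icc 0 (d - c)) := fun t ht =>
    ⟨sub_nonneg.2 ht.1, sub_le_sub_right ht.2 c⟩
  have hpos' : ∀ t ∈ Icc c d, (K (t - c)).PosDef := fun t ht => hpos _ (hm ht)
  have hder : ∀ t ∈ Ioo c d, HasDerivAt (fun t => K (t - c)) (K (t - c) * P (t - c)) t ∧
      HasDerivAt (fun t => P (t - c)) ((4 : ℂ) • curv B (K (t - c))) t := by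
    intro t ht
    have h2 := hd _ (hm (Ioo_subset_Icc_self ht))
    have hn : Icc 0 (d - c) ∈ 𝓝 (t - c) := Icc_mem_nhds (sub_pos.2 ht.1) (by linarith [ht.2])
    exact ⟨(h2.1.hasDerivAt hn).comp_sub_const t c, (h2.2.hasDerivAt hn).comp_sub_const t c⟩
  refine ⟨fun t => K (t - c), fun t => P (t - c), by simpa using h0, h1, ?_, hpos',
    fun t ht => hpos' t (Ioo_subset_Icc_self ht), ?_, fun t ht => (hder t ht).1,
    fun t ht => (hder t ht).2.congr_deriv (add_zero _).symm⟩
  · refine ContinuousOn.comp (t := Icc 0 (d - c)) (fun t ht => ?_)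
      (by fun_prop : ContinuousOn (fun t : ℝ => t - c) (Icc c d)) hm
    exact (HasDerivWithinAt.continuousWithinAt (𝕜 := ℝ) (hd t ht).1)
  · exact symm_of_hasDerivAt isOpen_Ioo (fun t ht => hpos' t (Ioo_subset_Icc_self ht))
      fun t ht => (hder t ht).1

/-- A function on `[0,1]` with second derivative below `-C (1/t + 1/(1-t))`. -/
noncomputable def barrier (C t : ℝ) : ℝ :=
  16 / 3 * C * (t ^ (3 / 4 : ℝ) + (1 - t) ^ (3 / 4 : ℝ) - 1)

theorem barrier_nonneg {C : ℝ} (hC : 0 ≤ C) (ht : t ∈ Icc (0 : ℝ) 1) : 0 ≤ barrier C t := by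
  have h1 : ∀ x ∈ Icc (0 : ℝ) 1, x ≤ x ^ (3 / 4 : ℝ) := by
    intro x hx
    have := Real.rpow_le_rpow_of_exponent_ge' hx.1 hx.2 (by norm_num)
        (by norm_num : (3 / 4 : ℝ) ≤ 1)
    rwa [rpow_one] at this
  have h2 := h1 t ht
  have h3 := h1 (1 - t) ⟨by linarith [ht.2], by linarith [ht.1]⟩
  exact mul_nonneg (by positivity) (by linarith)

theorem barrier_le {C : ℝ} (hC : 0 ≤ C) (ht : t ∈ Icc (0 : ℝ) 1) :
    barrier C t ≤ 16 / 3 * C * t ^ (3 / 4 : ℝ) := by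
  have h3 := rpow_le_one (sub_nonneg.2 ht.2) (by linarith [ht.1]) (by norm_num : (0 : ℝ) ≤ 3 / 4)
  exact mul_le_mul_of_nonneg_left (by linarith) (by positivity)

theorem barrier_deriv (C : ℝ) : ∃ w₁ w₂ : ℝ → ℝ, ∀ t ∈ 𝕀,
    HasDerivAt (barrier C) (w₁ t) t ∧ HasDerivAt w₁ (w₂ t) t ∧
    (0 ≤ C → w₂ t ≤ -(C * (1 / t + 1 / (1 - t)))) := by
  have hp : ∀ μ : ℝ, ∀ t ∈ 𝕀, HasDerivAt (fun t : ℝ => t ^ μ) (μ * t ^ (μ - 1)) t ∧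
      HasDerivAt (fun t : ℝ => (1 - t) ^ μ) (-(μ * (1 - t) ^ (μ - 1))) t := by
    intro μ t ht
    refine ⟨Real.hasDerivAt_rpow_const (Or.inl ht.1.ne'), ?_⟩
    have h1 := (Real.hasDerivAt_rpow_const (p := μ) (Or.inl (sub_pos.2 ht.2).ne')).comp t
      ((hasDerivAt_id t).const_sub 1)
    exact h1.congr_deriv (by simp)
  refine ⟨fun t => 16 / 3 * C * (3 / 4 * t ^ (3 / 4 - 1 : ℝ) +
      -(3 / 4 * (1 - t) ^ (3 / 4 - 1 : ℝ))),
    fun t => 16 / 3 * C * (3 / 4 * ((3 / 4 - 1) * t ^ (3 / 4 - 1 - 1 : ℝ)) +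
      -(3 / 4 * -((3 / 4 - 1) * (1 - t) ^ (3 / 4 - 1 - 1 : ℝ)))), fun t ht =>
          ⟨?_, ?_, fun hC => ?_⟩⟩
  · exact (((hp _ t ht).1.add (hp _ t ht).2).sub_const 1).const_mul _
  · exact (((hp _ t ht).1.const_mul _).add (((hp _ t ht).2.const_mul _).neg)).const_mul _
  · have h1 : ∀ x ∈ 𝕀, 1 / x ≤ x ^ (3 / 4 - 1 - 1 : ℝ) := by
      intro x hx
      rw [one_div, ← rpow_neg_one]
      exact Real.rpow_le_rpow_of_exponent_ge hx.1 hx.2.le (by norm_num)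
    have h2 := h1 t ht
    have h3 := h1 (1 - t) ⟨by linarith [ht.2], by linarith [ht.1]⟩
    nlinarith

/-- The maximum principle: a solution with the boundary values of a reference metric stays within
the barrier of it. -/
theorem IsMetricPath.trace_le (hk : 0 < k) {K₀ P₀ E₀ g₀ : ℝ → Mat k}
    (h₀ : IsMetricPath B 𝕀 K₀ P₀ E₀)
    (hg₀ : ∀ t ∈ 𝕀, IsUnit (g₀ t) ∧ K₀ t = (g₀ t)ᴴ * g₀ t) {C : ℝ} (hC : 0 ≤ C)
    (hE : ∀ t ∈ 𝕀, ‖g₀ t * E₀ t * (g₀ t)⁻¹‖ ≤ C * (1 / t + 1 / (1 - t)))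
    {c d : ℝ} (hc : 0 < c) (hcd : c < d) (hd : d < 1) {K P : ℝ → Mat k}
    (hK : IsMetricPath B (Ioo c d) K P fun _ => 0) (hcont : ContinuousOn K (Icc c d))
    (hpos : ∀ t ∈ Icc c d, (K t).PosDef) (hKc : K c = K₀ c) (hKd : K d = K₀ d) :
    ∀ t ∈ Icc c d, ((K₀ t)⁻¹ * K t).trace.re ≤ k * exp (barrier C t) ∧
      ((K t)⁻¹ * K₀ t).trace.re ≤ k * exp (barrier C t) := by
  have hsub : Icc c d ⊆ Ioo 0 1 := fun t ht => ⟨hc.trans_le ht.1, ht.2.trans_lt hd⟩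
  have hsub' : Ioo c d ⊆ Ioo 0 1 := Ioo_subset_Icc_self.trans hsub
  obtain ⟨w₁, w₂, hw⟩ := barrier_deriv C
  have hr : IsMetricPath B (Ioo c d) K₀ P₀ E₀ := ⟨fun t ht => h₀.posDef t (hsub' ht),
    fun t ht => h₀.symm t (hsub' ht), fun t ht => h₀.deriv_K t (hsub' ht),
    fun t ht => h₀.deriv_P t (hsub' ht)⟩
  have hcont₀ : ContinuousOn K₀ (Icc c d) := fun t ht =>
    (continuousAt (𝕜 := ℝ) (h₀.deriv_K t (hsub ht))).continuousWithinAt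
  have hpd₀ : ∀ t ∈ Icc c d, (K₀ t).PosDef := fun t ht => h₀.posDef t (hsub ht)
  have hwc : ContinuousOn (barrier C) (Icc c d) := fun t ht =>
    ((hw t (hsub ht)).1.continuousAt).continuousWithinAt
  have hl := left_mem_Icc.2 hcd.le
  have hr' := right_mem_Icc.2 hcd.le
  -- the estimate is symmetric in the two metrics, so it is proved for a general pair
  have key : ∀ {X Y P E P' E' : ℝ → Mat k}, IsMetricPath B (Ioo c d) X P E →
      IsMetricPath B (Ioo c d) Y P' E' → ContinuousOn X (Icc c d) → ContinuousOn Y (Icc c d) →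
      (∀ t ∈ Icc c d, (X t).PosDef) → (∀ t ∈ Icc c d, (Y t).PosDef) → X c = Y c → X d = Y d →
      (∀ r ∈ Ioo c d, |((Y r)⁻¹ * X r * (E r - E' r)).trace.re| ≤
        ((Y r)⁻¹ * X r).trace.re * ‖g₀ r * E₀ r * (g₀ r)⁻¹‖) →
      ∀ t ∈ Icc c d, ((Y t)⁻¹ * X t).trace.re ≤ k * exp (barrier C t) := by
    intro X Y P E P' E' hX hY cX cY pX pY hc hd hE'
    have hbd : ∀ t ∈ Icc c d, X t = Y t → ((Y t)⁻¹ * X t).trace.re ≤ k * exp (barrier C t) := by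
      intro t ht h
      have h1 : (k : ℝ) ≤ k * exp (barrier C t) := le_mul_of_one_le_right (cast_nonneg k)
        (Real.one_le_exp (barrier_nonneg hC (Ioo_subset_Icc_self (hsub ht))))
      rw [h, nonsing_inv_mul' (pY t ht).isUnit]
      simpa using h1
    obtain ⟨f₁, f₂, hf⟩ := hX.hasDerivAt_trace hY
    refine le_exp_of_log_deriv2 (by exact_mod_cast hk) ((reTrCLM k).continuous.comp_continuousOn
        ((continuousOn_inv cY fun t ht => (pY t ht).isUnit).mul cX)) hwc
      (fun t ht => trace_inv_mul_pos hk (pX t ht) (pY t ht)) (fun t ht => (hf t ht).1)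
      (fun t ht => (hf t ht).2.1) (fun t ht => (hw t (hsub' ht)).1)
      (fun t ht => (hw t (hsub' ht)).2.1) (fun r hr => ?_) (hbd c hl hc) (hbd d hr' hd)
    have h3 := trace_inv_mul_nonneg (pX r (Ioo_subset_Icc_self hr)) (pY r (Ioo_subset_Icc_self hr))
    have h4 := (hE' r hr).trans (mul_le_mul_of_nonneg_left (c := -w₂ r)
      (by linarith [hE r (hsub' hr), (hw r (hsub' hr)).2.2 hC]) h3)
    nlinarith [((hf r hr).2.2), (mul_le_mul_of_nonneg_left (neg_le_of_abs_le h4) h3)]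
  refine fun t ht => ⟨key hK hr hcont hcont₀ hpos hpd₀ hKc hKd (fun r hr => ?_) t ht,
    key hr hK hcont₀ hcont hpd₀ hpos hKc.symm hKd.symm (fun r hr => ?_) t ht⟩
  · have hr' := hsub' hr
    rw [zero_sub, mul_neg, trace_neg, neg_re, abs_neg, (hg₀ r hr').2]
    exact abs_trace_inv_mul_mul_le (hpos r (Ioo_subset_Icc_self hr)) (hg₀ r hr').1 _
  · have hr' := hsub' hr
    rw [sub_zero, (hg₀ r hr').2]
    exact abs_trace_inv_mul_mul_le' (hpos r (Ioo_subset_Icc_self hr)) (hg₀ r hr').1 _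

theorem norm_le_of_trace_le {g₀ : Mat k} (hK : K.PosDef) (hg₀ : IsUnit g₀) {τ : ℝ}
    (h1 : ((g₀ᴴ * g₀)⁻¹ * K).trace.re ≤ τ) (h2 : (K⁻¹ * (g₀ᴴ * g₀)).trace.re ≤ τ) :
    ‖K‖ ≤ τ * ‖g₀‖ ^ 2 ∧ ‖K⁻¹‖ ≤ τ * ‖g₀⁻¹‖ ^ 2 := by
  obtain ⟨g, hg, rfl⟩ := exists_posDef_factor hK
  rw [trace_inv_mul_factor] at h1 h2
  have e : ∀ A B C : Mat k, A = B * C → ‖B‖ ^ 2 ≤ τ → ‖A‖ ^ 2 ≤ τ * ‖C‖ ^ 2 := by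
    rintro A B C rfl h
    calc ‖B * C‖ ^ 2 ≤ (‖B‖ * ‖C‖) ^ 2 := by gcongr; exact norm_mul_le _ _
      _ = ‖B‖ ^ 2 * ‖C‖ ^ 2 := mul_pow _ _ _
      _ ≤ _ := by gcongr
  have h3 := e g _ g₀ (by rw [mul_assoc, nonsing_inv_mul' hg₀, mul_one]) h1
  have h4 : ‖(g⁻¹)ᴴ‖ ^ 2 ≤ τ * ‖(g₀⁻¹)ᴴ‖ ^ 2 := by
    refine e _ (g₀ * g⁻¹)ᴴ _ ?_ (by rwa [frobenius_norm_conjTranspose])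
    rw [← conjTranspose_mul, ← mul_assoc, nonsing_inv_mul' hg₀, one_mul]
  rw [frobenius_norm_conjTranspose, frobenius_norm_conjTranspose] at h4
  rw [inv_conjTranspose_mul_self]
  refine ⟨(norm_mul_le _ _).trans ?_, (norm_mul_le _ _).trans ?_⟩ <;>
    rwa [frobenius_norm_conjTranspose, ← sq]

/-- Bounds on a solution and its inverse bound its logarithmic derivative: the latter is constant
up to a bounded error, and integrating `(K⁻¹)' = -P K⁻¹` against that constant bounds it. -/
theorem IsMetricPath.exists_bound (B : Fin 3 → Mat k) {a b M : ℝ} (hab : a < b) (hM : 0 ≤ M) :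
    ∃ N : ℝ, ∀ K P : ℝ → Mat k, ∀ s, Icc a b ⊆ s → IsMetricPath B s K P (fun _ => 0) →
      (∀ t ∈ Icc a b, ‖K t‖ ≤ M ∧ ‖(K t)⁻¹‖ ≤ M) → ∀ t ∈ Icc a b, ‖P t‖ ≤ N := by
  set C := ∑ i, 8 * (‖B i‖ * (M * ‖B i‖ * M)) with hC
  have hC0 : 0 ≤ C := sum_nonneg fun i _ => by positivity
  set m := ‖(1 : Mat k)‖ * M + 1 with hm
  have hm0 : 0 < m := by positivity
  refine ⟨m * (2 * M / (b - a) + C * (b - a) * M) + C * (b - a), fun K P s hs h hb => ?_⟩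
  have hba := sub_pos.2 hab
  -- `P' = 4 curv` is bounded, so `P` differs little from `P a`
  have hcurv : ∀ t ∈ Icc a b, ‖(4 : ℂ) • curv B (K t)‖ ≤ C := by
    intro t ht
    rw [norm_smul, curv, norm_ofNat, hC]
    have e : ∀ i, 8 * (‖B i‖ * (M * ‖B i‖ * M)) = 4 * (2 * (‖B i‖ * (M * ‖B i‖ * M))) := fun i => by
      ring
    simp only [e, ← mul_sum _ _ (4 : ℝ)]
    refine mul_le_mul_of_nonneg_left (norm_sum_le_of_le _ fun i _ => ?_) (by norm_num)
    have h1 : ‖(K t)⁻¹ * (B i)ᴴ * K t‖ ≤ M * ‖B i‖ * M := norm_mul_le_of_le (norm_mul_le_of_le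
      (hb t ht).2 (frobenius_norm_conjTranspose _).le) (hb t ht).1
    rw [Ring.lie_def, two_mul]
    exact norm_sub_le_of_le (norm_mul_le_of_le le_rfl h1)
      ((norm_mul_le_of_le h1 le_rfl).trans (mul_comm _ _).le)
  have hPa : ∀ t ∈ Icc a b, ‖P t - P a‖ ≤ C * (b - a) := by
    intro t ht
    have h1 := Convex.norm_image_sub_le_of_norm_hasDerivWithin_le (f := P)
      (f' := fun t => (4 : ℂ) • curv B (K t)) (s := Icc a b) (C := C)
      (fun r hr => ((h.deriv_P r (hs hr)).congr_deriv (add_zero _)).hasDerivWithinAt) hcurv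
      (convex_Icc a b) (left_mem_Icc.2 hab.le) ht
    refine h1.trans (mul_le_mul_of_nonneg_left ?_ hC0)
    rw [norm_eq_abs, abs_of_nonneg (sub_nonneg.2 ht.1)]
    linarith [ht.2]
  -- mean value theorem for `Re tr (K⁻¹ (P a)ᴴ)`; its derivative is near `-tr (P a K⁻¹ (P a)ᴴ)`
  have hφ : ∀ t ∈ Icc a b, HasDerivAt (fun t => ((K t)⁻¹ * (P a)ᴴ).trace.re)
      (-(P t * (K t)⁻¹ * (P a)ᴴ).trace.re) t := by
    intro t ht
    have hu := (h.posDef t (hs ht)).isUnit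
    refine (hasDerivAt_reTr ((hasDerivAt_inv (h.deriv_K t (hs ht)) hu).mul_const _)).congr_deriv ?_
    rw [← mul_assoc, nonsing_inv_mul' hu, one_mul, neg_mul, trace_neg, neg_re]
  obtain ⟨ξ, hξ, hslope⟩ := exists_hasDerivAt_eq_slope (fun t => ((K t)⁻¹ * (P a)ᴴ).trace.re) _ hab
    (fun t ht => (hφ t ht).continuousAt.continuousWithinAt)
    (fun t ht => hφ t (Ioo_subset_Icc_self ht))
  have hξ' := Ioo_subset_Icc_self hξ
  rw [eq_div_iff hba.ne'] at hslope
  have hφb : ∀ t ∈ Icc a b, |((K t)⁻¹ * (P a)ᴴ).trace.re| ≤ M * ‖P a‖ := fun t ht => by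
    refine (abs_re_trace_mul_le' _ _).trans ?_
    rw [frobenius_norm_conjTranspose]
    exact mul_le_mul_of_nonneg_right (hb t ht).2 (norm_nonneg _)
  obtain ⟨g, hg, hKg⟩ := exists_posDef_factor (h.posDef ξ (hs hξ'))
  have hlow : ‖P a‖ ^ 2 ≤ m * (P a * (K ξ)⁻¹ * (P a)ᴴ).trace.re := by
    have h1 := norm_factor_sq 1 g (P a)
    rw [conjTranspose_one, one_mul, one_mul, one_mul, ← hKg] at h1
    have h2 : ‖g‖ ^ 2 ≤ m := by
      rw [norm_sq_eq_trace, ← hKg, ← one_mul (K ξ)]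
      refine ((le_abs_self _).trans (abs_re_trace_mul_le' _ _)).trans ?_
      have := mul_le_mul_of_nonneg_left (hb ξ hξ').1 (norm_nonneg (1 : Mat k))
      linarith
    calc ‖P a‖ ^ 2 = ‖P a * g⁻¹ * g‖ ^ 2 := by rw [mul_assoc, nonsing_inv_mul' hg, mul_one]
      _ ≤ (‖P a * g⁻¹‖ * ‖g‖) ^ 2 := pow_le_pow_left₀ (norm_nonneg _) (norm_mul_le _ _) 2
      _ = ‖g‖ ^ 2 * ‖P a * g⁻¹‖ ^ 2 := by ring
      _ ≤ _ := by rw [h1]; exact mul_le_mul_of_nonneg_right h2 (h1 ▸ sq_nonneg _)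
  have herr : |((P ξ - P a) * (K ξ)⁻¹ * (P a)ᴴ).trace.re| ≤ C * (b - a) * M * ‖P a‖ := by
    refine (abs_re_trace_mul_le' _ _).trans ?_
    rw [frobenius_norm_conjTranspose]
    gcongr
    exact norm_mul_le_of_le (hPa ξ hξ') (hb ξ hξ').2
  rw [sub_mul, sub_mul, trace_sub, sub_re] at herr
  have hb1 := (abs_le.1 (hφb a (left_mem_Icc.2 hab.le))).2
  have hb2 := (abs_le.1 (hφb b (right_mem_Icc.2 hab.le))).1
  beta_reduce at hslope hb1 hb2
  generalize ((K a)⁻¹ * (P a)ᴴ).trace.re = x₁ at hslope hb1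
  generalize ((K b)⁻¹ * (P a)ᴴ).trace.re = x₂ at hslope hb2
  generalize (P a * (K ξ)⁻¹ * (P a)ᴴ).trace.re = x₃ at hlow herr
  generalize (P ξ * (K ξ)⁻¹ * (P a)ᴴ).trace.re = x₄ at hslope herr
  clear_value m C
  have hmain : ‖P a‖ ≤ m * (2 * M / (b - a) + C * (b - a) * M) := by
    rcases (norm_nonneg (P a)).eq_or_lt with h0 | h0
    · rw [← h0]; positivity
    refine le_of_mul_le_mul_right ?_ h0
    have h3 : x₄ ≤ 2 * M / (b - a) * ‖P a‖ := by
      rw [div_mul_eq_mul_div, le_div_iff₀ hba]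
      linarith
    have h4 := mul_le_mul_of_nonneg_left (show x₃ ≤
      (2 * M / (b - a) + C * (b - a) * M) * ‖P a‖ by linarith [(abs_le.1 herr).1]) hm0.le
    linarith
  intro t ht
  have h5 := norm_le_insert' (P t) (P a)
  linarith [hPa t ht]

/-- Along a solution of an autonomous equation the first order Taylor remainder is quadratic. -/
theorem norm_sub_sub_smul_le {E : Type*} [NormedAddCommGroup E] [NormedSpace ℝ E] {f : E → E}
    {S : Set E} {L : ℝ} (hL : 0 ≤ L) (hf : ∀ x ∈ S, ‖f x‖ ≤ L)
    (hf' : ∀ x ∈ S, ∀ x' ∈ S, ‖f x - f x'‖ ≤ L * ‖x - x'‖) {y : ℝ → E} {s : ℝ} (hst : s ≤ t)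
    (hy : ∀ r ∈ Icc s t, y r ∈ S ∧ HasDerivAt y (f (y r)) r) :
    ‖y t - y s - (t - s) • f (y s)‖ ≤ L ^ 2 * (t - s) ^ 2 := by
  have hs : s ∈ Icc s t := left_mem_Icc.2 hst
  have h1 : ∀ r ∈ Icc s t, ‖y r - y s‖ ≤ L * (t - s) := by
    intro r hr
    refine (Convex.norm_image_sub_le_of_norm_hasDerivWithin_le
      (fun x hx => (hy x hx).2.hasDerivWithinAt) (fun x hx => hf _ (hy x hx).1)
      (convex_Icc s t) hs hr).trans (mul_le_mul_of_nonneg_left ?_ hL)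
    rw [norm_eq_abs, abs_of_nonneg (sub_nonneg.2 hr.1)]
    linarith [hr.2]
  have h2 := Convex.norm_image_sub_le_of_norm_hasDerivWithin_le (f := fun r => y r - r • f (y s))
    (f' := fun r => f (y r) - f (y s)) (C := L ^ 2 * (t - s))
    (fun x hx => ((hy x hx).2.sub
      (((hasDerivAt_id x).smul_const (f (y s))).congr_deriv (one_smul _ _))).hasDerivWithinAt)
    (fun x hx => (hf' _ (hy x hx).1 _ (hy s hs).1).trans
      (by have := mul_le_mul_of_nonneg_left (h1 x hx) hL; linarith))
    (convex_Icc s t) hs (right_mem_Icc.2 hst)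
  have e : y t - t • f (y s) - (y s - s • f (y s)) = y t - y s - (t - s) • f (y s) := by
    rw [sub_smul]; abel
  rw [e, norm_eq_abs, abs_of_nonneg (sub_nonneg.2 hst)] at h2
  linarith

/-- Solutions on exhausting intervals with the boundary values of the reference metric converge,
along an ultrafilter, to a solution on `(0,1)`. -/
theorem exists_metric (hk : 0 < k) {K₀ P₀ E₀ g₀ : ℝ → Mat k}
    (h₀ : IsMetricPath B 𝕀 K₀ P₀ E₀)
    (hg₀ : ∀ t ∈ 𝕀, IsUnit (g₀ t) ∧ K₀ t = (g₀ t)ᴴ * g₀ t)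
    (hgc : ContinuousOn g₀ 𝕀) {C : ℝ} (hC : 0 ≤ C)
    (hE : ∀ t ∈ 𝕀, ‖g₀ t * E₀ t * (g₀ t)⁻¹‖ ≤ C * (1 / t + 1 / (1 - t))) :
    ∃ K P : ℝ → Mat k, IsMetricPath B 𝕀 K P (fun _ => 0) ∧ ∀ t ∈ 𝕀,
      ((K₀ t)⁻¹ * K t).trace.re ≤ k * exp (barrier C t) ∧
      ((K t)⁻¹ * K₀ t).trace.re ≤ k * exp (barrier C t) := by
  have : ProperSpace (Mat³ k) := FiniteDimensional.proper_real _
  -- solve the boundary value problem on `[c n, 1 - c n]`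
  set c : ℕ → ℝ := fun n => 1 / ((n : ℝ) + 1 + 1 + 1) with hc
  have hc0 : ∀ n, 0 < c n := fun n => by positivity
  have hc1 : ∀ n, c n < 1 - c n := fun n => by
    have : c n < 1 / 2 := by
      rw [hc]
      exact one_div_lt_one_div_of_lt two_pos (by have := n.cast_nonneg (α := ℝ); linarith)
    linarith
  have hcl : Tendsto c atTop (𝓝 0) := by
    refine ((tendsto_one_div_add_atTop_nhds_zero_nat (𝕜 := ℝ)).comp (tendsto_add_atTop_nat
      2)).congr fun n => ?_
    simp only [Function.comp, hc]; push_cast; ring_nf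
  have hbvp : ∀ n, ∃ K P : ℝ → Mat k, IsMetricPath B (Ioo (c n) (1 - c n)) K P (fun _ => 0) ∧
      ∀ t ∈ Icc (c n) (1 - c n), ((K₀ t)⁻¹ * K t).trace.re ≤ k * exp (barrier C t) ∧
        ((K t)⁻¹ * K₀ t).trace.re ≤ k * exp (barrier C t) := by
    intro n
    have h1 : 1 - c n < 1 := sub_lt_self _ (hc0 n)
    obtain ⟨K, P, e0, e1, hcont, hpos, hK⟩ := exists_bvp_Icc hk B (hc1 n)
      (h₀.posDef (c n) ⟨hc0 n, (hc1 n).trans h1⟩) (h₀.posDef (1 - c n) ⟨(hc0 n).trans (hc1 n), h1⟩)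
    exact ⟨K, P, hK, h₀.trace_le hk hg₀ hC hE (hc0 n) (hc1 n) h1 hK hcont hpos e0 e1⟩
  choose K P hK htr using hbvp
  -- including the inverse makes the equation polynomial and keeps the limit invertible
  set y : ℕ → ℝ → Mat³ k := fun n t => (K n t, (K n t)⁻¹, P n t) with hy
  have hyd : ∀ n, ∀ t ∈ Ioo (c n) (1 - c n), HasDerivAt (y n) (metricField B (y n t)) t := by
    intro n t ht
    have hu := ((hK n).posDef t ht).isUnit
    refine (((hK n).deriv_K t ht).prodMk ((hasDerivAt_inv ((hK n).deriv_K t ht) hu).prodMk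
      ((hK n).deriv_P t ht))).congr_deriv ?_
    refine Prod.ext rfl (Prod.ext ?_ ?_)
    · change -((K n t)⁻¹ * (K n t * P n t) * (K n t)⁻¹) = -(P n t * (K n t)⁻¹)
      rw [← mul_assoc, nonsing_inv_mul' hu, one_mul]
    · exact add_zero _
  have hin : ∀ a b : ℝ, 0 < a → b < 1 → ∀ᶠ n in atTop, Icc a b ⊆ Ioo (c n) (1 - c n) := by
    intro a b ha hb
    filter_upwards [hcl.eventually_lt_const ha, hcl.eventually_lt_const (sub_pos.2 hb)] with n h1 h2
    exact fun t ht => ⟨h1.trans_le ht.1, by linarith [ht.2]⟩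
  have hbound : ∀ a b : ℝ, 0 < a → a < b → b < 1 → ∃ M, ∀ᶠ n in atTop,
      ∀ t ∈ Icc a b, ‖y n t‖ ≤ M := by
    intro a b ha hab hb
    have hsub : Icc a b ⊆ Ioo 0 1 := fun t ht => ⟨ha.trans_le ht.1, ht.2.trans_lt hb⟩
    obtain ⟨M₁, h1⟩ := isCompact_Icc.exists_bound_of_continuousOn (hgc.mono hsub)
    obtain ⟨M₂, h2⟩ := isCompact_Icc.exists_bound_of_continuousOn
      (continuousOn_inv (hgc.mono hsub) fun t ht => (hg₀ t (hsub ht)).1)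
    set τ := k * exp (16 / 3 * C)
    have hτ0 : 0 ≤ τ := by positivity
    set M := τ * (M₁ ^ 2 + M₂ ^ 2) with hM
    have hM0 : 0 ≤ M := by positivity
    obtain ⟨N, hN⟩ := IsMetricPath.exists_bound B hab hM0
    refine ⟨max M (max M N), ?_⟩
    filter_upwards [hin a b ha hb] with n hn
    have hKb : ∀ t ∈ Icc a b, ‖K n t‖ ≤ M ∧ ‖(K n t)⁻¹‖ ≤ M := by
      intro t ht
      have hτ : k * exp (barrier C t) ≤ τ := by
        refine mul_le_mul_of_nonneg_left (exp_le_exp.2 ?_) (cast_nonneg k)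
        have ht' := hsub ht
        exact (barrier_le hC (Ioo_subset_Icc_self ht')).trans (mul_le_of_le_one_right (by
          positivity) (rpow_le_one ht'.1.le ht'.2.le (by norm_num)))
      obtain ⟨e1, e2⟩ := htr n t (Ioo_subset_Icc_self (hn ht))
      rw [(hg₀ t (hsub ht)).2] at e1 e2
      obtain ⟨e3, e4⟩ := norm_le_of_trace_le ((hK n).posDef t (hn ht)) (hg₀ t (hsub ht)).1
        (e1.trans hτ) (e2.trans hτ)
      have e5 := pow_le_pow_left₀ (norm_nonneg _) (h1 t ht) 2
      have e6 := pow_le_pow_left₀ (norm_nonneg _) (h2 t ht) 2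
      constructor <;> nlinarith [sq_nonneg M₁, sq_nonneg M₂]
    intro t ht
    exact max_le_max (hKb t ht).1 (max_le_max (hKb t ht).2 (hN _ _ _ hn (hK n) hKb t ht))
  have hlim : ∀ t ∈ 𝕀, ∃ Y, Tendsto (fun n => y n t) 𝒰 (𝓝 Y) := by
    intro t ht
    obtain ⟨M, hM⟩ := hbound (t / 2) t (by linarith [ht.1]) (by linarith [ht.1]) ht.2
    exact exists_tendsto_hyperfilter (hM.mono fun n hn => hn t ⟨by linarith [ht.1], le_rfl⟩)
  choose! Y hY using hlim
  have hmem : ∀ t ∈ 𝕀, ∀ᶠ n in 𝒰, t ∈ Ioo (c n) (1 - c n) := fun t ht => hyperfilter_le_atTop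
    ((hin t t ht.1 ht.2).mono fun n hn => hn ⟨le_rfl, le_rfl⟩)
  have hYd : ∀ t ∈ 𝕀, HasDerivAt Y (metricField B (Y t)) t := by
    intro t ht
    obtain ⟨a, ha0, hat⟩ := exists_between ht.1
    obtain ⟨b, htb, hb1⟩ := exists_between ht.2
    have hsub : Icc a b ⊆ Ioo 0 1 := fun t ht => ⟨ha0.trans_le ht.1, ht.2.trans_lt hb1⟩
    obtain ⟨M, hM⟩ := hbound a b ha0 (hat.trans htb) hb1
    obtain ⟨L, hL, hf1, hf2⟩ := exists_bound_metricField B M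
    have hYM : ∀ s ∈ Icc a b, Y s ∈ closedBall (0 : Mat³ k) M := by
      intro s hs
      exact mem_closedBall_zero_iff.2 (le_of_tendsto (hY s (hsub hs)).norm (hyperfilter_le_atTop
        (hM.mono fun n hn => hn s hs)))
    refine (hasDerivWithinAt_of_tendsto (l := 𝒰) (y := y) (C := L ^ 2)
      (ε := fun _ _ => 0) hL (sq_nonneg L) (fun s hs => hY s (hsub hs))
      (contDiff_metricField B).continuous (fun s hs => hf1 _ (hYM s hs))
      (fun s hs r hr => hf2 _ (hYM s hs) _ (hYM r hr)) (fun _ => tendsto_const_nhds)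
      (fun s hs r hr hsr => ?_) t ⟨hat.le, htb.le⟩).hasDerivAt (Icc_mem_nhds hat htb)
    refine hyperfilter_le_atTop ?_
    filter_upwards [hM, hin a b ha0 hb1] with n hn hn'
    rw [add_zero]
    refine norm_sub_sub_smul_le hL hf1 hf2 hsr fun x hx => ?_
    have hx' : x ∈ Icc a b := ⟨hs.1.trans hx.1, hx.2.trans hr.2⟩
    exact ⟨mem_closedBall_zero_iff.2 (hn x hx'), hyd n x (hn' hx')⟩
  have hY1 : ∀ t ∈ 𝕀, Tendsto (fun n => K n t) 𝒰
      (𝓝 (Y t).1) := fun t ht => (continuous_fst.tendsto _).comp (hY t ht)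
  have hY2 : ∀ t ∈ 𝕀, Tendsto (fun n => (K n t)⁻¹) 𝒰
      (𝓝 (Y t).2.1) := fun t ht => ((continuous_fst.comp continuous_snd).tendsto _).comp (hY t ht)
  have hmul : ∀ t ∈ 𝕀, (Y t).1 * (Y t).2.1 = 1 := by
    intro t ht
    exact tendsto_nhds_unique ((hY1 t ht).mul (hY2 t ht)) (tendsto_const_nhds.congr' ((hmem t
      ht).mono fun n hn => (mul_nonsing_inv' ((hK n).posDef t hn).isUnit).symm))
  have hpos : ∀ t ∈ 𝕀, (Y t).1.PosDef := fun t ht =>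
    posDef_of_posSemidef_of_mul (isClosed_posSemidef.mem_of_tendsto (hY1 t ht)
      ((hmem t ht).mono fun n hn => ((hK n).posDef t hn).posSemidef)) (hmul t ht)
  have hinv : ∀ t ∈ 𝕀, (Y t).2.1 = (Y t).1⁻¹ := fun t ht => (inv_eq_right_inv (hmul t ht)).symm
  have hKd : ∀ t ∈ 𝕀, HasDerivAt (fun t => (Y t).1) ((Y t).1 * (Y t).2.2) t :=
    fun t ht => (fst ℝ (Mat k) (Mat k × Mat k)).hasFDerivAt.comp_hasDerivAt t (hYd t ht)
  have hre : ∀ {X : ℕ → Mat k} {Z : Mat k}, Tendsto X 𝒰 (𝓝 Z) →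
      Tendsto (fun n => (X n).trace.re) 𝒰 (𝓝 Z.trace.re) := fun h =>
    ((reTrCLM k).continuous.tendsto _).comp h
  refine ⟨fun t => (Y t).1, fun t => (Y t).2.2, ⟨hpos, symm_of_hasDerivAt isOpen_Ioo hpos hKd, hKd,
    fun t ht => ?_⟩, fun t ht => ⟨?_, ?_⟩⟩
  · have h1 := (((snd ℝ (Mat k) (Mat k)).comp
      (snd ℝ (Mat k) (Mat k × Mat k))).hasFDerivAt).comp_hasDerivAt t
      (hYd t ht)
    refine h1.congr_deriv ?_
    change (4 : ℂ) • ∑ i, ⁅B i, (Y t).2.1 * (B i)ᴴ * (Y t).1⁆ = _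
    rw [hinv t ht, add_zero]
    rfl
  · exact le_of_tendsto (hre (tendsto_const_nhds.mul (hY1 t ht)))
      ((hmem t ht).mono fun n hn => (htr n t (Ioo_subset_Icc_self hn)).1)
  · beta_reduce
    rw [← hinv t ht]
    exact le_of_tendsto (hre ((hY2 t ht).mul tendsto_const_nhds))
      ((hmem t ht).mono fun n hn => (htr n t (Ioo_subset_Icc_self hn)).2)

/-! ### Temporal gauge of a solution of the real equation -/

/-- The solution with Hermitian `α` whose metric in the trivialization is `K`: with `g' = g P / 2`
both `g` and `g⁻ᴴ K` solve the same equation, so `gᴴ g = K`. -/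
theorem exists_temporal {K P : ℝ → Mat k}
    (h : IsMetricPath B 𝕀 K P fun _ => 0) {Q : Mat k} (hQ : IsUnit Q)
    (hQK : K (1 / 2) = Qᴴ * Q) : ∃ (g : ℝ → Mat k) (D : ComplexData k),
      Intertwines g (flat B) D ∧ g (1 / 2) = Q ∧
      (∀ t ∈ 𝕀, K t = (g t)ᴴ * g t) ∧ (∀ t ∈ 𝕀, (D.α t)ᴴ = D.α t) ∧
      ∀ t ∈ 𝕀, HasDerivAt D.α (-∑ i, ⁅D.β i t, (D.β i t)ᴴ⁆) t := by
  have hPc : ContinuousOn (fun t => (1 / 2 : ℂ) • P t) 𝕀 := fun t ht =>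
    ((continuousAt (𝕜 := ℝ) (h.deriv_P t ht)).const_smul (1 / 2 : ℂ)).continuousWithinAt
  obtain ⟨f, hf0, hf⟩ := exists_frame_Ioo hPc
  set g : ℝ → Mat k := fun t => Q * f t with hg
  have hg0 : g (1 / 2) = Q := by rw [hg]; beta_reduce; rw [hf0, mul_one]
  have hgu : ∀ t ∈ 𝕀, IsUnit (g t) := fun t ht => hQ.mul (hf t ht).2
  have hgd : ∀ t ∈ 𝕀, HasDerivAt g (g t * ((1 / 2 : ℂ) • P t)) t := fun t ht =>
    ((hf t ht).1.const_mul Q).congr_deriv (mul_assoc _ _ _).symm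
  clear_value g
  have hst : ∀ {X : Mat k}, IsUnit X → IsUnit Xᴴ := fun h => h.star
  have hK : ∀ t ∈ 𝕀, K t = (g t)ᴴ * g t := by
    have hu : ∀ t ∈ 𝕀, HasDerivAt (fun t => ((g t)ᴴ)⁻¹ * K t)
        (((g t)ᴴ)⁻¹ * K t * ((1 / 2 : ℂ) • P t)) t := by
      intro t ht
      have hu := hst (hgu t ht)
      refine ((hasDerivAt_inv (hasDerivAt_conjTranspose (hgd t ht)) hu).mul
        (h.deriv_K t ht)).congr_deriv ?_
      have e : ((1 / 2 : ℂ) • P t)ᴴ = (1 / 2 : ℂ) • (P t)ᴴ := by rw [conjTranspose_smul]; norm_num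
      rw [conjTranspose_mul, e, smul_mul_assoc, mul_smul_comm, smul_mul_assoc,
        ← mul_assoc _ (P t)ᴴ, mul_assoc _ (g t)ᴴ, mul_nonsing_inv' hu, mul_one, neg_mul,
        smul_mul_assoc, mul_assoc _ _ (K t), (h.symm t ht), mul_smul_comm, mul_assoc]
      module
    have hi : ((g (1 / 2))ᴴ)⁻¹ * K (1 / 2) = g (1 / 2) := by
      rw [hQK, hg0, ← mul_assoc, nonsing_inv_mul' (hst hQ), one_mul]
    intro t ht
    have := linear_ode_unique (convex_Ioo 0 1) (fun t ht => (hu t ht).hasDerivWithinAt)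
      (fun t ht => (hgd t ht).hasDerivWithinAt) hgu (by norm_num) hi ht
    nth_rewrite 2 [← this]
    rw [← mul_assoc, mul_nonsing_inv' (hst (hgu t ht)), one_mul]
  have hherm : ∀ t ∈ 𝕀, (g t * P t * (g t)⁻¹)ᴴ = g t * P t * (g t)⁻¹ := by
    intro t ht
    have hs := h.symm t ht
    rw [hK t ht, ← mul_assoc] at hs
    have := congrArg (((g t)⁻¹)ᴴ * · * (g t)⁻¹) hs
    simp only [conjTranspose_mul]
    grind [conjTranspose_inv_mul (hgu t ht), mul_nonsing_inv' (hgu t ht)]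
  -- with `α = - g P g⁻¹ / 4`, the equation for `P` is the real equation
  have hd : ∀ t ∈ 𝕀, HasDerivAt (fun t => (-1 / 4 : ℂ) • (g t * P t * (g t)⁻¹))
      (-∑ i, ⁅g t * B i * (g t)⁻¹, (g t * B i * (g t)⁻¹)ᴴ⁆) t := by
    intro t ht
    have hu := hgu t ht
    refine ((((hgd t ht).mul (h.deriv_P t ht)).mul (hasDerivAt_inv (hgd t ht) hu)).const_smul
      (-1 / 4 : ℂ)).congr_deriv ?_
    have hc : g t * curv B (K t) * (g t)⁻¹ =
        ∑ i, ⁅g t * B i * (g t)⁻¹, (g t * B i * (g t)⁻¹)ᴴ⁆ := by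
      rw [curv, mul_sum, sum_mul]
      refine sum_congr rfl fun i _ => ?_
      have e : (g t * B i * (g t)⁻¹)ᴴ = g t * ((K t)⁻¹ * (B i)ᴴ * K t) * (g t)⁻¹ := by
        rw [hK t ht, inv_conjTranspose_mul_self]
        simp only [conjTranspose_mul]
        grind [mul_nonsing_inv' hu]
      rw [e, Ring.lie_def, Ring.lie_def, mul_sub, sub_mul]
      grind [nonsing_inv_mul' hu]
    rw [← hc, add_zero, ← mul_assoc (g t)⁻¹, nonsing_inv_mul' hu, one_mul]
    simp only [Pi.mul_apply, mul_neg, mul_smul_comm, smul_mul_assoc, add_mul, ← mul_assoc]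
    module
  refine ⟨g, ⟨fun t => (-1 / 4 : ℂ) • (g t * P t * (g t)⁻¹), fun i t => g t * B i * (g t)⁻¹, 0⟩,
    ⟨hgu, fun t ht => ?_, fun i t ht => ?_⟩, hg0, hK, fun t ht => ?_, hd⟩
  · refine (hgd t ht).congr_deriv ?_
    change _ = (2 : ℂ) • (g t * 0 - (-1 / 4 : ℂ) • (g t * P t * (g t)⁻¹) * g t)
    rw [smul_mul_assoc, mul_assoc _ (g t)⁻¹, nonsing_inv_mul' (hgu t ht), mul_one, mul_zero,
      mul_smul_comm]
    module
  · change g t * B i = g t * B i * (g t)⁻¹ * g t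
    rw [mul_assoc _ (g t)⁻¹, nonsing_inv_mul' (hgu t ht), mul_one]
  · change ((-1 / 4 : ℂ) • (g t * P t * (g t)⁻¹))ᴴ = _
    rw [conjTranspose_smul, hherm t ht]; norm_num

theorem realEquation_of_hasDerivAt (hα : ∀ t ∈ 𝕀, (D.α t)ᴴ = D.α t)
    (hd : ∀ t ∈ 𝕀, HasDerivAt D.α (-∑ i, ⁅D.β i t, (D.β i t)ᴴ⁆) t) :
    D.RealEquation := by
  intro t ht
  have h3 : deriv (fun s => D.α s + (D.α s)ᴴ) t = (-∑ i, ⁅D.β i t, (D.β i t)ᴴ⁆) +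
      -∑ i, ⁅D.β i t, (D.β i t)ᴴ⁆ := by
    refine Eq.trans (EventuallyEq.deriv_eq ?_) ((hd t ht).add (hd t ht)).deriv
    filter_upwards [Ioo_mem_nhds ht.1 ht.2] with r hr
    rw [hα r hr]; rfl
  rw [h3, hα t ht, Ring.lie_def (D.α t), sub_self, zero_add]
  module

/-! ### Behaviour of the gauge transformation at the pole -/

theorem isBigO_mul_rpow {a b c : ℝ} (hf : f =O⁺ a)
    (hg : g =O⁺ b) (hc : c ≤ a + b) :
    (fun t => f t * g t) =O⁺ c := by
  refine ((hf.mul hg).congr' .rfl ?_).trans (rpow_isBigO_rpow hc)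
  filter_upwards [self_mem_nhdsWithin] with t ht using (rpow_add ht a b).symm

theorem isBigO_inv_smul {a c : ℝ} (hf : f =O⁺ a)
    (hc : c ≤ -1 + a) : (fun t : ℝ => (t : ℂ)⁻¹ • f t) =O⁺ c := by
  refine ((isBigO_rpow_smul (ν := -1) hf).congr_left fun t => ?_).trans (rpow_isBigO_rpow hc)
  rw [rpow_neg_one, ← coe_smul, ofReal_inv]

theorem isBigO_const_rpow (A : Mat k) : (fun _ : ℝ => A) =O⁺ 0 :=
  isBigO_of_bound one_pos (C := ‖A‖) fun t _ => by rw [rpow_zero, mul_one]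

theorem isBigO_sub_pole {U V : ℝ → Mat k} {r U₀ V₀ : Mat k}
    (hf : (fun t : ℝ => f t - (t : ℂ)⁻¹ • r) =O⁺ (-13 / 16))
    (hU : U =O⁺ 0) (hV : V =O⁺ 0)
    (hU₀ : (fun t => U t - U₀) =O⁺ (3 / 16))
    (hV₀ : (fun t => V t - V₀) =O⁺ (3 / 16)) :
    (fun t : ℝ => U t * f t * V t - (t : ℂ)⁻¹ • (U₀ * r * V₀)) =O⁺ (-13 / 16) := by
  have h1 := isBigO_mul_rpow (isBigO_mul_rpow hU hf (c := -13 / 16) (by norm_num)) hV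
    (c := -13 / 16) (by norm_num)
  have h2 := isBigO_inv_smul (isBigO_mul_rpow (isBigO_mul_rpow hU₀ (isBigO_const_rpow r)
    (c := 3 / 16) (by norm_num)) hV (c := 3 / 16) (by norm_num)) (c := -13 / 16) (by norm_num)
  refine ((h1.add h2).add (isBigO_inv_smul (isBigO_mul_mul hV₀ (U₀ * r) 1) (c := -13 / 16) (by
    norm_num))).congr_left fun t => ?_
  simp only [mul_sub, sub_mul, mul_one, smul_sub, mul_smul_comm, smul_mul_assoc, mul_assoc]
  abel

/-- `f = O(tᵐ)` near `0`, with `f' = O(tᵐ⁻¹)`. -/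
def IsSymbol (μ : ℝ) (f : ℝ → Mat k) : Prop :=
  ∃ f' : ℝ → Mat k, (∀ᶠ t in 𝓝[>] (0 : ℝ), HasDerivAt f (f' t) t) ∧ (f =O⁺ μ) ∧ f' =O⁺ (μ - 1)

theorem IsSymbol.mul {μ ν : ℝ} (hf : IsSymbol μ f) (hg : IsSymbol ν g) :
    IsSymbol (μ + ν) fun t => f t * g t := by
  obtain ⟨f', a1, a2, a3⟩ := hf
  obtain ⟨g', b1, b2, b3⟩ := hg
  refine ⟨fun t => f' t * g t + f t * g' t, ?_, isBigO_mul_rpow a2 b2 le_rfl,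
    (isBigO_mul_rpow a3 b2 (by linarith)).add (isBigO_mul_rpow a2 b3 (by linarith))⟩
  filter_upwards [a1, b1] with t h1 h2 using h1.mul h2

theorem IsSymbol.conjTranspose {μ : ℝ} (hf : IsSymbol μ f) :
    IsSymbol μ fun t => (f t)ᴴ := by
  obtain ⟨f', a1, a2, a3⟩ := hf
  refine ⟨fun t => (f' t)ᴴ, ?_, isBigO_conjTranspose a2, isBigO_conjTranspose a3⟩
  filter_upwards [a1] with t h1 using hasDerivAt_conjTranspose h1

theorem IsSymbol.linearComb {μ : ℝ} (hf : IsSymbol μ f) (hg : IsSymbol μ g)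
    (c d : ℂ) : IsSymbol μ fun t => c • f t + d • g t := by
  obtain ⟨f', a1, a2, a3⟩ := hf
  obtain ⟨g', b1, b2, b3⟩ := hg
  refine ⟨fun t => c • f' t + d • g' t, ?_, (a2.const_smul_left c).add (b2.const_smul_left d),
    (a3.const_smul_left c).add (b3.const_smul_left d)⟩
  filter_upwards [a1, b1] with t h1 h2 using (h1.const_smul c).add (h2.const_smul d)

/-- A function of size `tᵃ` whose derivative is a symbol of order `-1` has a derivative of size
`t^(a/2 - 1)`, by interpolation. -/
theorem IsSymbol.deriv_isBigO {f' : ℝ → Mat k} {a : ℝ} (ha : 0 < a)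
    (hf : f =O⁺ a) (hd : ∀ᶠ t in 𝓝[>] (0 : ℝ), HasDerivAt f (f' t) t)
    (hs : IsSymbol (-1) f') : f' =O⁺ (a / 2 - 1) := by
  obtain ⟨f'', b1, -, b2⟩ := hs
  obtain ⟨C, hC, δ, hδ, -, hb⟩ := exists_bound_of_isBigO b2 b1
  refine deriv_isBigO_of_interpolation (B := C) ha hf hd
    (eventually_nhdsGT_iff.2 ⟨δ / 2, half_pos hδ, fun t ht s hs => ?_⟩)
  have hsub : ∀ r ∈ Icc t (2 * t), r ∈ Ioo 0 δ := fun r hr =>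
    ⟨ht.1.trans_le hr.1, by linarith [hr.2, ht.2]⟩
  have h1 := Convex.norm_image_sub_le_of_norm_hasDerivWithin_le (C := C / t ^ 2)
    (fun r hr => (hb r (hsub r hr)).1.hasDerivWithinAt) (fun r hr => ?_) (convex_Icc t (2 * t))
    (left_mem_Icc.2 (by linarith [ht.1])) hs
  · rwa [norm_eq_abs, abs_of_nonneg (sub_nonneg.2 hs.1)] at h1
  · refine (hb r (hsub r hr)).2.trans ?_
    rw [div_eq_mul_inv]
    refine mul_le_mul_of_nonneg_left ?_ hC.le
    rw [show (-1 - 1 : ℝ) = ((-2 : ℤ) : ℝ) by norm_num, Real.rpow_intCast, zpow_neg]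
    exact inv_anti₀ (pow_pos ht.1 2) (pow_le_pow_left₀ ht.1.le hr.1 2)

/-- If the metric of a gauge transformation `G` to temporal gauge tends to the identity like
`t^(3/4)`, then `G` itself converges at `0`, to a unitary matrix. -/
theorem Intertwines.exists_unitary_limit
    (hG : Intertwines G N D) {A : Mat k} {b : Fin 3 → Mat k} (hA : Aᴴ = A)
    (hα : IsSymbol (-1) N.α)
    (hα0 : (fun t : ℝ => N.α t - (t : ℂ)⁻¹ • A) =O⁺ 0)
    (hβ0 : ∀ i, (fun t : ℝ => N.β i t - (t : ℂ)⁻¹ • b i) =O⁺ 0)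
    (hherm : ∀ t ∈ 𝕀, (D.α t)ᴴ = D.α t)
    (hd : ∀ t ∈ 𝕀, HasDerivAt D.α (-∑ i, ⁅D.β i t, (D.β i t)ᴴ⁆) t) {c : ℝ}
    (hc : 0 ≤ c) (hb : ∀ t ∈ 𝕀, ‖G t‖ ^ 2 ≤ k * exp (c * t ^ (3 / 4 : ℝ)) ∧
      ‖(G t)⁻¹‖ ^ 2 ≤ k * exp (c * t ^ (3 / 4 : ℝ))) :
    ∃ U ∈ 𝐔 k, Tendsto G (𝓝[>] 0) (𝓝 U) ∧ ((fun t : ℝ => D.α t - (t : ℂ)⁻¹ • (U * A * Uᴴ))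
        =O⁺ (-13 / 16)) ∧
      ∀ i, (fun t : ℝ => D.β i t - (t : ℂ)⁻¹ • (U * b i * Uᴴ)) =O⁺ (-13 / 16) := by
  have hI : ∀ᶠ t : ℝ in 𝓝[>] 0, t ∈ 𝕀 := Ioo_mem_nhdsGT one_pos
  have hle : ∀ t ∈ 𝕀, exp (c * t ^ (3 / 4 : ℝ)) ≤ exp c := fun t ht =>
    exp_le_exp.2 (mul_le_of_le_one_right hc (rpow_le_one ht.1.le ht.2.le (by norm_num)))
  have hO1 : ∀ {F : ℝ → Mat k}, (∀ t ∈ 𝕀, ‖F t‖ ^ 2 ≤ k * exp (c * t ^ (3 / 4 : ℝ))) →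
      F =O⁺ 0 := fun h => isBigO_of_bound one_pos (C := √(k * exp c)) fun t ht => by
    rw [rpow_zero, mul_one]
    exact Real.le_sqrt_of_sq_le ((h t ht).trans
        (mul_le_mul_of_nonneg_left (hle t ht) (by positivity)))
  have hGO := hO1 fun t ht => (hb t ht).1
  have hLO := hO1 fun t ht => (hb t ht).2
  have hβN : ∀ i, N.β i =O⁺ (-1) := fun i => by
    refine (((hβ0 i).trans (rpow_isBigO_rpow (by norm_num))).add
      (isBigO_inv_smul (isBigO_const_rpow (b i)) (by norm_num))).congr_left fun t => ?_
    rw [sub_add_cancel]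
  have hβD : ∀ i, D.β i =O⁺ (-1) := fun i => by
    refine (isBigO_mul_rpow (isBigO_mul_rpow hGO (hβN i) (c := -1) (by norm_num)) hLO
      (by norm_num)).congr' ?_ .rfl
    filter_upwards [hI] with t ht using (hG.field_eq i ht).symm
  have hD2 : (fun t => -∑ i, ⁅D.β i t, (D.β i t)ᴴ⁆) =O⁺ (-1 - 1) := by
    refine (Asymptotics.IsBigO.fun_sum fun i _ => ?_).neg_left
    have h1 := isBigO_conjTranspose (hβD i)
    simp only [Ring.lie_def]
    exact (isBigO_mul_rpow (hβD i) h1 (by norm_num)).sub (isBigO_mul_rpow h1 (hβD i) (by norm_num))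
  have hαD : IsSymbol (-1) D.α := by
    refine ⟨_, hI.mono hd, ?_, hD2⟩
    have h1 := isBigO_rpow_smul (ν := 1) hD2
    refine isBigO_of_singular_ode_of_gt (ν := 0) ?_ (h1.trans (rpow_isBigO_rpow (by norm_num)))
      (by norm_num)
    filter_upwards [hI] with t ht
    refine (hd t ht).congr_deriv ?_
    rw [zero_smul, zero_add, rpow_one, smul_smul, inv_mul_cancel₀ ht.1.ne', one_smul]
  have hGS : IsSymbol 0 G := by
    refine ⟨_, hI.mono hG.deriv, hGO, ?_⟩
    refine Asymptotics.IsBigO.const_smul_left (c := (2 : ℂ)) (f' := fun t =>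
      G t * N.α t - D.α t * G t) ?_
    exact (isBigO_mul_rpow hGO hα.choose_spec.2.1 (by norm_num)).sub
      (isBigO_mul_rpow hαD.choose_spec.2.1 hGO (by norm_num))
  set h : ℝ → Mat k := fun t => (G t)ᴴ * G t with hh
  have hhS : IsSymbol 0 h := by simpa using hGS.conjTranspose.mul hGS
  -- `‖G - G⁻ᴴ‖² = ‖G‖² + ‖G⁻¹‖² - 2 k`, which is `O(t^(3/4))`
  have hh1 : (fun t => h t - 1) =O⁺ (3 / 8) := by
    have h1 : (fun t => G t - ((G t)⁻¹)ᴴ) =O⁺ (3 / 8) := by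
      refine isBigO_of_bound one_pos (C := √(2 * k * (c * exp c))) fun t ht => ?_
      set x := c * t ^ (3 / 4 : ℝ)
      have h3 : exp x - 1 ≤ x * exp x := by
        have := mul_le_mul_of_nonneg_right (Real.add_one_le_exp (-x)) (exp_pos x).le
        rw [← exp_add, neg_add_cancel, Real.exp_zero] at this
        linarith
      have hx : 0 ≤ x := mul_nonneg hc (rpow_nonneg ht.1.le _)
      have h5 := mul_le_mul_of_nonneg_left (h3.trans (mul_le_mul_of_nonneg_left (hle t ht) hx))
        (cast_nonneg (α := ℝ) k)
      have e : (t ^ (3 / 8 : ℝ)) ^ 2 = t ^ (3 / 4 : ℝ) := by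
        rw [← rpow_natCast, ← Real.rpow_mul ht.1.le]; norm_num
      refine abs_le_of_sq_le_sq' ?_ (by have := rpow_nonneg ht.1.le (3 / 8); positivity) |>.2
      rw [(norm_sub_conjTranspose_inv_sq (hG.isUnit t ht)), mul_pow, sq_sqrt (by positivity), e]
      grind
    refine (isBigO_mul_rpow (isBigO_conjTranspose hGO) h1 (by norm_num)).congr' ?_ .rfl
    filter_upwards [hI] with t ht
    rw [mul_sub, conjTranspose_mul_inv (hG.isUnit t ht)]
  -- the derivative of the metric
  set h' : ℝ → Mat k := fun t => (2 : ℂ) • ((N.α t)ᴴ * h t + h t * N.α t) +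
    (-4 : ℂ) • ((G t)ᴴ * D.α t * G t) with hh'
  have hhd : ∀ᶠ t in 𝓝[>] (0 : ℝ), HasDerivAt (fun t => h t - 1) (h' t) t := by
    filter_upwards [hI] with t ht
    refine (((hasDerivAt_conjTranspose (hG.deriv t ht)).mul (hG.deriv t ht)).sub_const
      (1 : Mat k)).congr_deriv ?_
    have e : ((2 : ℂ) • (G t * N.α t - D.α t * G t))ᴴ =
        (2 : ℂ) • ((N.α t)ᴴ * (G t)ᴴ - (G t)ᴴ * D.α t) := by
      simp [*]
    rw [e, hh', hh]
    simp only [smul_mul_assoc, mul_smul_comm, mul_sub, sub_mul, mul_assoc]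
    module
  have hh'S : IsSymbol (-1) h' := by
    have h1 : IsSymbol (-1) fun t => (N.α t)ᴴ * h t := by simpa using hα.conjTranspose.mul hhS
    have h3 : IsSymbol (-1) fun t => (G t)ᴴ * D.α t * G t := by
      simpa using (hGS.conjTranspose.mul hαD).mul hGS
    simpa only [one_smul] using (h1.linearComb (by simpa using hhS.mul hα) 1 1).linearComb h3 2 (-4)
  -- interpolation between `h - 1 = O(t^(3/8))` and `h'' = O(t⁻²)`
  have hh'O := hh'S.deriv_isBigO (by norm_num) hh1 hhd
  have hnear1 : (fun t : ℝ => h t * N.α t - (t : ℂ)⁻¹ • A) =O⁺ (-13 / 16) := by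
    refine ((isBigO_mul_rpow hh1 hα.choose_spec.2.1 (by norm_num)).add
      (hα0.trans (rpow_isBigO_rpow (by norm_num)))).congr_left fun t => ?_
    rw [sub_mul, one_mul]; abel
  have hX : (fun t : ℝ => (G t)ᴴ * D.α t * G t - (t : ℂ)⁻¹ • A) =O⁺ (-13 / 16) := by
    refine (((hnear1.add (isBigO_conjTranspose hnear1)).const_smul_left (1 / 2 : ℂ)).sub
      ((hh'O.trans (rpow_isBigO_rpow (show (-13 / 16 : ℝ) ≤ _ by norm_num))).const_smul_left (1 / 4
        : ℂ))).congr_left fun t => ?_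
    have e : ((t : ℂ)⁻¹ • A)ᴴ = (t : ℂ)⁻¹ • A := by simp [*]
    have e2 : (h t)ᴴ = h t := by rw [hh]; exact Matrix.isHermitian_conjTranspose_mul_self _
    simp only [Pi.smul_apply, hh', conjTranspose_sub, conjTranspose_mul, e, e2]
    module
  -- `G' = O(t^(3/16 - 1))` is integrable
  have hG'O : (fun t => (2 : ℂ) • (G t * N.α t - D.α t * G t)) =O⁺ (3 / 16 - 1) := by
    refine ((isBigO_mul_rpow (isBigO_conjTranspose hLO) (hnear1.sub hX) (c := 3 / 16 - 1)
      (by norm_num)).const_smul_left (2 : ℂ)).congr' ?_ .rfl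
    filter_upwards [hI] with t ht
    rw [Pi.smul_apply, sub_sub_sub_cancel_right, hh, mul_assoc, mul_assoc, ← mul_sub, ← mul_assoc,
      conjTranspose_inv_mul (hG.isUnit t ht), one_mul]
  obtain ⟨U, hU⟩ := exists_limit_of_deriv_isBigO (by norm_num) (hI.mono hG.deriv) hG'O
  have hlim : Tendsto G (𝓝[>] 0) (𝓝 U) := tendsto_of_sub_isBigO_rpow (by norm_num) hU
  have hUU : Uᴴ * U = 1 := tendsto_nhds_unique
    (((conjTransposeCLM k).continuous.tendsto U |>.comp hlim).mul hlim)
    (tendsto_of_sub_isBigO_rpow (by norm_num) hh1)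
  have hUU' : U * Uᴴ = 1 := mul_eq_one_comm.1 hUU
  have hL0 : (fun t => (G t)⁻¹ - Uᴴ) =O⁺ (3 / 16) := by
    refine (isBigO_mul_rpow hLO (isBigO_mul_mul hU (-1) Uᴴ) (by norm_num)).congr' ?_ .rfl
    filter_upwards [hI] with t ht
    rw [neg_one_mul, neg_sub, sub_mul, hUU', mul_sub, mul_one, ← mul_assoc,
      nonsing_inv_mul' (hG.isUnit t ht), one_mul]
  refine ⟨U, mem_unitaryGroup_iff'.2 hUU, hlim, ?_, fun i => ?_⟩
  · have h1 := isBigO_sub_pole hX (isBigO_conjTranspose hLO) hLO (U₀ := U) (by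
      simpa using isBigO_conjTranspose hL0) hL0
    refine h1.congr' ?_ .rfl
    filter_upwards [hI] with t ht
    have e1 := conjTranspose_inv_mul (hG.isUnit t ht)
    have e2 := mul_nonsing_inv' (hG.isUnit t ht)
    grind
  · refine (isBigO_sub_pole ((hβ0 i).trans (rpow_isBigO_rpow (by norm_num))) hGO hLO hU
      hL0).congr' (hI.mono fun t ht => ?_) .rfl
    beta_reduce
    rw [hG.field_eq i ht]

/-! ### Temporal solutions with a principal pole -/

theorem HasPrincipalPole.residues {s : Fin 3 → ℂ}
    (hp : HasPrincipalPole D U s) : HasResidueAtZero D.α (U * a₀ k * Uᴴ) ∧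
      ∀ i, HasResidueAtZero (D.β i) (U * (s i • b₀ k) * Uᴴ) :=
  ⟨hasResidueAtZero_of_isBigO (by norm_num) hp.pole_α,
    fun i => hasResidueAtZero_of_isBigO (by norm_num) (hp.pole_β i)⟩

/-- Such a solution is a Nahm complex. -/
theorem IsTemporalSolution.isNahmComplex (h : IsTemporalSolution D)
    {s : Fin 3 → ℂ} (hp : HasPrincipalPole D U s) : IsNahmComplex D := by
  obtain ⟨hα, hβ⟩ := h.extendsMeromorphically hp
  obtain ⟨Ψ, B, hΨ, hB⟩ := h.trivial
  have hU := hp.unitary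
  have hUU : Uᴴ * U = 1 := mem_unitaryGroup_iff'.1 hU
  have hUU' : U * Uᴴ = 1 := mem_unitaryGroup_iff.1 hU
  obtain ⟨r1, r2⟩ := hp.residues
  refine ⟨(hΨ.complexEquations hB).2, h.reflection_α, h.reflection_β, hα.contDiffOn,
    fun i => (hβ i).1.contDiffOn, hα.meromorphicAtEnd, fun i => (hβ i).1.meromorphicAtEnd,
    _, _, r1, r2, ?_, ?_, fun i => span_of_isUnit_cyclicMatrix
      (isUnit_cyclicMatrix_of_normal_form (M := Uᴴ) (hp.ne_zero i)
        (by rw [← mul_assoc, ← mul_assoc, hUU, one_mul]) hp.lowest)⟩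
  · rw [trace_mul_comm, ← mul_assoc, hUU, one_mul, ← (lie_principalB_principalC (k := k)),
      trace_sub,
      trace_mul_comm, sub_self]
  · have h1 := isUnitLowestVector_mulVec (a' := U * a₀ k * Uᴴ) hU
      (by rw [mul_assoc, hUU, mul_one]) hp.lowest
    rwa [mulVec_mulVec, hUU', one_mulVec] at h1

/-! ### Gauge transformations with prescribed value near the end points -/

/-- A path from `1` to `Z` gives a gauge transformation that equals `Z` near `0`: run the path
backwards on `[1/6, 1/3]`, and reflect. -/
theorem exists_gauge_of_path {w : ℝ → Mat k} (hw : ContDiffOn ℝ ∞ w (Icc 0 1))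
    (hu : ∀ s ∈ Icc (0 : ℝ) 1, IsUnit (w s)) (h0 : w 0 = 1) : ∃ g, IsComplexGauge g ∧
      (∀ t ≤ 1 / 6, g t = w 1) ∧
      ((∀ s ∈ Icc (0 : ℝ) 1, w s ∈ 𝐔 k) → IsUnitaryGauge g) := by
  set χ : ℝ → ℝ := fun t => Real.smoothTransition (2 - 6 * t) with hχ
  have hχI : ∀ t, χ t ∈ Icc (0 : ℝ) 1 := fun t =>
    ⟨Real.smoothTransition.nonneg _, Real.smoothTransition.le_one _⟩
  have hχ1 : ∀ t ≤ 1 / 6, χ t = 1 := fun t ht => Real.smoothTransition.one_of_one_le (by linarith)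
  have hχ0 : ∀ t, 1 / 3 ≤ t → χ t = 0 := fun t ht =>
    Real.smoothTransition.zero_of_nonpos (by linarith)
  set W : ℝ → Mat k := fun t => w (χ t) with hWdef
  have hWs : ContDiffOn ℝ ∞ W univ := hw.comp (Real.smoothTransition.contDiff.comp (by
    fun_prop)).contDiffOn fun t _ => hχI t
  have hWu : ∀ t, IsUnit (W t) := fun t => hu _ (hχI t)
  have hW1 : ∀ t, 1 / 3 ≤ t → W t = 1 := fun t ht => by simp only [hWdef, hχ0 t ht, h0]
  set g : ℝ → Mat k := fun t => W t * ((W (1 - t))ᵀ)⁻¹ with hg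
  have ht : ∀ {X : Mat k}, IsUnit X → IsUnit Xᵀ := fun h => (isUnit_transpose _).2 h
  have hgs : ContDiffOn ℝ ∞ g univ := by
    refine hWs.mul (contDiffOn_inv ((transposeCLM k).contDiff.comp_contDiffOn (hWs.comp
      (contDiff_const.sub contDiff_id).contDiffOn fun _ _ => mem_univ _)) fun t _ => ht (hWu _))
  have hcg : IsComplexGauge g := by
    refine ⟨hgs.continuousOn.mono (subset_univ _), hgs.mono (subset_univ _), fun t _ =>
      (hWu t).mul (isUnit_nonsing_inv (ht (hWu _))), fun t _ => ?_⟩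
    rw [hg]
    beta_reduce
    rw [sub_sub_cancel, transpose_mul, Matrix.mul_inv_rev, transpose_nonsing_inv,
      transpose_transpose, inv_inv' (hWu _)]
    -- the two factors commute, as one of them is `1`
    rcases le_total (1 / 3) t with h | h
    · rw [hW1 t h]; simp
    · rw [hW1 (1 - t) (by linarith)]; simp
  refine ⟨g, hcg, fun t ht => ?_, fun hU => ⟨hcg, fun t _ =>
    mul_mem (hU _ (hχI t)) (inv_transpose_mem_unitaryGroup (hU _ (hχI _)))⟩⟩
  change W t * ((W (1 - t))ᵀ)⁻¹ = w 1
  rw [hW1 (1 - t) (by linarith), hWdef]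
  beta_reduce
  rw [hχ1 t ht, Matrix.transpose_one, inv_one, mul_one]

/-- Every positive definite matrix is the value near `0` of a gauge transformation. -/
theorem exists_gauge_of_posDef {P : Mat k} (hP : P.PosDef) : ∃ g, IsComplexGauge g ∧
    ∀ t ≤ 1 / 6, g t = P := by
  have hu : ∀ s ∈ Icc (0 : ℝ) 1, IsUnit ((1 - s) • (1 : Mat k) + s • P) := by
    intro s hs
    rcases hs.1.eq_or_lt with rfl | h
    · simp
    · exact (Matrix.PosDef.posSemidef_add (Matrix.PosSemidef.one.smul (sub_nonneg.2 hs.2))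
        (hP.smul h)).isUnit
  obtain ⟨g, h1, h2, -⟩ := exists_gauge_of_path (w := fun s => (1 - s) • (1 : Mat k) + s • P)
    (by fun_prop) hu (by simp)
  exact ⟨g, h1, by simpa using h2⟩

/-- Every unitary matrix is, up to a phase, the value near `0` of a unitary gauge transformation: by
the Cayley transform it is joined to `1` by a path of unitary matrices once the phase is chosen so
that `-1` is not an eigenvalue. -/
theorem exists_gauge_of_unitary (hU : U ∈ 𝐔 k) :
    ∃ (c : ℂ) (g : ℝ → Mat k), c ≠ 0 ∧ IsUnitaryGauge g ∧ ∀ t ≤ 1 / 6, g t = c • U := by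
  obtain ⟨c, hc, hc'⟩ : ∃ c : ℂ, ‖c‖ = 1 ∧ IsUnit (1 + c • U) := by
    have h1 : (Metric.sphere (0 : ℂ) 1).Infinite := by
      refine (isPreconnected_sphere (by simp) (0 : ℂ) 1).infinite_of_nontrivial
        ⟨1, by simp, -1, by simp, by norm_num⟩
    -- the spectrum is finite and the circle is not
    obtain ⟨z, hz, hz'⟩ := (h1.sdiff (Module.End.finite_spectrum (Matrix.toLin' U))).nonempty
    rw [mem_sphere_zero_iff_norm] at hz
    have hz0 : z ≠ 0 := norm_ne_zero_iff.1 (by rw [hz]; exact one_ne_zero)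
    refine ⟨-z⁻¹, by rw [norm_neg, norm_inv, hz, inv_one], ?_⟩
    rw [Matrix.spectrum_toLin', spectrum.notMem_iff] at hz'
    have e : 1 + -z⁻¹ • U = (z⁻¹ • (1 : Mat k)) * (algebraMap ℂ (Mat k) z - U) := by
      rw [Algebra.algebraMap_eq_smul_one, smul_mul_assoc, one_mul, smul_sub, smul_smul,
        inv_mul_cancel₀ hz0, one_smul, neg_smul, sub_eq_add_neg]
    exact e ▸ ((isUnit_one (M := Mat k)).smul (Units.mk0 _ (inv_ne_zero hz0))).mul hz'
  set W := c • U with hW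
  have hWW : Wᴴ * W = 1 := by
    rw [hW, conjTranspose_smul, smul_mul_smul_comm, ← star_eq_conjTranspose U,
      mem_unitaryGroup_iff'.1 hU, star_def, Complex.conj_mul', hc]
    norm_num
  -- the Cayley transform
  set A := (1 - W) * (1 + W)⁻¹ with hA
  have hA1 : A * (1 + W) = 1 - W := by rw [hA, mul_assoc, (nonsing_inv_mul' hc'), mul_one]
  have hskew : Aᴴ = -A := by
    have h1 : (1 + W)ᴴ * Aᴴ = 1 - Wᴴ := by
      rw [← conjTranspose_mul, hA1, conjTranspose_sub, conjTranspose_one]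
    have h2 : IsUnit (1 + W)ᴴ := hc'.star
    refine h2.mul_left_cancel (hc'.mul_right_cancel ?_)
    rw [h1, mul_assoc, neg_mul, hA1, conjTranspose_add, conjTranspose_one]
    simp only [sub_mul, add_mul, mul_add, mul_sub, mul_neg, one_mul, mul_one, hWW]
    abel
  have hsA : ∀ s : ℝ, (s • A)ᴴ = -(s • A) := fun s => by
    rw [conjTranspose_smul, hskew, star_trivial, smul_neg]
  have hu : ∀ s : ℝ, IsUnit (1 + s • A) := by
    intro s
    have h1 : ((1 : Mat k) + (s • A)ᴴ * (s • A)).PosDef :=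
      Matrix.PosDef.one.add_posSemidef (Matrix.posSemidef_conjTranspose_mul_self _)
    have h2 : (1 - s • A) * (1 + s • A) = 1 + (s • A)ᴴ * (s • A) := by
      rw [hsA]; generalize s • A = X; noncomm_ring
    have h3 := h1.isUnit
    rw [← h2, isUnit_iff_isUnit_det, det_mul] at h3
    exact (isUnit_iff_isUnit_det _).2 (isUnit_of_mul_isUnit_right h3)
  have hV : ∀ s : ℝ, (1 - s • A) * (1 + s • A)⁻¹ ∈ 𝐔 k := by
    intro s
    have e1 : (1 - s • A)ᴴ = 1 + s • A := by
      rw [conjTranspose_sub, conjTranspose_one, hsA, sub_neg_eq_add]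
    have e2 : (1 + s • A)ᴴ = 1 - s • A := by rw [← e1, conjTranspose_conjTranspose]
    refine mem_unitaryGroup_iff'.2 ?_
    rw [star_eq_conjTranspose, conjTranspose_mul, e1, Matrix.conjTranspose_nonsing_inv,
      e2, mul_assoc, ← mul_assoc _ (1 - s • A), show (1 + s • A) * (1 - s • A) =
        (1 - s • A) * (1 + s • A) by generalize s • A = X; noncomm_ring, mul_assoc,
            mul_nonsing_inv' (hu s), mul_one]
    exact nonsing_inv_mul' (by rw [← e2]; exact (hu s).star)
  obtain ⟨g, -, h2, h3⟩ := exists_gauge_of_path (w := fun s => (1 - s • A) * (1 + s • A)⁻¹)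
    (ContDiffOn.mul (by fun_prop) (contDiffOn_inv (by fun_prop) fun s _ => hu s))
    (fun s _ => isUnit_of_unitary (hV s)) (by simp)
  refine ⟨c, g, norm_ne_zero_iff.1 (by rw [hc]; exact one_ne_zero), h3 fun s _ => hV s,
    fun t ht => ?_⟩
  rw [h2 t ht, one_smul]
  have h1 := hu 1
  rw [one_smul] at h1
  rw [show 1 - A = W * (1 + A) from hc'.mul_right_cancel
    (by rw [mul_assoc]; simp only [sub_mul, add_mul, hA1]; noncomm_ring), mul_assoc,
        mul_nonsing_inv' h1, mul_one]

/-! ### Nahm complexes near the pole -/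

theorem nhdsWithin_Ioo_zero : 𝓝[Ioo 0 1] (0 : ℝ) = 𝓝[>] 0 := nhdsWithin_Ioo_eq_nhdsGT one_pos

theorem inv_coe_smul (t : ℝ) (A : Mat k) : (t : ℂ)⁻¹ • A = t⁻¹ • A := by rw [← ofReal_inv, coe_smul]

/-- The factor `h` in `f = h / t` is differentiable at `0` together with its derivative. -/
theorem MeromorphicAtEnd.exists_factor {r : Mat k} (hf : MeromorphicAtEnd f 0)
    (hr : HasResidueAtZero f r) : ∃ h h' : ℝ → Mat k, DifferentiableAt ℝ h 0 ∧
      DifferentiableAt ℝ h' 0 ∧ h 0 = r ∧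
      ∀ᶠ t in 𝓝[>] 0, f t = t⁻¹ • h t ∧ HasDerivAt h (h' t) t := by
  obtain ⟨H, hH, he⟩ := hf
  rw [nhdsWithin_Ioo_zero] at he
  rw [ofReal_zero] at hH
  have hd : ∀ {H : ℂ → Mat k}, AnalyticAt ℂ H 0 → DifferentiableAt ℝ (fun t : ℝ => H t) 0 :=
    fun h => (hasDerivAt_comp_ofReal (z := fun t : ℝ => (t : ℂ)) (t := 0)
      (by rw [ofReal_zero]; exact h.differentiableAt.hasDerivAt)
          Complex.ofRealCLM.hasDerivAt).differentiableAt
  have hc : Tendsto (fun t : ℝ => (t : ℂ)) (𝓝[>] 0) (𝓝 0) :=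
    (Complex.continuous_ofReal.tendsto' 0 0 rfl).mono_left nhdsWithin_le_nhds
  refine ⟨fun t => H t, fun t => deriv H t, hd hH, hd hH.deriv, ?_, ?_⟩
  · refine tendsto_nhds_unique ((hd hH).continuousAt.tendsto.mono_left nhdsWithin_le_nhds)
      (hr.congr' ?_)
    filter_upwards [he, self_mem_nhdsWithin] with t ht ht0
    have ht0 : (t : ℂ) ≠ 0 := by exact_mod_cast (ne_of_gt ht0)
    simp [*]
  · filter_upwards [he, hc.eventually hH.eventually_analyticAt] with t ht ha
    exact ⟨by rw [ht, ofReal_zero, sub_zero, inv_coe_smul],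
      hasDerivAt_comp_ofReal ha.differentiableAt.hasDerivAt Complex.ofRealCLM.hasDerivAt⟩

theorem isBigO_one_of_differentiableAt {h : ℝ → Mat k} (hd : DifferentiableAt ℝ h 0) : (h =O⁺ 0) ∧
      (fun t => h t - h 0) =O⁺ 1 := by
  constructor
  · simpa using (hd.continuousAt.tendsto.isBigO_one ℝ).mono (nhdsWithin_le_nhds (s := Ioi 0))
  · simpa using hd.hasFDerivAt.isBigO_sub.mono (nhdsWithin_le_nhds (s := Ioi 0))

theorem isBigO_rinv_smul {a c : ℝ} (hf : f =O⁺ a)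
    (hc : c ≤ -1 + a) : (fun t : ℝ => t⁻¹ • f t) =O⁺ c := by
  simpa only [inv_coe_smul] using isBigO_inv_smul hf hc

theorem hasDerivAt_inv_smul {h : ℝ → Mat k} {h' : Mat k} (ht : 0 < t)
    (he : f =ᶠ[𝓝 t] fun t => t⁻¹ • h t) (hh : HasDerivAt h h' t) :
    HasDerivAt f (t⁻¹ • (h' - t⁻¹ • h t)) t :=
  (((_root_.hasDerivAt_inv ht.ne').smul hh).congr_of_eventuallyEq he).congr_deriv
    (by rw [smul_sub, smul_smul, ← sq, inv_pow]; module)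

theorem MeromorphicAtEnd.isSymbol {r : Mat k} (hf : MeromorphicAtEnd f 0)
    (hr : HasResidueAtZero f r) : IsSymbol (-1) f ∧ (fun t : ℝ => f t - (t : ℂ)⁻¹ • r) =O⁺ 0 := by
  obtain ⟨h, h', hd, hd', rfl, he⟩ := hf.exists_factor hr
  obtain ⟨o1, o2⟩ := isBigO_one_of_differentiableAt hd
  have e1 : (fun t : ℝ => t⁻¹ • h t) =ᶠ[𝓝[>] 0] f := he.mono fun t ht => ht.1.symm
  refine ⟨⟨fun t => t⁻¹ • (h' t - t⁻¹ • h t), ?_, ?_, ?_⟩, ?_⟩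
  · filter_upwards [eventually_eventually_nhdsWithin.2 he, self_mem_nhdsWithin] with t ht ht0
    rw [IsOpen.nhdsWithin_eq isOpen_Ioi ht0] at ht
    exact hasDerivAt_inv_smul ht0 (ht.mono fun _ h => h.1) ht.self_of_nhds.2
  · exact (isBigO_rinv_smul o1 (by norm_num)).congr' e1 .rfl
  · have o3 := (isBigO_one_of_differentiableAt hd').1.trans
      (rpow_isBigO_rpow (by norm_num : (-1 : ℝ) ≤ 0))
    exact isBigO_rinv_smul (o3.sub (isBigO_rinv_smul o1 (by norm_num))) (by norm_num)
  · refine (isBigO_rinv_smul o2 (by norm_num)).congr' ?_ .rfl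
    filter_upwards [e1] with t ht
    rw [← ht, inv_coe_smul, smul_sub]

/-- `t² defect` is a differentiable function of `t` near `0`; its value at `0` is
`2 (∑ [bᵢ, bᵢᴴ] - A)`. -/
theorem isBigO_defect {A : Mat k} {b : Fin 3 → Mat k}
    (hα : MeromorphicAtEnd N.α 0) (hβ : ∀ i, MeromorphicAtEnd (N.β i) 0)
    (rα : HasResidueAtZero N.α A) (rβ : ∀ i, HasResidueAtZero (N.β i) (b i)) (hA : Aᴴ = A)
    (hb : ∑ i, ⁅b i, (b i)ᴴ⁆ = A) : N.defect =O⁺ (-1) := by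
  obtain ⟨h, h', hd, hd', h0, he⟩ := hα.exists_factor rα
  choose β β' hβd _ hβ0 hβe using fun i => (hβ i).exists_factor (rβ i)
  have hs : ∀ {f : ℝ → Mat k}, DifferentiableAt ℝ f 0 → DifferentiableAt ℝ (fun t => (f t)ᴴ) 0 :=
    fun hf => (hasDerivAt_conjTranspose hf.hasDerivAt).differentiableAt
  have hl : ∀ {f : ℝ → Mat k}, DifferentiableAt ℝ f 0 →
      DifferentiableAt ℝ (fun t => ⁅f t, (f t)ᴴ⁆) 0 := fun hf =>
    (hf.mul (hs hf)).sub ((hs hf).mul hf)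
  set F : ℝ → Mat k := fun t => t • (h' t + (h' t)ᴴ) - (h t + (h t)ᴴ)
    + (2 : ℂ) • (⁅h t, (h t)ᴴ⁆ + ∑ i, ⁅β i t, (β i t)ᴴ⁆) with hF
  have hFd : DifferentiableAt ℝ F 0 :=
    ((differentiableAt_id.smul (hd'.add (hs hd'))).sub (hd.add (hs hd))).add
      (((hl hd).add (.fun_sum fun i _ => hl (hβd i))).const_smul (2 : ℂ))
  have hF0 : F 0 = 0 := by simp only [hF, h0, hβ0, hA, hb]; rw [Ring.lie_def, sub_self]; module
  have o := (isBigO_one_of_differentiableAt hFd).2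
  simp only [hF0, sub_zero] at o
  refine (isBigO_rinv_smul (isBigO_rinv_smul o (c := 0) (by norm_num)) (by norm_num)).congr' ?_ .rfl
  filter_upwards [eventually_eventually_nhdsWithin.2 he, self_mem_nhdsWithin,
    eventually_all.2 hβe] with t ht ht0 htβ
  rw [IsOpen.nhdsWithin_eq isOpen_Ioi ht0] at ht
  have h1 := hasDerivAt_inv_smul ht0 (ht.mono fun _ h => h.1) ht.self_of_nhds.2
  have h2 := (h1.add (hasDerivAt_conjTranspose h1)).deriv
  have hl' : ∀ X : Mat k, ⁅t⁻¹ • X, (t⁻¹ • X)ᴴ⁆ = t⁻¹ • t⁻¹ • ⁅X, Xᴴ⁆ := fun X => by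
    rw [conjTranspose_smul, star_trivial, Ring.lie_def, Ring.lie_def, smul_mul_smul_comm,
      smul_mul_smul_comm, ← smul_sub, smul_smul]
  rw [ComplexData.defect, show deriv (fun s => N.α s + (N.α s)ᴴ) t = _ from h2,
    ht.self_of_nhds.1, hl', sum_congr rfl fun i _ => by rw [(htβ i).1, hl'],
    ← smul_sum, ← smul_sum, hF]
  have ht1 : t⁻¹ * t = 1 := inv_mul_cancel₀ (ne_of_gt ht0)
  simp only [conjTranspose_smul, conjTranspose_sub, star_trivial, smul_add, smul_sub,
    smul_smul, ht1, mul_one, smul_comm (2 : ℂ)]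
  abel

/-- The complex equations multiplied by `t²`, in the limit `t → 0`. -/
theorem IsNahmComplex.lie_residues (hN : IsNahmComplex N) {a : Mat k}
    {b : Fin 3 → Mat k} (ha : HasResidueAtZero N.α a) (hb : ∀ i, HasResidueAtZero (N.β i) (b i)) :
    (∀ i, a * b i - b i * a = (1 / 2 : ℂ) • b i) ∧ ∀ i j, b i * b j = b j * b i := by
  have ta := tendsto_smul_comm_coe ha
  have tb := fun i => tendsto_smul_comm_coe (hb i)
  constructor
  · intro i
    have hd : ∀ t ∈ 𝕀, HasDerivAt (fun t => t • N.β i t)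
        (t • -((2 : ℂ) • ⁅N.α t, N.β i t⁆) + (1 : ℝ) • N.β i t) t := fun t ht =>
      (hasDerivAt_id t).smul ((differentiableAt_of_smooth (hN.smooth_β i)
          t ht).hasDerivAt.congr_deriv
        (eq_neg_of_add_eq_zero_left (hN.equations.1 i t ht)))
    have h1 := eq_zero_of_tendsto_smul_deriv (tb i) hd
        (ℓ := b i - (2 : ℂ) • (a * b i - b i * a)) <| by
      refine ((tb i).sub (((ta.mul (tb i)).sub ((tb i).mul ta)).const_smul (2 : ℂ))).congr
        fun t => ?_
      rw [Ring.lie_def, smul_mul_smul_comm, smul_mul_smul_comm, one_smul, ← smul_sub,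
        smul_comm (2 : ℂ), ← smul_smul, smul_add, smul_neg, smul_neg]
      abel
    have h2 := sub_eq_zero.1 h1
    generalize a * b i - b i * a = X at h2 ⊢
    rw [h2]
    module
  · intro i j
    refine tendsto_nhds_unique ((tb i).mul (tb j)) (((tb j).mul (tb i)).congr' ?_)
    filter_upwards [Ioo_mem_nhdsGT one_pos] with t ht
    rw [smul_mul_smul_comm, smul_mul_smul_comm, sub_eq_zero.1 (hN.equations.2 i j t ht)]

/-! ### Extension to the end points and reflection -/

theorem one_sub_mem (ht : t ∈ 𝕀) : 1 - t ∈ 𝕀 := ⟨by linarith [ht.2], by linarith [ht.1]⟩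

theorem exists_extension_Icc {a b : Mat k} (hf : ContinuousOn f 𝕀)
    (h0 : Tendsto f (𝓝[>] 0) (𝓝 a)) (h1 : Tendsto f (𝓝[<] 1) (𝓝 b)) : ∃ g : ℝ → Mat k,
      ContinuousOn g (Icc 0 1) ∧ g 0 = a ∧ g 1 = b ∧ ∀ t ∈ 𝕀, g t = f t :=
  ⟨extendFrom 𝕀 f, continuousOn_Icc_extendFrom_Ioo hf h0 h1,
    eq_lim_at_left_extendFrom_Ioo zero_lt_one h0, eq_lim_at_right_extendFrom_Ioo zero_lt_one h1,
    fun t ht => extendFrom_eq (subset_closure ht) (hf t ht)⟩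

theorem isUnit_inv_transpose (hU : IsUnit U) : IsUnit (Uᵀ)⁻¹ :=
  isUnit_nonsing_inv ((isUnit_transpose _).2 hU)

theorem tendsto_one_sub : Tendsto (fun t : ℝ => 1 - t) (𝓝[<] 1) (𝓝[>] 0) := by
  refine tendsto_nhdsWithin_iff.2 ⟨((by fun_prop : Continuous fun t : ℝ => 1 - t).tendsto' 1 0
    (by simp)).mono_left nhdsWithin_le_nhds, ?_⟩
  filter_upwards [self_mem_nhdsWithin] with t ht using sub_pos.2 (mem_Iio.1 ht)

theorem tendsto_reflect (hU : IsUnit U) (h : Tendsto G (𝓝[>] 0) (𝓝 U)) :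
    Tendsto (fun t => ((G (1 - t))ᵀ)⁻¹) (𝓝[<] 1) (𝓝 (Uᵀ)⁻¹) :=
  tendsto_inv ((isUnit_transpose _).2 hU)
    (((transposeCLM k).continuous.tendsto U).comp (h.comp tendsto_one_sub))

/-- A map on `(0,1)` with a limit at `0`, compatible with the reflection, extends to a complex gauge
transformation. -/
theorem exists_gauge_of_limit (hs : ContDiffOn ℝ ∞ G 𝕀) (hu : ∀ t ∈ 𝕀, IsUnit (G t))
    (hr : ∀ t ∈ 𝕀, G (1 - t) = ((G t)ᵀ)⁻¹) (hU : IsUnit U)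
    (hl : Tendsto G (𝓝[>] 0) (𝓝 U)) :
    ∃ g, IsComplexGauge g ∧ g 0 = U ∧ ∀ t ∈ 𝕀, g t = G t := by
  have h1 : Tendsto G (𝓝[<] 1) (𝓝 (Uᵀ)⁻¹) := by
    refine (tendsto_reflect hU hl).congr' ?_
    filter_upwards [Ioo_mem_nhdsLT one_pos] with t ht
    rw [← hr _ (one_sub_mem ht), sub_sub_cancel]
  obtain ⟨g, hc, h0, h1, he⟩ := exists_extension_Icc hs.continuousOn hl h1
  refine ⟨g, ⟨hc, hs.congr he, fun t ht => ?_, fun t ht => ?_⟩, h0, he⟩ <;>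
  rcases eq_endpoints_or_mem_Ioo_of_mem_Icc ht with rfl | rfl | ht'
  · rwa [h0]
  · rw [h1]; exact isUnit_inv_transpose hU
  · rw [he t ht']; exact hu t ht'
  · rw [sub_zero, h1, h0]
  · rw [sub_self, h1, h0, transpose_nonsing_inv, transpose_transpose, inv_inv' hU]
  · rw [he t ht', he _ (one_sub_mem ht'), hr t ht']

/-- The data `α(1-t)ᵀ, βᵢ(1-t)ᵀ`. -/
def ComplexData.reflect (D : ComplexData k) : ComplexData k :=
  ⟨fun t => (D.α (1 - t))ᵀ, fun i t => (D.β i (1 - t))ᵀ, D.v⟩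

theorem hasDerivAt_reflect {f' : Mat k} (h : HasDerivAt f f' (1 - t)) :
    HasDerivAt (fun t => (f (1 - t))ᵀ) (-f'ᵀ) t :=
  (hasDerivAt_transpose (h.comp_const_sub 1 t)).congr_deriv (Matrix.transpose_neg _)

theorem Intertwines.reflect (hG : Intertwines G N D)
    (hα : ∀ t ∈ 𝕀, N.α (1 - t) = (N.α t)ᵀ)
    (hβ : ∀ i, ∀ t ∈ 𝕀, N.β i (1 - t) = (N.β i t)ᵀ) :
    Intertwines (fun t => ((G (1 - t))ᵀ)⁻¹) N D.reflect := by
  have h : Intertwines (fun t => (G (1 - t))ᵀ) D.reflect N := by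
    refine ⟨fun t ht => (isUnit_transpose _).2 (hG.isUnit _ (one_sub_mem ht)),
      fun t ht => ?_, fun i t ht => ?_⟩
    · refine (hasDerivAt_reflect (hG.deriv _ (one_sub_mem ht))).congr_deriv ?_
      rw [hα t ht, transpose_smul, transpose_sub, transpose_mul,
        transpose_mul, transpose_transpose, ← smul_neg, neg_sub]
      rfl
    · have := congrArg transpose (hG.field i _ (one_sub_mem ht))
      rw [transpose_mul, transpose_mul, hβ i t ht, transpose_transpose] at this
      exact this.symm
  exact h.inv

/-- A gauge transformation compatible with the reflection preserves the reflection symmetry: the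
reflected target is the image of the same data under the same transformation. -/
theorem Intertwines.reflection (hG : Intertwines G N D)
    (hα : ∀ t ∈ 𝕀, N.α (1 - t) = (N.α t)ᵀ)
    (hβ : ∀ i, ∀ t ∈ 𝕀, N.β i (1 - t) = (N.β i t)ᵀ)
    (hr : ∀ t ∈ 𝕀, G (1 - t) = ((G t)ᵀ)⁻¹) :
    (∀ t ∈ 𝕀, D.α (1 - t) = (D.α t)ᵀ) ∧ ∀ i, ∀ t ∈ 𝕀, D.β i (1 - t) = (D.β i t)ᵀ := by
  have h := (hG.reflect hα hβ).congr (h := G) fun t ht => by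
    rw [← hr _ (one_sub_mem ht), sub_sub_cancel]
  exact ⟨fun t ht => by
      rw [← transpose_transpose (D.α (1 - t))]
      exact congrArg _ ((h.gaugeConnection ht).trans (hG.gaugeConnection ht).symm),
    fun i t ht => by
      rw [← transpose_transpose (D.β i (1 - t))]
      exact congrArg _ ((h.gaugeField i ht).trans (hG.gaugeField i ht).symm)⟩

theorem lie_transpose (X : Mat k) : ⁅X, Xᴴ⁆ᵀ = -⁅Xᵀ, (Xᵀ)ᴴ⁆ := by
  rw [Ring.lie_def, Ring.lie_def, transpose_sub, transpose_mul, transpose_mul, neg_sub]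
  rfl

theorem ComplexData.hasDerivAt_reflect
    (hd : ∀ t ∈ 𝕀, HasDerivAt D.α (-∑ i, ⁅D.β i t, (D.β i t)ᴴ⁆) t) :
    ∀ t ∈ 𝕀, HasDerivAt D.reflect.α (-∑ i, ⁅D.reflect.β i t, (D.reflect.β i t)ᴴ⁆) t := by
  intro t ht
  refine (Nahm.hasDerivAt_reflect (hd _ (one_sub_mem ht))).congr_deriv ?_
  rw [Matrix.transpose_neg, neg_neg, Matrix.transpose_sum, ← sum_neg_distrib]
  exact sum_congr rfl fun i _ => lie_transpose _

theorem norm_defect_reflection (hs : ContDiffOn ℝ ∞ N.α 𝕀)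
    (hα : ∀ t ∈ 𝕀, N.α (1 - t) = (N.α t)ᵀ)
    (hβ : ∀ i, ∀ t ∈ 𝕀, N.β i (1 - t) = (N.β i t)ᵀ) (ht : t ∈ 𝕀) :
    ‖N.defect (1 - t)‖ = ‖N.defect t‖ := by
  have hd := differentiableAt_of_smooth hs t ht
  have h1 := hd.hasDerivAt.add (hasDerivAt_conjTranspose hd.hasDerivAt)
  have h2 : deriv (fun s => N.α s + (N.α s)ᴴ) (1 - t) =
      -(deriv (fun s => N.α s + (N.α s)ᴴ) t)ᵀ := by
    have h3 := hasDerivAt_reflect (f := fun s => N.α s + (N.α s)ᴴ) (t := 1 - t)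
      (by rw [sub_sub_cancel]; exact h1)
    rw [show deriv (fun s => N.α s + (N.α s)ᴴ) t = _ from h1.deriv]
    refine (h3.congr_of_eventuallyEq ?_).deriv
    filter_upwards [isOpen_Ioo.mem_nhds (one_sub_mem ht)] with s hs
    rw [hα s hs, transpose_add, transpose_transpose]
    rfl
  have h4 : N.defect (1 - t) = -(N.defect t)ᵀ := by
    simp only [ComplexData.defect, transpose_add, transpose_smul, lie_transpose,
      Matrix.transpose_sum, h2, hα t ht, hβ _ t ht, sum_neg_distrib]
    module
  rw [h4, norm_neg, Matrix.frobenius_norm_transpose]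

theorem exists_bound_of_reflection (hc : ContinuousOn f 𝕀) (h0 : f =O⁺ (-1))
    (hr : ∀ t ∈ 𝕀, ‖f (1 - t)‖ = ‖f t‖) :
    ∃ C, 0 ≤ C ∧ ∀ t ∈ 𝕀, ‖f t‖ ≤ C * (1 / t + 1 / (1 - t)) := by
  obtain ⟨C, hC, δ, hδ, -, hb⟩ := exists_bound_of_isBigO (p := fun _ => True) h0 (by simp)
  obtain ⟨M, hM⟩ := isCompact_Icc.exists_bound_of_continuousOn (hc.mono
    (fun t ht => ⟨hδ.trans_le ht.1, ht.2.trans_lt (by norm_num)⟩ : Icc δ (1 / 2) ⊆ 𝕀))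
  have key : ∀ t ∈ Ioc (0 : ℝ) (1 / 2), ‖f t‖ ≤ (C + |M|) * (1 / t) := by
    intro t ht
    have h1 : 1 ≤ 1 / t := by rw [le_div_iff₀ ht.1]; linarith [ht.2]
    rcases lt_or_ge t δ with h | h
    · have h2 := (hb t ⟨ht.1, h⟩).2
      rw [rpow_neg_one, ← one_div] at h2
      nlinarith [abs_nonneg M]
    · nlinarith [hM t ⟨h, ht.2⟩, le_abs_self M, abs_nonneg M]
  have hC' : 0 ≤ C + |M| := by positivity
  refine ⟨C + |M|, hC', fun t ht => ?_⟩
  have p1 : 0 < 1 / t := one_div_pos.2 ht.1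
  have p2 : 0 < 1 / (1 - t) := one_div_pos.2 (sub_pos.2 ht.2)
  rcases le_or_gt t (1 / 2) with h | h
  · nlinarith [key t ⟨ht.1, h⟩]
  · have := key (1 - t) ⟨(one_sub_mem ht).1, by linarith⟩
    rw [hr t ht] at this
    nlinarith

theorem continuousOn_defect (hα : ContDiffOn ℝ ∞ N.α 𝕀)
    (hβ : ∀ i, ContinuousOn (N.β i) 𝕀) : ContinuousOn N.defect 𝕀 := by
  have hl : ∀ {f : ℝ → Mat k}, ContinuousOn f 𝕀 →
      ContinuousOn (fun t => ⁅f t, (f t)ᴴ⁆) 𝕀 := fun hf =>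
    (hf.mul hf.star).sub (hf.star.mul hf)
  exact ((hα.add ((conjTransposeCLM k).contDiff.comp_contDiffOn hα)).continuousOn_deriv_of_isOpen
    isOpen_Ioo (by simp)).add (((hl hα.continuousOn).add
      (continuousOn_finsetSum _ fun i _ => hl (hβ i))).const_smul (2 : ℂ))

open scoped MatrixOrder in
theorem eq_one_of_unitary_inv_transpose {Q : Mat k} (hQ : Q.PosDef)
    (h : (Qᵀ)⁻¹ * Q⁻¹ ∈ 𝐔 k) : (Qᵀ)⁻¹ * Q⁻¹ = 1 := by
  have hT := hQ.transpose
  have h1 : (Qᵀ)⁻¹ * Q⁻¹ * (Q⁻¹ * (Qᵀ)⁻¹) = 1 := by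
    have := mem_unitaryGroup_iff.1 h
    rwa [star_eq_conjTranspose, conjTranspose_mul, hQ.inv.isHermitian.eq,
      hT.inv.isHermitian.eq] at this
  have h2 : Q⁻¹ * Q⁻¹ = Qᵀ * Qᵀ := by
    have a1 := mul_nonsing_inv' hT.isUnit
    have a2 := nonsing_inv_mul' hT.isUnit
    calc Q⁻¹ * Q⁻¹ = Qᵀ * ((Qᵀ)⁻¹ * Q⁻¹ * (Q⁻¹ * (Qᵀ)⁻¹)) * Qᵀ := by
          rw [mul_assoc (Qᵀ)⁻¹, ← mul_assoc Qᵀ, a1, one_mul, mul_assoc, mul_assoc, a2, mul_one]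
      _ = _ := by rw [h1, mul_one]
  have h3 : Q⁻¹ = Qᵀ := (CFC.sqrt_unique h2 (nonneg_iff_posSemidef.2 hQ.inv.posSemidef)).symm.trans
    (CFC.sqrt_unique rfl (nonneg_iff_posSemidef.2 hT.posSemidef))
  rw [h3, nonsing_inv_mul' hT.isUnit]

/-! ### Solving the real equation in a complex gauge orbit -/

/-- Symmetric data whose residues at `0` are unitarily conjugate to `a₀, sᵢ b₀`, so that the real
equation holds to leading order. -/
structure IsBalanced (N : ComplexData k) (V : Mat k) (s : Fin 3 → ℂ) : Prop where
  trivial : ∃ (Ψ : ℝ → Mat k) (B : Fin 3 → Mat k), Intertwines Ψ N (flat B) ∧ ∀ i j, ⁅B i, B j⁆ = 0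
  smooth : ContDiffOn ℝ ∞ N.α 𝕀
  reflection_α : ∀ t ∈ 𝕀, N.α (1 - t) = (N.α t)ᵀ
  reflection_β : ∀ i, ∀ t ∈ 𝕀, N.β i (1 - t) = (N.β i t)ᵀ
  pole_α : MeromorphicAtEnd N.α 0
  pole_β : ∀ i, MeromorphicAtEnd (N.β i) 0
  residue_α : HasResidueAtZero N.α (V * a₀ k * Vᴴ)
  residue_β : ∀ i, HasResidueAtZero (N.β i) (V * (s i • b₀ k) * Vᴴ)
  unitary : V ∈ 𝐔 k
  ne_zero : ∀ i, s i ≠ 0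
  norm : ∑ i, ‖s i‖ ^ 2 = 1
  lowest : IsUnitLowestVector (a₀ k) (Vᴴ *ᵥ N.v)

theorem MeromorphicAtEnd.conj (hf : MeromorphicAtEnd f 0) (A B : Mat k)
    (he : ∀ᶠ t in 𝓝[>] 0, g t = A * f t * B) : MeromorphicAtEnd g 0 := by
  obtain ⟨H, hH, h⟩ := hf
  refine ⟨fun z => A * H z * B, (analyticAt_const.mul hH).mul analyticAt_const, ?_⟩
  rw [nhdsWithin_Ioo_zero] at h ⊢
  filter_upwards [h, he] with t h1 h2
  rw [h2, h1, mul_smul_comm, smul_mul_assoc]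

theorem HasResidueAtZero.conj {r : Mat k} (hf : HasResidueAtZero f r)
    (A B : Mat k) (he : ∀ᶠ t in 𝓝[>] 0, g t = A * f t * B) : HasResidueAtZero g (A * r * B) := by
  refine ((hf.const_mul A).mul_const B).congr' ?_
  filter_upwards [he] with t h
  rw [h, mul_smul_comm, smul_mul_assoc]

theorem eventually_gauge_eq {Z : Mat k} (hg : ∀ t ≤ 1 / 6, g t = Z)
    (f : ℝ → Mat k) : (∀ᶠ t in 𝓝[>] 0, gaugeConnection (1 / 2) g f t = Z * f t * Z⁻¹) ∧
      ∀ᶠ t in 𝓝[>] 0, gaugeField g f t = Z * f t * Z⁻¹ := by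
  constructor <;> filter_upwards [Ioo_mem_nhdsGT (by norm_num : (0 : ℝ) < 1 / 6)] with t ht
  · have hd : deriv g t = 0 := by
      refine Eq.trans (EventuallyEq.deriv_eq ?_) (deriv_const t Z)
      filter_upwards [Iio_mem_nhds ht.2] with s hs using hg s hs.le
    rw [gaugeConnection, hg t ht.2.le, hd, zero_mul, smul_zero, sub_zero]
  · rw [gaugeField, hg t ht.2.le]

/-- Every Nahm complex is equivalent to a balanced one: if `M` brings the residues to normal form,
then `P = (Mᴴ M)^{1/2}` is connected to `1`, and `P M⁻¹` is unitary. -/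
theorem IsNahmComplex.exists_isBalanced (hk : 0 < k) (hN : IsNahmComplex N) :
    ∃ N' V s, IsBalanced N' V s ∧ N.GaugeEquiv N' := by
  obtain ⟨a, b, ha, hb, -, hv, hspan⟩ := hN.residues
  obtain ⟨hab, hcomm⟩ := hN.lie_residues ha hb
  obtain ⟨s, M, hM, hs, hs1, hMa, hMb, hMv⟩ := exists_normal_form hk hcomm hab hv hspan
  obtain ⟨P, hP, hPM⟩ := exists_posDef_sqrt (posDef_conjTranspose_mul_self hM)
  obtain ⟨g, hg, hgP⟩ := exists_gauge_of_posDef hP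
  set V := P * M⁻¹ with hV
  have hVM : V * M = P := by rw [hV, mul_assoc, nonsing_inv_mul' hM, mul_one]
  have hVV : Vᴴ * V = 1 := by
    rw [hV, conjTranspose_mul, hP.isHermitian.eq, mul_assoc, ← mul_assoc P, hPM,
      mul_assoc Mᴴ, mul_nonsing_inv' hM, mul_one, conjTranspose_inv_mul hM]
  have hVP : Vᴴ * P = M := by rw [← hVM, ← mul_assoc, hVV, one_mul]
  have hconj : ∀ {X Y : Mat k}, M * X = Y * M → P * X * P⁻¹ = V * Y * Vᴴ := fun {X Y} h => by
    rw [← mul_one Vᴴ, ← mul_nonsing_inv' hP.isUnit, ← mul_assoc Vᴴ, hVP, ← mul_assoc, mul_assoc V,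
      ← h, ← mul_assoc, hVM]
  clear_value V
  set N' : ComplexData k := ⟨gaugeConnection (1 / 2) g N.α, fun i => gaugeField g (N.β i),
    g 0 *ᵥ N.v⟩ with hN'
  have hI : Intertwines g N N' := hg.intertwines (fun _ _ => rfl) fun _ _ _ => rfl
  obtain ⟨Ψ, B, hΨ, hB⟩ := Intertwines.exists_flat hN.smooth_α.continuousOn
    (fun i => differentiableAt_of_smooth (hN.smooth_β i)) hN.equations
  obtain ⟨r1, r2⟩ := hI.reflection hN.reflection_α hN.reflection_β fun t ht =>
    hg.reflection t (Ioo_subset_Icc_self ht)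
  have e1 : ∀ᶠ t in 𝓝[>] 0, N'.α t = P * N.α t * P⁻¹ := (eventually_gauge_eq hgP N.α).1
  have e2 : ∀ i, ∀ᶠ t in 𝓝[>] 0, N'.β i t = P * N.β i t * P⁻¹ := fun i =>
    (eventually_gauge_eq hgP (N.β i)).2
  refine ⟨N', V, s, ⟨⟨_, B, hΨ.mul hI.inv, hB⟩, ?_, r1, r2, hN.pole_α.1.conj _ _ e1,
    fun i => (hN.pole_β i).1.conj _ _ (e2 i), hconj hMa ▸ ha.conj _ _ e1,
    fun i => hconj (hMb i) ▸ (hb i).conj _ _ (e2 i), (mem_unitaryGroup_iff'.2 hVV), hs, hs1, ?_⟩,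
    g, hg, fun _ _ => rfl, fun _ _ _ => rfl, rfl⟩
  · have hi : ContDiffOn ℝ ∞ (fun t => (g t)⁻¹) 𝕀 := contDiffOn_inv hg.smooth hI.isUnit
    exact ((hg.smooth.mul hN.smooth_α).mul hi).sub
      (((hg.smooth.deriv_of_isOpen isOpen_Ioo (by simp)).mul hi).const_smul (1 / 2 : ℂ))
  · rwa [hN', mulVec_mulVec, hgP 0 (by norm_num), hVP]

theorem exp_barrier_le {C τ : ℝ} (hC : 0 ≤ C) (ht : t ∈ 𝕀) (h : τ ≤ k * exp (barrier C t)) :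
    τ ≤ k * exp (16 / 3 * C * t ^ (3 / 4 : ℝ)) :=
  h.trans (mul_le_mul_of_nonneg_left
    (exp_le_exp.2 (barrier_le hC (Ioo_subset_Icc_self ht))) k.cast_nonneg)

/-- The complex gauge orbit of balanced data contains a solution of the real equation. The
transformation `G` to the solution provided by the boundary value problem has unitary limits; it
is compatible with the reflection because the transformation between the solution and its
reflection is unitary, hence constant, and `G(1/2)` is positive definite. -/
theorem IsBalanced.exists_solution (hk : 0 < k) {V : Mat k} {s : Fin 3 → ℂ}
    (hN : IsBalanced N V s) :
    ∃ D U, IsTemporalSolution D ∧ HasPrincipalPole D U s ∧ N.GaugeEquiv D := by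
  have hm : (1 / 2 : ℝ) ∈ 𝕀 := by norm_num
  obtain ⟨Ψ, B, hΨ, hB⟩ := hN.trivial
  have hA : (V * a₀ k * Vᴴ)ᴴ = V * a₀ k * Vᴴ := by
    rw [conjTranspose_mul, conjTranspose_mul, conjTranspose_conjTranspose,
      principalA_conjTranspose, mul_assoc]
  have hb : ∑ i, ⁅V * (s i • b₀ k) * Vᴴ, (V * (s i • b₀ k) * Vᴴ)ᴴ⁆ = V * a₀ k * Vᴴ := by
    have h1 : ∀ i, ⁅V * (s i • b₀ k) * Vᴴ, (V * (s i • b₀ k) * Vᴴ)ᴴ⁆ =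
        ((‖s i‖ ^ 2 : ℝ) : ℂ) • (V * a₀ k * Vᴴ) := fun i => by
      rw [conjTranspose_mul, conjTranspose_mul, conjTranspose_conjTranspose, ← mul_assoc V,
        lie_conj (A' := Vᴴ) (mem_unitaryGroup_iff'.1 hN.unitary), conjTranspose_smul,
        Ring.lie_def, smul_mul_smul_comm, smul_mul_smul_comm, mul_comm (star (s i)), ← smul_sub,
        show (b₀ k)ᴴ = c₀ k from rfl, lie_principalB_principalC, mul_smul_comm,
        smul_mul_assoc, star_def, mul_conj, normSq_eq_norm_sq]
    rw [sum_congr rfl fun i _ => h1 i, ← sum_smul, ← ofReal_sum, hN.norm, ofReal_one, one_smul]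
  obtain ⟨C, hC, hCb⟩ := exists_bound_of_reflection (continuousOn_defect hN.smooth fun i t ht =>
      (continuousAt (𝕜 := ℝ) ((hΨ.complexEquations hB).1 i t ht)).continuousWithinAt)
    (isBigO_defect hN.pole_α hN.pole_β hN.residue_α hN.residue_β hA hb)
    fun t ht => norm_defect_reflection hN.smooth hN.reflection_α hN.reflection_β ht
  have hΨi : ∀ t ∈ 𝕀, IsUnit (Ψ t)⁻¹ := fun t ht => isUnit_nonsing_inv (hΨ.isUnit t ht)
  -- the reference metric is the one of `N` itself, with the defect as its error term
  obtain ⟨K, P, hK, hKb⟩ := exists_metric hk (hΨ.isMetricPath (differentiableAt_of_smooth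
    hN.smooth)) (g₀ := fun t => (Ψ t)⁻¹)
    (fun t ht => ⟨hΨi t ht, rfl⟩) (continuousOn_inv hΨ.continuousOn hΨ.isUnit)
    (mul_nonneg zero_le_two hC) (fun t ht => by
      have a := nonsing_inv_mul' (hΨ.isUnit t ht)
      rw [mul_smul_comm, smul_mul_assoc, ← mul_assoc, ← mul_assoc, a, one_mul,
        inv_inv' (hΨ.isUnit t ht),
        mul_assoc, a, mul_one, norm_smul, mul_assoc]
      norm_num
      simpa using hCb t ht)
  obtain ⟨f, hf, hKf⟩ := exists_posDef_factor (hK.posDef _ hm)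
  obtain ⟨Q, hQ, hQf⟩ := exists_posDef_sqrt
      (posDef_conjTranspose_mul_self (hf.mul (hΨ.isUnit _ hm)))
  -- the initial value `Q Ψ⁻¹` makes `G = g Ψ` positive definite at `1 / 2`
  obtain ⟨g, D, hg, hgQ, hKg, hherm, hd⟩ := exists_temporal hK (hQ.isUnit.mul (hΨi _ hm)) (by
    rw [conjTranspose_mul, hQ.isHermitian.eq, mul_assoc, ← mul_assoc Q, hQf,
      conjTranspose_mul, mul_assoc (_ * _), mul_assoc f, (mul_nonsing_inv' (hΨ.isUnit _ hm)),
        mul_one, mul_assoc,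
      ← mul_assoc, conjTranspose_inv_mul (hΨ.isUnit _ hm), one_mul, hKf])
  have hG := hg.mul hΨ
  have hGm : g (1 / 2) * Ψ (1 / 2) = Q := by
    rw [hgQ, mul_assoc, nonsing_inv_mul' (hΨ.isUnit _ hm), mul_one]
  have hGb : ∀ t ∈ 𝕀, ‖g t * Ψ t‖ ^ 2 ≤ k * exp (barrier (2 * C) t) ∧
      ‖(g t * Ψ t)⁻¹‖ ^ 2 ≤ k * exp (barrier (2 * C) t) := fun t ht => by
    have h1 := hKb t ht
    rw [hKg t ht, frameMetric, trace_inv_mul_factor, trace_inv_mul_factor, ← Matrix.mul_inv_rev,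
      inv_inv' (hΨ.isUnit t ht)] at h1
    exact h1
  set G : ℝ → Mat k := fun t => g t * Ψ t with hGdef
  replace hGm : G (1 / 2) = Q := hGm
  replace hGb : ∀ t ∈ 𝕀, ‖G t‖ ^ 2 ≤ k * exp (barrier (2 * C) t) ∧
      ‖(G t)⁻¹‖ ^ 2 ≤ k * exp (barrier (2 * C) t) := hGb
  clear_value G
  have hC2 : 0 ≤ 2 * C := by positivity
  obtain ⟨sα, oα⟩ := hN.pole_α.isSymbol hN.residue_α
  have oβ := fun i => ((hN.pole_β i).isSymbol (hN.residue_β i)).2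
  obtain ⟨U, hU, hlim, pα, pβ⟩ := hG.exists_unitary_limit hA sα oα oβ hherm hd
    (c := 16 / 3 * (2 * C)) (by positivity) fun t ht =>
      ⟨exp_barrier_le hC2 ht (hGb t ht).1, exp_barrier_le hC2 ht (hGb t ht).2⟩
  have hR := hG.reflect hN.reflection_α hN.reflection_β
  have hherm' : ∀ t ∈ 𝕀, (D.reflect.α t)ᴴ = D.reflect.α t := fun t ht =>
    congrArg transpose (hherm _ (one_sub_mem ht))
  have hd' := ComplexData.hasDerivAt_reflect hd
  obtain ⟨U', hU', hlim', -, -⟩ := hR.exists_unitary_limit hA sα oα oβ hherm' hd'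
    (c := 16 / 3 * (2 * C)) (by positivity) fun t ht => by
      have ht' := one_sub_mem ht
      have hs : barrier (2 * C) (1 - t) = barrier (2 * C) t := by
        rw [barrier, barrier, sub_sub_cancel, add_comm (t ^ _)]
      have h1 := hGb _ ht'
      rw [hs] at h1
      rw [inv_inv' ((isUnit_transpose _).2 (hG.isUnit _ ht')), ← transpose_nonsing_inv,
        Matrix.frobenius_norm_transpose, Matrix.frobenius_norm_transpose]
      exact ⟨exp_barrier_le hC2 ht h1.2, exp_barrier_le hC2 ht h1.1⟩
  have hu := isUnit_of_unitary hU
  have hu' := isUnit_of_unitary hU'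
  have hW := hR.mul hG.inv
  -- `W = (G(1-t)ᵀ)⁻¹ G⁻¹` relates the solution to its reflection, both in the same orbit
  have hGr : ∀ t ∈ 𝕀, G (1 - t) = ((G t)ᵀ)⁻¹ := by
    have hWl : Tendsto G (𝓝[<] 1) (𝓝 (U'ᵀ)⁻¹) := by
      refine (tendsto_reflect hu' hlim').congr' ?_
      filter_upwards [Ioo_mem_nhdsLT one_pos] with t ht
      rw [sub_sub_cancel, transpose_nonsing_inv, transpose_transpose, inv_inv' (hG.isUnit t ht)]
    obtain ⟨W, hWc, hW0, hW1, hWe⟩ := exists_extension_Icc hW.continuousOn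
      (hlim'.mul (tendsto_inv hu hlim))
      ((tendsto_reflect hu hlim).mul (tendsto_inv (isUnit_inv_transpose hu') hWl))
    have u0 : W 0 ∈ 𝐔 k := hW0 ▸ mul_mem hU' (inv_mem_unitaryGroup hU)
    have u1 : W 1 ∈ 𝐔 k := hW1 ▸ mul_mem
      (inv_transpose_mem_unitaryGroup hU)
          (inv_mem_unitaryGroup (inv_transpose_mem_unitaryGroup hU'))
    have hI := hW.congr hWe
    have hWU := hI.unitary hk hWc (fun t ht => by
      rcases eq_endpoints_or_mem_Ioo_of_mem_Icc ht with rfl | rfl | ht'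
      exacts [isUnit_of_unitary u0, isUnit_of_unitary u1, hI.isUnit t ht']) hg.inv
      (fun t ht => (hd t ht).differentiableAt) (fun t ht => (hd' t ht).differentiableAt)
      (realEquation_of_hasDerivAt hherm hd) (realEquation_of_hasDerivAt hherm' hd') u0 u1
    have hWm : W (1 / 2) = (Qᵀ)⁻¹ * Q⁻¹ := by
      rw [hWe _ hm, show (1 - 1 / 2 : ℝ) = 1 / 2 by norm_num, hGm]
    intro t ht
    have h1 := hI.constant_of_unitary (fun t ht => hWU t (Ioo_subset_Icc_self ht)) hherm hherm' _
      (one_sub_mem ht)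
    rw [hWm, eq_one_of_unitary_inv_transpose hQ (hWm ▸ hWU _ (Ioo_subset_Icc_self hm)),
      hWe _ (one_sub_mem ht), sub_sub_cancel] at h1
    rw [← mul_one ((G t)ᵀ)⁻¹, ← nonsing_inv_mul' (hG.isUnit _ (one_sub_mem ht)), ← mul_assoc, h1,
      one_mul]
  obtain ⟨r1, r2⟩ := hG.reflection hN.reflection_α hN.reflection_β hGr
  have hI : Intertwines G N { D with v := U *ᵥ N.v } := ⟨hG.isUnit, hG.deriv, hG.field⟩
  have hT : IsTemporalSolution { D with v := U *ᵥ N.v } :=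
    ⟨⟨_, B, hΨ.mul hI.inv, hB⟩, fun t ht => (hd t ht).differentiableAt,
      realEquation_of_hasDerivAt hherm hd, hherm, r1, r2⟩
  have hUV : ∀ X, U * (V * X * Vᴴ) * Uᴴ = (U * V) * X * (U * V)ᴴ := fun X => by
    simp only [conjTranspose_mul, mul_assoc]
  rw [hUV] at pα
  simp only [hUV] at pβ
  have hp : HasPrincipalPole { D with v := U *ᵥ N.v } (U * V) s := by
    refine ⟨mul_mem hU hN.unitary, hN.ne_zero, hN.norm, ?_, pα, pβ⟩
    rw [mulVec_mulVec, conjTranspose_mul, mul_assoc, ← star_eq_conjTranspose U,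
      mem_unitaryGroup_iff'.1 hU, mul_one]
    exact hN.lowest
  obtain ⟨h, hh, h0, he⟩ := exists_gauge_of_limit
    (hI.contDiffOn hN.smooth (hT.extendsMeromorphically hp).1.contDiffOn) hG.isUnit hGr hu hlim
  have hI' := hI.congr he
  exact ⟨_, _, hT, hp, h, hh, fun t ht => hI'.gaugeConnection ht, fun i t ht => hI'.gaugeField i ht,
    by rw [h0]⟩

/-! ### Framed solutions and solutions in temporal gauge -/

/-- A solution in temporal gauge, read as real data with `X₀ = 0`, is a framed solution. -/
theorem IsTemporalSolution.exists_isPoleSolution (h : IsTemporalSolution D)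
    {s : Fin 3 → ℂ} (hp : HasPrincipalPole D U s) :
    ∃ S, IsPoleSolution S ∧ S.toComplexData = D := by
  obtain ⟨hα, hβ⟩ := h.extendsMeromorphically hp
  have hN := h.isNahmComplex hp
  obtain ⟨rα, rβ⟩ := hp.residues
  -- skew-Hermitian parts: `X = (p X + i q X) / 2`
  let p : Mat k → Mat k := fun X => X - Xᴴ
  let q : Mat k → Mat k := fun X => -I • (X + Xᴴ)
  set S : RealData k := ⟨![fun _ => 0, fun t => (-2 * I) • D.α t,
    fun t => p (D.β 0 t), fun t => q (D.β 0 t), fun t => p (D.β 1 t), fun t => q (D.β 1 t),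
    fun t => p (D.β 2 t), fun t => q (D.β 2 t)], D.v⟩ with hS
  have e1 : ∀ X : Mat k, (1 / 2 : ℂ) • ((0 : Mat k) + I • (-2 * I) • X) = X := by
    intro X
    rw [zero_add, smul_smul, smul_smul, show (1 / 2 : ℂ) * I * (-2 * I) =
      -(I * I) by ring, I_mul_I, neg_neg, one_smul]
  have e2 : ∀ X : Mat k, (1 / 2 : ℂ) • (p X + I • q X) = X := by
    intro X
    rw [smul_smul, mul_neg, I_mul_I, neg_neg]
    module
  have hSD : S.toComplexData = D := by
    refine congr (congr (congrArg ComplexData.mk (funext fun t => e1 _))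
      (funext fun i => funext fun t => ?_)) rfl
    fin_cases i <;> exact e2 _
  have hX1 : ∀ i, ExtendsMeromorphically fun t => p (D.β i t) := fun i =>
    (hβ i).1.linearComb (hβ i).2 1 (-1) fun t _ => by module
  have hX2 : ∀ i, ExtendsMeromorphically fun t => q (D.β i t) := fun i =>
    (hβ i).1.linearComb (hβ i).2 (-I) (-I) fun t _ => smul_add _ _ _
  have hX : ∀ i, ExtendsMeromorphically (S.X i) := fun i => by
    fin_cases i
    exacts [hα.linearComb hα 0 0 fun _ _ => by simp [hS], hα.linearComb hα (-2 * I) 0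
      fun _ _ => by simp [hS], hX1 0, hX2 0, hX1 1, hX2 1, hX1 2, hX2 2]
  have c1 : ∀ X : Mat k, (p X)ᴴ = -p X := fun X => by simp [p]
  have c2 : ∀ X : Mat k, (q X)ᴴ = -q X := fun X => by simp [q]
  have r1 : ∀ i, ∀ t ∈ 𝕀, p (D.β i (1 - t)) = (p (D.β i t))ᵀ := fun i t ht => by
    rw [h.reflection_β i t ht, transpose_sub]; rfl
  have r2 : ∀ i, ∀ t ∈ 𝕀, q (D.β i (1 - t)) = (q (D.β i t))ᵀ := fun i t ht => by
    rw [h.reflection_β i t ht, transpose_smul, transpose_add]; rfl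
  obtain ⟨c, g, hc, hg, hgU⟩ := exists_gauge_of_unitary (star_mem hp.unitary)
  have hZ : ∀ X, (c • star U) * (U * X * Uᴴ) * (c • star U)⁻¹ = X := fun X => by
    have h1 := mem_unitaryGroup_iff'.1 hp.unitary
    rw [inv_eq_right_inv (B := c⁻¹ • U) (by
      rw [smul_mul_smul_comm, h1, mul_inv_cancel₀ hc, one_smul]), mul_smul_comm, smul_mul_assoc,
      smul_mul_assoc, smul_smul, inv_mul_cancel₀ hc, one_smul, ← star_eq_conjTranspose]
    grind
  have hres := (eventually_gauge_eq hgU D.α).1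
  obtain ⟨a, -, ha, -, -, hv, -⟩ := hN.residues
  refine ⟨S, ⟨fun i => (hX i).contDiffOn, hSD ▸ hN.equations, hSD ▸ h.realEquation,
    fun i t ht => ?_, fun i t ht => ?_, continuousOn_const, fun i _ => hX i,
    ⟨s, g, hp.ne_zero, hp.norm, hg, ?_, fun i => ?_⟩, a, hSD ▸ ha, hv⟩, hSD⟩
  · fin_cases i
    exacts [by simp [hS], by simp [hS, h.hermitian t ht], c1 _, c2 _, c1 _, c2 _, c1 _, c2 _]
  · fin_cases i
    exacts [by simp [hS], by simp [hS, h.reflection_α t ht], r1 _ t ht, r2 _ t ht, r1 _ t ht,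
      r2 _ t ht, r1 _ t ht, r2 _ t ht]
  · rw [hSD, ← hZ (a₀ k)]
    exact rα.conj _ _ hres
  · rw [hSD, ← hZ (s i • b₀ k)]
    exact (rβ i).conj _ _ (eventually_gauge_eq hgU (D.β i)).2

/-- The parallel frame of `X₀` along `[0,1]`, normalized at `t = 1/2`, is a real gauge
transformation that makes `X₀` vanish. -/
theorem IsPoleSolution.exists_temporal {S : RealData k} (hS : IsPoleSolution S) :
    ∃ D U s, IsTemporalSolution D ∧ HasPrincipalPole D U s ∧ S.toComplexData.GaugeEquiv D := by
  have hm : (1 / 2 : ℝ) ∈ 𝕀 := by norm_num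
  obtain ⟨f, hf0, hf⟩ := exists_frame_Icc hS.continuous_zero (Ioo_subset_Icc_self hm)
  have hfd : ∀ t ∈ 𝕀, HasDerivAt f (f t * S.X 0 t) t := fun t ht =>
    (hf t (Ioo_subset_Icc_self ht)).1.hasDerivAt (Icc_mem_nhds ht.1 ht.2)
  have hu : ∀ t ∈ 𝕀, IsUnit (f t) := fun t ht => (hf t (Ioo_subset_Icc_self ht)).2
  -- `f` is unitary because `X₀` is skew-Hermitian
  have hff : ∀ t ∈ 𝕀, f t * (f t)ᴴ = 1 := fun t ht => by
    refine (constant_of_hasDerivWithinAt_zero (f := fun t => f t * (f t)ᴴ) (convex_Ioo 0 1)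
      (fun t ht => (((hfd t ht).mul (hasDerivAt_conjTranspose (hfd t ht))).congr_deriv
        ?_).hasDerivWithinAt) ht hm).trans (by rw [hf0]; simp)
    rw [conjTranspose_mul, hS.skew 0 t ht]
    noncomm_ring
  have hfr : ∀ t ∈ 𝕀, f (1 - t) = ((f t)ᵀ)⁻¹ := fun t ht => by
    refine (Matrix.inv_eq_left_inv ?_).symm
    refine (constant_of_hasDerivWithinAt_zero (f := fun t => f (1 - t) * (f t)ᵀ) (convex_Ioo 0 1)
      (fun t ht => ((((hfd _ (one_sub_mem ht)).comp_const_sub 1 t).mul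
        (hasDerivAt_transpose (hfd t ht))).congr_deriv ?_).hasDerivWithinAt) ht hm).trans (by
          norm_num [hf0])
    rw [transpose_mul, hS.reflection 0 t ht]
    noncomm_ring
  have hle : 𝓝[>] (0 : ℝ) ≤ 𝓝[Icc 0 1] 0 :=
    nhdsWithin_Ioo_zero ▸ nhdsWithin_mono _ Ioo_subset_Icc_self
  have hd0 := (hf 0 ⟨le_rfl, zero_le_one⟩).1
  have hl : Tendsto f (𝓝[>] 0) (𝓝 (f 0)) :=
    (HasDerivWithinAt.continuousWithinAt (𝕜 := ℝ) hd0).mono_left hle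
  have hf0U : f 0 ∈ 𝐔 k := by
    refine mem_unitaryGroup_iff.2 (tendsto_nhds_unique (hl.mul hl.star) (tendsto_const_nhds.congr'
      ?_))
    filter_upwards [Ioo_mem_nhdsGT one_pos] with t ht using (hff t ht).symm
  have hsm : ContDiffOn ℝ ∞ f 𝕀 := contDiffOn_of_bootstrap isOpen_Ioo hfd fun n hn =>
    hn.mul ((hS.smooth 0).of_le (by exact_mod_cast le_top))
  have hinv : ∀ t ∈ 𝕀, (f t)⁻¹ = (f t)ᴴ := fun t ht => inv_eq_right_inv (hff t ht)
  set D : ComplexData k := ⟨gaugeConnection (1 / 2) f S.toComplexData.α,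
    fun i => gaugeField f (S.toComplexData.β i), f 0 *ᵥ S.v⟩ with hD
  have hI : Intertwines f S.toComplexData D := .of_gauge hu
      (fun t ht => (hfd t ht).differentiableAt)
    (fun _ _ => rfl) fun _ _ _ => rfl
  -- the Hermitian part of `α`, which is `α` in the new gauge up to conjugation by `f`
  set Y : ℝ → Mat k := fun t => (I / 2) • S.X 1 t with hY
  have hαY : ∀ t, S.toComplexData.α t = (1 / 2 : ℂ) • S.X 0 t + Y t := fun t => by
    change (1 / 2 : ℂ) • (S.X 0 t + I • S.X 1 t) = _
    rw [smul_add, smul_smul, one_div_mul_eq_div]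
  have hYh : ∀ t ∈ 𝕀, (Y t)ᴴ = Y t := fun t ht => by
    rw [hY, conjTranspose_smul, hS.skew 1 t ht, smul_neg, ← neg_smul]
    simp [neg_div]
  have hαh : ∀ t ∈ 𝕀, (S.toComplexData.α t)ᴴ = Y t - (1 / 2 : ℂ) • S.X 0 t := fun t ht => by
      rw [hαY, conjTranspose_add, hYh t ht, conjTranspose_smul, hS.skew 0 t ht,
        smul_neg, neg_add_eq_sub]
      simp
  have hDα : ∀ t ∈ 𝕀, D.α t = f t * Y t * (f t)ᴴ := fun t ht => by
    change f t * _ * (f t)⁻¹ - (1 / 2 : ℂ) • (deriv f t * (f t)⁻¹) = _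
    rw [show deriv f t = _ from (hfd t ht).deriv, hαY, hinv t ht, mul_add, add_mul, mul_smul_comm,
      smul_mul_assoc, add_sub_cancel_left]
  have hDβ : ∀ i, ∀ t ∈ 𝕀, D.β i t = f t * S.toComplexData.β i t * (f t)ᴴ := fun i t ht => by
      change f t * _ * (f t)⁻¹ = _
      rw [hinv t ht]
  have hherm : ∀ t ∈ 𝕀, (D.α t)ᴴ = D.α t := fun t ht => by
    rw [hDα t ht, conjTranspose_mul, conjTranspose_mul, hYh t ht,
      conjTranspose_conjTranspose, mul_assoc]
  have hd : ∀ t ∈ 𝕀, HasDerivAt D.α (-∑ i, ⁅D.β i t, (D.β i t)ᴴ⁆) t := by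
    intro t ht
    set Z := ∑ i, ⁅S.toComplexData.β i t, (S.toComplexData.β i t)ᴴ⁆ with hZ
    have hY' : HasDerivAt Y (-(S.X 0 t * Y t - Y t * S.X 0 t + Z)) t := by
      have h1 := differentiableAt_of_smooth hS.smooth_α t ht
      refine ((((h1.hasDerivAt.add (hasDerivAt_conjTranspose
        h1.hasDerivAt)).differentiableAt).hasDerivAt.congr_deriv (eq_neg_of_add_eq_zero_left
        (hS.realEquation t ht))).const_smul (1 / 2 : ℂ)).congr_of_eventuallyEq ?_ |>.congr_deriv ?_
      · filter_upwards [isOpen_Ioo.mem_nhds ht] with s hs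
        change _ = (1 / 2 : ℂ) • (S.toComplexData.α s + (S.toComplexData.α s)ᴴ)
        rw [hαh s hs, hαY]; module
      · rw [hαh t ht, hαY, ← hZ, Ring.lie_def]
        generalize S.X 0 t = X; generalize Y t = Y
        simp only [add_mul, mul_add, sub_mul, mul_sub, smul_mul_assoc, mul_smul_comm]
        module
    refine ((((hfd t ht).mul hY').mul (hasDerivAt_conjTranspose (hfd t ht))).congr_of_eventuallyEq
      ?_).congr_deriv ?_
    · filter_upwards [isOpen_Ioo.mem_nhds ht] with s hs using hDα s hs
    · have h2 : ∀ i, ⁅D.β i t, (D.β i t)ᴴ⁆ =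
          f t * ⁅S.toComplexData.β i t, (S.toComplexData.β i t)ᴴ⁆ * (f t)ᴴ := fun i => by
        rw [← lie_conj (A' := (f t)ᴴ)
          (mem_unitaryGroup_iff'.1 (mem_unitaryGroup_iff.2 (hff t ht))), hDβ i t ht,
          conjTranspose_mul, conjTranspose_mul, conjTranspose_conjTranspose, ← mul_assoc (f t)]
      rw [sum_congr rfl fun i _ => h2 i, ← sum_mul, ← mul_sum, ← hZ,
        conjTranspose_mul, hS.skew 0 t ht, Pi.mul_apply]
      noncomm_ring
  obtain ⟨Ψ, B, hΨ, hB⟩ := hS.exists_flat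
  obtain ⟨q1, q2⟩ := hI.reflection (fun t ht => by
      rw [hαY, hαY, transpose_add, transpose_smul, hS.reflection 0 t ht, hY]
      beta_reduce
      rw [hS.reflection 1 t ht, transpose_smul]) (fun i t ht => by
      have := fun j => hS.reflection j t ht
      fin_cases i <;> simp [RealData.toComplexData, this]) hfr
  obtain ⟨s, U, a, b, hU, hs, hs1, ha, hb, hUa, hUb, hv⟩ := hS.exists_residues
  have hUU : Uᴴ * U = 1 := mem_unitaryGroup_iff'.1 hU
  have oc : ∀ {h : ℝ → Mat k}, ((fun t => h t - h 0) =O⁺ (3 / 16)) → h =O⁺ 0 := fun {h} ho =>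
    ((ho.trans (rpow_isBigO_rpow (by norm_num))).add (isBigO_const_rpow (h 0))).congr_left
      fun t => sub_add_cancel _ _
  have o1 : (fun t => f t - f 0) =O⁺ (3 / 16) := by
    refine Asymptotics.IsBigO.trans ?_ (rpow_isBigO_rpow (by norm_num : (3 / 16 : ℝ) ≤ 1))
    simpa using hd0.hasFDerivWithinAt.isBigO_sub.mono hle
  have o2 : (fun t => (f t)ᴴ - (f 0)ᴴ) =O⁺ (3 / 16) := by
    simpa only [conjTranspose_sub] using isBigO_conjTranspose o1
  -- conjugation by `f` changes a simple pole only by `O(t⁻¹ ‖f t - f 0‖)`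
  have pole : ∀ {h : ℝ → Mat k} {r r' : Mat k}, ExtendsMeromorphically h → HasResidueAtZero h r →
      U * r = r' * U → (fun t : ℝ => f t * h t * (f t)ᴴ - (t : ℂ)⁻¹ • (f 0 * Uᴴ * r' * (f 0 * Uᴴ)ᴴ))
        =O⁺ (-13 / 16) := fun {h r r'} hh hr he => by
    have e : f 0 * Uᴴ * r' * (f 0 * Uᴴ)ᴴ = f 0 * r * (f 0)ᴴ := by
      rw [conjTranspose_mul, conjTranspose_conjTranspose]
      grind
    rw [e]
    exact isBigO_sub_pole ((hh.meromorphicAtEnd.1.isSymbol hr).2.trans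
      (rpow_isBigO_rpow (by norm_num))) (oc o1) (oc (h := fun t => (f t)ᴴ) o2) o1 o2
  have hYE : ExtendsMeromorphically Y :=
    (hS.meromorphic 1 (by decide)).linearComb (hS.meromorphic 1 (by decide)) (I / 2) 0
      fun t _ => by simp [hY]
  have hE : ∀ {i j : Fin 8}, i ≠ 0 → j ≠ 0 →
      ExtendsMeromorphically fun t => (1 / 2 : ℂ) • (S.X i t + I • S.X j t) := fun hi hj =>
    (hS.meromorphic _ hi).linearComb (hS.meromorphic _ hj) (1 / 2) (1 / 2 * I) fun t _ => by
      rw [mul_smul, ← smul_add]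
  have hβE : ∀ i, ExtendsMeromorphically (S.toComplexData.β i) := fun i => by
    fin_cases i <;> exact hE (by decide) (by decide)
  have hYr : HasResidueAtZero Y a := by
    have h1 : Tendsto (fun t : ℝ => (t : ℂ) • (1 / 2 : ℂ) • S.X 0 t) (𝓝[>] 0) (𝓝 ((0 : ℂ) •
        (1 / 2 : ℂ) • S.X 0 0)) :=
      ((Complex.continuous_ofReal.tendsto' 0 0 rfl).mono_left nhdsWithin_le_nhds).smul
        (((hS.continuous_zero 0 ⟨le_rfl, zero_le_one⟩).mono_left hle).const_smul (1 / 2 : ℂ))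
    rw [zero_smul] at h1
    refine (sub_zero a ▸ ha.sub h1 :).congr fun t => ?_
    rw [hαY, smul_add, add_sub_cancel_left]
  obtain ⟨g, hg, hg0, hgf⟩ := exists_gauge_of_limit hsm hu hfr (isUnit_of_unitary hf0U) hl
  have hI' := hI.congr hgf
  have hev : ∀ᶠ t in 𝓝[>] (0 : ℝ), t ∈ 𝕀 := Ioo_mem_nhdsGT one_pos
  refine ⟨D, f 0 * Uᴴ, s, ⟨⟨_, B, hΨ.mul hI.inv, hB⟩, fun t ht => (hd t ht).differentiableAt,
    realEquation_of_hasDerivAt hherm hd, hherm, q1, q2⟩,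
    ⟨mul_mem hf0U (star_mem hU), hs, hs1, ?_, ?_, fun i => ?_⟩,
    g, hg, fun t ht => hI'.gaugeConnection ht, fun i t ht => hI'.gaugeField i ht, by rw [hg0]; rfl⟩
  · rw [hD, mulVec_mulVec, conjTranspose_mul, conjTranspose_conjTranspose,
      mul_assoc, ← star_eq_conjTranspose (f 0), mem_unitaryGroup_iff'.1 hf0U, mul_one]
    exact isUnitLowestVector_mulVec hU hUa hv
  · exact (pole hYE hYr hUa).congr' (hev.mono fun t ht => by beta_reduce; rw [hDα t ht]) .rfl
  · exact (pole (hβE i) (hb i) (hUb i)).congr'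
      (hev.mono fun t ht => by beta_reduce; rw [hDβ i t ht]) .rfl

theorem IsUnitLowestVector.pos {a : Mat k} (h : IsUnitLowestVector a v) : 0 < k := by
  rcases k.eq_zero_or_pos with rfl | hk
  · simpa using h.1
  · exact hk

end Nahm

theorem mainTheorem4 (k : ℕ) :
    ∃ Ξ : Nahm.PoleModuli k → Nahm.NahmModuli k,
      (∀ (S : Nahm.PoleSolution k) (N : Nahm.NahmComplex k),
        Ξ S.toModuli = N.toModuli ↔ S.1.toComplexData.GaugeEquiv N.1) ∧
      Function.Bijective Ξ := by
  have heq := Nahm.ComplexData.gaugeEquiv_equivalence (k := k)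
  have hF : ∀ S : Nahm.PoleSolution k, ∃ N : Nahm.NahmComplex k,
      S.1.toComplexData.GaugeEquiv N.1 := fun S => by
    obtain ⟨D, U, s, hD, hp, h⟩ := S.2.exists_temporal
    exact ⟨⟨D, hD.isNahmComplex hp⟩, h⟩
  choose F hF using hF
  have hmk : ∀ N N' : Nahm.NahmComplex k, N.toModuli = N'.toModuli ↔ N.1.GaugeEquiv N'.1 :=
    fun N N' => Quotient.eq
  let Ξ : Nahm.PoleModuli k → Nahm.NahmModuli k := Quotient.lift (fun S => (F S).toModuli)
    fun S S' (h : S.1.GaugeEquiv S'.1) => (hmk _ _).2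
      (heq.trans (heq.symm (hF S)) (heq.trans h.toComplexData (hF S')))
  have hΞ : ∀ (S : Nahm.PoleSolution k) (N : Nahm.NahmComplex k),
      Ξ S.toModuli = N.toModuli ↔ S.1.toComplexData.GaugeEquiv N.1 := fun S N =>
    (hmk (F S) N).trans ⟨heq.trans (hF S), heq.trans (heq.symm (hF S))⟩
  refine ⟨Ξ, hΞ, fun x y hxy => ?_, fun y => ?_⟩
  · obtain ⟨S, rfl⟩ := Quotient.exists_rep x
    obtain ⟨S', rfl⟩ := Quotient.exists_rep y
    obtain ⟨a, -, hv⟩ := S.2.framing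
    exact Quotient.sound (Nahm.gaugeEquiv_of_complex hv.pos S.2 S'.2
      (heq.trans ((hΞ S (F S')).1 hxy) (heq.symm (hF S'))))
  · obtain ⟨N, rfl⟩ := Quotient.exists_rep y
    obtain ⟨a, b, -, -, -, hv, -⟩ := N.2.residues
    obtain ⟨N', V, s, hN', h⟩ := N.2.exists_isBalanced hv.pos
    obtain ⟨D, U, hD, hp, h'⟩ := hN'.exists_solution hv.pos
    obtain ⟨S, hS, hSD⟩ := hD.exists_isPoleSolution hp
    exact ⟨Nahm.PoleSolution.toModuli ⟨S, hS⟩, (hΞ ⟨S, hS⟩ N).2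
      (heq.symm (heq.trans h (hSD ▸ h')))⟩
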